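/- Identify the plane $\{y=0\}\subset\mathbb{R}^3$, with unit normal $\nu=e_y$, with $\mathbb{R}^2$. For $\tau>0$ with $\tau^{-1}\in\mathbb{N}$, let $G_\tau\subset O(3)$ be the group generated by $\omega_\tau$ (the rotation about the $y$-axis by the angle $\pi\tau$, followed by the reflection $y\mapsto -y$) and $\xi_\tau$ (the reflection through the plane obtained from $\{z=0\}$ by rotation by the angle $\frac{\pi}{2}\tau$ about the $y$-axis). A function $f$ on a rotation-invariant domain in the plane is called $G_\tau$-equivariant if $f\circ\beta=\langle\nu,\beta\nu\rangle f$ for all $\beta\in G_\tau$. Let $$\mathcal{L}_{\mathcal P}u=\Delta u-\tfrac12\,(x\cdot\nabla u-u).$$ For open $\Omega$, $H^2(\Omega)$ is the Sobolev space of functions with weak derivatives up to order two in $L^2(\Omega)$, and $e^{|x|^2/8}L^2(\Omega)$, $e^{|x|^2/8}H^2(\Omega)$ consist of the functions $f$ with $e^{-|x|^2/8}f$ in $L^2(\Omega)$, $H^2(\Omega)$ respectively. Elements of $e^{|x|^2/8}H^2(\Omega)$ are identified with their continuous representatives (for an exterior domain, continuous on $\overline\Omega$). **Lemma.** There is a constant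 $C>0$ such that the following holds for every $\tau$ with $0<\tau\le\frac13$ and $\tau^{-1}\in\mathbb{N}$. (a) For every $G_\tau$-equivariant $E\in e^{|x|^2/8}L^2(\mathbb{R}^2)$ there is a unique $G_\tau$-equivariant $u\in e^{|x|^2/8}H^2(\mathbb{R}^2)$ such that $\mathcal{L}_{\mathcal P}u=E$. (b) Every $E\in C^0(\mathbb{R}^2)$ with $\sup_{x\in\mathbb{R}^2}(1+|x|)|E(x)|<\infty$ lies in $e^{|x|^2/8}L^2(\mathbb{R}^2)$; and if such an $E$ is $G_\tau$-equivariant, then the solution $u$ in (a) satisfies $$|u(x)|\le C\Big(\sup_{y\in\mathbb{R}^2}(1+|y|)|E(y)|\Big)(1+|x|)\qquad\text{for all }x\in\mathbb{R}^2.$$ (c) For every $R>0$, with the same constant $C$, the statements (a) and (b) hold with $\mathbb{R}^2$ replaced by the exterior domain $\Omega=\{x\in\mathbb{R}^2:|x|>R\}$ throughout, when the Dirichlet condition $u|_{\partial\Omega}=0$ is added to the requirements on $u$ (both for existence and for uniqueness). -/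

import Mathlib

open Real Set MeasureTheory Topology
open scoped ContDiff Matrix

noncomputable section

namespace SelfShrinker

/-! ### The symmetry group `G_τ ⊂ O(3)` and equivariant functions on the plane `{y = 0}` -/

/-- Matrix of the rotation of `ℝ³` (coordinates `x, y, z`) about the `y`-axis by the angle `φ`. -/
def rotYMatrix (φ : ℝ) : Matrix (Fin 3) (Fin 3) ℝ :=
  !![cos φ, 0, sin φ; 0, 1, 0; -sin φ, 0, cos φ]

theorem rotYMatrix_mem (φ : ℝ) : rotYMatrix φ ∈ Matrix.orthogonalGroup (Fin 3) ℝ := by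
  rw [Matrix.mem_orthogonalGroup_iff]
  have h := sin_sq_add_cos_sq φ
  ext i j
  fin_cases i <;> fin_cases j <;>
    simp [rotYMatrix, Matrix.mul_apply, Fin.sum_univ_three] <;> nlinarith

/-- The rotation about the `y`-axis by the angle `φ`, as an element of `O(3)`. -/
def rotY (φ : ℝ) : Matrix.orthogonalGroup (Fin 3) ℝ := ⟨rotYMatrix φ, rotYMatrix_mem φ⟩

/-- The reflection `y ↦ -y`. -/
def reflY : Matrix.orthogonalGroup (Fin 3) ℝ :=
  ⟨Matrix.diagonal ![1, -1, 1], by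
    rw [Matrix.mem_orthogonalGroup_iff]
    ext i j
    fin_cases i <;> fin_cases j <;>
      simp [Matrix.mul_apply, Fin.sum_univ_three]⟩

/-- The reflection `z ↦ -z` through the plane `{z = 0}`. -/
def reflZ : Matrix.orthogonalGroup (Fin 3) ℝ :=
  ⟨Matrix.diagonal ![1, 1, -1], by
    rw [Matrix.mem_orthogonalGroup_iff]
    ext i j
    fin_cases i <;> fin_cases j <;>
      simp [Matrix.mul_apply, Fin.sum_univ_three]⟩

/-- `ω_τ`: rotation about the `y`-axis by `π τ`, followed by the reflection `y ↦ -y`. -/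
def omega (τ : ℝ) : Matrix.orthogonalGroup (Fin 3) ℝ := reflY * rotY (π * τ)

/-- `ξ_τ`: reflection through the plane `{z = 0}` rotated by `(π / 2) τ` about the `y`-axis. -/
def xi (τ : ℝ) : Matrix.orthogonalGroup (Fin 3) ℝ :=
  rotY (π / 2 * τ) * reflZ * (rotY (π / 2 * τ))⁻¹

/-- The group `G_τ`, generated by `ω_τ` and `ξ_τ`. -/
def G (τ : ℝ) : Subgroup (Matrix.orthogonalGroup (Fin 3) ℝ) :=
  Subgroup.closure {omega τ, xi τ}

/-- The Euclidean plane. -/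
abbrev Plane : Type := EuclideanSpace ℝ (Fin 2)

/-- The action on the plane `{y = 0}`, with coordinates `(x, z)`, of an element of `O(3)`
that preserves this plane (every element of `G τ` does). -/
def planeAct (β : Matrix.orthogonalGroup (Fin 3) ℝ) (x : Plane) : Plane :=
  !₂[((β : Matrix (Fin 3) (Fin 3) ℝ) *ᵥ ![x 0, 0, x 1]) 0,
     ((β : Matrix (Fin 3) (Fin 3) ℝ) *ᵥ ![x 0, 0, x 1]) 2]

/-- The unit normal `e_y` of the plane `{y = 0}`. -/
def normalY : Fin 3 → ℝ := ![0, 1, 0]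

/-- `G_τ`-equivariance of a function (class) `f` on the (rotation invariant) planar domain `Ω`:
`f ∘ β = ⟨ν, β ν⟩ f` almost everywhere on `Ω`, for every `β ∈ G_τ`. -/
def Equivariant (τ : ℝ) (Ω : Set Plane) (f : Plane → ℝ) : Prop :=
  ∀ β ∈ G τ, ∀ᵐ x ∂(volume.restrict Ω),
    f (planeAct β x) =
      (normalY ⬝ᵥ ((β : Matrix (Fin 3) (Fin 3) ℝ) *ᵥ normalY)) * f x

/-! ### Weak derivatives and weighted spaces -/

/-- The classical partial derivative `∂_i φ`. -/
def partialDeriv (i : Fin 2) (φ : Plane → ℝ) (x : Plane) : ℝ :=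
  fderiv ℝ φ x (EuclideanSpace.single i 1)

/-- `g ∈ L¹_loc(Ω)` is the `i`-th weak partial derivative of `u ∈ L¹_loc(Ω)` on the open set `Ω`. -/
def IsWeakPartial (Ω : Set Plane) (i : Fin 2) (u g : Plane → ℝ) : Prop :=
  LocallyIntegrableOn u Ω volume ∧ LocallyIntegrableOn g Ω volume ∧
    ∀ φ : Plane → ℝ, ContDiff ℝ ∞ φ → HasCompactSupport φ → tsupport φ ⊆ Ω →
      ∫ x in Ω, u x * partialDeriv i φ x = -∫ x in Ω, g x * φ x

/-- `v ∈ H²(Ω)`: `v` and its weak derivatives of order at most two are in `L²(Ω)`. -/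
def MemH2 (Ω : Set Plane) (v : Plane → ℝ) : Prop :=
  MemLp v 2 (volume.restrict Ω) ∧
    ∃ (g : Fin 2 → Plane → ℝ) (h : Fin 2 → Fin 2 → Plane → ℝ),
      (∀ i, IsWeakPartial Ω i v (g i) ∧ MemLp (g i) 2 (volume.restrict Ω)) ∧
      ∀ i j, IsWeakPartial Ω j (g i) (h i j) ∧ MemLp (h i j) 2 (volume.restrict Ω)

/-- `f ∈ e^{|x|²/8} L²(Ω)`. -/
def MemWeightedL2 (Ω : Set Plane) (f : Plane → ℝ) : Prop :=
  MemLp (fun x => exp (-(‖x‖ ^ 2 / 8)) * f x) 2 (volume.restrict Ω)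

/-- `f ∈ e^{|x|²/8} H²(Ω)`. -/
def MemWeightedH2 (Ω : Set Plane) (f : Plane → ℝ) : Prop :=
  MemH2 Ω (fun x => exp (-(‖x‖ ^ 2 / 8)) * f x)

/-- `L_P u = Δ u - (x · ∇u - u) / 2 = E` almost everywhere on `Ω`, with weak derivatives. -/
def LPEq (Ω : Set Plane) (u E : Plane → ℝ) : Prop :=
  ∃ g h : Fin 2 → Plane → ℝ,
    (∀ i, IsWeakPartial Ω i u (g i)) ∧ (∀ i, IsWeakPartial Ω i (g i) (h i)) ∧
      ∀ᵐ x ∂(volume.restrict Ω),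
        (∑ i, h i x) - (1 / 2) * ((∑ i, x i * g i x) - u x) = E x

/-- `u` is a `G_τ`-equivariant element of `e^{|x|²/8} H²(Ω)` with `L_P u = E`. -/
def IsSolution (τ : ℝ) (Ω : Set Plane) (E u : Plane → ℝ) : Prop :=
  Equivariant τ Ω u ∧ MemWeightedH2 Ω u ∧ LPEq Ω u E

/-- The Dirichlet condition `u|_{∂Ω} = 0`, where `u` is only given almost everywhere on `Ω`:
the representative of `u` that is continuous on the closure of `Ω` vanishes on the boundary. -/
def VanishesOnBoundary (Ω : Set Plane) (u : Plane → ℝ) : Prop :=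
  ∃ w : Plane → ℝ, ContinuousOn w (closure Ω) ∧ w =ᵐ[volume.restrict Ω] u ∧
    ∀ x ∈ frontier Ω, w x = 0

/-- The exterior of the disk of radius `R` about the origin. -/
def exteriorDomain (R : ℝ) : Set Plane := {x | R < ‖x‖}

/-- `sup_{x ∈ Ω} (1 + |x|) |E(x)|`; only used where this set of values is bounded. -/
def weightedSup (Ω : Set Plane) (E : Plane → ℝ) : ℝ :=
  sSup ((fun x => (1 + ‖x‖) * |E x|) '' Ω)

/-- `E ∈ C⁰(Ω)` with `sup_{x ∈ Ω} (1 + |x|) |E(x)| < ∞`. -/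
def DecayingContinuous (Ω : Set Plane) (E : Plane → ℝ) : Prop :=
  ContinuousOn E Ω ∧ BddAbove ((fun x => (1 + ‖x‖) * |E x|) '' Ω)

end SelfShrinker

end

/-! Write `u = e^{|x|²/8} v` and `E = e^{|x|²/8} F`. The drift disappears and `L_P u = E` becomes
`Δv - |x|² v / 16 + v = F` in unweighted `L²`. Put `k = 1/τ ≥ 3`. Equivariance means that functions
change sign under rotation by `π/k` and are odd in `θ`, so only the modes `sin (lθ)` with `l` an odd
multiple of `k` occur; in particular `l ≥ 3`. On mode `m` the equation is `V'' + V'/r = (Q - 1) V +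
e` with `Q = m²/r² + r²/16 ≥ m/2 ≥ 3/2`, hence `Q - 1 ≥ Q/3` and the problem is coercive. The linear
functions, which `L_P` annihilates, sit in mode `1` and are excluded by the symmetry.

Existence. For `e` continuous with compact support in `(R, ∞)` the radial problem is solved by
variation of constants (`exists_modeSol`) from a positive decaying homogeneous solution, given
explicitly by a Laplace integral. Multiplying the equation by `r Q V` and integrating
(`ModeSol.energy_le`) bounds `Q V` and `√Q V'` in `L²(r dr)` by `e`, with a constant that does not
depend on `m` or `R`. These quantities dominate all derivatives up to order two, so Parseval gives
an `H²` bound for finite sums of modes, together with a pointwise bound linear in `|x|`. Finite sums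
of admissible modes are dense among the equivariant functions (`exists_modes_tendsto`), and the a
priori bounds allow passage to the limit (`exists_planeSol`).

The growth bound. `L_P` maps `r (2 cos (θ - π/6) - 1)` to `-1/r`, and this function is positive in a
sector `0 ≤ θ ≤ π/k` with `k ≥ 3`, on whose sides `u` vanishes. Comparison with it
(`FiniteSol.le_barrier`) shows that `|E| ≤ M/|x|` implies `|u| ≤ M|x|`. The approximation by modes
must therefore preserve pointwise bounds on each circle; this is why it averages against the
positive kernel `(1 + cos φ)ⁿ` instead of truncating the Fourier series.

Uniqueness is by duality. A difference `z` of two solutions is tested against `V(r) sin (mθ)`, where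
`V` solves the radial problem with an arbitrary right-hand side `e`. After removing cutoffs near `R`
and near infinity one obtains `∫ z e sin (mθ) = 0` for every admissible `m`
(`integral_mode_eq_zero`), so `z = 0`. For `R > 0` the Dirichlet condition makes the inner cutoff
error negligible. For `R = 0` the decay of `V` at the origin does so.

The plane is the case `R = 0`, that is, the punctured plane. A single point carries no obstruction
to weak derivatives of `L²` functions in dimension two (`IsWeakPartial.of_punctured`). -/

noncomputable section

namespace SelfShrinker

open Filter Asymptotics

/-! ### A Laplace type integral -/

/-- The integral `∫₀^∞ e^{-σ} σ^α (1 + q σ)^β dσ`. -/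
def kummerInt (α β q : ℝ) : ℝ := ∫ σ in Ioi (0 : ℝ), exp (-σ) * σ ^ α * (1 + q * σ) ^ β

theorem continuousOn_kummer_integrand {α β q : ℝ} (hα : 0 ≤ α) (hβ : 0 ≤ β) :
    Continuous fun σ : ℝ => exp (-σ) * σ ^ α * (1 + q * σ) ^ β := by
  have h1 : Continuous fun σ : ℝ => σ ^ α := continuous_rpow_const hα
  have h2 : Continuous fun σ : ℝ => (1 + q * σ) ^ β :=
    (continuous_rpow_const hβ).comp (by fun_prop)
  exact ((by fun_prop : Continuous fun σ : ℝ => exp (-σ)).mul h1).mul h2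

/-- Each of the two powers is absorbed by `e^{σ/4}`, which leaves half of the exponential decay. -/
theorem isBigO_kummer_integrand {α β q : ℝ} (hβ : 0 ≤ β) (hq : 0 ≤ q) :
    (fun σ : ℝ => exp (-σ) * σ ^ α * (1 + q * σ) ^ β) =O[atTop]
      fun σ => exp (-(1 / 2) * σ) := by
  have h1 : (fun σ : ℝ => σ ^ α) =O[atTop] fun σ => exp (1 / 4 * σ) :=
    (isLittleO_rpow_exp_pos_mul_atTop α (by norm_num)).isBigO
  have h2 : (fun σ : ℝ => (1 + q * σ) ^ β) =O[atTop] fun σ => exp (1 / 4 * σ) := by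
    have h3 : (fun σ : ℝ => (1 + q * σ) ^ β) =O[atTop] fun σ => σ ^ β := by
      refine IsBigO.of_bound ((1 + q) ^ β) ?_
      filter_upwards [eventually_ge_atTop 1] with σ hσ
      have : 0 ≤ q * σ := by positivity
      rw [norm_of_nonneg (by positivity), norm_of_nonneg (by positivity),
        ← mul_rpow (by positivity) (by positivity)]
      exact rpow_le_rpow (by positivity) (by nlinarith) hβ
    exact h3.trans (isLittleO_rpow_exp_pos_mul_atTop β (by norm_num)).isBigO
  have h0 : (fun σ : ℝ => exp (-σ)) =O[atTop] fun σ => exp (-σ) := isBigO_refl _ _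
  refine ((h0.mul h1).mul h2).congr_right fun σ => ?_
  rw [← exp_add, ← exp_add]
  ring_nf

theorem integrableOn_kummer {α β q : ℝ} (hα : 0 ≤ α) (hβ : 0 ≤ β) (hq : 0 ≤ q) :
    IntegrableOn (fun σ : ℝ => exp (-σ) * σ ^ α * (1 + q * σ) ^ β) (Ioi 0) :=
  integrable_of_isBigO_exp_neg (by norm_num : (0 : ℝ) < 1 / 2)
    (continuousOn_kummer_integrand hα hβ).continuousOn (isBigO_kummer_integrand hβ hq)

theorem kummerInt_pos {α β q : ℝ} (hα : 0 ≤ α) (hβ : 0 ≤ β) (hq : 0 ≤ q) :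
    0 < kummerInt α β q := by
  have hpos : ∀ σ ∈ Ioi (0 : ℝ), 0 < exp (-σ) * σ ^ α * (1 + q * σ) ^ β := by
    intro σ hσ
    have : (0 : ℝ) < σ := hσ
    positivity
  rw [kummerInt, setIntegral_pos_iff_support_of_nonneg_ae
    ((ae_restrict_mem measurableSet_Ioi).mono fun σ hσ => (hpos σ hσ).le)
    (integrableOn_kummer hα hβ hq)]
  have : Ioi (0 : ℝ) ⊆ Function.support (fun σ : ℝ => exp (-σ) * σ ^ α * (1 + q * σ) ^ β) ∩
      Ioi 0 := fun σ hσ => ⟨(hpos σ hσ).ne', hσ⟩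
  exact lt_of_lt_of_le (by simp) (measure_mono this)

theorem kummerInt_mono {α β q q' : ℝ} (hα : 0 ≤ α) (hβ : 0 ≤ β) (hq : 0 ≤ q) (h : q ≤ q') :
    kummerInt α β q ≤ kummerInt α β q' := by
  refine setIntegral_mono_on (integrableOn_kummer hα hβ hq)
    (integrableOn_kummer hα hβ (hq.trans h)) measurableSet_Ioi fun σ hσ => ?_
  have : (0 : ℝ) < σ := hσ
  gcongr

/-- Because `1 + qσ ≤ q(1 + σ)` for `q ≥ 1`. Together with the lower bound that follows it fixes the
growth rate `q^β`, which becomes the blow-up rate `r^{-m}` of the radial solution at the origin. -/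
theorem kummerInt_le_rpow {α β q : ℝ} (hα : 0 ≤ α) (hβ : 0 ≤ β) (hq : 1 ≤ q) :
    kummerInt α β q ≤ kummerInt α β 1 * q ^ β := by
  rw [kummerInt, kummerInt, ← integral_mul_const]
  have hq0 : 0 ≤ q := by linarith
  refine setIntegral_mono_on (integrableOn_kummer hα hβ hq0)
    ((integrableOn_kummer hα hβ zero_le_one).mul_const _) measurableSet_Ioi fun σ hσ => ?_
  have hσ' : (0 : ℝ) < σ := hσ
  rw [mul_assoc _ _ (q ^ β), ← mul_rpow (by positivity) hq0]
  gcongr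
  nlinarith

theorem rpow_le_kummerInt {α β q : ℝ} (hα : 0 ≤ α) (hβ : 0 ≤ β) (hq : 0 ≤ q) :
    kummerInt (α + β) 0 0 * q ^ β ≤ kummerInt α β q := by
  rw [kummerInt, kummerInt, ← integral_mul_const]
  refine setIntegral_mono_on ((integrableOn_kummer (by positivity) le_rfl le_rfl).mul_const _)
    (integrableOn_kummer hα hβ hq) measurableSet_Ioi fun σ hσ => ?_
  have hσ' : (0 : ℝ) < σ := hσ
  rw [rpow_zero, mul_one, rpow_add hσ', mul_assoc, mul_assoc, mul_assoc,
    ← mul_rpow hσ'.le hq]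
  gcongr
  nlinarith

theorem hasDerivAt_kummerInt {α β q : ℝ} (hα : 0 ≤ α) (hβ : 1 ≤ β) (hq : 0 < q) :
    HasDerivAt (kummerInt α β) (β * kummerInt (α + 1) (β - 1) q) q := by
  have hβ0 : 0 ≤ β := by linarith
  have hβ1 : 0 ≤ β - 1 := by linarith
  have hα1 : 0 ≤ α + 1 := by linarith
  have key := hasDerivAt_integral_of_dominated_loc_of_deriv_le
    (μ := volume.restrict (Ioi (0 : ℝ)))
    (F := fun q σ => exp (-σ) * σ ^ α * (1 + q * σ) ^ β)
    (F' := fun q σ => β * (exp (-σ) * σ ^ (α + 1) * (1 + q * σ) ^ (β - 1)))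
    -- The integrand increases with `q`, so on the neighbourhood `(0, 2q)` its value at `2q`
    -- dominates.
    (bound := fun σ => β * (exp (-σ) * σ ^ (α + 1) * (1 + (2 * q) * σ) ^ (β - 1)))
    (Ioo_mem_nhds hq (by linarith : q < 2 * q))
    (Eventually.of_forall fun x => (continuousOn_kummer_integrand hα hβ0).aestronglyMeasurable)
    (integrableOn_kummer hα hβ0 hq.le)
    ((continuousOn_kummer_integrand hα1 hβ1).const_mul β).aestronglyMeasurable
    ?_ ((integrableOn_kummer hα1 hβ1 (by linarith)).const_mul _) ?_
  · have := key.2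
    rw [integral_const_mul] at this
    exact this
  · refine (ae_restrict_mem measurableSet_Ioi).mono fun σ hσ x hx => ?_
    have hσ' : (0 : ℝ) < σ := hσ
    have hx0 : 0 < x := hx.1
    have hx1 : x < 2 * q := hx.2
    rw [norm_of_nonneg (by positivity)]
    gcongr
  · refine (ae_restrict_mem measurableSet_Ioi).mono fun σ hσ x hx => ?_
    have hσ' : (0 : ℝ) < σ := hσ
    have hx0 : 0 < x := hx.1
    have h1 : HasDerivAt (fun x : ℝ => 1 + x * σ) σ x := by
      simpa using ((hasDerivAt_id x).mul_const σ).const_add 1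
    have h2 := (h1.rpow_const (p := β) (Or.inl (by positivity))).const_mul (exp (-σ) * σ ^ α)
    refine h2.congr_deriv ?_
    rw [rpow_add hσ', rpow_one]
    ring

/-- The differential equation satisfied by `kummerInt (a - 1) (a + 1)`. -/
theorem kummerInt_ode {a q : ℝ} (ha : 1 ≤ a) (hq : 0 < q) :
    q ^ 2 * ((a + 1) * (a * kummerInt (a + 1) (a - 1) q)) + (a + 1) * kummerInt a a q =
      a * (a + 1) * kummerInt (a - 1) (a + 1) q := by
  have i1 := integrableOn_kummer (α := a + 1) (β := a - 1) (by linarith) (by linarith) hq.le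
  have i2 := integrableOn_kummer (α := a) (β := a) (by linarith) (by linarith) hq.le
  have i3 := integrableOn_kummer (α := a - 1) (β := a + 1) (by linarith) (by linarith) hq.le
  -- The combination that has to integrate to zero is a total derivative: its primitive `e^{-σ} σ^a
  -- (1 + qσ)^a` vanishes at `0`, since `a > 0`, and at infinity.
  have hG : ∀ σ ∈ Ioi (0 : ℝ), HasDerivAt (fun σ : ℝ => exp (-σ) * σ ^ a * (1 + q * σ) ^ a)
      (-(a * q ^ 2 * (exp (-σ) * σ ^ (a + 1) * (1 + q * σ) ^ (a - 1)) +
        exp (-σ) * σ ^ a * (1 + q * σ) ^ a -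
        a * (exp (-σ) * σ ^ (a - 1) * (1 + q * σ) ^ (a + 1)))) σ := by
    intro σ hσ
    have hσ' : (0 : ℝ) < σ := hσ
    have hp : 0 < 1 + q * σ := by positivity
    have h1 : HasDerivAt (fun x : ℝ => 1 + q * x) q σ := by
      simpa using ((hasDerivAt_id σ).const_mul q).const_add 1
    have h2 : HasDerivAt (fun x : ℝ => exp (-x)) (-exp (-σ)) σ := by
      simpa using (hasDerivAt_neg σ).exp
    have h3 := (h2.mul ((hasDerivAt_id σ).rpow_const (p := a) (Or.inl hσ'.ne'))).mul
      (h1.rpow_const (p := a) (Or.inl hp.ne'))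
    refine h3.congr_deriv ?_
    have e1 : σ ^ (a + 1) = σ ^ (a - 1) * σ ^ 2 := by
      rw [← rpow_natCast, ← rpow_add hσ']; congr 1; push_cast; ring
    have e2 : σ ^ a = σ ^ (a - 1) * σ := by
      nth_rewrite 3 [← rpow_one σ]
      rw [← rpow_add hσ']; congr 1; ring
    have e3 : (1 + q * σ) ^ (a + 1) = (1 + q * σ) ^ (a - 1) * (1 + q * σ) ^ 2 := by
      rw [← rpow_natCast, ← rpow_add hp]; congr 1; push_cast; ring
    have e4 : (1 + q * σ) ^ a = (1 + q * σ) ^ (a - 1) * (1 + q * σ) := by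
      nth_rewrite 3 [← rpow_one (1 + q * σ)]
      rw [← rpow_add hp]; congr 1; ring
    simp only [id, e1, e2, e3, e4, Pi.mul_apply]
    ring
  have hint := ((i1.const_mul (a * q ^ 2)).add i2).sub (i3.const_mul a)
  have hlim : Tendsto (fun σ : ℝ => exp (-σ) * σ ^ a * (1 + q * σ) ^ a) atTop (𝓝 0) := by
    refine (isBigO_kummer_integrand (by linarith) hq.le).trans_tendsto ?_
    exact tendsto_exp_atBot.comp (tendsto_id.const_mul_atTop_of_neg (by norm_num))
  have key := integral_Ioi_of_hasDerivAt_of_tendsto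
    (continuousOn_kummer_integrand (by linarith : 0 ≤ a)
      (by linarith : 0 ≤ a)).continuousAt.continuousWithinAt hG hint.neg hlim
  have e0 : ∫ σ in Ioi (0 : ℝ), -(a * q ^ 2 * (exp (-σ) * σ ^ (a + 1) * (1 + q * σ) ^ (a - 1)) +
        exp (-σ) * σ ^ a * (1 + q * σ) ^ a -
        a * (exp (-σ) * σ ^ (a - 1) * (1 + q * σ) ^ (a + 1))) =
      -(a * q ^ 2 * kummerInt (a + 1) (a - 1) q + kummerInt a a q -
        a * kummerInt (a - 1) (a + 1) q) := by
    rw [integral_neg]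
    have := integral_sub ((i1.const_mul (a * q ^ 2)).add i2) (i3.const_mul a)
    have h' := integral_add (i1.const_mul (a * q ^ 2)) i2
    simp only [Pi.add_apply] at this
    rw [this, h', integral_const_mul, integral_const_mul]
    rfl
  rw [e0, zero_rpow (by linarith)] at key
  have k2 : a * q ^ 2 * kummerInt (a + 1) (a - 1) q + kummerInt a a q -
        a * kummerInt (a - 1) (a + 1) q = 0 := by
    have : -(a * q ^ 2 * kummerInt (a + 1) (a - 1) q + kummerInt a a q -
        a * kummerInt (a - 1) (a + 1) q) = 0 := by simpa using key
    linarith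
  linear_combination (a + 1) * k2

/-! ### The homogeneous radial equation -/

/-- The potential `m² / r² + r² / 16` of the radial equation. -/
def radialPot (m : ℕ) (r : ℝ) : ℝ := (m : ℝ) ^ 2 / r ^ 2 + r ^ 2 / 16

/-- The radial profile `k(q)`, with `q = 4 / r²`, of the decaying homogeneous solution. -/
def profile (m : ℕ) (q : ℝ) : ℝ := kummerInt (((m : ℝ) - 1) / 2 - 1) (((m : ℝ) - 1) / 2 + 1) q

/-- The derivative of `profile`. -/
def profile₁ (m : ℕ) (q : ℝ) : ℝ :=
  (((m : ℝ) - 1) / 2 + 1) * kummerInt (((m : ℝ) - 1) / 2) (((m : ℝ) - 1) / 2) q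

/-- The second derivative of `profile`. -/
def profile₂ (m : ℕ) (q : ℝ) : ℝ :=
  (((m : ℝ) - 1) / 2 + 1) * ((((m : ℝ) - 1) / 2) *
    kummerInt (((m : ℝ) - 1) / 2 + 1) (((m : ℝ) - 1) / 2 - 1) q)

theorem one_le_half_sub_one {m : ℕ} (hm : 3 ≤ m) : 1 ≤ ((m : ℝ) - 1) / 2 := by
  have : (3 : ℝ) ≤ m := by exact_mod_cast hm
  linarith

theorem hasDerivAt_profile {m : ℕ} (hm : 3 ≤ m) {q : ℝ} (hq : 0 < q) :
    HasDerivAt (profile m) (profile₁ m q) q := by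
  have h1 := one_le_half_sub_one hm
  have := hasDerivAt_kummerInt (α := ((m : ℝ) - 1) / 2 - 1) (β := ((m : ℝ) - 1) / 2 + 1) (q := q)
    (by linarith) (by linarith) hq
  rw [sub_add_cancel, add_sub_cancel_right] at this
  exact this

theorem hasDerivAt_profile₁ {m : ℕ} (hm : 3 ≤ m) {q : ℝ} (hq : 0 < q) :
    HasDerivAt (profile₁ m) (profile₂ m q) q := by
  have h1 := one_le_half_sub_one hm
  exact (hasDerivAt_kummerInt (by linarith) h1 hq).const_mul _

/-- The exponents in `profile` are those with `a = (m - 1)/2`, for which `a(a + 1) = (m² - 1)/4`. -/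
theorem profile_ode {m : ℕ} (hm : 3 ≤ m) {q : ℝ} (hq : 0 < q) :
    q ^ 2 * profile₂ m q + profile₁ m q = ((m : ℝ) ^ 2 - 1) / 4 * profile m q := by
  have h1 := one_le_half_sub_one hm
  have := kummerInt_ode h1 hq
  rw [profile, profile₁, profile₂]
  linear_combination this

theorem profile_pos {m : ℕ} (hm : 3 ≤ m) {q : ℝ} (hq : 0 ≤ q) : 0 < profile m q := by
  have h1 := one_le_half_sub_one hm
  exact kummerInt_pos (by linarith) (by linarith) hq

theorem profile₁_nonneg {m : ℕ} (hm : 3 ≤ m) {q : ℝ} (hq : 0 ≤ q) : 0 ≤ profile₁ m q := by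
  have h1 := one_le_half_sub_one hm
  exact mul_nonneg (by linarith) (kummerInt_pos (by linarith) (by linarith) hq).le

theorem profile_mono {m : ℕ} (hm : 3 ≤ m) {q q' : ℝ} (hq : 0 ≤ q) (h : q ≤ q') :
    profile m q ≤ profile m q' := by
  have h1 := one_le_half_sub_one hm
  exact kummerInt_mono (by linarith) (by linarith) hq h

theorem profile₁_mono {m : ℕ} (hm : 3 ≤ m) {q q' : ℝ} (hq : 0 ≤ q) (h : q ≤ q') :
    profile₁ m q ≤ profile₁ m q' := by
  have h1 := one_le_half_sub_one hm
  exact mul_le_mul_of_nonneg_left (kummerInt_mono (by linarith) (by linarith) hq h) (by linarith)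

theorem four_div_sq_rpow (m : ℕ) {r : ℝ} (hr : 0 < r) :
    (4 / r ^ 2) ^ (((m : ℝ) - 1) / 2 + 1) = 2 ^ (m + 1) / r ^ (m + 1) := by
  have : 4 / r ^ 2 = (2 / r) ^ (2 : ℝ) := by
    rw [rpow_two]; ring
  rw [this, ← rpow_mul (by positivity), ← div_pow, ← rpow_natCast]
  congr 1
  push_cast
  ring

/-- For `r ≤ 1` the argument `q = 4/r²` is at least `1`, so the growth bounds in `q` apply. The
derivative has growth exponent one less, which the factor `q` restores. -/
theorem exists_profile_bounds {m : ℕ} (hm : 3 ≤ m) :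
    ∃ c C : ℝ, 0 < c ∧ 0 < C ∧ ∀ r : ℝ, 0 < r → r ≤ 1 →
      c / r ^ (m + 1) ≤ profile m (4 / r ^ 2) ∧ profile m (4 / r ^ 2) ≤ C / r ^ (m + 1) ∧
        4 / r ^ 2 * profile₁ m (4 / r ^ 2) ≤ C / r ^ (m + 1) := by
  have h1 := one_le_half_sub_one hm
  set a : ℝ := ((m : ℝ) - 1) / 2 with ha
  have p1 := kummerInt_pos (α := a - 1 + (a + 1)) (β := 0) (q := 0) (by linarith) le_rfl le_rfl
  have p2 := kummerInt_pos (α := a - 1) (β := a + 1) (q := 1) (by linarith) (by linarith)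
    zero_le_one
  have p3 := kummerInt_pos (α := a) (β := a) (q := 1) (by linarith) (by linarith) zero_le_one
  refine ⟨kummerInt (a - 1 + (a + 1)) 0 0 * 2 ^ (m + 1),
    (kummerInt (a - 1) (a + 1) 1 + (a + 1) * kummerInt a a 1) * 2 ^ (m + 1), by positivity,
    by positivity, fun r hr hr1 => ?_⟩
  have hq1 : 1 ≤ 4 / r ^ 2 := by
    rw [le_div_iff₀ (by positivity)]
    nlinarith
  have hq0 : 0 < 4 / r ^ 2 := by positivity
  have e := four_div_sq_rpow m hr
  rw [← ha] at e
  have hpos : (0 : ℝ) < 2 ^ (m + 1) / r ^ (m + 1) := by positivity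
  refine ⟨?_, ?_, ?_⟩
  · have := rpow_le_kummerInt (α := a - 1) (β := a + 1) (by linarith) (by linarith) hq0.le
    rw [e] at this
    rw [mul_div_assoc]
    exact this
  · have := kummerInt_le_rpow (α := a - 1) (β := a + 1) (by linarith) (by linarith) hq1
    rw [e] at this
    rw [mul_div_assoc, add_mul]
    exact this.trans (le_add_of_nonneg_right (by positivity))
  · have := kummerInt_le_rpow (α := a) (β := a) (by linarith) (by linarith) hq1
    have e2 : 4 / r ^ 2 * (4 / r ^ 2) ^ a = 2 ^ (m + 1) / r ^ (m + 1) := by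
      rw [← e, rpow_add hq0, rpow_one, mul_comm]
    rw [mul_div_assoc, add_mul]
    refine le_trans ?_ (le_add_of_nonneg_left (by positivity))
    calc 4 / r ^ 2 * profile₁ m (4 / r ^ 2)
        ≤ 4 / r ^ 2 * ((a + 1) * (kummerInt a a 1 * (4 / r ^ 2) ^ a)) := by
          rw [profile₁, ← ha]; gcongr
      _ = (a + 1) * kummerInt a a 1 * (2 ^ (m + 1) / r ^ (m + 1)) := by rw [← e2]; ring

/-- The positive solution of the homogeneous radial equation that decays at infinity. -/
def radialSol (m : ℕ) (r : ℝ) : ℝ := exp (-(r ^ 2 / 8)) * (r * profile m (4 / r ^ 2))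

/-- The derivative of `radialSol`. -/
def radialSol₁ (m : ℕ) (r : ℝ) : ℝ :=
  exp (-(r ^ 2 / 8)) * (profile m (4 / r ^ 2) - 2 * (4 / r ^ 2 * profile₁ m (4 / r ^ 2)) -
    r ^ 2 / 4 * profile m (4 / r ^ 2))

theorem radialSol_pos {m : ℕ} (hm : 3 ≤ m) {r : ℝ} (hr : 0 < r) : 0 < radialSol m r := by
  have := profile_pos hm (q := 4 / r ^ 2) (by positivity)
  unfold radialSol
  positivity

theorem hasDerivAt_exp_neg_sq (r : ℝ) :
    HasDerivAt (fun r : ℝ => exp (-(r ^ 2 / 8))) (exp (-(r ^ 2 / 8)) * (-(r / 4))) r := by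
  have : HasDerivAt (fun r : ℝ => -(r ^ 2 / 8)) (-(r / 4)) r :=
    (((hasDerivAt_pow 2 r).div_const 8).neg).congr_deriv (by norm_num; ring)
  exact this.exp

theorem hasDerivAt_four_div_sq {r : ℝ} (hr : 0 < r) :
    HasDerivAt (fun r : ℝ => 4 / r ^ 2) (-(8 / r ^ 3)) r := by
  have := ((hasDerivAt_pow 2 r).inv (by positivity : r ^ 2 ≠ 0)).const_mul 4
  refine (this.congr_deriv ?_)
  norm_num
  field_simp
  norm_num

theorem hasDerivAt_radialSol {m : ℕ} (hm : 3 ≤ m) {r : ℝ} (hr : 0 < r) :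
    HasDerivAt (radialSol m) (radialSol₁ m r) r := by
  have hq : 0 < 4 / r ^ 2 := by positivity
  have h1 := (hasDerivAt_profile hm hq).comp r (hasDerivAt_four_div_sq hr)
  have h2 := (hasDerivAt_exp_neg_sq r).mul ((hasDerivAt_id r).mul h1)
  refine h2.congr_deriv ?_
  simp only [radialSol₁, Function.comp, id, Pi.mul_apply]
  field_simp
  ring

/-- The substitution `q = 4/r²` and the factor `r e^{-r²/8}` turn `profile_ode` into the homogeneous
radial equation. -/
theorem hasDerivAt_radialSol₁ {m : ℕ} (hm : 3 ≤ m) {r : ℝ} (hr : 0 < r) :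
    HasDerivAt (radialSol₁ m)
      (-(radialSol₁ m r / r) + (radialPot m r - 1) * radialSol m r) r := by
  have hq : 0 < 4 / r ^ 2 := by positivity
  have h4 := hasDerivAt_four_div_sq hr
  have h1 := (hasDerivAt_profile hm hq).comp r h4
  have h1' := (hasDerivAt_profile₁ hm hq).comp r h4
  have h2 := (hasDerivAt_exp_neg_sq r).mul ((h1.sub ((h4.mul h1').const_mul 2)).sub
    (((hasDerivAt_pow 2 r).div_const 4).mul h1))
  refine h2.congr_deriv ?_
  have ode := profile_ode hm hq
  have e : profile₂ m (4 / r ^ 2) = r ^ 4 / 16 * (((m : ℝ) ^ 2 - 1) / 4 * profile m (4 / r ^ 2)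
      - profile₁ m (4 / r ^ 2)) := by
    rw [← ode]; field_simp; ring
  simp only [radialSol₁, radialSol, radialPot, Function.comp, Pi.mul_apply, Pi.sub_apply, e]
  field_simp
  norm_num
  ring

/-- The solution that decays at infinity is singular at the origin, of exact order `r^{-m}`. The
lower bound is what makes variation of constants work there. -/
theorem exists_radialSol_bounds {m : ℕ} (hm : 3 ≤ m) :
    ∃ c C : ℝ, 0 < c ∧ 0 < C ∧ ∀ r : ℝ, 0 < r → r ≤ 1 →
      c / r ^ m ≤ radialSol m r ∧ radialSol m r ≤ C / r ^ m ∧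
        |radialSol₁ m r| ≤ C / r ^ (m + 1) := by
  obtain ⟨c, C, hc, hC, h⟩ := exists_profile_bounds hm
  refine ⟨exp (-1) * c, 4 * C, by positivity, by positivity, fun r hr hr1 => ?_⟩
  obtain ⟨h1, h2, h3⟩ := h r hr hr1
  have hq : 0 < 4 / r ^ 2 := by positivity
  have e1 : exp (-(r ^ 2 / 8)) ≤ 1 := exp_le_one_iff.2 (by have := sq_nonneg r; linarith)
  have e2 : exp (-1) ≤ exp (-(r ^ 2 / 8)) := exp_le_exp.2 (by nlinarith)
  have hp := profile_pos hm hq.le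
  have hp1 := profile₁_nonneg hm hq.le
  have hr' : ∀ x : ℝ, x / r ^ m = r * (x / r ^ (m + 1)) := fun x => by
    rw [pow_succ]; field_simp
  have hX : 0 < C / r ^ (m + 1) := by positivity
  refine ⟨?_, ?_, ?_⟩
  · rw [hr', radialSol, mul_div_assoc, mul_left_comm]
    gcongr
  · rw [hr', radialSol, mul_div_assoc]
    calc exp (-(r ^ 2 / 8)) * (r * profile m (4 / r ^ 2)) ≤ 1 * (r * (C / r ^ (m + 1))) := by
          gcongr
      _ ≤ _ := by nlinarith [mul_pos hr hX]
  · rw [radialSol₁, abs_mul, abs_of_pos (exp_pos _), mul_div_assoc]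
    have hq1 : 0 ≤ 4 / r ^ 2 * profile₁ m (4 / r ^ 2) := by positivity
    have hr2 : r ^ 2 ≤ 1 := by nlinarith
    have hb : r ^ 2 / 4 * profile m (4 / r ^ 2) ≤ C / r ^ (m + 1) := by
      have : r ^ 2 / 4 ≤ 1 := by linarith
      nlinarith
    have hb0 : 0 ≤ r ^ 2 / 4 * profile m (4 / r ^ 2) := by positivity
    have : |profile m (4 / r ^ 2) - 2 * (4 / r ^ 2 * profile₁ m (4 / r ^ 2)) -
        r ^ 2 / 4 * profile m (4 / r ^ 2)| ≤ 4 * (C / r ^ (m + 1)) := by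
      rw [abs_le]; constructor <;> linarith
    calc _ ≤ 1 * (4 * (C / r ^ (m + 1))) := by gcongr
      _ = _ := one_mul _

theorem tendsto_pow_mul_exp_neg_sq (n : ℕ) :
    Tendsto (fun r : ℝ => r ^ n * exp (-(r ^ 2 / 8))) atTop (𝓝 0) := by
  have h : Tendsto (fun r : ℝ => r ^ n * exp (-r)) atTop (𝓝 0) :=
    tendsto_pow_mul_exp_neg_atTop_nhds_zero n
  refine squeeze_zero' ?_ ?_ h
  · filter_upwards [eventually_ge_atTop 0] with r hr
    positivity
  · filter_upwards [eventually_ge_atTop 8] with r hr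
    have : exp (-(r ^ 2 / 8)) ≤ exp (-r) := exp_le_exp.2 (by nlinarith)
    gcongr

/-- For `r ≥ 1` the profile stays below its value at `q = 4`, and the Gaussian beats every power.
The weight `r²` is the one needed by the boundary term of the energy and by the comparison with the
barrier at infinity. -/
theorem tendsto_radialSol_atTop {m : ℕ} (hm : 3 ≤ m) :
    Tendsto (fun r => r ^ 2 * radialSol m r) atTop (𝓝 0) := by
  have h := (tendsto_pow_mul_exp_neg_sq 3).mul_const (profile m 4)
  rw [zero_mul] at h
  refine squeeze_zero' ?_ ?_ h
  · filter_upwards [eventually_gt_atTop 0] with r hr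
    have := radialSol_pos hm hr
    positivity
  · filter_upwards [eventually_ge_atTop 1] with r hr
    have hr0 : 0 < r := by linarith
    have hq : 4 / r ^ 2 ≤ 4 := div_le_self (by norm_num) (by nlinarith)
    have := profile_mono hm (by positivity) hq
    calc r ^ 2 * radialSol m r = r ^ 3 * exp (-(r ^ 2 / 8)) * profile m (4 / r ^ 2) := by
          rw [radialSol]; ring
      _ ≤ _ := by gcongr

theorem tendsto_radialSol₁_atTop {m : ℕ} (hm : 3 ≤ m) :
    Tendsto (fun r => r * radialSol₁ m r) atTop (𝓝 0) := by
  have h := ((tendsto_pow_mul_exp_neg_sq 1).add (tendsto_pow_mul_exp_neg_sq 3)).mul_const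
    (profile m 4 + 8 * profile₁ m 4)
  rw [zero_add, zero_mul] at h
  refine squeeze_zero_norm' ?_ h
  filter_upwards [eventually_ge_atTop 1] with r hr
  have hr0 : 0 < r := by linarith
  have hq : 4 / r ^ 2 ≤ 4 := div_le_self (by norm_num) (by nlinarith)
  have hq0 : 0 ≤ 4 / r ^ 2 := by positivity
  have h1 := profile_mono hm hq0 hq
  have h2 := profile₁_mono hm hq0 hq
  have p1 := profile_pos hm hq0
  have p2 := profile₁_nonneg hm hq0
  have h3 : 4 / r ^ 2 * profile₁ m (4 / r ^ 2) ≤ 4 * profile₁ m 4 := by gcongr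
  have h4 : r ^ 2 / 4 * profile m (4 / r ^ 2) ≤ r ^ 2 * profile m 4 := by
    have : r ^ 2 / 4 ≤ r ^ 2 := by nlinarith
    gcongr
  have p4 : 0 ≤ r ^ 2 / 4 * profile m (4 / r ^ 2) := by positivity
  have p3 : 0 ≤ 4 / r ^ 2 * profile₁ m (4 / r ^ 2) := by positivity
  have p5 : 0 ≤ r ^ 2 * profile₁ m 4 := mul_nonneg (by positivity) (p2.trans h2)
  have hb : |profile m (4 / r ^ 2) - 2 * (4 / r ^ 2 * profile₁ m (4 / r ^ 2)) -
      r ^ 2 / 4 * profile m (4 / r ^ 2)| ≤ (1 + r ^ 2) * (profile m 4 + 8 * profile₁ m 4) := by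
    rw [abs_le]; constructor <;> nlinarith
  calc ‖r * radialSol₁ m r‖ = r * exp (-(r ^ 2 / 8)) * |profile m (4 / r ^ 2) -
        2 * (4 / r ^ 2 * profile₁ m (4 / r ^ 2)) - r ^ 2 / 4 * profile m (4 / r ^ 2)| := by
        rw [radialSol₁, norm_mul, norm_mul, norm_of_nonneg hr0.le, norm_of_nonneg (exp_pos _).le,
          Real.norm_eq_abs]; ring
    _ ≤ r * exp (-(r ^ 2 / 8)) * ((1 + r ^ 2) * (profile m 4 + 8 * profile₁ m 4)) := by gcongr
    _ = _ := by ring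

/-! ### The inhomogeneous radial equation -/

/-- `V`, with derivatives `V₁` and `V₂`, solves the radial equation of angular frequency `m` with
right-hand side `e ∈ C_c(R, ∞)`, vanishes at `R` and decays at infinity. -/
structure ModeSol (R : ℝ) (m : ℕ) (e V V₁ V₂ : ℝ → ℝ) : Prop where
  cont : Continuous e
  supp : ∃ a b, R < a ∧ ∀ r, r ∉ Icc a b → e r = 0
  deriv : ∀ r, R < r → HasDerivAt V (V₁ r) r
  deriv₁ : ∀ r, R < r → HasDerivAt V₁ (V₂ r) r
  ode : ∀ r, R < r → V₂ r + V₁ r / r = (radialPot m r - 1) * V r + e r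
  lim : Tendsto (fun r => V r / r) (𝓝[>] R) (𝓝 0)
  bdd₁ : ∃ C, ∀ᶠ r in 𝓝[>] R, |V₁ r| ≤ C
  lim_top : Tendsto (fun r => r ^ 2 * V r) atTop (𝓝 0)
  lim_top₁ : Tendsto (fun r => r * V₁ r) atTop (𝓝 0)

/-- The weight `r Φ(r) e(r)` of the variation of constants formula. -/
def vocWeight (m : ℕ) (e : ℝ → ℝ) (t : ℝ) : ℝ := t * radialSol m t * e t

/-- The derivative of the coefficient in the variation of constants formula. -/
def vocDeriv (m : ℕ) (e : ℝ → ℝ) (b r : ℝ) : ℝ :=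
  if r ≤ 0 then 0 else -(∫ t in r..b, vocWeight m e t) / (r * radialSol m r ^ 2)

theorem continuousAt_radialSol {m : ℕ} (hm : 3 ≤ m) {r : ℝ} (hr : 0 < r) :
    ContinuousAt (radialSol m) r := (hasDerivAt_radialSol hm hr).continuousAt

theorem continuous_vocWeight {m : ℕ} (hm : 3 ≤ m) {e : ℝ → ℝ} (he : Continuous e) {a b : ℝ}
    (ha : 0 < a) (hs : ∀ r, r ∉ Icc a b → e r = 0) : Continuous (vocWeight m e) := by
  rw [continuous_iff_continuousAt]
  intro t
  rcases lt_or_ge t a with h | h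
  · have : vocWeight m e =ᶠ[𝓝 t] fun _ => 0 := by
      filter_upwards [Iio_mem_nhds h] with s hsa
      rw [vocWeight, hs s fun h' => not_lt.2 h'.1 hsa, mul_zero]
    exact continuousAt_const.congr this.symm
  · exact (continuousAt_id.mul (continuousAt_radialSol hm (ha.trans_le h))).mul he.continuousAt

theorem hasDerivAt_vocIntegral {m : ℕ} {e : ℝ → ℝ} (hc : Continuous (vocWeight m e)) (b r : ℝ) :
    HasDerivAt (fun r => ∫ t in r..b, vocWeight m e t) (-vocWeight m e r) r :=
  intervalIntegral.integral_hasDerivAt_left (hc.intervalIntegrable _ _)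
    hc.stronglyMeasurable.stronglyMeasurableAtFilter hc.continuousAt

/-- Here the singularity of the homogeneous solution helps: its square in the denominator is at
least `c² r^{-2m}`, so the derivative of the coefficient vanishes to order `2m - 1` at the origin.
-/
theorem exists_vocDeriv_bound {m : ℕ} (hm : 3 ≤ m) {e : ℝ → ℝ} (hc : Continuous (vocWeight m e))
    (b : ℝ) : ∃ C, 0 ≤ C ∧ ∀ r, 0 < r → r ≤ 1 → |vocDeriv m e b r| ≤ C * ((r ^ m) ^ 2 / r) := by
  obtain ⟨c, _, hc0, _, hbd⟩ := exists_radialSol_bounds hm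
  have hI : Continuous fun r => ∫ t in r..b, vocWeight m e t :=
    continuous_iff_continuousAt.2 fun r => (hasDerivAt_vocIntegral hc b r).continuousAt
  obtain ⟨M, hM⟩ := (isCompact_Icc (a := (0 : ℝ)) (b := 1)).exists_bound_of_continuousOn
    hI.continuousOn
  have hM0 : 0 ≤ M := (norm_nonneg _).trans (hM 0 ⟨le_rfl, zero_le_one⟩)
  refine ⟨M / c ^ 2, by positivity, fun r hr hr1 => ?_⟩
  have h1 := (hbd r hr hr1).1
  have h2 : (c / r ^ m) ^ 2 ≤ radialSol m r ^ 2 := by gcongr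
  have hpos := radialSol_pos hm hr
  rw [vocDeriv, if_neg (not_le.2 hr), abs_div, abs_neg,
    abs_of_pos (mul_pos hr (pow_pos hpos 2))]
  calc _ ≤ M / (r * (c / r ^ m) ^ 2) := by
        gcongr
        exact hM r ⟨hr.le, hr1⟩
    _ = _ := by field_simp

theorem hasDerivAt_vocDeriv {m : ℕ} (hm : 3 ≤ m) {e : ℝ → ℝ} (hc : Continuous (vocWeight m e))
    (b : ℝ) {r : ℝ} (hr : 0 < r) : HasDerivAt (vocDeriv m e b)
      (e r / radialSol m r - vocDeriv m e b r * (1 / r + 2 * radialSol₁ m r / radialSol m r)) r := by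
  have hpos := radialSol_pos hm hr
  have h1 := (hasDerivAt_vocIntegral hc b r).neg.div
    ((hasDerivAt_id r).mul ((hasDerivAt_radialSol hm hr).pow 2)) (mul_pos hr (pow_pos hpos 2)).ne'
  have h2 : vocDeriv m e b =ᶠ[𝓝 r] fun r => -(∫ t in r..b, vocWeight m e t) /
      (r * radialSol m r ^ 2) := by
    filter_upwards [Ioi_mem_nhds hr] with s hs
    rw [vocDeriv, if_neg (not_le.2 hs)]
  refine (HasDerivAt.congr_of_eventuallyEq h1 h2).congr_deriv ?_
  simp only [vocDeriv, if_neg (not_le.2 hr), vocWeight, Pi.neg_apply, Pi.mul_apply, id, Pi.pow_apply]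
  field_simp
  norm_num
  ring

/-- The extension by zero to `r ≤ 0` is continuous because of the vanishing order at the origin.
Hence the coefficient can be defined as an ordinary integral starting at `R`, also when `R = 0`. -/
theorem continuous_vocDeriv {m : ℕ} (hm : 3 ≤ m) {e : ℝ → ℝ} (hc : Continuous (vocWeight m e))
    (b : ℝ) : Continuous (vocDeriv m e b) := by
  rw [continuous_iff_continuousAt]
  intro r
  rcases lt_trichotomy r 0 with h | h | h
  · have : vocDeriv m e b =ᶠ[𝓝 r] fun _ => 0 := by
      filter_upwards [Iio_mem_nhds h] with s hs
      rw [vocDeriv, if_pos (le_of_lt hs)]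
    exact continuousAt_const.congr this.symm
  · subst h
    obtain ⟨C, hC, hb⟩ := exists_vocDeriv_bound hm hc b
    have h0 : vocDeriv m e b 0 = 0 := by simp [vocDeriv]
    rw [ContinuousAt, h0]
    have hl : Tendsto (fun r : ℝ => C * |r|) (𝓝 0) (𝓝 0) := by
      have : Continuous fun r : ℝ => C * |r| := by fun_prop
      simpa using this.tendsto 0
    refine squeeze_zero_norm' ?_ hl
    filter_upwards [Iio_mem_nhds (zero_lt_one (α := ℝ))] with r hr
    rcases le_or_gt r 0 with h | h
    · rw [vocDeriv, if_pos h, norm_zero]; positivity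
    · refine (hb r h (le_of_lt hr)).trans ?_
      rw [abs_of_pos h]
      gcongr
      rw [div_le_iff₀ h, ← pow_mul, ← pow_two]
      exact pow_le_pow_of_le_one h.le (le_of_lt hr) (by omega)
  · exact (hasDerivAt_vocDeriv hm hc b h).continuousAt

/-- With `V = Φ y`, where `Φ = radialSol m`, the equation reads `(r Φ² y')' = r Φ e`. Choosing `y'`
to vanish beyond the support of `e` makes `V` a constant multiple of `Φ` near infinity, and `y(R) =
0` gives the boundary condition. For `R = 0` the bounds `y = O(r^{2m})` and `Φ = O(r^{-m})` combine
to `V = O(r^m)`. -/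
theorem exists_modeSol {R : ℝ} (hR : 0 ≤ R) {m : ℕ} (hm : 3 ≤ m) {e : ℝ → ℝ} (he : Continuous e)
    (hs : ∃ a b, R < a ∧ ∀ r, r ∉ Icc a b → e r = 0) :
    ∃ V V₁ V₂, ModeSol R m e V V₁ V₂ := by
  have hs' := hs
  obtain ⟨a, b, hRa, hs⟩ := hs
  have hc := continuous_vocWeight hm he (hR.trans_lt hRa) hs
  have hy1 := continuous_vocDeriv hm hc b
  set y : ℝ → ℝ := fun r => ∫ t in R..r, vocDeriv m e b t with hy
  have dy : ∀ r, HasDerivAt y (vocDeriv m e b r) r := fun r =>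
    intervalIntegral.integral_hasDerivAt_right (hy1.intervalIntegrable _ _)
      hy1.stronglyMeasurable.stronglyMeasurableAtFilter hy1.continuousAt
  set V : ℝ → ℝ := fun r => radialSol m r * y r with hV
  set V₁ : ℝ → ℝ := fun r => radialSol₁ m r * y r + radialSol m r * vocDeriv m e b r with hV₁
  have dV : ∀ r, 0 < r → HasDerivAt V (V₁ r) r := fun r hr =>
    (hasDerivAt_radialSol hm hr).mul (dy r)
  have dV₁ : ∀ r, 0 < r → HasDerivAt V₁ ((radialPot m r - 1) * V r + e r - V₁ r / r) r := by
    intro r hr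
    have hpos := radialSol_pos hm hr
    refine (((hasDerivAt_radialSol₁ hm hr).mul (dy r)).add
      ((hasDerivAt_radialSol hm hr).mul (hasDerivAt_vocDeriv hm hc b hr))).congr_deriv ?_
    simp only [hV, hV₁]
    field_simp
    ring
  have hyb : ∀ r, b ⊔ a ≤ r → vocDeriv m e b r = 0 := by
    intro r hr
    have hbr : b ≤ r := le_sup_left.trans hr
    have : ∫ t in r..b, vocWeight m e t = 0 := by
      rw [intervalIntegral.integral_symm, neg_eq_zero]
      refine intervalIntegral.integral_zero_ae (Eventually.of_forall fun t ht => ?_)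
      rw [uIoc_of_le hbr] at ht
      rw [vocWeight, hs t fun h => not_lt.2 h.2 ht.1, mul_zero]
    rw [vocDeriv, this]
    simp
  have hyc : ∀ r, b ⊔ a ≤ r → y r = y (b ⊔ a) := by
    intro r hr
    have : y r - y (b ⊔ a) = ∫ t in (b ⊔ a)..r, vocDeriv m e b t := by
      simp only [hy]
      rw [intervalIntegral.integral_interval_sub_left (hy1.intervalIntegrable _ _)
        (hy1.intervalIntegrable _ _)]
    rw [intervalIntegral.integral_congr (g := fun _ => 0), intervalIntegral.integral_zero] at this
    · linarith
    · intro t ht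
      rw [uIcc_of_le hr] at ht
      exact hyb t ht.1
  have hlocal : Tendsto (fun r => V r / r) (𝓝[>] R) (𝓝 0) ∧
      ∃ C, ∀ᶠ r in 𝓝[>] R, |V₁ r| ≤ C := by
    rcases hR.eq_or_lt with h0 | h0
    · subst h0
      obtain ⟨c, C, -, hC, hbd⟩ := exists_radialSol_bounds hm
      obtain ⟨D, hD, hyd⟩ := exists_vocDeriv_bound hm hc b
      have hyb : ∀ r, 0 < r → r ≤ 1 → |y r| ≤ D * (r ^ m) ^ 2 := by
        intro r hr hr1
        have := intervalIntegral.norm_integral_le_of_norm_le_const (a := 0) (b := r)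
          (f := vocDeriv m e b) (C := D * ((r ^ m) ^ 2 / r)) ?_
        · rw [sub_zero, abs_of_pos hr] at this
          calc |y r| ≤ D * ((r ^ m) ^ 2 / r) * r := this
            _ = _ := by field_simp
        · intro t ht
          rw [uIoc_of_le hr.le] at ht
          refine (hyd t ht.1 (ht.2.trans hr1)).trans ?_
          have e1 : ∀ x : ℝ, 0 < x → (x ^ m) ^ 2 / x = x ^ (2 * m - 1) := fun x hx => by
            rw [div_eq_iff hx.ne', ← pow_succ, ← pow_mul]; congr 1; omega
          rw [e1 t ht.1, e1 r hr]
          gcongr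
          · exact ht.1.le
          · exact ht.2
      constructor
      · have hl : Tendsto (fun r : ℝ => C * D * |r|) (𝓝[>] 0) (𝓝 0) := by
          have : Continuous fun r : ℝ => C * D * |r| := by fun_prop
          simpa using (this.tendsto 0).mono_left nhdsWithin_le_nhds
        refine squeeze_zero_norm' ?_ hl
        filter_upwards [Ioo_mem_nhdsGT (zero_lt_one (α := ℝ))] with r hr
        have hr0 := hr.1
        have h1 := hyb r hr.1 hr.2.le
        have h2 := (hbd r hr.1 hr.2.le).2.1
        rw [norm_div, Real.norm_eq_abs, hV, abs_mul, abs_of_pos (radialSol_pos hm hr0),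
          norm_of_nonneg hr0.le, abs_of_pos hr0, div_le_iff₀ hr0]
        calc _ ≤ (C / r ^ m) * (D * (r ^ m) ^ 2) := by gcongr
          _ = C * D * r ^ m := by field_simp
          _ ≤ C * D * r ^ 2 := by
            gcongr C * D * ?_
            exact pow_le_pow_of_le_one hr0.le hr.2.le (by omega)
          _ = _ := by ring
      · refine ⟨C * D + C * D, ?_⟩
        filter_upwards [Ioo_mem_nhdsGT (zero_lt_one (α := ℝ))] with r hr
        have hr0 := hr.1
        have h1 := hyb r hr.1 hr.2.le
        have h2 := (hbd r hr.1 hr.2.le).2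
        have h3 := hyd r hr.1 hr.2.le
        have h4 : r ^ m / r ≤ 1 := by
          rw [div_le_one hr0]
          calc r ^ m ≤ r ^ 1 := pow_le_pow_of_le_one hr0.le hr.2.le (by omega)
            _ = r := pow_one r
        refine (abs_add_le _ _).trans (add_le_add ?_ ?_)
        · rw [abs_mul]
          calc _ ≤ (C / r ^ (m + 1)) * (D * (r ^ m) ^ 2) := by gcongr; exact h2.2
            _ = C * D * (r ^ m / r) := by rw [pow_succ]; field_simp
            _ ≤ C * D * 1 := by gcongr
            _ = _ := mul_one _
        · rw [abs_mul, abs_of_pos (radialSol_pos hm hr0)]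
          calc _ ≤ (C / r ^ m) * (D * ((r ^ m) ^ 2 / r)) := by gcongr; exact h2.1
            _ = C * D * (r ^ m / r) := by field_simp
            _ ≤ C * D * 1 := by gcongr
            _ = _ := mul_one _
    · constructor
      · have h1 : ContinuousAt (fun r => V r / r) R :=
          (dV R h0).continuousAt.div continuousAt_id h0.ne'
        have h2 : V R / R = 0 := by simp [hV, hy]
        have := h1.tendsto
        rw [h2] at this
        exact this.mono_left nhdsWithin_le_nhds
      · refine ⟨|V₁ R| + 1, ?_⟩
        have := (dV₁ R h0).continuousAt.abs.eventually (gt_mem_nhds (lt_add_one _))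
        exact (this.filter_mono nhdsWithin_le_nhds).mono fun r hr => hr.le
  refine ⟨V, V₁, fun r => (radialPot m r - 1) * V r + e r - V₁ r / r,
    he, hs', fun r hr => dV r (hR.trans_lt hr), fun r hr => dV₁ r (hR.trans_lt hr),
    fun r _ => by ring, hlocal.1, hlocal.2, ?_, ?_⟩
  · have := (tendsto_radialSol_atTop hm).mul_const (y (b ⊔ a))
    rw [zero_mul] at this
    refine this.congr' ?_
    filter_upwards [eventually_ge_atTop (b ⊔ a)] with r hr
    simp only [hV, hyc r hr]
    ring
  · have := (tendsto_radialSol₁_atTop hm).mul_const (y (b ⊔ a))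
    rw [zero_mul] at this
    refine this.congr' ?_
    filter_upwards [eventually_ge_atTop (b ⊔ a)] with r hr
    simp only [hV₁, hyc r hr, hyb r hr]
    ring

/-- The derivatives of a solution with smooth right-hand side are smooth. -/
theorem ModeSol.contDiffOn {R : ℝ} (hR : 0 ≤ R) {m : ℕ} {e V V₁ V₂ : ℝ → ℝ}
    (h : ModeSol R m e V V₁ V₂) (he : ContDiff ℝ ∞ e) :
    ContDiffOn ℝ ∞ V (Ioi R) := by
  have hne : ∀ r ∈ Ioi R, r ≠ 0 := fun r hr => (hR.trans_lt hr).ne'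
  -- Bootstrap for the pair: the derivative of `V` is `V₁`, and the equation expresses that of `V₁`
  -- through `V`, `V₁` and `e`.
  have key : ∀ n : ℕ, ContDiffOn ℝ n V (Ioi R) ∧ ContDiffOn ℝ n V₁ (Ioi R) := by
    intro n
    induction n with
    | zero =>
      simp only [Nat.cast_zero, contDiffOn_zero]
      exact ⟨fun r hr => (h.deriv r hr).continuousAt.continuousWithinAt,
        fun r hr => (h.deriv₁ r hr).continuousAt.continuousWithinAt⟩
    | succ n ih =>
      push_cast
      rw [contDiffOn_succ_iff_deriv_of_isOpen isOpen_Ioi,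
        contDiffOn_succ_iff_deriv_of_isOpen isOpen_Ioi]
      refine ⟨⟨fun r hr => (h.deriv r hr).differentiableAt.differentiableWithinAt, by simp,
        ih.2.congr fun r hr => (h.deriv r hr).deriv⟩,
        ⟨fun r hr => (h.deriv₁ r hr).differentiableAt.differentiableWithinAt, by simp, ?_⟩⟩
      have : ContDiffOn ℝ n (fun r => (radialPot m r - 1) * V r + e r - V₁ r / r) (Ioi R) := by
        have hid : ContDiffOn ℝ n (fun r : ℝ => r) (Ioi R) := contDiffOn_id
        have hp : ContDiffOn ℝ n (radialPot m) (Ioi R) :=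
          (contDiffOn_const.div (hid.pow 2) fun r hr => pow_ne_zero 2 (hne r hr)).add
            ((hid.pow 2).div_const 16)
        exact (((hp.sub contDiffOn_const).mul ih.1).add
          ((he.of_le (by exact_mod_cast le_top)).contDiffOn)).sub (ih.2.div hid hne)
      refine this.congr fun r hr => ?_
      rw [(h.deriv₁ r hr).deriv]
      linarith [h.ode r hr]
  exact contDiffOn_infty.2 fun n => (key n).1

open scoped ENNReal

/-! ### The energy estimate for the radial equation -/

/-- The density of the radial energy. -/
def energyDens (m : ℕ) (V V₁ : ℝ → ℝ) (r : ℝ) : ℝ :=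
  r * (radialPot m r * V₁ r ^ 2 + radialPot m r ^ 2 * V r ^ 2 / 18)

/-- The boundary term in the radial energy identity. -/
def energyBdry (m : ℕ) (V V₁ : ℝ → ℝ) (r : ℝ) : ℝ :=
  r * V₁ r * (radialPot m r * V r) - 1 / 2 * ((r ^ 2 / 8 - 2 * (m : ℝ) ^ 2 / r ^ 2) * V r ^ 2)

theorem nine_le_sq {m : ℕ} (hm : 3 ≤ m) : (9 : ℝ) ≤ (m : ℝ) ^ 2 := by
  have : (3 : ℝ) ≤ m := by exact_mod_cast hm
  nlinarith

/-- The two summands have product `m²/16`, so their sum is at least `m/2`. The condition `m ≥ 3`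
enters here: it yields `Q - 1 ≥ Q/3`. -/
theorem radialPot_ge {m : ℕ} (hm : 3 ≤ m) {r : ℝ} (hr : 0 < r) : 3 / 2 ≤ radialPot m r := by
  have h9 := nine_le_sq hm
  have hX : 0 < (m : ℝ) ^ 2 / r ^ 2 := by positivity
  have hXY : (m : ℝ) ^ 2 / r ^ 2 * (r ^ 2 / 16) = (m : ℝ) ^ 2 / 16 := by field_simp
  rw [radialPot]
  set X := (m : ℝ) ^ 2 / r ^ 2
  set Y := r ^ 2 / 16
  have hY : 0 ≤ Y := by positivity
  nlinarith [sq_nonneg (X - Y)]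

/-- With `X = m²/r²` one has `(Q - 1) Q ≥ Q²/3` and `Q² ≥ X² + m²/8`, while `2m²/r⁴ ≤ 2X²/9` because
`m² ≥ 9`. The two subtracted terms are those produced by differentiating the multiplier `Q` in the
energy identity. -/
theorem radialPot_absorb {m : ℕ} (hm : 3 ≤ m) {r : ℝ} (hr : 0 < r) :
    radialPot m r ^ 2 / 9 ≤
      (radialPot m r - 1) * radialPot m r - 2 * (m : ℝ) ^ 2 / r ^ 4 - 1 / 8 := by
  have h9 := nine_le_sq hm
  have hQ := radialPot_ge hm hr
  have hX : 0 < (m : ℝ) ^ 2 / r ^ 2 := by positivity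
  have hXY : (m : ℝ) ^ 2 / r ^ 2 * (r ^ 2 / 16) = (m : ℝ) ^ 2 / 16 := by field_simp
  have h4 : 2 * (m : ℝ) ^ 2 / r ^ 4 ≤ 2 / 9 * ((m : ℝ) ^ 2 / r ^ 2) ^ 2 := by
    rw [div_pow, ← mul_div_assoc, ← pow_mul r]
    exact div_le_div_of_nonneg_right (by nlinarith) (by positivity)
  have hd : radialPot m r = (m : ℝ) ^ 2 / r ^ 2 + r ^ 2 / 16 := rfl
  set X := (m : ℝ) ^ 2 / r ^ 2
  set Y := r ^ 2 / 16
  have hY : 0 ≤ Y := by positivity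
  set Q := radialPot m r
  nlinarith [sq_nonneg Y]

theorem hasDerivAt_radialPot (m : ℕ) {r : ℝ} (hr : 0 < r) :
    HasDerivAt (radialPot m) (-(2 * (m : ℝ) ^ 2 / r ^ 3) + r / 8) r := by
  have h1 := ((hasDerivAt_pow 2 r).inv (by positivity : r ^ 2 ≠ 0)).const_mul ((m : ℝ) ^ 2)
  have h2 := (hasDerivAt_pow 2 r).div_const 16
  refine (h1.add h2).congr_deriv ?_
  field_simp
  norm_num
  ring

section

variable {R : ℝ} {m : ℕ} {e V V₁ V₂ : ℝ → ℝ}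

theorem ModeSol.integrable_rhs (h : ModeSol R m e V V₁ V₂) :
    Integrable fun r => r * e r ^ 2 := by
  obtain ⟨a, b, -, hs⟩ := h.supp
  refine Continuous.integrable_of_hasCompactSupport (by have := h.cont; fun_prop) ?_
  exact HasCompactSupport.intro isCompact_Icc (K := Icc a b) fun r hr => by rw [hs r hr]; simp

theorem ModeSol.continuousOn (h : ModeSol R m e V V₁ V₂) : ContinuousOn V (Ioi R) :=
  fun r hr => (h.deriv r hr).continuousAt.continuousWithinAt

theorem ModeSol.continuousOn₁ (h : ModeSol R m e V V₁ V₂) : ContinuousOn V₁ (Ioi R) :=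
  fun r hr => (h.deriv₁ r hr).continuousAt.continuousWithinAt

theorem continuousOn_radialPot {R : ℝ} (hR : 0 ≤ R) (m : ℕ) : ContinuousOn (radialPot m) (Ioi R) :=
  fun _ hr => (hasDerivAt_radialPot m (hR.trans_lt hr)).continuousAt.continuousWithinAt

theorem ModeSol.continuousOn₂ (hR : 0 ≤ R) (h : ModeSol R m e V V₁ V₂) :
    ContinuousOn V₂ (Ioi R) := by
  have : ContinuousOn (fun r => (radialPot m r - 1) * V r + e r - V₁ r / r) (Ioi R) :=
    ((((continuousOn_radialPot hR m).sub continuousOn_const).mul h.continuousOn).add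
      h.cont.continuousOn).sub (h.continuousOn₁.div continuousOn_id
        fun r hr => (hR.trans_lt hr).ne')
  exact this.congr fun r hr => by linarith [h.ode r hr]

theorem ModeSol.continuousOn_energyDens (hR : 0 ≤ R) (h : ModeSol R m e V V₁ V₂) :
    ContinuousOn (energyDens m V V₁) (Ioi R) := by
  have h1 := continuousOn_radialPot hR m
  have h2 := h.continuousOn
  have h3 := h.continuousOn₁
  exact continuousOn_id.mul ((h1.mul (h3.pow 2)).add (((h1.pow 2).mul (h2.pow 2)).div_const 18))

theorem energyDens_nonneg (m : ℕ) (V V₁ : ℝ → ℝ) {r : ℝ} (hr : 0 < r) :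
    0 ≤ energyDens m V V₁ r := by
  unfold energyDens radialPot
  positivity

/-- Energy identity with multiplier `r Q V`. The second term of `energyBdry` is `r Q' V²/2`; it
removes the cross term `r Q' V V'` at the price of `(r Q')' V²/2`. -/
theorem ModeSol.hasDerivAt_energyBdry (hR : 0 ≤ R) (h : ModeSol R m e V V₁ V₂) {r : ℝ}
    (hr : R < r) : HasDerivAt (energyBdry m V V₁)
      (r * (((radialPot m r - 1) * V r + e r) * (radialPot m r * V r) + radialPot m r * V₁ r ^ 2
        - (2 * (m : ℝ) ^ 2 / r ^ 4 + 1 / 8) * V r ^ 2)) r := by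
  have hr0 : 0 < r := hR.trans_lt hr
  have d1 := h.deriv r hr
  have d2 := h.deriv₁ r hr
  have d3 := hasDerivAt_radialPot m hr0
  have h5 := ((hasDerivAt_pow 2 r).inv (by positivity : r ^ 2 ≠ 0)).const_mul (2 * (m : ℝ) ^ 2)
  have h6 := ((hasDerivAt_pow 2 r).div_const 8).sub h5
  have h7 := (((hasDerivAt_id r).mul d2).mul (d3.mul d1)).sub
    ((h6.mul (d1.pow 2)).const_mul (1 / 2))
  refine h7.congr_deriv ?_
  have e2 : V₂ r = (radialPot m r - 1) * V r + e r - V₁ r / r := by linarith [h.ode r hr]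
  simp only [e2, Pi.mul_apply, Pi.sub_apply, Pi.pow_apply, Pi.inv_apply, id, radialPot]
  norm_num
  field_simp
  ring

theorem ModeSol.energy_le_interval (hR : 0 ≤ R) (hm : 3 ≤ m) (h : ModeSol R m e V V₁ V₂)
    {α β : ℝ} (hα : R < α) (hαβ : α ≤ β) :
    ∫ r in α..β, energyDens m V V₁ r ≤
      energyBdry m V V₁ β - energyBdry m V V₁ α + 9 / 2 * ∫ r in Ioi R, r * e r ^ 2 := by
  have hcont : Continuous fun r => r * e r ^ 2 := by have := h.cont; fun_prop
  have hsub : Icc α β ⊆ Ioi R := fun r hr => hα.trans_le hr.1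
  have dI : ∀ r, HasDerivAt (fun r => 9 / 2 * ∫ t in α..r, t * e t ^ 2) (9 / 2 * (r * e r ^ 2)) r :=
    fun r => (intervalIntegral.integral_hasDerivAt_right (hcont.intervalIntegrable _ _)
      hcont.stronglyMeasurable.stronglyMeasurableAtFilter hcont.continuousAt).const_mul _
  have key := intervalIntegral.integral_le_sub_of_hasDeriv_right_of_le hαβ
    (g := fun r => energyBdry m V V₁ r + 9 / 2 * ∫ t in α..r, t * e t ^ 2)
    (φ := energyDens m V V₁)
    (fun r hr => ((h.hasDerivAt_energyBdry hR (hsub hr)).add (dI r)).continuousAt.continuousWithinAt)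
    (fun r hr => ((h.hasDerivAt_energyBdry hR
      (hsub ⟨hr.1.le, hr.2.le⟩)).add (dI r)).hasDerivWithinAt)
    (((h.continuousOn_energyDens hR).mono hsub).integrableOn_Icc) ?_
  · have hle : ∫ t in α..β, t * e t ^ 2 ≤ ∫ r in Ioi R, r * e r ^ 2 := by
      rw [intervalIntegral.integral_of_le hαβ]
      refine setIntegral_mono_set h.integrable_rhs.integrableOn ?_
        (Eventually.of_forall fun r hr => hα.trans hr.1)
      refine (ae_restrict_mem measurableSet_Ioi).mono fun r hr => ?_
      have : (0 : ℝ) < r := hR.trans_lt hr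
      simp only [Pi.zero_apply]
      positivity
    simp only [intervalIntegral.integral_same] at key
    linarith
  · intro r hr
    have hr0 : 0 < r := hR.trans_lt (hα.trans hr.1)
    have hab := radialPot_absorb hm hr0
    rw [energyDens, mul_left_comm (9 / 2 : ℝ), ← mul_add]
    refine mul_le_mul_of_nonneg_left ?_ hr0.le
    have h1 := mul_le_mul_of_nonneg_right hab (sq_nonneg (V r))
    -- Young's inequality `e Q V ≥ -Q² V²/18 - 9 e²/2`: half of the `Q²/9` from `radialPot_absorb`
    -- is spent, and the other half stays in the energy.
    nlinarith [sq_nonneg (radialPot m r * V r / 3 + 3 * e r)]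

/-- All terms are polynomials in `r` times `V' (V/r)` or `(V/r)²`. This is why `ModeSol` asks for
`V/r → 0` and for `V'` bounded, which covers `R = 0` as well. -/
theorem ModeSol.tendsto_energyBdry (hR : 0 ≤ R) (h : ModeSol R m e V V₁ V₂) :
    Tendsto (energyBdry m V V₁) (𝓝[>] R) (𝓝 0) := by
  obtain ⟨C, hC⟩ := h.bdd₁
  have h1 : Tendsto (fun r => V₁ r * (V r / r)) (𝓝[>] R) (𝓝 0) :=
    bdd_le_mul_tendsto_zero' C hC h.lim
  have hp1 : Tendsto (fun r : ℝ => (m : ℝ) ^ 2 + r ^ 4 / 16) (𝓝[>] R)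
      (𝓝 ((m : ℝ) ^ 2 + R ^ 4 / 16)) :=
    ((by fun_prop : Continuous fun r : ℝ => (m : ℝ) ^ 2 + r ^ 4 / 16).tendsto R).mono_left
      nhdsWithin_le_nhds
  have hp2 : Tendsto (fun r : ℝ => r ^ 4 / 8 - 2 * (m : ℝ) ^ 2) (𝓝[>] R)
      (𝓝 (R ^ 4 / 8 - 2 * (m : ℝ) ^ 2)) :=
    ((by fun_prop : Continuous fun r : ℝ => r ^ 4 / 8 - 2 * (m : ℝ) ^ 2).tendsto R).mono_left
      nhdsWithin_le_nhds
  have h3 := (h1.mul hp1).sub (((h.lim.pow 2).mul hp2).const_mul (1 / 2))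
  norm_num at h3
  refine h3.congr' ?_
  filter_upwards [self_mem_nhdsWithin] with r hr
  have hr0 : 0 < r := hR.trans_lt hr
  rw [energyBdry, radialPot]
  field_simp

theorem ModeSol.tendsto_energyBdry_atTop (h : ModeSol R m e V V₁ V₂) :
    Tendsto (energyBdry m V V₁) atTop (𝓝 0) := by
  have hi : ∀ n : ℕ, n ≠ 0 → Tendsto (fun r : ℝ => (r ^ n)⁻¹) atTop (𝓝 0) := fun n hn =>
    (tendsto_pow_atTop hn).inv_tendsto_atTop
  have hp1 := ((hi 4 (by norm_num)).const_mul ((m : ℝ) ^ 2)).add_const (1 / 16)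
  have hp2 := ((hi 2 (by norm_num)).const_mul (1 / 8)).sub
    ((hi 6 (by norm_num)).const_mul (2 * (m : ℝ) ^ 2))
  have h3 := ((h.lim_top₁.mul h.lim_top).mul hp1).sub
    (((h.lim_top.pow 2).mul hp2).const_mul (1 / 2))
  norm_num at h3
  refine h3.congr' ?_
  filter_upwards [eventually_gt_atTop 0] with r hr
  rw [energyBdry, radialPot]
  field_simp

/-- The boundary terms vanish at both ends, so the estimate on compact intervals passes to the
half-line along an exhausting sequence. -/
theorem ModeSol.energy_le (hR : 0 ≤ R) (hm : 3 ≤ m) (h : ModeSol R m e V V₁ V₂) :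
    IntegrableOn (energyDens m V V₁) (Ioi R) ∧
      ∫ r in Ioi R, energyDens m V V₁ r ≤ 9 / 2 * ∫ r in Ioi R, r * e r ^ 2 := by
  set J := ∫ r in Ioi R, r * e r ^ 2
  set φ : ℕ → Set ℝ := fun n => Ioc (R + 1 / ((n : ℝ) + 1)) (R + ((n : ℝ) + 1)) with hφ
  have ha : Tendsto (fun n : ℕ => R + 1 / ((n : ℝ) + 1)) atTop (𝓝[>] R) := by
    refine tendsto_nhdsWithin_iff.2 ⟨?_, Eventually.of_forall fun n => ?_⟩
    · simpa using (tendsto_one_div_add_atTop_nhds_zero_nat (𝕜 := ℝ)).const_add R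
    · have : 0 < 1 / ((n : ℝ) + 1) := by positivity
      simpa using this
  have hb : Tendsto (fun n : ℕ => R + ((n : ℝ) + 1)) atTop atTop :=
    tendsto_atTop_add_const_left _ _ (tendsto_atTop_add_const_right _ _ tendsto_natCast_atTop_atTop)
  have hα : ∀ n : ℕ, R < R + 1 / ((n : ℝ) + 1) := fun n => by
    have : 0 < 1 / ((n : ℝ) + 1) := by positivity
    linarith
  have hαβ : ∀ n : ℕ, R + 1 / ((n : ℝ) + 1) ≤ R + ((n : ℝ) + 1) := fun n => by
    have h1 : (1 : ℝ) ≤ (n : ℝ) + 1 := by simp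
    have : 1 / ((n : ℝ) + 1) ≤ 1 := (div_le_one (by positivity)).2 h1
    linarith
  have hsub : ∀ n, φ n ⊆ Ioi R := fun n r hr => (hα n).trans hr.1
  have hres : ∀ n, (volume.restrict (Ioi R)).restrict (φ n) = volume.restrict (φ n) := fun n =>
    Measure.restrict_restrict_of_subset (hsub n)
  have hcov : AECover (volume.restrict (Ioi R)) atTop φ := by
    refine ⟨(ae_restrict_mem measurableSet_Ioi).mono fun r hr => ?_, fun n => measurableSet_Ioc⟩
    have h1 := (tendsto_nhdsWithin_iff.1 ha).1.eventually (gt_mem_nhds hr)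
    filter_upwards [h1, hb.eventually_ge_atTop r] with n h1 h2
    exact ⟨h1, h2⟩
  have hbound : ∀ n, ∫ r in φ n, energyDens m V V₁ r ∂(volume.restrict (Ioi R)) ≤
      energyBdry m V V₁ (R + ((n : ℝ) + 1)) - energyBdry m V V₁ (R + 1 / ((n : ℝ) + 1)) +
        9 / 2 * J := fun n => by
    rw [hres, ← intervalIntegral.integral_of_le (hαβ n)]
    exact h.energy_le_interval hR hm (hα n) (hαβ n)
  have hlim : Tendsto (fun n : ℕ => energyBdry m V V₁ (R + ((n : ℝ) + 1)) -
      energyBdry m V V₁ (R + 1 / ((n : ℝ) + 1)) + 9 / 2 * J) atTop (𝓝 (9 / 2 * J)) := by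
    have := ((h.tendsto_energyBdry_atTop.comp hb).sub
      ((h.tendsto_energyBdry hR).comp ha)).add_const (9 / 2 * J)
    simpa using this
  have hint : IntegrableOn (energyDens m V V₁) (Ioi R) := by
    refine hcov.integrable_of_integral_bounded_of_nonneg_ae (9 / 2 * J + 1) (fun n => ?_) ?_ ?_
    · rw [IntegrableOn, hres]
      have : Icc (R + 1 / ((n : ℝ) + 1)) (R + ((n : ℝ) + 1)) ⊆ Ioi R :=
        fun r hr => (hα n).trans_le hr.1
      exact (((h.continuousOn_energyDens hR).mono this).integrableOn_Icc).mono_set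
        Ioc_subset_Icc_self
    · exact (ae_restrict_mem measurableSet_Ioi).mono fun r hr =>
        energyDens_nonneg m V V₁ (hR.trans_lt hr)
    · filter_upwards [hlim.eventually (gt_mem_nhds (lt_add_one _))] with n hn
      exact (hbound n).trans (le_of_lt hn)
  exact ⟨hint, le_of_tendsto_of_tendsto' (hcov.integral_tendsto_of_countably_generated hint) hlim
    hbound⟩

/-- The squared norm of `A` in `L²((R, ∞), r dr)`. -/
def radialNorm (R : ℝ) (A : ℝ → ℝ) : ℝ≥0∞ := ∫⁻ r in Ioi R, ENNReal.ofReal (A r ^ 2 * r)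

theorem ModeSol.radialNorm_rhs (hR : 0 ≤ R) (h : ModeSol R m e V V₁ V₂) :
    radialNorm R e = ENNReal.ofReal (∫ r in Ioi R, r * e r ^ 2) := by
  rw [radialNorm, ofReal_integral_eq_lintegral_ofReal h.integrable_rhs.integrableOn]
  · simp_rw [mul_comm]
  · refine (ae_restrict_mem measurableSet_Ioi).mono fun r hr => ?_
    have : (0 : ℝ) < r := hR.trans_lt hr
    simp only [Pi.zero_apply]
    positivity

/-- The energy estimate gives `60 · 9/2 + 3 = 273 ≤ 300`. Every derivative needed later is
controlled in this form. -/
theorem ModeSol.radialNorm_le (hR : 0 ≤ R) (hm : 3 ≤ m) (h : ModeSol R m e V V₁ V₂)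
    {A : ℝ → ℝ} (hA : ∀ r, R < r → A r ^ 2 ≤
      60 * (radialPot m r * V₁ r ^ 2 + radialPot m r ^ 2 * V r ^ 2 / 18) + 3 * e r ^ 2) :
    radialNorm R A ≤ 300 * radialNorm R e := by
  obtain ⟨hint, hle⟩ := h.energy_le hR hm
  have h1 : radialNorm R A ≤
      ∫⁻ r in Ioi R, ENNReal.ofReal (60 * energyDens m V V₁ r + 3 * (r * e r ^ 2)) := by
    refine setLIntegral_mono' measurableSet_Ioi fun r hr => ENNReal.ofReal_le_ofReal ?_
    have hr0 : (0 : ℝ) < r := hR.trans_lt hr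
    have := mul_le_mul_of_nonneg_right (hA r hr) hr0.le
    rw [energyDens]
    linarith
  have hi2 : IntegrableOn (fun r => 60 * energyDens m V V₁ r + 3 * (r * e r ^ 2)) (Ioi R) :=
    (hint.const_mul 60).add (h.integrable_rhs.integrableOn.const_mul 3)
  refine h1.trans ?_
  rw [← ofReal_integral_eq_lintegral_ofReal hi2, h.radialNorm_rhs hR]
  · rw [show (300 : ℝ≥0∞) = ENNReal.ofReal 300 by norm_num, ← ENNReal.ofReal_mul (by norm_num)]
    refine ENNReal.ofReal_le_ofReal ?_
    rw [integral_add (hint.const_mul 60) (h.integrable_rhs.integrableOn.const_mul 3),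
      integral_const_mul, integral_const_mul]
    have : 0 ≤ ∫ r in Ioi R, r * e r ^ 2 := setIntegral_nonneg measurableSet_Ioi fun r hr => by
      have : (0 : ℝ) < r := hR.trans_lt hr
      positivity
    linarith
  · refine (ae_restrict_mem measurableSet_Ioi).mono fun r hr => ?_
    have hr0 : (0 : ℝ) < r := hR.trans_lt hr
    have := energyDens_nonneg m V V₁ hr0
    simp only [Pi.zero_apply]
    positivity

theorem ModeSol.tendsto_zero (hR : 0 ≤ R) (h : ModeSol R m e V V₁ V₂) :
    Tendsto V (𝓝[>] R) (𝓝 0) := by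
  have h1 := h.lim.mul ((continuous_id.tendsto R).mono_left nhdsWithin_le_nhds)
  rw [zero_mul] at h1
  refine h1.congr' ?_
  filter_upwards [self_mem_nhdsWithin] with r hr
  have hr0 : 0 < r := hR.trans_lt hr
  rw [id, div_mul_cancel₀ _ hr0.ne']

/-- Integrate `(m² V²)' = 2 m² V V'` from `R`, where `V` vanishes. Pairing `m² V/t²` with `V'/t`
bounds the integrand by `18 t²` times the energy density, and `18 · 9/2 = 81`. The factor `m` on the
left is what makes the sum over all modes converge. -/
theorem ModeSol.sq_le (hR : 0 ≤ R) (hm : 3 ≤ m) (h : ModeSol R m e V V₁ V₂) {r : ℝ}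
    (hr : R < r) :
    ((m : ℝ) * V r) ^ 2 ≤ 81 * r ^ 2 * ∫ t in Ioi R, t * e t ^ 2 := by
  obtain ⟨hint, hle⟩ := h.energy_le hR hm
  have h9 := nine_le_sq hm
  have hr0 : 0 < r := hR.trans_lt hr
  have key : ∀ s, R < s → s < r →
      ((m : ℝ) * V r) ^ 2 ≤ ((m : ℝ) * V s) ^ 2 + 81 * r ^ 2 * ∫ t in Ioi R, t * e t ^ 2 := by
    intro s hs hsr
    have hd : ∀ t, R < t → HasDerivAt (fun t => ((m : ℝ) * V t) ^ 2)
        (2 * (m : ℝ) ^ 2 * V t * V₁ t) t := fun t ht => by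
      refine (((h.deriv t ht).const_mul (m : ℝ)).pow 2).congr_deriv ?_
      push_cast
      ring
    have hsub : Icc s r ⊆ Ioi R := fun t ht => hs.trans_le ht.1
    have h2 := intervalIntegral.sub_le_integral_of_hasDeriv_right_of_le hsr.le
      (fun t ht => (hd t (hsub ht)).continuousAt.continuousWithinAt)
      (fun t ht => (hd t (hsub ⟨ht.1.le, ht.2.le⟩)).hasDerivWithinAt)
      (φ := fun t => 18 * r ^ 2 * energyDens m V V₁ t)
      ((hint.mono_set hsub).const_mul _) ?_
    · rw [intervalIntegral.integral_const_mul] at h2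
      have h3 : ∫ t in s..r, energyDens m V V₁ t ≤ ∫ t in Ioi R, energyDens m V V₁ t := by
        rw [intervalIntegral.integral_of_le hsr.le]
        refine setIntegral_mono_set hint ?_ (Eventually.of_forall fun t ht => hs.trans ht.1)
        exact (ae_restrict_mem measurableSet_Ioi).mono fun t ht =>
          energyDens_nonneg m V V₁ (hR.trans_lt ht)
      have h4 := mul_le_mul_of_nonneg_left (h3.trans hle) (by positivity : 0 ≤ 18 * r ^ 2)
      linarith
    · intro t ht
      have ht0 : 0 < t := hR.trans_lt (hs.trans ht.1)
      have hQ := radialPot_ge hm ht0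
      have hQ1 : (m : ℝ) ^ 2 / t ^ 2 ≤ radialPot m t := le_add_of_nonneg_right (by positivity)
      have hX : 0 < (m : ℝ) ^ 2 / t ^ 2 := by positivity
      have e1 : 2 * (m : ℝ) ^ 2 * V t * V₁ t = t ^ 2 * t *
          (2 * ((m : ℝ) ^ 2 / t ^ 2 * V t) * (V₁ t / t)) := by field_simp
      have h5 : 2 * ((m : ℝ) ^ 2 / t ^ 2 * V t) * (V₁ t / t) ≤
          18 * (radialPot m t * V₁ t ^ 2 + radialPot m t ^ 2 * V t ^ 2 / 18) := by
        have h6 : ((m : ℝ) ^ 2 / t ^ 2 * V t) ^ 2 ≤ radialPot m t ^ 2 * V t ^ 2 := by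
          rw [mul_pow]; gcongr
        have h7 : (V₁ t / t) ^ 2 ≤ radialPot m t * V₁ t ^ 2 := by
          have : 1 / t ^ 2 ≤ (m : ℝ) ^ 2 / t ^ 2 := by gcongr; linarith
          calc (V₁ t / t) ^ 2 = 1 / t ^ 2 * V₁ t ^ 2 := by ring
            _ ≤ _ := by gcongr; linarith
        have h8 : 0 ≤ radialPot m t * V₁ t ^ 2 := by positivity
        nlinarith [sq_nonneg ((m : ℝ) ^ 2 / t ^ 2 * V t - V₁ t / t)]
      have h9 : t ^ 2 ≤ r ^ 2 := by gcongr; exact ht.2.le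
      have h10 := energyDens_nonneg m V V₁ ht0
      calc 2 * (m : ℝ) ^ 2 * V t * V₁ t ≤ t ^ 2 * t *
            (18 * (radialPot m t * V₁ t ^ 2 + radialPot m t ^ 2 * V t ^ 2 / 18)) := by
            rw [e1]; gcongr
        _ = t ^ 2 * (18 * energyDens m V V₁ t) := by rw [energyDens]; ring
        _ ≤ r ^ 2 * (18 * energyDens m V V₁ t) := by gcongr
        _ = _ := by ring
  have hlim : Tendsto (fun s => ((m : ℝ) * V s) ^ 2 + 81 * r ^ 2 * ∫ t in Ioi R, t * e t ^ 2)
      (𝓝[>] R) (𝓝 (81 * r ^ 2 * ∫ t in Ioi R, t * e t ^ 2)) := by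
    simpa using (((h.tendsto_zero hR).const_mul (m : ℝ)).pow 2).add_const
      (81 * r ^ 2 * ∫ t in Ioi R, t * e t ^ 2)
  refine ge_of_tendsto hlim ?_
  filter_upwards [Ioo_mem_nhdsGT hr] with s hs
  exact key s hs.1 hs.2

theorem ModeSol.sub {e' V' V₁' V₂' : ℝ → ℝ} (h : ModeSol R m e V V₁ V₂)
    (h' : ModeSol R m e' V' V₁' V₂') :
    ModeSol R m (e - e') (V - V') (V₁ - V₁') (V₂ - V₂') where
  cont := h.cont.sub h'.cont
  supp := by
    obtain ⟨a, b, ha, hs⟩ := h.supp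
    obtain ⟨a', b', ha', hs'⟩ := h'.supp
    refine ⟨a ⊓ a', b ⊔ b', lt_inf_iff.2 ⟨ha, ha'⟩, fun r hr => ?_⟩
    rw [Pi.sub_apply, hs r fun hh => hr ⟨inf_le_left.trans hh.1, hh.2.trans le_sup_left⟩,
      hs' r fun hh => hr ⟨inf_le_right.trans hh.1, hh.2.trans le_sup_right⟩, sub_zero]
  deriv r hr := (h.deriv r hr).sub (h'.deriv r hr)
  deriv₁ r hr := (h.deriv₁ r hr).sub (h'.deriv₁ r hr)
  ode r hr := by
    have h1 := h.ode r hr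
    have h2 := h'.ode r hr
    simp only [Pi.sub_apply]
    linear_combination h1 - h2
  lim := by
    have := h.lim.sub h'.lim
    rw [sub_zero] at this
    exact this.congr fun r => by simp only [Pi.sub_apply]; ring
  bdd₁ := by
    obtain ⟨C, hC⟩ := h.bdd₁
    obtain ⟨C', hC'⟩ := h'.bdd₁
    refine ⟨C + C', ?_⟩
    filter_upwards [hC, hC'] with r h1 h2
    exact (abs_sub _ _).trans (add_le_add h1 h2)
  lim_top := by
    have := h.lim_top.sub h'.lim_top
    rw [sub_zero] at this
    exact this.congr fun r => by simp only [Pi.sub_apply]; ring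
  lim_top₁ := by
    have := h.lim_top₁.sub h'.lim_top₁
    rw [sub_zero] at this
    exact this.congr fun r => by simp only [Pi.sub_apply]; ring

theorem ModeSol.zero (R : ℝ) (m : ℕ) : ModeSol R m 0 0 0 0 where
  cont := continuous_const
  supp := ⟨R + 1, 0, by simp, fun _ _ => rfl⟩
  deriv r _ := hasDerivAt_const r 0
  deriv₁ r _ := hasDerivAt_const r 0
  ode r _ := by simp
  lim := by simp
  bdd₁ := ⟨0, by simp⟩
  lim_top := by simp
  lim_top₁ := by simp

end

/-! ### Angular modes on the plane -/

/-- The identification of the plane with `ℂ`. -/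
def toComplex (x : Plane) : ℂ := ⟨x 0, x 1⟩

/-- The complex angular mode `e^{i l θ}`. -/
def angMode (l : ℕ) (x : Plane) : ℂ := (toComplex x / (‖x‖ : ℂ)) ^ l

/-- The angular mode `sin (l θ)`. -/
def sinMode (l : ℕ) (x : Plane) : ℝ := (angMode l x).im

/-- The angular mode `cos (l θ)`. -/
def cosMode (l : ℕ) (x : Plane) : ℝ := (angMode l x).re

/-- The tangential vector `(-x₁, x₀)`. -/
def tang (x : Plane) (j : Fin 2) : ℝ := ![-x 1, x 0] j

/-- The point with polar coordinates `(r, θ)`. -/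
def polarPt (r θ : ℝ) : Plane := !₂[r * cos θ, r * sin θ]

/-- The finite sum `∑_{l < N} A_l(|x|) sin (l θ)`. -/
def sinSum (A : ℕ → ℝ → ℝ) (N : ℕ) (x : Plane) : ℝ := ∑ l ∈ Finset.range N, A l ‖x‖ * sinMode l x

/-- The finite sum `∑_{l < N} A_l(|x|) cos (l θ)`. -/
def cosSum (A : ℕ → ℝ → ℝ) (N : ℕ) (x : Plane) : ℝ := ∑ l ∈ Finset.range N, A l ‖x‖ * cosMode l x

theorem norm_sq_plane (x : Plane) : ‖x‖ ^ 2 = x 0 ^ 2 + x 1 ^ 2 := by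
  rw [EuclideanSpace.norm_sq_eq]
  simp

theorem abs_coord_le (x : Plane) (j : Fin 2) : |x j| ≤ ‖x‖ := by
  rw [← Real.norm_eq_abs]
  exact PiLp.norm_apply_le x j

theorem abs_tang_le (x : Plane) (j : Fin 2) : |tang x j| ≤ ‖x‖ := by
  fin_cases j
  · simpa [tang] using abs_coord_le x 1
  · simpa [tang] using abs_coord_le x 0

theorem norm_polarPt {r : ℝ} (hr : 0 ≤ r) (θ : ℝ) : ‖polarPt r θ‖ = r := by
  have : ‖polarPt r θ‖ ^ 2 = r ^ 2 := by
    rw [norm_sq_plane]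
    simp only [polarPt, PiLp.toLp_apply, Matrix.cons_val_zero, Matrix.cons_val_one]
    linear_combination r ^ 2 * sin_sq_add_cos_sq θ
  exact (sq_eq_sq₀ (norm_nonneg _) hr).1 this

theorem angMode_polarPt {r : ℝ} (hr : 0 < r) (l : ℕ) (θ : ℝ) :
    angMode l (polarPt r θ) = ⟨cos (l * θ), sin (l * θ)⟩ := by
  have h1 : toComplex (polarPt r θ) = (r : ℂ) * (Complex.cos θ + Complex.sin θ * Complex.I) := by
    apply Complex.ext <;> simp [toComplex, polarPt, ← Complex.ofReal_cos, ← Complex.ofReal_sin]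
  have hr' : (r : ℂ) ≠ 0 := by exact_mod_cast hr.ne'
  rw [angMode, norm_polarPt hr.le, h1, mul_div_cancel_left₀ _ hr',
    Complex.cos_add_sin_mul_I_pow]
  apply Complex.ext <;>
    simp [← Complex.ofReal_natCast, ← Complex.ofReal_mul, ← Complex.ofReal_cos,
      ← Complex.ofReal_sin]

theorem sinMode_polarPt {r : ℝ} (hr : 0 < r) (l : ℕ) (θ : ℝ) :
    sinMode l (polarPt r θ) = sin (l * θ) := by rw [sinMode, angMode_polarPt hr]

theorem cosMode_polarPt {r : ℝ} (hr : 0 < r) (l : ℕ) (θ : ℝ) :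
    cosMode l (polarPt r θ) = cos (l * θ) := by rw [cosMode, angMode_polarPt hr]

theorem exists_polarPt (x : Plane) : ∃ θ, x = polarPt ‖x‖ θ := by
  refine ⟨Complex.arg (toComplex x), ?_⟩
  have hn : ‖toComplex x‖ = ‖x‖ := by
    have : ‖toComplex x‖ ^ 2 = ‖x‖ ^ 2 := by
      rw [norm_sq_plane, ← Complex.normSq_eq_norm_sq, Complex.normSq_apply, toComplex]
      ring
    exact (sq_eq_sq₀ (norm_nonneg _) (norm_nonneg _)).1 this
  ext j
  fin_cases j
  · simp only [polarPt, ← hn]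
    exact (Complex.norm_mul_cos_arg (toComplex x)).symm
  · simp only [polarPt, ← hn]
    exact (Complex.norm_mul_sin_arg (toComplex x)).symm

theorem sinSum_polarPt (A : ℕ → ℝ → ℝ) (N : ℕ) {r : ℝ} (hr : 0 < r) (θ : ℝ) :
    sinSum A N (polarPt r θ) = ∑ l ∈ Finset.range N, A l r * sin (l * θ) := by
  simp only [sinSum, norm_polarPt hr.le, sinMode_polarPt hr]

theorem cosSum_polarPt (A : ℕ → ℝ → ℝ) (N : ℕ) {r : ℝ} (hr : 0 < r) (θ : ℝ) :
    cosSum A N (polarPt r θ) = ∑ l ∈ Finset.range N, A l r * cos (l * θ) := by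
  simp only [cosSum, norm_polarPt hr.le, cosMode_polarPt hr]

theorem norm_angMode_le (l : ℕ) (x : Plane) (hx : x ≠ 0) : ‖angMode l x‖ ≤ 1 := by
  obtain ⟨θ, hθ⟩ := exists_polarPt x
  rw [hθ, angMode_polarPt (norm_pos_iff.2 hx)]
  have : ‖(⟨cos (l * θ), sin (l * θ)⟩ : ℂ)‖ ^ 2 = 1 := by
    rw [← Complex.normSq_eq_norm_sq, Complex.normSq_mk]
    linarith [sin_sq_add_cos_sq ((l : ℝ) * θ)]
  nlinarith [norm_nonneg (⟨cos (l * θ), sin (l * θ)⟩ : ℂ)]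

theorem abs_sinMode_le (l : ℕ) {x : Plane} (hx : x ≠ 0) : |sinMode l x| ≤ 1 :=
  (Complex.abs_im_le_norm _).trans (norm_angMode_le l x hx)

/-! ### Line derivatives of angular modes -/

theorem hasLineDerivAt_norm {x : Plane} (hx : x ≠ 0) (j : Fin 2) :
    HasLineDerivAt ℝ (fun y : Plane => ‖y‖) (x j / ‖x‖) x (EuclideanSpace.single j 1) := by
  have hpos : 0 < ‖x‖ := norm_pos_iff.2 hx
  have h1 : HasDerivAt (fun t : ℝ => x + t • (EuclideanSpace.single j (1 : ℝ) : Plane))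
      (EuclideanSpace.single j 1) 0 := by
    simpa using ((hasDerivAt_id (0 : ℝ)).smul_const
      (EuclideanSpace.single j (1 : ℝ) : Plane)).const_add x
  have h2 := h1.norm_sq
  have h3 := h2.sqrt (by simp; exact hx)
  rw [HasLineDerivAt]
  refine (h3.congr_deriv ?_).congr_of_eventuallyEq (Eventually.of_forall fun t => ?_)
  · simp [EuclideanSpace.inner_single_right]
    field_simp
  · simp [Real.sqrt_sq]

theorem hasLineDerivAt_toComplex (x : Plane) (j : Fin 2) :
    HasLineDerivAt ℝ toComplex (toComplex (EuclideanSpace.single j 1)) x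
      (EuclideanSpace.single j 1) := by
  have : ∀ t : ℝ, toComplex (x + t • (EuclideanSpace.single j (1 : ℝ) : Plane)) =
      toComplex x + t * toComplex (EuclideanSpace.single j 1) := by
    intro t
    apply Complex.ext <;> simp [toComplex]
  rw [HasLineDerivAt]
  simp only [this]
  have h := ((Complex.ofRealCLM.hasDerivAt (x := (0 : ℝ))).mul_const
    (toComplex (EuclideanSpace.single j 1))).const_add (toComplex x)
  simpa using h

/-- This is `∂_j e^{ilθ} = i l (∂_j θ) e^{ilθ}` with `∂_j θ = tang x j / |x|²`, obtained without
choosing a branch of `θ`. -/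
theorem hasLineDerivAt_angMode (l : ℕ) {x : Plane} (hx : x ≠ 0) (j : Fin 2) :
    HasLineDerivAt ℝ (angMode l) (Complex.I * (l * tang x j / ‖x‖ ^ 2 : ℝ) * angMode l x) x
      (EuclideanSpace.single j 1) := by
  have hpos : 0 < ‖x‖ := norm_pos_iff.2 hx
  have hne : (‖x‖ : ℂ) ≠ 0 := by exact_mod_cast hpos.ne'
  have h1 : HasDerivAt (fun t : ℝ => toComplex (x + t • EuclideanSpace.single j 1)) _ 0 :=
    hasLineDerivAt_toComplex x j
  have h2 : HasDerivAt (fun t : ℝ => ‖x + t • (EuclideanSpace.single j (1 : ℝ) : Plane)‖) _ 0 :=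
    hasLineDerivAt_norm hx j
  have h3 := (h1.div h2.ofReal_comp (by simpa using hx)).pow l
  rw [HasLineDerivAt]
  refine h3.congr_deriv ?_
  cases l with
  | zero => simp
  | succ n =>
    have hsq : (‖x‖ : ℂ) ^ 2 = (x 0 : ℂ) ^ 2 + (x 1 : ℂ) ^ 2 := by
      exact_mod_cast congrArg (fun r : ℝ => (r : ℂ)) (norm_sq_plane x)
    have hc : toComplex x = (x 0 : ℂ) + x 1 * Complex.I := by
      apply Complex.ext <;> simp [toComplex]
    -- Splitting of the `j`-th basis vector into its radial and tangential components, multiplied by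
    -- `|x|²`.
    have key : toComplex x * (Complex.I * tang x j) =
        toComplex (EuclideanSpace.single j 1) * ‖x‖ ^ 2 - toComplex x * x j := by
      rw [hsq, hc]
      fin_cases j
      · have : toComplex (EuclideanSpace.single 0 1) = 1 := by
          apply Complex.ext <;> simp [toComplex]
        simp [tang, this]
        linear_combination (-(x 1 : ℂ) ^ 2) * Complex.I_sq
      · have : toComplex (EuclideanSpace.single 1 1) = Complex.I := by
          apply Complex.ext <;> simp [toComplex]
        simp [tang, this]
        linear_combination (x 0 * x 1 : ℂ) * Complex.I_sq
    simp only [Pi.div_apply, zero_smul, add_zero, angMode, Nat.add_sub_cancel]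
    push_cast
    have e1 : (toComplex (EuclideanSpace.single j 1) * ‖x‖ - toComplex x * (x j / ‖x‖)) / ‖x‖ ^ 2
        = (toComplex x / ‖x‖) * (Complex.I * tang x j / ‖x‖ ^ 2) := by
      field_simp
      linear_combination -key
    rw [e1, pow_succ]
    ring

section

variable {A : ℝ → ℝ} {A' : ℝ} {x : Plane}

theorem hasLineDerivAt_mul_angMode (l : ℕ) (hx : x ≠ 0) (hA : HasDerivAt A A' ‖x‖) (j : Fin 2) :
    HasLineDerivAt ℝ (fun y => (A ‖y‖ : ℂ) * angMode l y)
      (((x j * (A' / ‖x‖) : ℝ) + (tang x j * (l * A ‖x‖ / ‖x‖ ^ 2) : ℝ) * Complex.I) *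
        angMode l x) x (EuclideanSpace.single j 1) := by
  have h2 : HasDerivAt (fun t : ℝ => ‖x + t • (EuclideanSpace.single j (1 : ℝ) : Plane)‖) _ 0 :=
    hasLineDerivAt_norm hx j
  have h3 : HasDerivAt (fun t : ℝ => angMode l (x + t • EuclideanSpace.single j 1)) _ 0 :=
    hasLineDerivAt_angMode l hx j
  have hA0 : HasDerivAt A A' ‖x + (0 : ℝ) • (EuclideanSpace.single j (1 : ℝ) : Plane)‖ := by
    simpa using hA
  have h4 := ((hA0.comp (0 : ℝ) h2).ofReal_comp).mul h3
  rw [HasLineDerivAt]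
  refine h4.congr_deriv ?_
  simp only [zero_smul, add_zero, Function.comp]
  push_cast
  ring

theorem hasLineDerivAt_mul_sinMode (l : ℕ) (hx : x ≠ 0) (hA : HasDerivAt A A' ‖x‖) (j : Fin 2) :
    HasLineDerivAt ℝ (fun y => A ‖y‖ * sinMode l y)
      (x j * (A' / ‖x‖ * sinMode l x) + tang x j * (l * A ‖x‖ / ‖x‖ ^ 2 * cosMode l x)) x
      (EuclideanSpace.single j 1) := by
  have h := hasLineDerivAt_mul_angMode l hx hA j
  rw [HasLineDerivAt] at h ⊢
  have h' := Complex.imCLM.hasFDerivAt.comp_hasDerivAt (0 : ℝ) h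
  refine (h'.congr_deriv ?_).congr_of_eventuallyEq (Eventually.of_forall fun t => ?_)
  · simp only [Complex.imCLM_apply, Complex.mul_im, Complex.add_re, Complex.add_im,
      Complex.ofReal_re, Complex.ofReal_im, Complex.mul_re, Complex.I_re, Complex.I_im, sinMode,
      cosMode]
    ring
  · simp [sinMode]

theorem hasLineDerivAt_mul_cosMode (l : ℕ) (hx : x ≠ 0) (hA : HasDerivAt A A' ‖x‖) (j : Fin 2) :
    HasLineDerivAt ℝ (fun y => A ‖y‖ * cosMode l y)
      (x j * (A' / ‖x‖ * cosMode l x) - tang x j * (l * A ‖x‖ / ‖x‖ ^ 2 * sinMode l x)) x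
      (EuclideanSpace.single j 1) := by
  have h := hasLineDerivAt_mul_angMode l hx hA j
  rw [HasLineDerivAt] at h ⊢
  have h' := Complex.reCLM.hasFDerivAt.comp_hasDerivAt (0 : ℝ) h
  refine (h'.congr_deriv ?_).congr_of_eventuallyEq (Eventually.of_forall fun t => ?_)
  · simp only [Complex.reCLM_apply, Complex.add_re, Complex.add_im,
      Complex.ofReal_re, Complex.ofReal_im, Complex.mul_re, Complex.mul_im, Complex.I_re,
      Complex.I_im, sinMode, cosMode]
    ring
  · simp [cosMode]

end

section

variable {A A' : ℕ → ℝ → ℝ} {N : ℕ} {x : Plane}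

theorem hasLineDerivAt_sinSum (hx : x ≠ 0) (hA : ∀ l, HasDerivAt (A l) (A' l ‖x‖) ‖x‖)
    (j : Fin 2) :
    HasLineDerivAt ℝ (sinSum A N) (x j * sinSum (fun l r => A' l r / r) N x +
      tang x j * cosSum (fun l r => l * A l r / r ^ 2) N x) x (EuclideanSpace.single j 1) := by
  have h := HasDerivAt.fun_sum (u := Finset.range N)
    fun l _ => hasLineDerivAt_mul_sinMode l hx (hA l) j
  rw [HasLineDerivAt]
  refine h.congr_deriv ?_
  rw [Finset.sum_add_distrib, ← Finset.mul_sum, ← Finset.mul_sum]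
  rfl

theorem hasLineDerivAt_cosSum (hx : x ≠ 0) (hA : ∀ l, HasDerivAt (A l) (A' l ‖x‖) ‖x‖)
    (j : Fin 2) :
    HasLineDerivAt ℝ (cosSum A N) (x j * cosSum (fun l r => A' l r / r) N x -
      tang x j * sinSum (fun l r => l * A l r / r ^ 2) N x) x (EuclideanSpace.single j 1) := by
  have h := HasDerivAt.fun_sum (u := Finset.range N)
    fun l _ => hasLineDerivAt_mul_cosMode l hx (hA l) j
  rw [HasLineDerivAt]
  refine h.congr_deriv ?_
  rw [Finset.sum_sub_distrib, ← Finset.mul_sum, ← Finset.mul_sum]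
  rfl

end

/-- The partial derivative of `sinSum V N`. -/
def sinSumGrad (V V₁ : ℕ → ℝ → ℝ) (N : ℕ) (j : Fin 2) (x : Plane) : ℝ :=
  x j * sinSum (fun l r => V₁ l r / r) N x + tang x j * cosSum (fun l r => l * V l r / r ^ 2) N x

/-- The partial derivative of `x ↦ tang x i` in the direction `j`. -/
def tangGrad (i j : Fin 2) : ℝ := tang (EuclideanSpace.single j 1) i

/-- The second partial derivatives of `sinSum V N`. -/
def sinSumHess (V V₁ V₂ : ℕ → ℝ → ℝ) (N : ℕ) (i j : Fin 2) (x : Plane) : ℝ :=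
  (if i = j then 1 else 0) * sinSum (fun l r => V₁ l r / r) N x +
    x i * x j * sinSum (fun l r => (V₂ l r - V₁ l r / r) / r ^ 2) N x +
    x i * tang x j * cosSum (fun l r => l * (V₁ l r / r) / r ^ 2) N x +
    tangGrad i j * cosSum (fun l r => l * V l r / r ^ 2) N x +
    tang x i * x j * cosSum (fun l r => l * (V₁ l r / r - 2 * V l r / r ^ 2) / r ^ 2) N x -
    tang x i * tang x j * sinSum (fun l r => l * (l * V l r / r ^ 2) / r ^ 2) N x

theorem hasLineDerivAt_sinSumGrad {V V₁ V₂ : ℕ → ℝ → ℝ} {N : ℕ} {x : Plane} (hx : x ≠ 0)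
    (h1 : ∀ l, HasDerivAt (V l) (V₁ l ‖x‖) ‖x‖) (h2 : ∀ l, HasDerivAt (V₁ l) (V₂ l ‖x‖) ‖x‖)
    (i j : Fin 2) :
    HasLineDerivAt ℝ (sinSumGrad V V₁ N i) (sinSumHess V V₁ V₂ N i j x) x
      (EuclideanSpace.single j 1) := by
  have hr : ‖x‖ ≠ 0 := norm_ne_zero_iff.2 hx
  have d1 := hasLineDerivAt_sinSum (N := N) hx (A := fun l r => V₁ l r / r)
    (A' := fun l r => (V₂ l r - V₁ l r / r) / r) (fun l => by
      refine ((h2 l).div (hasDerivAt_id _) hr).congr_deriv ?_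
      simp only [id]
      field_simp) j
  have d2 := hasLineDerivAt_cosSum (N := N) hx (A := fun l r => l * V l r / r ^ 2)
    (A' := fun l r => l * (V₁ l r / r - 2 * V l r / r ^ 2) / r) (fun l => by
      refine (((h1 l).const_mul (l : ℝ)).div (hasDerivAt_pow 2 _) (pow_ne_zero 2 hr)).congr_deriv ?_
      push_cast
      field_simp) j
  have c1 : HasLineDerivAt ℝ (fun y : Plane => y i) (if i = j then 1 else 0) x
      (EuclideanSpace.single j 1) := by
    rw [HasLineDerivAt]
    have := ((hasDerivAt_id (0 : ℝ)).mul_const (if i = j then (1 : ℝ) else 0)).const_add (x i)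
    simpa using this
  have c2 : HasLineDerivAt ℝ (fun y : Plane => tang y i) (tangGrad i j) x
      (EuclideanSpace.single j 1) := by
    rw [HasLineDerivAt]
    have := ((hasDerivAt_id (0 : ℝ)).mul_const (tangGrad i j)).const_add (tang x i)
    rw [one_mul] at this
    refine this.congr_of_eventuallyEq (Eventually.of_forall fun t => ?_)
    fin_cases i <;> simp [tang, tangGrad]
    ring
  rw [HasLineDerivAt] at d1 d2 c1 c2 ⊢
  refine ((c1.mul d1).add (c2.mul d2)).congr_deriv ?_
  simp only [zero_smul, add_zero, sinSumHess]
  have e1 : sinSum (fun l r => (V₂ l r - V₁ l r / r) / r / r) N x =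
      sinSum (fun l r => (V₂ l r - V₁ l r / r) / r ^ 2) N x := by
    simp only [div_div, pow_two]
  have e2 : cosSum (fun l r => l * (V₁ l r / r - 2 * V l r / r ^ 2) / r / r) N x =
      cosSum (fun l r => l * (V₁ l r / r - 2 * V l r / r ^ 2) / r ^ 2) N x := by
    simp only [div_div, pow_two]
  rw [e1, e2]
  ring

/-- The Laplacian in polar coordinates. The mixed terms cancel because `tang x` is orthogonal to
`x`, and the two have the same length. -/
theorem sinSumHess_trace (V V₁ V₂ : ℕ → ℝ → ℝ) (N : ℕ) {x : Plane} (hx : x ≠ 0) :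
    ∑ i, sinSumHess V V₁ V₂ N i i x =
      sinSum (fun l r => V₂ l r + V₁ l r / r - (l : ℝ) ^ 2 / r ^ 2 * V l r) N x := by
  have hr : ‖x‖ ≠ 0 := norm_ne_zero_iff.2 hx
  have hsq := norm_sq_plane x
  simp only [Fin.sum_univ_two, sinSumHess, tangGrad, tang]
  simp
  have e : sinSum (fun l r => V₂ l r + V₁ l r / r - (l : ℝ) ^ 2 / r ^ 2 * V l r) N x =
      2 * sinSum (fun l r => V₁ l r / r) N x + ‖x‖ ^ 2 *
        sinSum (fun l r => (V₂ l r - V₁ l r / r) / r ^ 2) N x -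
      ‖x‖ ^ 2 * sinSum (fun l r => l * (l * V l r / r ^ 2) / r ^ 2) N x := by
    simp only [sinSum, Finset.mul_sum, ← Finset.sum_add_distrib, ← Finset.sum_sub_distrib]
    refine Finset.sum_congr rfl fun l _ => ?_
    field_simp
    ring
  rw [e, hsq]
  ring

/-! ### Polar coordinates and orthogonality -/

theorem isOpen_exteriorDomain (R : ℝ) : IsOpen (exteriorDomain R) :=
  isOpen_lt continuous_const continuous_norm

theorem measurableSet_exteriorDomain (R : ℝ) : MeasurableSet (exteriorDomain R) :=
  (isOpen_exteriorDomain R).measurableSet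

theorem ne_zero_of_mem_exteriorDomain {R : ℝ} (hR : 0 ≤ R) {x : Plane}
    (hx : x ∈ exteriorDomain R) : x ≠ 0 := norm_pos_iff.1 (hR.trans_lt hx)

/-- The plane as a product of two lines. -/
def planeEquiv : ℝ × ℝ ≃ᵐ Plane :=
  MeasurableEquiv.finTwoArrow.symm.trans (MeasurableEquiv.toLp 2 (Fin 2 → ℝ))

theorem planeEquiv_apply (p : ℝ × ℝ) : planeEquiv p = !₂[p.1, p.2] := by
  simp [planeEquiv, MeasurableEquiv.finTwoArrow, MeasurableEquiv.piFinTwo]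

theorem measurePreserving_planeEquiv : MeasurePreserving planeEquiv :=
  (PiLp.volume_preserving_toLp (Fin 2)).comp (volume_preserving_finTwoArrow ℝ).symm

theorem continuous_polarPt : Continuous fun p : ℝ × ℝ => polarPt p.1 p.2 := by
  unfold polarPt
  refine (PiLp.continuous_toLp 2 _).comp (continuous_pi fun i => ?_)
  fin_cases i <;> simp <;> fun_prop

theorem lintegral_exteriorDomain {R : ℝ} (hR : 0 ≤ R) (f : Plane → ℝ≥0∞)
    (hf : AEMeasurable (fun p : ℝ × ℝ => ENNReal.ofReal p.1 * f (polarPt p.1 p.2))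
      ((volume.restrict (Ioi R)).prod (volume.restrict (Ioo (-π) π)))) :
    ∫⁻ x in exteriorDomain R, f x =
      ∫⁻ r in Ioi R, ∫⁻ θ in Ioo (-π) π, ENNReal.ofReal r * f (polarPt r θ) := by
  rw [← lintegral_indicator (measurableSet_exteriorDomain R),
    ← measurePreserving_planeEquiv.lintegral_comp_emb planeEquiv.measurableEmbedding,
    ← lintegral_comp_polarCoord_symm, polarCoord_target]
  have h1 : ∀ p ∈ Ioi (0 : ℝ) ×ˢ Ioo (-π) π, ENNReal.ofReal p.1 •
      (exteriorDomain R).indicator f (planeEquiv (polarCoord.symm p)) =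
      (Ioi R ×ˢ Ioo (-π) π).indicator
        (fun p => ENNReal.ofReal p.1 * f (polarPt p.1 p.2)) p := by
    rintro ⟨r, θ⟩ ⟨hr, hθ⟩
    have e : planeEquiv (polarCoord.symm (r, θ)) = polarPt r θ := by
      rw [planeEquiv_apply, polarCoord_symm_apply, polarPt]
    rw [e, smul_eq_mul]
    by_cases h : R < r
    · rw [indicator_of_mem, indicator_of_mem]
      · exact ⟨h, hθ⟩
      · show R < ‖polarPt r θ‖
        rwa [norm_polarPt (le_of_lt hr)]
    · rw [indicator_of_notMem, indicator_of_notMem, mul_zero]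
      · exact fun h' => h h'.1
      · show ¬ R < ‖polarPt r θ‖
        rwa [norm_polarPt (le_of_lt hr)]
  rw [setLIntegral_congr_fun (measurableSet_Ioi.prod measurableSet_Ioo) h1,
    setLIntegral_indicator (measurableSet_Ioi.prod measurableSet_Ioo),
    inter_eq_left.2 (prod_mono (Ioi_subset_Ioi hR) le_rfl), Measure.volume_eq_prod,
    ← Measure.prod_restrict, lintegral_prod _ hf]

theorem integral_cos_int_mul (n : ℤ) (hn : n ≠ 0) : ∫ θ in -π..π, cos (n * θ) = 0 := by
  have hn' : (n : ℝ) ≠ 0 := by exact_mod_cast hn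
  rw [intervalIntegral.integral_comp_mul_left (fun θ => cos θ) hn', integral_cos]
  rw [mul_neg, sin_neg, sin_int_mul_pi]
  simp

/-- Degree zero is excluded because the integral of the square is then `0` for sines and `2π` for
cosines instead of `π`. This is also why the radial coefficient of index `0` is required to vanish
in the Parseval identities. -/
theorem integral_sin_mul_sin (l l' : ℕ) (hl : l ≠ 0) :
    ∫ θ in -π..π, sin (l * θ) * sin (l' * θ) = if l = l' then π else 0 := by
  have e : ∀ θ : ℝ, sin (l * θ) * sin (l' * θ) =
      (cos (((l : ℤ) - l' : ℤ) * θ) - cos (((l : ℤ) + l' : ℤ) * θ)) / 2 := by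
    intro θ
    push_cast
    rw [sub_mul, add_mul, cos_sub, cos_add]
    ring
  simp only [e, intervalIntegral.integral_div]
  rw [intervalIntegral.integral_sub (by apply Continuous.intervalIntegrable; fun_prop)
    (by apply Continuous.intervalIntegrable; fun_prop),
    integral_cos_int_mul ((l : ℤ) + l') (by omega)]
  split_ifs with h
  · subst h
    simp
  · rw [integral_cos_int_mul _ (by omega)]
    simp

theorem integral_cos_mul_cos (l l' : ℕ) (hl : l ≠ 0) :
    ∫ θ in -π..π, cos (l * θ) * cos (l' * θ) = if l = l' then π else 0 := by
  have e : ∀ θ : ℝ, cos (l * θ) * cos (l' * θ) =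
      (cos (((l : ℤ) - l' : ℤ) * θ) + cos (((l : ℤ) + l' : ℤ) * θ)) / 2 := by
    intro θ
    push_cast
    rw [sub_mul, add_mul, cos_sub, cos_add]
    ring
  simp only [e, intervalIntegral.integral_div]
  rw [intervalIntegral.integral_add (by apply Continuous.intervalIntegrable; fun_prop)
    (by apply Continuous.intervalIntegrable; fun_prop),
    integral_cos_int_mul ((l : ℤ) + l') (by omega)]
  split_ifs with h
  · subst h
    simp
  · rw [integral_cos_int_mul _ (by omega)]
    simp

theorem integral_sq_sum_orthogonal {f : ℕ → ℝ → ℝ} (hf : ∀ l, Continuous (f l))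
    (ho : ∀ l l', l ≠ 0 → ∫ θ in -π..π, f l θ * f l' θ = if l = l' then π else 0)
    (c : ℕ → ℝ) (hc : c 0 = 0) (N : ℕ) :
    ∫ θ in -π..π, (∑ l ∈ Finset.range N, c l * f l θ) ^ 2 =
      π * ∑ l ∈ Finset.range N, c l ^ 2 := by
  have e : ∀ θ, (∑ l ∈ Finset.range N, c l * f l θ) ^ 2 =
      ∑ l ∈ Finset.range N, ∑ l' ∈ Finset.range N, c l * c l' * (f l θ * f l' θ) := by
    intro θ
    rw [pow_two, Finset.sum_mul_sum]
    exact Finset.sum_congr rfl fun l _ => Finset.sum_congr rfl fun l' _ => by ring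
  simp only [e]
  have hci : ∀ l l', IntervalIntegrable (fun θ => c l * c l' * (f l θ * f l' θ)) volume (-π) π :=
    fun l l' => (continuous_const.mul ((hf l).mul (hf l'))).intervalIntegrable _ _
  rw [intervalIntegral.integral_finsetSum fun l _ =>
    (by fun_prop : Continuous fun θ => ∑ l' ∈ Finset.range N,
      c l * c l' * (f l θ * f l' θ)).intervalIntegrable _ _, Finset.mul_sum]
  refine Finset.sum_congr rfl fun l hl => ?_
  rw [intervalIntegral.integral_finsetSum fun l' _ => hci l l']
  simp only [intervalIntegral.integral_const_mul]
  by_cases h0 : l = 0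
  · simp [h0, hc]
  · simp only [ho l _ h0, mul_ite, mul_zero, Finset.sum_ite_eq, if_pos hl]
    ring

theorem sq_eLpNorm_two {α : Type*} [MeasurableSpace α] (μ : Measure α) (f : α → ℝ) :
    eLpNorm f 2 μ ^ 2 = ∫⁻ x, ENNReal.ofReal (f x ^ 2) ∂μ := by
  rw [eLpNorm_eq_lintegral_rpow_enorm_toReal (by norm_num) (by norm_num), ← ENNReal.rpow_natCast,
    ← ENNReal.rpow_mul]
  norm_num
  refine lintegral_congr fun x => ?_
  rw [← ofReal_norm, ← ENNReal.ofReal_pow (norm_nonneg _), Real.norm_eq_abs, sq_abs]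

/-- Parseval on each circle, integrated in polar coordinates. -/
theorem sq_eLpNorm_sum_modes {R : ℝ} (hR : 0 ≤ R) {f : ℕ → ℝ → ℝ} (hf : ∀ l, Continuous (f l))
    (ho : ∀ l l', l ≠ 0 → ∫ θ in -π..π, f l θ * f l' θ = if l = l' then π else 0)
    {A : ℕ → ℝ → ℝ} (hA : ∀ l, ContinuousOn (A l) (Ioi R)) (hA0 : A 0 = 0) (N : ℕ)
    {u : Plane → ℝ}
    (hu : ∀ r, 0 < r → ∀ θ, u (polarPt r θ) = ∑ l ∈ Finset.range N, A l r * f l θ) :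
    eLpNorm u 2 (volume.restrict (exteriorDomain R)) ^ 2 =
      ENNReal.ofReal π * ∑ l ∈ Finset.range N, radialNorm R (A l) := by
  have hmem : ∀ᵐ p ∂((volume.restrict (Ioi R)).prod (volume.restrict (Ioo (-π) π))),
      p ∈ Ioi R ×ˢ Ioo (-π) π := by
    rw [Measure.prod_restrict]
    exact ae_restrict_mem (measurableSet_Ioi.prod measurableSet_Ioo)
  rw [sq_eLpNorm_two, lintegral_exteriorDomain hR]
  · have h1 : ∀ r ∈ Ioi R, ∫⁻ θ in Ioo (-π) π, ENNReal.ofReal r *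
        ENNReal.ofReal (u (polarPt r θ) ^ 2) =
        ENNReal.ofReal π * ∑ l ∈ Finset.range N, ENNReal.ofReal (A l r ^ 2 * r) := by
      intro r hr
      have hr0 : 0 < r := hR.trans_lt hr
      have hc : Continuous fun θ => (∑ l ∈ Finset.range N, A l r * f l θ) ^ 2 := by fun_prop
      simp only [hu r hr0]
      rw [lintegral_const_mul _ (by fun_prop), ← ofReal_integral_eq_lintegral_ofReal,
        ← integral_Ioc_eq_integral_Ioo,
        ← intervalIntegral.integral_of_le (by linarith [pi_pos]),
        integral_sq_sum_orthogonal hf ho _ (by simp [hA0]) N,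
        ← ENNReal.ofReal_mul hr0.le, mul_left_comm, ENNReal.ofReal_mul pi_pos.le, Finset.mul_sum,
        ENNReal.ofReal_sum_of_nonneg]
      · simp only [mul_comm]
      · intro l _; positivity
      · exact (hc.integrableOn_Icc (a := -π) (b := π)).mono_set Ioo_subset_Icc_self
      · exact Eventually.of_forall fun θ => sq_nonneg _
    rw [setLIntegral_congr_fun measurableSet_Ioi h1, lintegral_const_mul', lintegral_finsetSum']
    · rfl
    · intro l _
      exact (((((hA l).pow 2).mul continuousOn_id).aemeasurable measurableSet_Ioi)).ennreal_ofReal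
    · exact ENNReal.ofReal_ne_top
  · have hcont : ContinuousOn (fun p : ℝ × ℝ => (∑ l ∈ Finset.range N, A l p.1 * f l p.2) ^ 2)
        (Ioi R ×ˢ Ioo (-π) π) := by
      refine (continuousOn_finsetSum _ fun l _ => ?_).pow 2
      exact ((hA l).comp continuousOn_fst fun p hp => hp.1).mul
        ((hf l).comp_continuousOn continuousOn_snd)
    have hm : AEMeasurable (fun p : ℝ × ℝ => (∑ l ∈ Finset.range N, A l p.1 * f l p.2) ^ 2)
        ((volume.restrict (Ioi R)).prod (volume.restrict (Ioo (-π) π))) := by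
      rw [Measure.prod_restrict]
      exact hcont.aemeasurable (measurableSet_Ioi.prod measurableSet_Ioo)
    refine (measurable_fst.ennreal_ofReal.aemeasurable.mul hm.ennreal_ofReal).congr ?_
    filter_upwards [hmem] with p hp
    simp only [Pi.mul_apply]
    rw [hu p.1 (hR.trans_lt hp.1)]

theorem sq_eLpNorm_sinSum {R : ℝ} (hR : 0 ≤ R) {A : ℕ → ℝ → ℝ}
    (hA : ∀ l, ContinuousOn (A l) (Ioi R)) (hA0 : A 0 = 0) (N : ℕ) :
    eLpNorm (sinSum A N) 2 (volume.restrict (exteriorDomain R)) ^ 2 =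
      ENNReal.ofReal π * ∑ l ∈ Finset.range N, radialNorm R (A l) :=
  sq_eLpNorm_sum_modes hR (fun l => by fun_prop) integral_sin_mul_sin hA hA0 N
    fun _ hr θ => sinSum_polarPt A N hr θ

theorem sq_eLpNorm_cosSum {R : ℝ} (hR : 0 ≤ R) {A : ℕ → ℝ → ℝ}
    (hA : ∀ l, ContinuousOn (A l) (Ioi R)) (hA0 : A 0 = 0) (N : ℕ) :
    eLpNorm (cosSum A N) 2 (volume.restrict (exteriorDomain R)) ^ 2 =
      ENNReal.ofReal π * ∑ l ∈ Finset.range N, radialNorm R (A l) :=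
  sq_eLpNorm_sum_modes hR (fun l => by fun_prop) integral_cos_mul_cos hA hA0 N
    fun _ hr θ => cosSum_polarPt A N hr θ

theorem continuousOn_angMode (l : ℕ) : ContinuousOn (angMode l) {x | x ≠ 0} := by
  refine ContinuousOn.pow (ContinuousOn.div ?_ ?_ ?_) l
  · have : toComplex = fun x : Plane => (x 0 : ℂ) + x 1 * Complex.I := by
      funext x
      apply Complex.ext <;> simp [toComplex]
    rw [this]
    fun_prop
  · fun_prop
  · intro x hx
    have : ‖x‖ ≠ 0 := norm_ne_zero_iff.2 hx
    exact_mod_cast this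

section

variable {R : ℝ} {A : ℕ → ℝ → ℝ}

theorem continuousOn_sinMode (hR : 0 ≤ R) (l : ℕ) : ContinuousOn (sinMode l) (exteriorDomain R) :=
  Complex.continuous_im.comp_continuousOn
    ((continuousOn_angMode l).mono fun _ => ne_zero_of_mem_exteriorDomain hR)

theorem continuousOn_cosMode (hR : 0 ≤ R) (l : ℕ) : ContinuousOn (cosMode l) (exteriorDomain R) :=
  Complex.continuous_re.comp_continuousOn
    ((continuousOn_angMode l).mono fun _ => ne_zero_of_mem_exteriorDomain hR)

theorem continuousOn_sinSum (hR : 0 ≤ R) (hA : ∀ l, ContinuousOn (A l) (Ioi R)) (N : ℕ) :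
    ContinuousOn (sinSum A N) (exteriorDomain R) :=
  continuousOn_finsetSum _ fun l _ =>
    ((hA l).comp continuous_norm.continuousOn fun _ hx => hx).mul (continuousOn_sinMode hR l)

theorem continuousOn_cosSum (hR : 0 ≤ R) (hA : ∀ l, ContinuousOn (A l) (Ioi R)) (N : ℕ) :
    ContinuousOn (cosSum A N) (exteriorDomain R) :=
  continuousOn_finsetSum _ fun l _ =>
    ((hA l).comp continuous_norm.continuousOn fun _ hx => hx).mul (continuousOn_cosMode hR l)

/-- Coefficients such as `x i` or `tang x i` are not radial. Replacing them by a radial majorant `p`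
restores a sum of modes, to which Parseval applies. -/
theorem eLpNorm_mul_sinSum_le {a : Plane → ℝ} {p : ℝ → ℝ} (ha : ∀ x, |a x| ≤ p ‖x‖) (N : ℕ) :
    eLpNorm (fun x => a x * sinSum A N x) 2 (volume.restrict (exteriorDomain R)) ≤
      eLpNorm (sinSum (fun l r => p r * A l r) N) 2 (volume.restrict (exteriorDomain R)) := by
  refine eLpNorm_mono fun x => ?_
  have : sinSum (fun l r => p r * A l r) N x = p ‖x‖ * sinSum A N x := by
    simp only [sinSum, Finset.mul_sum, mul_assoc]
  rw [this, norm_mul, norm_mul]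
  exact mul_le_mul_of_nonneg_right ((ha x).trans (le_abs_self _)) (norm_nonneg _)

theorem eLpNorm_mul_cosSum_le {a : Plane → ℝ} {p : ℝ → ℝ} (ha : ∀ x, |a x| ≤ p ‖x‖) (N : ℕ) :
    eLpNorm (fun x => a x * cosSum A N x) 2 (volume.restrict (exteriorDomain R)) ≤
      eLpNorm (cosSum (fun l r => p r * A l r) N) 2 (volume.restrict (exteriorDomain R)) := by
  refine eLpNorm_mono fun x => ?_
  have : cosSum (fun l r => p r * A l r) N x = p ‖x‖ * cosSum A N x := by
    simp only [cosSum, Finset.mul_sum, mul_assoc]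
  rw [this, norm_mul, norm_mul]
  exact mul_le_mul_of_nonneg_right ((ha x).trans (le_abs_self _)) (norm_nonneg _)

end

/-! ### Solutions with finitely many angular modes -/

/-- Radial data `V, V₁, V₂` of a solution with right-hand side `∑ e_l(|x|) sin (l θ)`, where the
sum is over `l < N` of the form `k (2 j + 1)`. -/
structure FiniteSol (k : ℕ) (R : ℝ) (N : ℕ) (e V V₁ V₂ : ℕ → ℝ → ℝ) : Prop where
  mode : ∀ l, ModeSol R l (e l) (V l) (V₁ l) (V₂ l)
  zero : ∀ l, (l < N ∧ ∃ j, l = k * (2 * j + 1)) ∨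
    (e l = 0 ∧ V l = 0 ∧ V₁ l = 0 ∧ V₂ l = 0)

section

variable {k : ℕ} {R : ℝ} {N : ℕ} {e V V₁ V₂ : ℕ → ℝ → ℝ}

theorem FiniteSol.zero_of_lt (hk : 3 ≤ k) (h : FiniteSol k R N e V V₁ V₂) {l : ℕ} (hl : l < 3) :
    e l = 0 ∧ V l = 0 ∧ V₁ l = 0 ∧ V₂ l = 0 := by
  refine (h.zero l).resolve_left ?_
  rintro ⟨-, j, rfl⟩
  exact absurd hl (not_lt.2 (hk.trans (Nat.le_mul_of_pos_right k (by omega))))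

theorem FiniteSol.eLpNorm_rhs (hk : 3 ≤ k) (hR : 0 ≤ R) (h : FiniteSol k R N e V V₁ V₂) :
    eLpNorm (sinSum e N) 2 (volume.restrict (exteriorDomain R)) ^ 2 =
      ENNReal.ofReal π * ∑ l ∈ Finset.range N, radialNorm R (e l) :=
  sq_eLpNorm_sinSum hR (fun l => (h.mode l).cont.continuousOn)
    (h.zero_of_lt hk (by norm_num)).1 N

theorem FiniteSol.sum_radialNorm_le (hR : 0 ≤ R) (h : FiniteSol k R N e V V₁ V₂)
    {B : ℕ → ℝ → ℝ}
    (hB : ∀ l, 3 ≤ l → ∀ r, R < r → B l r ^ 2 ≤ 60 * (radialPot l r * V₁ l r ^ 2 +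
      radialPot l r ^ 2 * V l r ^ 2 / 18) + 3 * e l r ^ 2)
    (hB0 : ∀ l, l < 3 → B l = 0) :
    ∑ l ∈ Finset.range N, radialNorm R (B l) ≤
      300 * ∑ l ∈ Finset.range N, radialNorm R (e l) := by
  rw [Finset.mul_sum]
  refine Finset.sum_le_sum fun l _ => ?_
  rcases lt_or_ge l 3 with hl | hl
  · rw [hB0 l hl]
    simp [radialNorm]
  · exact (h.mode l).radialNorm_le hR hl (hB l hl)

/-- Because `300 ≤ 18² = 324`. -/
theorem le_of_sq_le_mul_sq {a b : ℝ≥0∞} (h : a ^ 2 ≤ 300 * b ^ 2) : a ≤ 18 * b := by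
  have h1 : a ^ 2 ≤ (18 * b) ^ 2 := by
    rw [mul_pow]
    refine h.trans ?_
    gcongr
    norm_num
  exact (ENNReal.pow_le_pow_left_iff (by norm_num)).1 h1

theorem FiniteSol.eLpNorm_sinSum_le (hk : 3 ≤ k) (hR : 0 ≤ R) (h : FiniteSol k R N e V V₁ V₂)
    {B : ℕ → ℝ → ℝ} (hc : ∀ l, ContinuousOn (B l) (Ioi R))
    (hB : ∀ l, 3 ≤ l → ∀ r, R < r → B l r ^ 2 ≤ 60 * (radialPot l r * V₁ l r ^ 2 +
      radialPot l r ^ 2 * V l r ^ 2 / 18) + 3 * e l r ^ 2)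
    (hB0 : ∀ l, l < 3 → B l = 0) :
    eLpNorm (sinSum B N) 2 (volume.restrict (exteriorDomain R)) ≤
      18 * eLpNorm (sinSum e N) 2 (volume.restrict (exteriorDomain R)) := by
  refine le_of_sq_le_mul_sq ?_
  rw [sq_eLpNorm_sinSum hR hc (hB0 0 (by norm_num)), h.eLpNorm_rhs hk hR, mul_left_comm]
  gcongr
  exact h.sum_radialNorm_le hR hB hB0

theorem FiniteSol.eLpNorm_cosSum_le (hk : 3 ≤ k) (hR : 0 ≤ R) (h : FiniteSol k R N e V V₁ V₂)
    {B : ℕ → ℝ → ℝ} (hc : ∀ l, ContinuousOn (B l) (Ioi R))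
    (hB : ∀ l, 3 ≤ l → ∀ r, R < r → B l r ^ 2 ≤ 60 * (radialPot l r * V₁ l r ^ 2 +
      radialPot l r ^ 2 * V l r ^ 2 / 18) + 3 * e l r ^ 2)
    (hB0 : ∀ l, l < 3 → B l = 0) :
    eLpNorm (cosSum B N) 2 (volume.restrict (exteriorDomain R)) ≤
      18 * eLpNorm (sinSum e N) 2 (volume.restrict (exteriorDomain R)) := by
  refine le_of_sq_le_mul_sq ?_
  rw [sq_eLpNorm_cosSum hR hc (hB0 0 (by norm_num)), h.eLpNorm_rhs hk hR, mul_left_comm]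
  gcongr
  exact h.sum_radialNorm_le hR hB hB0

/-! #### Pointwise bounds by the energy density -/

/-- The quantity that controls all derivatives up to second order. -/
def modeBound (e V V₁ : ℕ → ℝ → ℝ) (l : ℕ) (r : ℝ) : ℝ :=
  60 * (radialPot l r * V₁ l r ^ 2 + radialPot l r ^ 2 * V l r ^ 2 / 18) + 3 * e l r ^ 2

section

variable {l : ℕ} {r : ℝ}

theorem sq_div_le_radialPot (l : ℕ) (r : ℝ) : (l : ℝ) ^ 2 / r ^ 2 ≤ radialPot l r :=
  le_add_of_nonneg_right (by positivity)

theorem modeBound_ge (e V V₁ : ℕ → ℝ → ℝ) (l : ℕ) (r : ℝ) (hQ : 0 ≤ radialPot l r) :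
    60 * (radialPot l r * V₁ l r ^ 2) ≤ modeBound e V V₁ l r ∧
      3 * (radialPot l r * V l r) ^ 2 ≤ modeBound e V V₁ l r := by
  have h1 : 0 ≤ radialPot l r * V₁ l r ^ 2 := by positivity
  have h2 : 0 ≤ (radialPot l r * V l r) ^ 2 := sq_nonneg _
  have h3 : 0 ≤ e l r ^ 2 := sq_nonneg _
  rw [mul_pow] at h2 ⊢
  unfold modeBound
  constructor <;> nlinarith

theorem mode_sq_le (hl : 3 ≤ l) (hr : 0 < r) : V l r ^ 2 ≤ modeBound e V V₁ l r := by
  have hQ := radialPot_ge hl hr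
  refine le_trans ?_ (modeBound_ge e V V₁ l r (by linarith)).2
  have h1 : 1 ≤ radialPot l r ^ 2 := by nlinarith
  rw [mul_pow]
  nlinarith [mul_le_mul_of_nonneg_right h1 (sq_nonneg (V l r)), sq_nonneg (V l r)]

theorem mode_deriv_sq_le (hl : 3 ≤ l) (hr : 0 < r) : V₁ l r ^ 2 ≤ modeBound e V V₁ l r := by
  have hQ := radialPot_ge hl hr
  refine le_trans ?_ (modeBound_ge e V V₁ l r (by linarith)).1
  nlinarith [sq_nonneg (V₁ l r)]

theorem mode_mul_div_sq_le (hl : 3 ≤ l) (hr : 0 < r) :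
    (l * V l r / r) ^ 2 ≤ modeBound e V V₁ l r := by
  have hQ := radialPot_ge hl hr
  have h1 := sq_div_le_radialPot l r
  refine le_trans ?_ (modeBound_ge e V V₁ l r (by linarith)).2
  have e1 : ((l : ℝ) * V l r / r) ^ 2 = (l : ℝ) ^ 2 / r ^ 2 * V l r ^ 2 := by ring
  rw [e1, mul_pow, ← mul_assoc]
  gcongr
  nlinarith

theorem mode_mul_deriv_div_sq_le (hl : 3 ≤ l) (hr : 0 < r) :
    60 * (l * (V₁ l r / r)) ^ 2 ≤ modeBound e V V₁ l r := by
  have hQ := radialPot_ge hl hr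
  have h1 := sq_div_le_radialPot l r
  refine le_trans ?_ (modeBound_ge e V V₁ l r (by linarith)).1
  have e1 : ((l : ℝ) * (V₁ l r / r)) ^ 2 = (l : ℝ) ^ 2 / r ^ 2 * V₁ l r ^ 2 := by ring
  rw [e1]
  gcongr

theorem mode_deriv_div_sq_le (hl : 3 ≤ l) (hr : 0 < r) :
    540 * (V₁ l r / r) ^ 2 ≤ modeBound e V V₁ l r := by
  refine le_trans ?_ (mode_mul_deriv_div_sq_le hl hr)
  have := nine_le_sq hl
  rw [mul_pow]
  nlinarith [sq_nonneg (V₁ l r / r)]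

theorem mode_sq_mul_div_sq_le (hl : 3 ≤ l) (hr : 0 < r) :
    3 * (l * (l * V l r / r ^ 2)) ^ 2 ≤ modeBound e V V₁ l r := by
  have hQ := radialPot_ge hl hr
  have h1 := sq_div_le_radialPot l r
  refine le_trans ?_ (modeBound_ge e V V₁ l r (by linarith)).2
  have e1 : (l : ℝ) * (l * V l r / r ^ 2) = (l : ℝ) ^ 2 / r ^ 2 * V l r := by ring
  rw [e1, mul_pow, mul_pow]
  gcongr

theorem mode_mul_div_sq_sq_le (hl : 3 ≤ l) (hr : 0 < r) :
    27 * (l * V l r / r ^ 2) ^ 2 ≤ modeBound e V V₁ l r := by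
  refine le_trans ?_ (mode_sq_mul_div_sq_le hl hr)
  have := nine_le_sq hl
  rw [mul_pow (l : ℝ) ((l : ℝ) * V l r / r ^ 2)]
  nlinarith [sq_nonneg ((l : ℝ) * V l r / r ^ 2)]

theorem mode_mixed_sq_le (hl : 3 ≤ l) (hr : 0 < r) :
    (l * (V₁ l r / r - 2 * V l r / r ^ 2)) ^ 2 ≤ modeBound e V V₁ l r := by
  have h1 := mode_mul_deriv_div_sq_le (e := e) (V := V) (V₁ := V₁) hl hr
  have h2 := mode_mul_div_sq_sq_le (e := e) (V := V) (V₁ := V₁) hl hr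
  have e1 : (l : ℝ) * (V₁ l r / r - 2 * V l r / r ^ 2) =
      l * (V₁ l r / r) - 2 * (l * V l r / r ^ 2) := by ring
  rw [e1]
  nlinarith [sq_nonneg ((l : ℝ) * (V₁ l r / r) + 2 * (l * V l r / r ^ 2)),
    sq_nonneg ((l : ℝ) * (V₁ l r / r)), sq_nonneg ((l : ℝ) * V l r / r ^ 2)]

/-- The equation gives `V'' - V'/r = (Q - 1) V + e - 2 V'/r`. Squaring three terms costs a factor
`3`, which is the source of `3 e²` in `modeBound`; the other two terms fit into the energy part. -/
theorem FiniteSol.mode_second_sq_le (hR : 0 ≤ R) (h : FiniteSol k R N e V V₁ V₂) (hl : 3 ≤ l)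
    (hr : R < r) : (V₂ l r - V₁ l r / r) ^ 2 ≤ modeBound e V V₁ l r := by
  have hr0 : 0 < r := hR.trans_lt hr
  have hQ := radialPot_ge hl hr0
  have ode := (h.mode l).ode r hr
  have e1 : V₂ l r - V₁ l r / r = (radialPot l r - 1) * V l r + e l r - 2 * (V₁ l r / r) := by
    linarith
  have h1 : ((radialPot l r - 1) * V l r) ^ 2 ≤ radialPot l r ^ 2 * V l r ^ 2 := by
    rw [mul_pow]
    gcongr
    · linarith
    · linarith
  have h2 : 9 * (V₁ l r / r) ^ 2 ≤ radialPot l r * V₁ l r ^ 2 := by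
    have := sq_div_le_radialPot l r
    have h9 := nine_le_sq hl
    calc 9 * (V₁ l r / r) ^ 2 = 9 / r ^ 2 * V₁ l r ^ 2 := by ring
      _ ≤ (l : ℝ) ^ 2 / r ^ 2 * V₁ l r ^ 2 := by gcongr
      _ ≤ _ := by gcongr
  rw [e1, modeBound]
  generalize (radialPot l r - 1) * V l r = a at h1 ⊢
  generalize V₁ l r / r = b at h2 ⊢
  nlinarith [sq_nonneg (a - e l r), sq_nonneg (a + 2 * b), sq_nonneg (e l r + 2 * b)]

end

/-! #### Norm bounds for finite sums -/

theorem continuousOn_div_pow (hR : 0 ≤ R) {A : ℝ → ℝ} (hA : ContinuousOn A (Ioi R)) (n : ℕ) :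
    ContinuousOn (fun r => A r / r ^ n) (Ioi R) :=
  hA.div (continuousOn_id.pow n) fun _ hr => pow_ne_zero _ (hR.trans_lt hr).ne'

theorem FiniteSol.eLpNorm_le (hk : 3 ≤ k) (hR : 0 ≤ R) (h : FiniteSol k R N e V V₁ V₂) :
    eLpNorm (sinSum V N) 2 (volume.restrict (exteriorDomain R)) ≤
      18 * eLpNorm (sinSum e N) 2 (volume.restrict (exteriorDomain R)) :=
  h.eLpNorm_sinSum_le hk hR (fun l => (h.mode l).continuousOn)
    (fun _ hl _ hr => mode_sq_le hl (hR.trans_lt hr)) fun _ hl => (h.zero_of_lt hk hl).2.1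

theorem eLpNorm_add_le_const {α : Type*} [MeasurableSpace α] {μ : Measure α} {f g : α → ℝ}
    {a b : ℝ≥0∞} {c : ℝ≥0∞} (hf : AEStronglyMeasurable f μ) (hg : AEStronglyMeasurable g μ)
    (h1 : eLpNorm f 2 μ ≤ a * c) (h2 : eLpNorm g 2 μ ≤ b * c) :
    AEStronglyMeasurable (fun x => f x + g x) μ ∧
      eLpNorm (fun x => f x + g x) 2 μ ≤ (a + b) * c := by
  refine ⟨hf.add hg, (eLpNorm_add_le hf hg (by norm_num)).trans ?_⟩
  rw [add_mul]
  exact add_le_add h1 h2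

theorem eLpNorm_sub_le_const {α : Type*} [MeasurableSpace α] {μ : Measure α} {f g : α → ℝ}
    {a b : ℝ≥0∞} {c : ℝ≥0∞} (hf : AEStronglyMeasurable f μ) (hg : AEStronglyMeasurable g μ)
    (h1 : eLpNorm f 2 μ ≤ a * c) (h2 : eLpNorm g 2 μ ≤ b * c) :
    eLpNorm (fun x => f x - g x) 2 μ ≤ (a + b) * c := by
  refine (eLpNorm_sub_le hf hg (by norm_num)).trans ?_
  rw [add_mul]
  exact add_le_add h1 h2

theorem FiniteSol.mul_sinSum (hk : 3 ≤ k) (hR : 0 ≤ R) (h : FiniteSol k R N e V V₁ V₂)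
    {a : Plane → ℝ} {p : ℝ → ℝ} {B : ℕ → ℝ → ℝ} (ha : ∀ x, |a x| ≤ p ‖x‖) (hac : Continuous a)
    (hp : Continuous p) (hc : ∀ l, ContinuousOn (B l) (Ioi R))
    (hB : ∀ l, 3 ≤ l → ∀ r, R < r → (p r * B l r) ^ 2 ≤ modeBound e V V₁ l r)
    (hB0 : ∀ l, l < 3 → B l = 0) :
    AEStronglyMeasurable (fun x => a x * sinSum B N x) (volume.restrict (exteriorDomain R)) ∧
    eLpNorm (fun x => a x * sinSum B N x) 2 (volume.restrict (exteriorDomain R)) ≤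
      18 * eLpNorm (sinSum e N) 2 (volume.restrict (exteriorDomain R)) := by
  refine ⟨(hac.continuousOn.mul (continuousOn_sinSum hR hc N)).aestronglyMeasurable
    (measurableSet_exteriorDomain R), (eLpNorm_mul_sinSum_le ha N).trans
    (h.eLpNorm_sinSum_le hk hR (fun l => hp.continuousOn.mul (hc l)) hB fun l hl => ?_)⟩
  funext r
  simp [hB0 l hl]

theorem FiniteSol.mul_cosSum (hk : 3 ≤ k) (hR : 0 ≤ R) (h : FiniteSol k R N e V V₁ V₂)
    {a : Plane → ℝ} {p : ℝ → ℝ} {B : ℕ → ℝ → ℝ} (ha : ∀ x, |a x| ≤ p ‖x‖) (hac : Continuous a)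
    (hp : Continuous p) (hc : ∀ l, ContinuousOn (B l) (Ioi R))
    (hB : ∀ l, 3 ≤ l → ∀ r, R < r → (p r * B l r) ^ 2 ≤ modeBound e V V₁ l r)
    (hB0 : ∀ l, l < 3 → B l = 0) :
    AEStronglyMeasurable (fun x => a x * cosSum B N x) (volume.restrict (exteriorDomain R)) ∧
    eLpNorm (fun x => a x * cosSum B N x) 2 (volume.restrict (exteriorDomain R)) ≤
      18 * eLpNorm (sinSum e N) 2 (volume.restrict (exteriorDomain R)) := by
  refine ⟨(hac.continuousOn.mul (continuousOn_cosSum hR hc N)).aestronglyMeasurable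
    (measurableSet_exteriorDomain R), (eLpNorm_mul_cosSum_le ha N).trans
    (h.eLpNorm_cosSum_le hk hR (fun l => hp.continuousOn.mul (hc l)) hB fun l hl => ?_)⟩
  funext r
  simp [hB0 l hl]

theorem continuous_tang (j : Fin 2) : Continuous fun x : Plane => tang x j := by
  fin_cases j <;> simp [tang] <;> fun_prop

theorem continuous_coord (j : Fin 2) : Continuous fun x : Plane => x j := by fun_prop

theorem abs_mul_le_sq {x : Plane} {a b : ℝ} (ha : |a| ≤ ‖x‖) (hb : |b| ≤ ‖x‖) :
    |a * b| ≤ ‖x‖ ^ 2 := by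
  rw [abs_mul, pow_two]
  gcongr

theorem FiniteSol.eLpNorm_grad_le (hk : 3 ≤ k) (hR : 0 ≤ R) (h : FiniteSol k R N e V V₁ V₂)
    (j : Fin 2) :
    eLpNorm (sinSumGrad V V₁ N j) 2 (volume.restrict (exteriorDomain R)) ≤
      36 * eLpNorm (sinSum e N) 2 (volume.restrict (exteriorDomain R)) := by
  have hz := fun l (hl : l < 3) => h.zero_of_lt hk hl
  have t1 := h.mul_sinSum hk hR (fun x => abs_coord_le x j) (continuous_coord j) continuous_id
    (B := fun l r => V₁ l r / r)
    (fun l => by simpa using continuousOn_div_pow hR (h.mode l).continuousOn₁ 1)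
    (fun l hl r hr => by
      have hr0 := hR.trans_lt hr
      rw [id, mul_div_cancel₀ _ hr0.ne']
      exact mode_deriv_sq_le hl hr0)
    (fun l hl => by funext r; simp [(hz l hl).2.2.1])
  have t2 := h.mul_cosSum hk hR (fun x => abs_tang_le x j) (continuous_tang j) continuous_id
    (B := fun l r => l * V l r / r ^ 2)
    (fun l => continuousOn_div_pow hR ((h.mode l).continuousOn.const_mul _) 2)
    (fun l hl r hr => by
      have hr0 := hR.trans_lt hr
      have : id r * (l * V l r / r ^ 2) = l * V l r / r := by
        rw [id]; field_simp
      rw [this]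
      exact mode_mul_div_sq_le hl hr0)
    (fun l hl => by funext r; simp [(hz l hl).2.1])
  have := (eLpNorm_add_le_const t1.1 t2.1 t1.2 t2.2).2
  norm_num at this
  exact this

/-- Each of the six terms of `sinSumHess` has a coefficient bounded by `1` or by `|x|²`, and after
absorbing it the radial factor is bounded by `modeBound`. Each term contributes `18`. -/
theorem FiniteSol.eLpNorm_hess_le (hk : 3 ≤ k) (hR : 0 ≤ R) (h : FiniteSol k R N e V V₁ V₂)
    (i j : Fin 2) :
    eLpNorm (sinSumHess V V₁ V₂ N i j) 2 (volume.restrict (exteriorDomain R)) ≤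
      108 * eLpNorm (sinSum e N) 2 (volume.restrict (exteriorDomain R)) := by
  have hz := fun l (hl : l < 3) => h.zero_of_lt hk hl
  have cV := fun l => (h.mode l).continuousOn
  have cV₁ : ∀ l, ContinuousOn (fun r => V₁ l r / r) (Ioi R) := fun l => by
    simpa using continuousOn_div_pow hR (h.mode l).continuousOn₁ 1
  have cV₂ := fun l => (h.mode l).continuousOn₂ hR
  have csq : Continuous fun r : ℝ => r ^ 2 := by fun_prop
  have c1 : Continuous fun _ : ℝ => (1 : ℝ) := continuous_const
  have hsq : ∀ {r : ℝ}, R < r → ∀ y : ℝ, r ^ 2 * (y / r ^ 2) = y := fun hr y =>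
    mul_div_cancel₀ _ (pow_ne_zero 2 (hR.trans_lt hr).ne')
  have t1 := h.mul_sinSum hk hR (a := fun _ => if i = j then 1 else 0) (p := fun _ => 1)
    (fun x => by split_ifs <;> simp) continuous_const c1 (B := fun l r => V₁ l r / r) cV₁
    (fun l hl r hr => by
      rw [one_mul]
      have := mode_deriv_div_sq_le (e := e) (V := V) (V₁ := V₁) hl (hR.trans_lt hr)
      nlinarith [sq_nonneg (V₁ l r / r)])
    (fun l hl => by funext r; simp [(hz l hl).2.2.1])
  have t2 := h.mul_sinSum hk hR (a := fun x => x i * x j) (p := fun r => r ^ 2)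
    (fun x => abs_mul_le_sq (abs_coord_le x i) (abs_coord_le x j))
    ((continuous_coord i).mul (continuous_coord j)) csq
    (B := fun l r => (V₂ l r - V₁ l r / r) / r ^ 2)
    (fun l => continuousOn_div_pow hR ((cV₂ l).sub (cV₁ l)) 2)
    (fun l hl r hr => by
      rw [hsq hr]
      exact h.mode_second_sq_le hR hl hr)
    (fun l hl => by funext r; simp [(hz l hl).2.2.1, (hz l hl).2.2.2])
  have t3 := h.mul_cosSum hk hR (a := fun x => x i * tang x j) (p := fun r => r ^ 2)
    (fun x => abs_mul_le_sq (abs_coord_le x i) (abs_tang_le x j))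
    ((continuous_coord i).mul (continuous_tang j)) csq
    (B := fun l r => l * (V₁ l r / r) / r ^ 2)
    (fun l => continuousOn_div_pow hR ((cV₁ l).const_mul _) 2)
    (fun l hl r hr => by
      rw [hsq hr]
      have := mode_mul_deriv_div_sq_le (e := e) (V := V) (V₁ := V₁) hl (hR.trans_lt hr)
      nlinarith [sq_nonneg ((l : ℝ) * (V₁ l r / r))])
    (fun l hl => by funext r; simp [(hz l hl).2.2.1])
  have t4 := h.mul_cosSum hk hR (a := fun _ => tangGrad i j) (p := fun _ => 1)
    (fun x => by fin_cases i <;> fin_cases j <;> simp [tangGrad, tang]) continuous_const c1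
    (B := fun l r => l * V l r / r ^ 2)
    (fun l => continuousOn_div_pow hR ((cV l).const_mul _) 2)
    (fun l hl r hr => by
      rw [one_mul]
      have := mode_mul_div_sq_sq_le (e := e) (V := V) (V₁ := V₁) hl (hR.trans_lt hr)
      nlinarith [sq_nonneg ((l : ℝ) * V l r / r ^ 2)])
    (fun l hl => by funext r; simp [(hz l hl).2.1])
  have t5 := h.mul_cosSum hk hR (a := fun x => tang x i * x j) (p := fun r => r ^ 2)
    (fun x => abs_mul_le_sq (abs_tang_le x i) (abs_coord_le x j))
    ((continuous_tang i).mul (continuous_coord j)) csq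
    (B := fun l r => l * (V₁ l r / r - 2 * V l r / r ^ 2) / r ^ 2)
    (fun l => continuousOn_div_pow hR (((cV₁ l).sub
      (continuousOn_div_pow hR ((cV l).const_mul _) 2)).const_mul _) 2)
    (fun l hl r hr => by
      rw [hsq hr]
      exact mode_mixed_sq_le hl (hR.trans_lt hr))
    (fun l hl => by funext r; simp [(hz l hl).2.2.1, (hz l hl).2.1])
  have t6 := h.mul_sinSum hk hR (a := fun x => tang x i * tang x j) (p := fun r => r ^ 2)
    (fun x => abs_mul_le_sq (abs_tang_le x i) (abs_tang_le x j))
    ((continuous_tang i).mul (continuous_tang j)) csq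
    (B := fun l r => l * (l * V l r / r ^ 2) / r ^ 2)
    (fun l => continuousOn_div_pow hR ((continuousOn_div_pow hR
      ((cV l).const_mul _) 2).const_mul _) 2)
    (fun l hl r hr => by
      rw [hsq hr]
      have := mode_sq_mul_div_sq_le (e := e) (V := V) (V₁ := V₁) hl (hR.trans_lt hr)
      nlinarith [sq_nonneg ((l : ℝ) * (l * V l r / r ^ 2))])
    (fun l hl => by funext r; simp [(hz l hl).2.1])
  have s2 := eLpNorm_add_le_const t1.1 t2.1 t1.2 t2.2
  have s3 := eLpNorm_add_le_const s2.1 t3.1 s2.2 t3.2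
  have s4 := eLpNorm_add_le_const s3.1 t4.1 s3.2 t4.2
  have s5 := eLpNorm_add_le_const s4.1 t5.1 s4.2 t5.2
  have := eLpNorm_sub_le_const s5.1 t6.1 s5.2 t6.2
  rwa [show (18 + 18 + 18 + 18 + 18 + 18 : ℝ≥0∞) = 108 by norm_num] at this

theorem FiniteSol.eLpNorm_rhs_lt_top (hk : 3 ≤ k) (hR : 0 ≤ R) (h : FiniteSol k R N e V V₁ V₂) :
    eLpNorm (sinSum e N) 2 (volume.restrict (exteriorDomain R)) < ⊤ := by
  have h1 := h.eLpNorm_rhs hk hR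
  have h2 : ENNReal.ofReal π * ∑ l ∈ Finset.range N, radialNorm R (e l) < ⊤ := by
    refine ENNReal.mul_lt_top ENNReal.ofReal_lt_top (ENNReal.sum_lt_top.2 fun l _ => ?_)
    rw [(h.mode l).radialNorm_rhs hR]
    exact ENNReal.ofReal_lt_top
  rw [← h1] at h2
  by_contra hc
  rw [not_lt, top_le_iff] at hc
  simp [hc] at h2

/-- Cauchy–Schwarz with the weights `1/l`: the sum of `1/l²` is at most `2`, and `ModeSol.sq_le`
bounds `(l V_l)²`. The factor `2` is absorbed by the `π` of Parseval. This bound later makes `L²`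
convergence of the data locally uniform convergence of the solutions. -/
theorem FiniteSol.abs_le (hk : 3 ≤ k) (hR : 0 ≤ R) (h : FiniteSol k R N e V V₁ V₂) {x : Plane}
    (hx : R < ‖x‖) :
    |sinSum V N x| ≤
      9 * ‖x‖ * (eLpNorm (sinSum e N) 2 (volume.restrict (exteriorDomain R))).toReal := by
  set J : ℕ → ℝ := fun l => ∫ r in Ioi R, r * e l r ^ 2
  have hJ : ∀ l, 0 ≤ J l := fun l => setIntegral_nonneg measurableSet_Ioi fun r hr => by
    have : (0 : ℝ) < r := hR.trans_lt hr
    positivity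
  have hn : (eLpNorm (sinSum e N) 2 (volume.restrict (exteriorDomain R))).toReal ^ 2 =
      π * ∑ l ∈ Finset.range N, J l := by
    rw [← ENNReal.toReal_pow, h.eLpNorm_rhs hk hR, ENNReal.toReal_mul,
      ENNReal.toReal_ofReal pi_pos.le, ENNReal.toReal_sum]
    · congr 1
      refine Finset.sum_congr rfl fun l _ => ?_
      rw [(h.mode l).radialNorm_rhs hR, ENNReal.toReal_ofReal (hJ l)]
    · intro l _
      rw [(h.mode l).radialNorm_rhs hR]
      exact ENNReal.ofReal_ne_top
  have hx0 : x ≠ 0 := ne_zero_of_mem_exteriorDomain hR hx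
  have h1 : |sinSum V N x| ≤ ∑ l ∈ Finset.range N, (l : ℝ)⁻¹ * |l * V l ‖x‖| := by
    refine (Finset.abs_sum_le_sum_abs _ _).trans (Finset.sum_le_sum fun l _ => ?_)
    rw [abs_mul]
    refine (mul_le_of_le_one_right (abs_nonneg _) (abs_sinMode_le l hx0)).trans ?_
    rcases Nat.eq_zero_or_pos l with rfl | hl
    · simp [(h.zero_of_lt hk (by norm_num : 0 < 3)).2.1]
    · have : (0 : ℝ) < l := by exact_mod_cast hl
      rw [abs_mul, abs_of_pos this, inv_mul_cancel_left₀ this.ne']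
  have h2 := Finset.sum_mul_sq_le_sq_mul_sq (Finset.range N) (fun l : ℕ => (l : ℝ)⁻¹)
    fun l => |l * V l ‖x‖|
  have h3 : ∑ l ∈ Finset.range N, ((l : ℝ)⁻¹) ^ 2 ≤ 2 := by
    have := sum_Ioo_inv_sq_le (α := ℝ) 0 N
    norm_num at this
    refine le_trans (le_of_eq ?_) this
    symm
    simp only [inv_pow]
    refine Finset.sum_subset (fun l hl => ?_) fun l hl hl' => ?_
    · simp at hl ⊢; exact hl.2
    · simp at hl hl'
      have : l = 0 := by by_contra h0; exact absurd (hl' (by omega)) (by omega)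
      simp [this]
  have h4 : ∑ l ∈ Finset.range N, |l * V l ‖x‖| ^ 2 ≤
      81 * ‖x‖ ^ 2 * ∑ l ∈ Finset.range N, J l := by
    rw [Finset.mul_sum]
    refine Finset.sum_le_sum fun l _ => ?_
    rw [sq_abs]
    rcases lt_or_ge l 3 with hl | hl
    · have := hJ l
      simp only [(h.zero_of_lt hk hl).2.1, Pi.zero_apply, mul_zero]
      rw [zero_pow two_ne_zero]
      positivity
    · exact (h.mode l).sq_le hR hl hx
  refine abs_le_of_sq_le_sq ?_ (by positivity)
  rw [mul_pow, mul_pow, hn]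
  have h5 : sinSum V N x ^ 2 ≤ (∑ l ∈ Finset.range N, (l : ℝ)⁻¹ * |l * V l ‖x‖|) ^ 2 := by
    rw [← sq_abs]
    gcongr
  have hS : 0 ≤ ∑ l ∈ Finset.range N, J l := Finset.sum_nonneg fun l _ => hJ l
  have h6 : (∑ l ∈ Finset.range N, ((l : ℝ)⁻¹) ^ 2) * ∑ l ∈ Finset.range N, |l * V l ‖x‖| ^ 2 ≤
      2 * (81 * ‖x‖ ^ 2 * ∑ l ∈ Finset.range N, J l) := by gcongr
  refine (h5.trans (h2.trans h6)).trans ?_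
  have := pi_gt_three
  have h7 : 0 ≤ 81 * ‖x‖ ^ 2 * ∑ l ∈ Finset.range N, J l := by positivity
  nlinarith

end

/-! ### Calculus of weak derivatives -/

section

variable {Ω : Set Plane} {i : Fin 2}

theorem continuous_partialDeriv {φ : Plane → ℝ} (hφ : ContDiff ℝ ∞ φ) (i : Fin 2) :
    Continuous (partialDeriv i φ) :=
  (hφ.continuous_fderiv (by simp)).clm_apply continuous_const

theorem contDiff_partialDeriv {φ : Plane → ℝ} (hφ : ContDiff ℝ ∞ φ) (i : Fin 2) :
    ContDiff ℝ ∞ (partialDeriv i φ) :=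
  (hφ.fderiv_right (m := ∞) (by simp)).clm_apply contDiff_const

theorem tsupport_partialDeriv_subset (φ : Plane → ℝ) (i : Fin 2) :
    tsupport (partialDeriv i φ) ⊆ tsupport φ :=
  tsupport_fderiv_apply_subset ℝ _

theorem hasCompactSupport_partialDeriv {φ : Plane → ℝ} (hφ : HasCompactSupport φ) (i : Fin 2) :
    HasCompactSupport (partialDeriv i φ) :=
  hφ.fderiv_apply ℝ _

theorem hasLineDerivAt_of_contDiff {φ : Plane → ℝ} (hφ : ContDiff ℝ ∞ φ) (i : Fin 2) (x : Plane) :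
    HasLineDerivAt ℝ φ (partialDeriv i φ x) x (EuclideanSpace.single i 1) :=
  ((hφ.differentiable (by simp)) x).hasFDerivAt.hasLineDerivAt _

theorem partialDeriv_mul {φ ψ : Plane → ℝ} (hφ : ContDiff ℝ ∞ φ) (hψ : ContDiff ℝ ∞ ψ)
    (i : Fin 2) (x : Plane) :
    partialDeriv i (fun x => φ x * ψ x) x = φ x * partialDeriv i ψ x + partialDeriv i φ x * ψ x := by
  rw [partialDeriv, fderiv_fun_mul ((hφ.differentiable (by simp)) x)
    ((hψ.differentiable (by simp)) x)]
  simp [partialDeriv]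
  ring

theorem integrable_mul_of_tsupport_subset {u ψ : Plane → ℝ} (hu : LocallyIntegrableOn u Ω volume)
    (hψ : Continuous ψ) (hc : HasCompactSupport ψ) (hs : tsupport ψ ⊆ Ω) :
    Integrable fun x => u x * ψ x := by
  have h1 : IntegrableOn u (tsupport ψ) := hu.integrableOn_compact_subset hs hc
  exact (h1.mul_continuousOn hψ.continuousOn hc).integrable_of_forall_notMem_eq_zero
    fun x hx => by rw [image_eq_zero_of_notMem_tsupport hx, mul_zero]

theorem setIntegral_mul_of_tsupport_subset (u : Plane → ℝ) {ψ : Plane → ℝ}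
    (hs : tsupport ψ ⊆ Ω) : ∫ x in Ω, u x * ψ x = ∫ x, u x * ψ x :=
  setIntegral_eq_integral_of_forall_compl_eq_zero fun x hx => by
    rw [image_eq_zero_of_notMem_tsupport fun h => hx (hs h), mul_zero]

/-- Integration by parts along lines; the compact support of the test function inside `Ω` makes all
integrands integrable on the whole plane. -/
theorem isWeakPartial_of_hasLineDerivAt (hΩ : MeasurableSet Ω) {u g : Plane → ℝ}
    (hu : ContinuousOn u Ω) (hg : ContinuousOn g Ω)
    (hd : ∀ x ∈ Ω, HasLineDerivAt ℝ u (g x) x (EuclideanSpace.single i 1)) :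
    IsWeakPartial Ω i u g := by
  have lu := hu.locallyIntegrableOn (μ := volume) hΩ
  have lg := hg.locallyIntegrableOn (μ := volume) hΩ
  refine ⟨lu, lg, fun φ hφ hc hs => ?_⟩
  have hs' := (tsupport_partialDeriv_subset φ i).trans hs
  rw [setIntegral_mul_of_tsupport_subset u hs', setIntegral_mul_of_tsupport_subset g hs]
  exact integral_bilinear_hasLineDerivAt_right_eq_neg_left_of_integrable
    (B := ContinuousLinearMap.mul ℝ ℝ) (f := u) (f' := g) (g := φ) (g' := partialDeriv i φ)
    (v := EuclideanSpace.single i 1)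
    (integrable_mul_of_tsupport_subset lg hφ.continuous hc hs)
    (integrable_mul_of_tsupport_subset lu (continuous_partialDeriv hφ i)
      (hasCompactSupport_partialDeriv hc i) hs')
    (integrable_mul_of_tsupport_subset lu hφ.continuous hc hs)
    (fun x hx => hd x (hs hx)) (fun x _ => hasLineDerivAt_of_contDiff hφ i x)

theorem IsWeakPartial.add {u g u' g' : Plane → ℝ} (h : IsWeakPartial Ω i u g)
    (h' : IsWeakPartial Ω i u' g') :
    IsWeakPartial Ω i (fun x => u x + u' x) (fun x => g x + g' x) := by
  refine ⟨h.1.add h'.1, h.2.1.add h'.2.1, fun φ hφ hc hs => ?_⟩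
  have hs' := (tsupport_partialDeriv_subset φ i).trans hs
  have hc' := hasCompactSupport_partialDeriv hc i
  have cd := continuous_partialDeriv hφ i
  simp only [add_mul]
  rw [integral_add (integrable_mul_of_tsupport_subset h.1 cd hc' hs').integrableOn
      (integrable_mul_of_tsupport_subset h'.1 cd hc' hs').integrableOn,
    integral_add (integrable_mul_of_tsupport_subset h.2.1 hφ.continuous hc hs).integrableOn
      (integrable_mul_of_tsupport_subset h'.2.1 hφ.continuous hc hs).integrableOn,
    h.2.2 φ hφ hc hs, h'.2.2 φ hφ hc hs]
  ring

theorem IsWeakPartial.const_mul {u g : Plane → ℝ} (h : IsWeakPartial Ω i u g) (c : ℝ) :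
    IsWeakPartial Ω i (fun x => c * u x) (fun x => c * g x) := by
  refine ⟨h.1.smul c, h.2.1.smul c, fun φ hφ hc hs => ?_⟩
  simp only [mul_assoc, integral_const_mul]
  rw [h.2.2 φ hφ hc hs]
  ring

theorem IsWeakPartial.sub {u g u' g' : Plane → ℝ} (h : IsWeakPartial Ω i u g)
    (h' : IsWeakPartial Ω i u' g') :
    IsWeakPartial Ω i (fun x => u x - u' x) (fun x => g x - g' x) := by
  have := h.add (h'.const_mul (-1))
  simpa only [neg_mul, one_mul, ← sub_eq_add_neg] using this

theorem IsWeakPartial.mono {Ω' : Set Plane} (hsub : Ω' ⊆ Ω) {u g : Plane → ℝ}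
    (h : IsWeakPartial Ω i u g) : IsWeakPartial Ω' i u g := by
  refine ⟨h.1.mono_set hsub, h.2.1.mono_set hsub, fun φ hφ hc hs => ?_⟩
  have hs' := (tsupport_partialDeriv_subset φ i).trans hs
  have := h.2.2 φ hφ hc (hs.trans hsub)
  rw [setIntegral_mul_of_tsupport_subset _ hs', setIntegral_mul_of_tsupport_subset _ hs]
  rwa [setIntegral_mul_of_tsupport_subset _ (hs'.trans hsub),
    setIntegral_mul_of_tsupport_subset _ (hs.trans hsub)] at this

theorem IsWeakPartial.mul_smooth (hΩ : IsOpen Ω) {u g a : Plane → ℝ} (h : IsWeakPartial Ω i u g)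
    (ha : ContDiff ℝ ∞ a) :
    IsWeakPartial Ω i (fun x => a x * u x) (fun x => a x * g x + partialDeriv i a x * u x) := by
  have cda := continuous_partialDeriv ha i
  have l1 : LocallyIntegrableOn (fun x => a x * g x) Ω volume :=
    h.2.1.continuousOn_mul ha.continuous.continuousOn hΩ.isLocallyClosed
  have l2 : LocallyIntegrableOn (fun x => partialDeriv i a x * u x) Ω volume :=
    h.1.continuousOn_mul cda.continuousOn hΩ.isLocallyClosed
  refine ⟨h.1.continuousOn_mul ha.continuous.continuousOn hΩ.isLocallyClosed, l1.add l2,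
    fun φ hφ hc hs => ?_⟩
  have haφ : ContDiff ℝ ∞ fun x => a x * φ x := ha.mul hφ
  have hcaφ : HasCompactSupport fun x => a x * φ x := hc.mul_left
  have hsaφ : (tsupport fun x => a x * φ x) ⊆ Ω := (tsupport_mul_subset_right).trans hs
  have key := h.2.2 _ haφ hcaφ hsaφ
  have hs' := (tsupport_partialDeriv_subset φ i).trans hs
  have hc' := hasCompactSupport_partialDeriv hc i
  have cd := continuous_partialDeriv hφ i
  simp only [partialDeriv_mul ha hφ, mul_add] at key
  have i1 : Integrable fun x => u x * (a x * partialDeriv i φ x) :=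
    integrable_mul_of_tsupport_subset h.1 (ha.continuous.mul cd) hc'.mul_left
      ((tsupport_mul_subset_right).trans hs')
  have i2 : Integrable fun x => u x * (partialDeriv i a x * φ x) :=
    integrable_mul_of_tsupport_subset h.1 (cda.mul hφ.continuous) hc.mul_left
      ((tsupport_mul_subset_right).trans hs)
  have i3 : Integrable fun x => g x * (a x * φ x) :=
    integrable_mul_of_tsupport_subset h.2.1 haφ.continuous hcaφ hsaφ
  rw [integral_add i1.integrableOn i2.integrableOn] at key
  have e1 : ∫ x in Ω, a x * u x * partialDeriv i φ x =
      ∫ x in Ω, u x * (a x * partialDeriv i φ x) := by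
    congr 1; funext x; ring
  have e2 : ∫ x in Ω, (a x * g x + partialDeriv i a x * u x) * φ x =
      (∫ x in Ω, g x * (a x * φ x)) + ∫ x in Ω, u x * (partialDeriv i a x * φ x) := by
    rw [← integral_add i3.integrableOn i2.integrableOn]
    congr 1; funext x; ring
  rw [e1, e2]
  linarith

theorem locallyIntegrableOn_of_memLp {u : Plane → ℝ} (hu : MemLp u 2 (volume.restrict Ω)) :
    LocallyIntegrableOn u Ω volume :=
  locallyIntegrableOn_of_locallyIntegrable_restrict (hu.locallyIntegrable (by norm_num))

theorem memLp_of_hasCompactSupport {ψ : Plane → ℝ} (hψ : Continuous ψ) (hc : HasCompactSupport ψ)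
    (μ : Measure Plane) [IsFiniteMeasureOnCompacts μ] : MemLp ψ 2 μ :=
  hψ.memLp_of_hasCompactSupport hc

theorem tendsto_integral_mul_of_eLpNorm {α : Type*} [MeasurableSpace α] {μ : Measure α}
    {u : ℕ → α → ℝ} {u₀ ψ : α → ℝ} (hu : ∀ n, MemLp (u n) 2 μ) (hu₀ : MemLp u₀ 2 μ)
    (hψ : MemLp ψ 2 μ) (hlim : Tendsto (fun n => eLpNorm (u n - u₀) 2 μ) atTop (𝓝 0)) :
    Tendsto (fun n => ∫ x, u n x * ψ x ∂μ) atTop (𝓝 (∫ x, u₀ x * ψ x ∂μ)) := by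
  have hi : ∀ {w : α → ℝ}, MemLp w 2 μ → Integrable (fun x => w x * ψ x) μ := fun hw =>
    hw.integrable_mul hψ
  refine tendsto_integral_of_L1' _ (hi hu₀).1 (Eventually.of_forall fun n => hi (hu n)) ?_
  have hle : ∀ n, eLpNorm ((fun x => u n x * ψ x) - fun x => u₀ x * ψ x) 1 μ ≤
      eLpNorm (u n - u₀) 2 μ * eLpNorm ψ 2 μ := by
    intro n
    have e : ((fun x => u n x * ψ x) - fun x => u₀ x * ψ x) = (u n - u₀) • ψ := by
      funext x
      simp [sub_mul]
    rw [e]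
    exact eLpNorm_smul_le_mul_eLpNorm hψ.1 ((hu n).sub hu₀).1
  have h0 : Tendsto (fun n => eLpNorm (u n - u₀) 2 μ * eLpNorm ψ 2 μ) atTop (𝓝 0) := by
    simpa using ENNReal.Tendsto.mul_const hlim (Or.inr hψ.2.ne)
  exact tendsto_of_tendsto_of_tendsto_of_le_of_le tendsto_const_nhds h0 (fun _ => zero_le) hle

/-- Pairing with a fixed test function, or with its derivative, is continuous in `L²`, so the
defining identity survives the limit. -/
theorem IsWeakPartial.of_tendsto {u g : ℕ → Plane → ℝ} {u₀ g₀ : Plane → ℝ}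
    (h : ∀ n, IsWeakPartial Ω i (u n) (g n))
    (hu : ∀ n, MemLp (u n) 2 (volume.restrict Ω)) (hg : ∀ n, MemLp (g n) 2 (volume.restrict Ω))
    (hu₀ : MemLp u₀ 2 (volume.restrict Ω)) (hg₀ : MemLp g₀ 2 (volume.restrict Ω))
    (lu : Tendsto (fun n => eLpNorm (u n - u₀) 2 (volume.restrict Ω)) atTop (𝓝 0))
    (lg : Tendsto (fun n => eLpNorm (g n - g₀) 2 (volume.restrict Ω)) atTop (𝓝 0)) :
    IsWeakPartial Ω i u₀ g₀ := by
  refine ⟨locallyIntegrableOn_of_memLp hu₀, locallyIntegrableOn_of_memLp hg₀,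
    fun φ hφ hc hs => ?_⟩
  have t1 := tendsto_integral_mul_of_eLpNorm hu hu₀ (memLp_of_hasCompactSupport
    (continuous_partialDeriv hφ i) (hasCompactSupport_partialDeriv hc i) _) lu
  have t2 := (tendsto_integral_mul_of_eLpNorm hg hg₀ (memLp_of_hasCompactSupport
    hφ.continuous hc _) lg).neg
  refine tendsto_nhds_unique t1 (t2.congr fun n => ?_)
  exact ((h n).2.2 φ hφ hc hs).symm

end

/-! ### Removing the origin -/

theorem smoothTransition_eventually_const {t : ℝ} (ht : t ∉ Icc (0 : ℝ) 1) :
    ∃ c : ℝ, smoothTransition =ᶠ[𝓝 t] fun _ => c := by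
  rcases lt_or_ge t 0 with h | h
  · refine ⟨0, ?_⟩
    filter_upwards [Iio_mem_nhds h] with s hs
    exact smoothTransition.zero_of_nonpos (le_of_lt hs)
  · have h1 : 1 < t := by
      by_contra hh
      exact ht ⟨h, not_lt.1 hh⟩
    refine ⟨1, ?_⟩
    filter_upwards [Ioi_mem_nhds h1] with s hs
    exact smoothTransition.one_of_one_le (le_of_lt hs)

theorem deriv_smoothTransition_eq_zero {t : ℝ} (ht : t ∉ Icc (0 : ℝ) 1) :
    deriv smoothTransition t = 0 ∧ deriv (deriv smoothTransition) t = 0 := by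
  obtain ⟨c, hc⟩ := smoothTransition_eventually_const ht
  have h1 := hc.deriv
  have h2 := h1.deriv
  refine ⟨by rw [h1.self_of_nhds]; simp, by rw [h2.self_of_nhds]; simp⟩

theorem hasDerivAt_smoothTransition (t : ℝ) :
    HasDerivAt smoothTransition (deriv smoothTransition t) t :=
  ((Real.smoothTransition.contDiff (n := 1)).differentiable (by norm_num) t).hasDerivAt

theorem contDiff_deriv_smoothTransition : ContDiff ℝ 1 (deriv smoothTransition) :=
  (Real.smoothTransition.contDiff (n := 2)).deriv' (n := 1)

theorem hasDerivAt_deriv_smoothTransition (t : ℝ) :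
    HasDerivAt (deriv smoothTransition) (deriv (deriv smoothTransition) t) t :=
  (contDiff_deriv_smoothTransition.differentiable (by norm_num) t).hasDerivAt

theorem continuous_deriv_deriv_smoothTransition : Continuous (deriv (deriv smoothTransition)) :=
  contDiff_deriv_smoothTransition.continuous_deriv (by norm_num)

theorem exists_bound_of_zero_outside {f : ℝ → ℝ} (hf : Continuous f)
    (h0 : ∀ t ∉ Icc (0 : ℝ) 1, f t = 0) : ∃ C, 0 ≤ C ∧ ∀ t, |f t| ≤ C := by
  obtain ⟨C, hC⟩ := (isCompact_Icc (a := (0 : ℝ)) (b := 1)).exists_bound_of_continuousOn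
    hf.continuousOn
  have hC0 : 0 ≤ C := (norm_nonneg _).trans (hC 0 ⟨le_rfl, zero_le_one⟩)
  refine ⟨C, hC0, fun t => ?_⟩
  by_cases ht : t ∈ Icc (0 : ℝ) 1
  · exact hC t ht
  · rw [h0 t ht, abs_zero]
    exact hC0

theorem exists_smoothTransition_bound :
    ∃ K, 0 ≤ K ∧ ∀ t, |deriv smoothTransition t| ≤ K ∧ |deriv (deriv smoothTransition) t| ≤ K := by
  obtain ⟨C, hC, h1⟩ := exists_bound_of_zero_outside contDiff_deriv_smoothTransition.continuous
    fun t ht => (deriv_smoothTransition_eq_zero ht).1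
  obtain ⟨C', hC', h2⟩ := exists_bound_of_zero_outside continuous_deriv_deriv_smoothTransition
    fun t ht => (deriv_smoothTransition_eq_zero ht).2
  exact ⟨max C C', hC.trans (le_max_left _ _),
    fun t => ⟨(h1 t).trans (le_max_left _ _), (h2 t).trans (le_max_right _ _)⟩⟩

/-- A smooth function on the plane vanishing near the origin and equal to one away from it. -/
def originCutoff (n : ℕ) (x : Plane) : ℝ := smoothTransition ((n : ℝ) ^ 2 * ‖x‖ ^ 2 - 1)

theorem contDiff_originCutoff (n : ℕ) : ContDiff ℝ ∞ (originCutoff n) := by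
  have h : ContDiff ℝ ∞ fun x : Plane => ‖x‖ ^ 2 := contDiff_norm_sq ℝ
  exact (Real.smoothTransition.contDiff (n := ⊤)).comp
    ((contDiff_const.mul h).sub contDiff_const)

theorem originCutoff_eq_zero {n : ℕ} {x : Plane} (h : (n : ℝ) ^ 2 * ‖x‖ ^ 2 ≤ 1) :
    originCutoff n x = 0 := smoothTransition.zero_of_nonpos (by linarith)

theorem originCutoff_eq_one {n : ℕ} {x : Plane} (h : 2 ≤ (n : ℝ) ^ 2 * ‖x‖ ^ 2) :
    originCutoff n x = 1 := smoothTransition.one_of_one_le (by linarith)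

theorem abs_originCutoff_le (n : ℕ) (x : Plane) : |originCutoff n x| ≤ 1 := by
  rw [originCutoff, abs_of_nonneg (smoothTransition.nonneg _)]
  exact smoothTransition.le_one _

theorem tendsto_originCutoff {x : Plane} (hx : x ≠ 0) :
    ∀ᶠ n : ℕ in atTop, originCutoff n x = 1 := by
  have hpos : 0 < ‖x‖ := norm_pos_iff.2 hx
  have h1 : Tendsto (fun n : ℕ => (n : ℝ) ^ 2 * ‖x‖ ^ 2) atTop atTop :=
    ((tendsto_pow_atTop two_ne_zero).comp tendsto_natCast_atTop_atTop).atTop_mul_const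
      (by positivity)
  filter_upwards [h1.eventually_ge_atTop 2] with n hn
  exact originCutoff_eq_one hn

/-- The gradient is supported where `n|x|` is bounded, which turns the factor `n²|x|` from the chain
rule into a multiple of `n`. -/
theorem exists_partialDeriv_originCutoff_bound :
    ∃ C, 0 ≤ C ∧ ∀ (n : ℕ) (i : Fin 2) (x : Plane),
      |partialDeriv i (originCutoff n) x| ≤ C * n ∧
        (2 < (n : ℝ) ^ 2 * ‖x‖ ^ 2 → partialDeriv i (originCutoff n) x = 0) := by
  obtain ⟨C, hC, hb⟩ := exists_smoothTransition_bound
  refine ⟨4 * C, by positivity, fun n i x => ?_⟩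
  have hone : 2 < (n : ℝ) ^ 2 * ‖x‖ ^ 2 → partialDeriv i (originCutoff n) x = 0 := by
    intro h
    have : originCutoff n =ᶠ[𝓝 x] fun _ => 1 := by
      have ho : IsOpen {y : Plane | 2 < (n : ℝ) ^ 2 * ‖y‖ ^ 2} :=
        isOpen_lt continuous_const (by fun_prop)
      filter_upwards [ho.mem_nhds h] with y hy
      exact originCutoff_eq_one (le_of_lt hy)
    rw [partialDeriv, this.fderiv_eq]
    simp
  refine ⟨?_, hone⟩
  by_cases h : 2 < (n : ℝ) ^ 2 * ‖x‖ ^ 2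
  · rw [hone h, abs_zero]
    positivity
  · have hnx : (n : ℝ) * ‖x‖ ≤ 2 := by
      have : 0 ≤ (n : ℝ) * ‖x‖ := by positivity
      nlinarith
    have hsm : DifferentiableAt ℝ smoothTransition ((n : ℝ) ^ 2 * ‖x‖ ^ 2 - 1) :=
      (Real.smoothTransition.contDiff (n := 1)).differentiable (by norm_num) _
    have h1 := hsm.hasDerivAt
    have h2 : HasFDerivAt (fun y : Plane => (n : ℝ) ^ 2 * ‖y‖ ^ 2 - 1)
        ((n : ℝ) ^ 2 • (2 • (innerSL ℝ x))) x :=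
      ((hasStrictFDerivAt_norm_sq x).hasFDerivAt.const_mul _).sub_const _
    have h3 := (h1.comp_hasFDerivAt x h2).fderiv
    have e : partialDeriv i (originCutoff n) x =
        deriv smoothTransition ((n : ℝ) ^ 2 * ‖x‖ ^ 2 - 1) * ((n : ℝ) ^ 2 * (2 * x i)) := by
      rw [partialDeriv]
      change fderiv ℝ (smoothTransition ∘ fun y : Plane => (n : ℝ) ^ 2 * ‖y‖ ^ 2 - 1) x _ = _
      rw [h3]
      simp [EuclideanSpace.inner_single_right]
    rw [e, abs_mul, abs_mul, abs_mul, abs_of_nonneg (by positivity : (0 : ℝ) ≤ (n : ℝ) ^ 2),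
      abs_of_pos (by norm_num : (0 : ℝ) < 2)]
    calc _ ≤ C * ((n : ℝ) ^ 2 * (2 * ‖x‖)) := by
          gcongr
          · exact (hb _).1
          · exact abs_coord_le x i
      _ = 2 * C * n * (n * ‖x‖) := by ring
      _ ≤ 2 * C * n * 2 := by gcongr
      _ = _ := by ring

theorem exteriorDomain_zero : exteriorDomain 0 = {(0 : Plane)}ᶜ := by
  ext x
  simp [exteriorDomain]

theorem restrict_exteriorDomain_zero :
    (volume : Measure Plane).restrict (exteriorDomain 0) = volume := by
  rw [exteriorDomain_zero]
  exact Measure.restrict_eq_self_of_ae_mem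
    (compl_mem_ae_iff.2 (measure_singleton (0 : Plane)))

/-- In dimension two a function of size `n` on a ball of radius `2/n` has bounded `L²` norm, whereas
the `L²` norm of the fixed function `v` on that ball tends to zero. -/
theorem tendsto_integral_of_shrinking {v : Plane → ℝ} (hv : MemLp v 2 volume)
    {w : ℕ → Plane → ℝ} {C : ℝ} (hC : 0 ≤ C) (hw : ∀ n, Continuous (w n))
    (hb : ∀ n x, |w n x| ≤ C * n)
    (hz : ∀ (n : ℕ) x, 2 < (n : ℝ) ^ 2 * ‖x‖ ^ 2 → w n x = 0) :
    Tendsto (fun n => ∫ x, v x * w n x) atTop (𝓝 0) := by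
  let B : ℕ → Set Plane := fun n => Metric.closedBall 0 (2 / n)
  have hBm : ∀ n, MeasurableSet (B n) := fun n => Metric.isClosed_closedBall.measurableSet
  have hvol : ∀ n, volume (B n) = ENNReal.ofReal (2 / n) ^ 2 * ENNReal.ofReal π := fun n =>
    EuclideanSpace.volume_closedBall_fin_two _ _
  have hout : ∀ n, 0 < n → ∀ x ∉ B n, w n x = 0 := by
    intro n hn x hx
    have h0 : (0 : ℝ) < n := by exact_mod_cast hn
    have h1 : 2 / (n : ℝ) < ‖x‖ := by simpa [B] using hx
    rw [div_lt_iff₀ h0] at h1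
    exact hz n x (by nlinarith)
  have hwB : ∀ n, 0 < n → eLpNorm (w n) 2 volume ≤
      ENNReal.ofReal (C * 2) * ENNReal.ofReal π ^ (1 / 2 : ℝ) := by
    intro n hn
    have h0 : (0 : ℝ) < n := by exact_mod_cast hn
    calc eLpNorm (w n) 2 volume ≤ eLpNorm ((B n).indicator fun _ => C * (n : ℝ)) 2 volume := by
          refine eLpNorm_mono fun x => ?_
          by_cases hx : x ∈ B n
          · rw [indicator_of_mem hx, Real.norm_eq_abs, Real.norm_eq_abs,
              abs_of_nonneg (by positivity : 0 ≤ C * (n : ℝ))]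
            exact hb n x
          · simp [hout n hn x hx]
      _ ≤ ‖C * (n : ℝ)‖ₑ * volume (B n) ^ (1 / (2 : ℝ≥0∞).toReal) := eLpNorm_indicator_const_le _ _
      _ = _ := by
          rw [hvol, ENNReal.mul_rpow_of_nonneg _ _ (by norm_num), ← mul_assoc]
          congr 1
          · rw [← ENNReal.rpow_natCast, ← ENNReal.rpow_mul]
            norm_num
            rw [Real.enorm_of_nonneg hC, ← ENNReal.ofReal_natCast, ← ENNReal.ofReal_mul hC,
              ← ENNReal.ofReal_mul (by positivity)]
            congr 1
            field_simp
  set K : ℝ≥0∞ := ENNReal.ofReal (C * 2) * ENNReal.ofReal π ^ (1 / 2 : ℝ) with hK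
  have hKt : K ≠ ⊤ := ENNReal.mul_ne_top ENNReal.ofReal_ne_top
    (ENNReal.rpow_ne_top_of_nonneg (by norm_num) ENNReal.ofReal_ne_top)
  have hind : Tendsto (fun n => eLpNorm ((B n).indicator v) 2 volume) atTop (𝓝 0) := by
    rw [ENNReal.tendsto_nhds_zero]
    intro ε hε
    rcases eq_or_ne ε ⊤ with rfl | hεt
    · exact Eventually.of_forall fun _ => le_top
    obtain ⟨δ, hδ, h⟩ := hv.eLpNorm_indicator_le (p := 2) (by norm_num) (by norm_num)
      (ENNReal.toReal_pos hε.ne' hεt)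
    have hvol0 : Tendsto (fun n => volume (B n)) atTop (𝓝 0) := by
      simp only [hvol]
      have h1 : Tendsto (fun n : ℕ => ENNReal.ofReal (2 / n)) atTop (𝓝 0) := by
        have := ENNReal.tendsto_ofReal (tendsto_const_div_atTop_nhds_zero_nat 2)
        simpa using this
      have h2 := ENNReal.Tendsto.mul_const (b := ENNReal.ofReal π)
        (ENNReal.Tendsto.pow (n := 2) h1) (Or.inr ENNReal.ofReal_ne_top)
      simpa using h2
    filter_upwards [hvol0.eventually_le_const (ENNReal.ofReal_pos.2 hδ)] with n hn
    have := h (B n) (hBm n) hn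
    rwa [ENNReal.ofReal_toReal hεt] at this
  have hmain : Tendsto (fun n => eLpNorm ((B n).indicator v) 2 volume * K) atTop (𝓝 0) := by
    simpa using ENNReal.Tendsto.mul_const hind (Or.inr hKt)
  rw [tendsto_zero_iff_enorm_tendsto_zero]
  refine tendsto_of_tendsto_of_tendsto_of_le_of_le' tendsto_const_nhds hmain
    (Eventually.of_forall fun _ => zero_le) ?_
  filter_upwards [eventually_gt_atTop 0] with n hn
  calc ‖∫ x, v x * w n x‖ₑ ≤ ∫⁻ x, ‖v x * w n x‖ₑ := enorm_integral_le_lintegral_enorm _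
    _ = eLpNorm (((B n).indicator v) • w n) 1 volume := by
        rw [eLpNorm_one_eq_lintegral_enorm]
        congr 1
        funext x
        by_cases hx : x ∈ B n
        · simp [indicator_of_mem hx]
        · simp [indicator_of_notMem hx, hout n hn x hx]
    _ ≤ eLpNorm ((B n).indicator v) 2 volume * eLpNorm (w n) 2 volume :=
        eLpNorm_smul_le_mul_eLpNorm (hw n).aestronglyMeasurable (hv.1.indicator (hBm n))
    _ ≤ _ := by gcongr; exact hwB n hn

/-- Multiply the test function by a cutoff vanishing near the origin. The only extra term contains
the gradient of the cutoff, and `tendsto_integral_of_shrinking` disposes of it. -/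
theorem IsWeakPartial.of_punctured {i : Fin 2} {v g : Plane → ℝ} (hv : MemLp v 2 volume)
    (hg : MemLp g 2 volume) (h : IsWeakPartial (exteriorDomain 0) i v g) :
    IsWeakPartial univ i v g := by
  have lv := hv.locallyIntegrable (by norm_num)
  have lg := hg.locallyIntegrable (by norm_num)
  refine ⟨lv.locallyIntegrableOn _, lg.locallyIntegrableOn _, fun φ hφ hc _ => ?_⟩
  simp only [setIntegral_univ]
  obtain ⟨C, hC, hη⟩ := exists_partialDeriv_originCutoff_bound
  obtain ⟨M, hM⟩ := hφ.continuous.bounded_above_of_compact_support hc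
  have hM0 : 0 ≤ M := (norm_nonneg _).trans (hM 0)
  have cη := fun n => (contDiff_originCutoff n).continuous
  have cdη := fun n => continuous_partialDeriv (contDiff_originCutoff n) i
  have cd := continuous_partialDeriv hφ i
  have hc' := hasCompactSupport_partialDeriv hc i
  have key : ∀ n : ℕ, 0 < n → ∫ x, v x * (originCutoff n x * partialDeriv i φ x) =
      -(∫ x, g x * (originCutoff n x * φ x)) - ∫ x, v x * (partialDeriv i (originCutoff n) x * φ x) := by
    intro n hn
    have hn0 : (0 : ℝ) < n := by exact_mod_cast hn
    have hsup : (tsupport fun x => originCutoff n x * φ x) ⊆ exteriorDomain 0 := by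
      refine tsupport_mul_subset_left.trans ?_
      have hcl : IsClosed {x : Plane | 1 ≤ (n : ℝ) ^ 2 * ‖x‖ ^ 2} :=
        isClosed_le continuous_const (by fun_prop)
      refine (closure_minimal (fun x hx => ?_) hcl).trans fun x hx => ?_
      · by_contra hlt
        exact hx (originCutoff_eq_zero (le_of_lt (not_le.1 hlt)))
      · change 0 < ‖x‖
        refine norm_pos_iff.2 fun h0 => ?_
        have : (1 : ℝ) ≤ (n : ℝ) ^ 2 * ‖x‖ ^ 2 := hx
        rw [h0] at this
        norm_num at this
    have := h.2.2 _ ((contDiff_originCutoff n).mul hφ) hc.mul_left hsup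
    simp only [partialDeriv_mul (contDiff_originCutoff n) hφ, restrict_exteriorDomain_zero,
      mul_add] at this
    rw [integral_add] at this
    · linarith
    · exact integrable_mul_of_tsupport_subset (lv.locallyIntegrableOn univ)
        ((cη n).mul cd) hc'.mul_left (subset_univ _)
    · exact integrable_mul_of_tsupport_subset (lv.locallyIntegrableOn univ)
        ((cdη n).mul hφ.continuous) hc.mul_left (subset_univ _)
  have lim : ∀ {f ψ : Plane → ℝ}, LocallyIntegrable f → Continuous ψ → HasCompactSupport ψ →
      Tendsto (fun n => ∫ x, f x * (originCutoff n x * ψ x)) atTop (𝓝 (∫ x, f x * ψ x)) := by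
    intro f ψ hf hψ hcψ
    have hi := integrable_mul_of_tsupport_subset (hf.locallyIntegrableOn univ) hψ hcψ (subset_univ _)
    refine tendsto_integral_of_dominated_convergence (fun x => ‖f x * ψ x‖) (fun n => ?_) hi.norm
      (fun n => ?_) ?_
    · exact (integrable_mul_of_tsupport_subset (hf.locallyIntegrableOn univ)
        ((cη n).mul hψ) hcψ.mul_left (subset_univ _)).1
    · refine Eventually.of_forall fun x => ?_
      have e : f x * (originCutoff n x * ψ x) = originCutoff n x * (f x * ψ x) := by ring
      rw [e, norm_mul]
      exact mul_le_of_le_one_left (norm_nonneg _) (abs_originCutoff_le n x)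
    · have h0 : ∀ᵐ x : Plane, x ≠ 0 := compl_mem_ae_iff.2 (measure_singleton (0 : Plane))
      filter_upwards [h0] with x hx
      refine tendsto_const_nhds.congr' ?_
      filter_upwards [tendsto_originCutoff hx] with n hn
      rw [hn, one_mul]
  have l1 := lim lv cd hc'
  have l2 := lim lg hφ.continuous hc
  have l3 : Tendsto (fun n => ∫ x, v x * (partialDeriv i (originCutoff n) x * φ x)) atTop (𝓝 0) := by
    refine tendsto_integral_of_shrinking hv (C := C * M) (by positivity)
      (fun n => (cdη n).mul hφ.continuous) (fun n x => ?_) (fun n x hx => ?_)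
    · rw [abs_mul, mul_right_comm]
      exact mul_le_mul ((hη n i x).1) (hM x) (abs_nonneg _) (by positivity)
    · rw [(hη n i x).2 hx, zero_mul]
  have l4 := l2.neg.sub l3
  rw [sub_zero] at l4
  refine tendsto_nhds_unique l1 (l4.congr' ?_)
  filter_upwards [eventually_gt_atTop 0] with n hn
  exact (key n hn).symm

/-! ### The action of the symmetry group on the plane -/

/-- The rotation of the plane about the origin by the angle `φ`. -/
def rotPlane (φ : ℝ) (x : Plane) : Plane :=
  !₂[cos φ * x 0 - sin φ * x 1, sin φ * x 0 + cos φ * x 1]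

/-- The reflection of the plane in the first coordinate axis. -/
def conjPlane (x : Plane) : Plane := !₂[x 0, -x 1]

theorem rotPlane_polarPt (φ r θ : ℝ) : rotPlane φ (polarPt r θ) = polarPt r (θ + φ) := by
  ext i
  fin_cases i <;> simp [rotPlane, polarPt, cos_add, sin_add] <;> ring

theorem conjPlane_polarPt (r θ : ℝ) : conjPlane (polarPt r θ) = polarPt r (-θ) := by
  ext i
  fin_cases i <;> simp [conjPlane, polarPt]

theorem norm_rotPlane (φ : ℝ) (x : Plane) : ‖rotPlane φ x‖ = ‖x‖ := by
  obtain ⟨θ, h⟩ := exists_polarPt x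
  rw [h, rotPlane_polarPt, norm_polarPt (norm_nonneg x), norm_polarPt (norm_nonneg x)]

theorem norm_conjPlane (x : Plane) : ‖conjPlane x‖ = ‖x‖ := by
  obtain ⟨θ, h⟩ := exists_polarPt x
  rw [h, conjPlane_polarPt, norm_polarPt (norm_nonneg x), norm_polarPt (norm_nonneg x)]

theorem rotPlane_rotPlane (φ ψ : ℝ) (x : Plane) :
    rotPlane φ (rotPlane ψ x) = rotPlane (φ + ψ) x := by
  ext i
  fin_cases i <;> simp [rotPlane, cos_add, sin_add] <;> ring

theorem rotPlane_zero (x : Plane) : rotPlane 0 x = x := by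
  ext i
  fin_cases i <;> simp [rotPlane]

theorem conjPlane_conjPlane (x : Plane) : conjPlane (conjPlane x) = x := by
  ext i
  fin_cases i <;> simp [conjPlane]

theorem continuous_rotPlane (φ : ℝ) : Continuous (rotPlane φ) := by
  unfold rotPlane
  refine (PiLp.continuous_toLp 2 _).comp (continuous_pi fun i => ?_)
  fin_cases i <;> simp <;> fun_prop

theorem continuous_conjPlane : Continuous conjPlane := by
  unfold conjPlane
  refine (PiLp.continuous_toLp 2 _).comp (continuous_pi fun i => ?_)
  fin_cases i <;> simp <;> fun_prop

theorem planeAct_eq (β : Matrix.orthogonalGroup (Fin 3) ℝ) (x : Plane) :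
    planeAct β x = !₂[β.1 0 0 * x 0 + β.1 0 2 * x 1, β.1 2 0 * x 0 + β.1 2 2 * x 1] := by
  ext i
  fin_cases i <;> simp [planeAct, Matrix.mulVec, dotProduct, Fin.sum_univ_three]

theorem normalY_dotProduct (β : Matrix (Fin 3) (Fin 3) ℝ) :
    normalY ⬝ᵥ (β *ᵥ normalY) = β 1 1 := by
  simp [normalY, Matrix.mulVec, dotProduct, Fin.sum_univ_three]

theorem omega_val (τ : ℝ) : (omega τ).1 =
    !![cos (π * τ), 0, sin (π * τ); 0, -1, 0; -sin (π * τ), 0, cos (π * τ)] := by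
  ext i j
  fin_cases i <;> fin_cases j <;>
    simp [omega, reflY, rotY, rotYMatrix]

theorem xi_val (τ : ℝ) : (xi τ).1 =
    !![cos (π * τ), 0, -sin (π * τ); 0, 1, 0; -sin (π * τ), 0, -cos (π * τ)] := by
  have h : π * τ = π / 2 * τ + π / 2 * τ := by ring
  rw [h, cos_add, sin_add]
  have hi : ((rotY (π / 2 * τ))⁻¹).1 = (rotYMatrix (π / 2 * τ))ᵀ := by
    ext i j
    rfl
  have e : (xi τ).1 = rotYMatrix (π / 2 * τ) * reflZ.1 * (rotYMatrix (π / 2 * τ))ᵀ := by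
    rw [← hi]
    rfl
  rw [e]
  ext i j
  fin_cases i <;> fin_cases j <;>
    simp [reflZ, rotYMatrix, Matrix.mul_apply, Matrix.vecMul_diagonal, Fin.sum_univ_three] <;> ring

theorem planeAct_omega (τ : ℝ) (x : Plane) : planeAct (omega τ) x = rotPlane (-(π * τ)) x := by
  rw [planeAct_eq, omega_val]
  ext i
  fin_cases i <;> simp [rotPlane]

theorem planeAct_xi (τ : ℝ) (x : Plane) :
    planeAct (xi τ) x = rotPlane (-(π * τ)) (conjPlane x) := by
  rw [planeAct_eq, xi_val]
  ext i
  fin_cases i <;> simp [rotPlane, conjPlane] <;> ring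

/-- The product is the half-turn about the `x`-axis: it acts on the plane as `θ ↦ -θ` and reverses
the normal. This is the element that makes equivariant functions odd in `θ`. -/
theorem xi_mul_omega_val (τ : ℝ) :
    (xi τ * omega τ).1 = !![1, 0, 0; 0, -1, 0; 0, 0, -1] := by
  have h := sin_sq_add_cos_sq (π * τ)
  have e : (xi τ * omega τ).1 = (xi τ).1 * (omega τ).1 := rfl
  rw [e, xi_val, omega_val]
  ext i j
  fin_cases i <;> fin_cases j <;>
    simp [Matrix.mul_apply, Fin.sum_univ_three] <;> nlinarith

theorem planeAct_xi_mul_omega (τ : ℝ) (x : Plane) :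
    planeAct (xi τ * omega τ) x = conjPlane x := by
  rw [planeAct_eq, xi_mul_omega_val]
  ext i
  fin_cases i <;> simp [conjPlane]

theorem Equivariant.rot {τ : ℝ} {Ω : Set Plane} {f : Plane → ℝ} (h : Equivariant τ Ω f) :
    ∀ᵐ x ∂(volume.restrict Ω), f (rotPlane (-(π * τ)) x) = -f x := by
  have := h _ (Subgroup.subset_closure (show omega τ ∈ ({omega τ, xi τ} : Set _) by simp))
  filter_upwards [this] with x hx
  rw [planeAct_omega, normalY_dotProduct, omega_val] at hx
  simpa using hx

theorem Equivariant.conj {τ : ℝ} {Ω : Set Plane} {f : Plane → ℝ} (h : Equivariant τ Ω f) :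
    ∀ᵐ x ∂(volume.restrict Ω), f (conjPlane x) = -f x := by
  have := h _ (mul_mem (Subgroup.subset_closure (show xi τ ∈ ({omega τ, xi τ} : Set _) by simp))
    (Subgroup.subset_closure (show omega τ ∈ ({omega τ, xi τ} : Set _) by simp)))
  filter_upwards [this] with x hx
  rw [planeAct_xi_mul_omega, normalY_dotProduct, xi_mul_omega_val] at hx
  simpa using hx

/-- Induction over the generated group. One must carry along that each element preserves the plane
and its normal up to sign, since only then does `planeAct` respect products and inverses. -/
theorem equivariant_of_forall {τ R : ℝ} {f : Plane → ℝ}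
    (hr : ∀ x, R < ‖x‖ → f (rotPlane (-(π * τ)) x) = -f x)
    (hc : ∀ x, R < ‖x‖ → f (conjPlane x) = -f x) : Equivariant τ (exteriorDomain R) f := by
  have key : ∀ β ∈ G τ, (β.1 0 1 = 0 ∧ β.1 1 0 = 0 ∧ β.1 1 2 = 0 ∧ β.1 2 1 = 0) ∧
      β.1 1 1 * β.1 1 1 = 1 ∧ (∀ x, ‖planeAct β x‖ = ‖x‖) ∧
      ∀ x, R < ‖x‖ → f (planeAct β x) = β.1 1 1 * f x := by
    intro β hβ
    induction hβ using Subgroup.closure_induction with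
    | mem β hβ =>
      rcases hβ with rfl | rfl
      · refine ⟨by simp [omega_val], by simp [omega_val], fun x => ?_, fun x hx => ?_⟩
        · rw [planeAct_omega, norm_rotPlane]
        · rw [planeAct_omega, hr x hx, omega_val]
          simp
      · refine ⟨by simp [xi_val], by simp [xi_val], fun x => ?_, fun x hx => ?_⟩
        · rw [planeAct_xi, norm_rotPlane, norm_conjPlane]
        · rw [planeAct_xi, hr _ (by rwa [norm_conjPlane]), hc x hx, xi_val]
          simp
    | one =>
      have e : ∀ x, planeAct 1 x = x := fun x => by
        rw [planeAct_eq]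
        ext i
        fin_cases i <;> simp
      exact ⟨by simp, by simp, fun x => by rw [e], fun x _ => by rw [e]; simp⟩
    | mul β γ _ _ hβ hγ =>
      obtain ⟨⟨a1, a2, a3, a4⟩, a5, a6, a7⟩ := hβ
      obtain ⟨⟨b1, b2, b3, b4⟩, b5, b6, b7⟩ := hγ
      have hm : ∀ i j, (β * γ).1 i j = β.1 i 0 * γ.1 0 j + β.1 i 1 * γ.1 1 j + β.1 i 2 * γ.1 2 j :=
        fun i j => by
          change (β.1 * γ.1) i j = _
          rw [Matrix.mul_apply, Fin.sum_univ_three]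
      have e : ∀ x, planeAct (β * γ) x = planeAct β (planeAct γ x) := fun x => by
        rw [planeAct_eq, planeAct_eq β, planeAct_eq γ]
        ext i
        fin_cases i <;> simp [hm, b2, b3] <;> ring
      refine ⟨by simp [*], ?_, fun x => by rw [e, a6, b6], fun x hx => ?_⟩
      · rw [hm, a2, a3]
        linear_combination γ.1 1 1 * γ.1 1 1 * a5 + b5
      · rw [e, a7 _ (by rwa [b6]), b7 x hx, hm, a2, a3]
        ring
    | inv β _ hβ =>
      obtain ⟨⟨a1, a2, a3, a4⟩, a5, a6, a7⟩ := hβ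
      have hi : ∀ i j, (β⁻¹).1 i j = β.1 j i := fun i j => rfl
      have ho := (Matrix.mem_orthogonalGroup_iff (Fin 3) ℝ).1 β.2
      have e : ∀ x, planeAct β (planeAct β⁻¹ x) = x := fun x => by
        have h := fun i j => congrFun (congrFun ho i) j
        simp only [Matrix.mul_apply, Fin.sum_univ_three] at h
        have h00 := h 0 0
        have h02 := h 0 2
        have h22 := h 2 2
        simp [a1, a4] at h00 h02 h22
        rw [planeAct_eq, planeAct_eq β⁻¹]
        ext i
        fin_cases i
        · simp [hi]
          linear_combination x 0 * h00 + x 1 * h02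
        · simp [hi]
          linear_combination x 0 * h02 + x 1 * h22
      have e' : ∀ x, ‖planeAct β⁻¹ x‖ = ‖x‖ := fun x => by rw [← a6, e]
      refine ⟨by simp [*], by rw [hi, a5], e', fun x hx => ?_⟩
      have := a7 (planeAct β⁻¹ x) (by rwa [e'])
      rw [e] at this
      rw [this, hi]
      linear_combination -f (planeAct β⁻¹ x) * a5
  intro β hβ
  filter_upwards [ae_restrict_mem (measurableSet_exteriorDomain R)] with x hx
  rw [normalY_dotProduct]
  exact (key β hβ).2.2.2 x hx

/-! ### Orthogonality of equivariant functions to the other modes -/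

/-- `rotPlane` as a linear isometry. -/
def rotIso (φ : ℝ) : Plane ≃ₗᵢ[ℝ] Plane where
  toFun := rotPlane φ
  invFun := rotPlane (-φ)
  map_add' x y := by ext i; fin_cases i <;> simp [rotPlane] <;> ring
  map_smul' c x := by ext i; fin_cases i <;> simp [rotPlane] <;> ring
  left_inv x := by rw [rotPlane_rotPlane, neg_add_cancel, rotPlane_zero]
  right_inv x := by rw [rotPlane_rotPlane, add_neg_cancel, rotPlane_zero]
  norm_map' := norm_rotPlane φ

/-- `conjPlane` as a linear isometry. -/
def conjIso : Plane ≃ₗᵢ[ℝ] Plane where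
  toFun := conjPlane
  invFun := conjPlane
  map_add' x y := by ext i; fin_cases i <;> simp [conjPlane] <;> ring
  map_smul' c x := by ext i; fin_cases i <;> simp [conjPlane]
  left_inv := conjPlane_conjPlane
  right_inv := conjPlane_conjPlane
  norm_map' := norm_conjPlane

theorem setIntegral_comp_isometry (T : Plane ≃ₗᵢ[ℝ] Plane) (R : ℝ) (f : Plane → ℝ) :
    ∫ x in exteriorDomain R, f (T x) = ∫ x in exteriorDomain R, f x := by
  have h := T.measurePreserving.setIntegral_preimage_emb
    T.toHomeomorph.measurableEmbedding f (exteriorDomain R)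
  have e : T ⁻¹' exteriorDomain R = exteriorDomain R := by
    ext x
    simp [exteriorDomain]
  rw [e] at h
  exact h

/-- The degrees of the angular modes compatible with the symmetry group. -/
def IsMode (k l : ℕ) : Prop := ∃ j : ℕ, l = k * (2 * j + 1)

/-- The cosine is `-1` exactly at odd multiples of `π`; non-negativity of `l` then excludes the
negative ones. -/
theorem isMode_of_cos_eq {k l : ℕ} (hk : 0 < k) (h : cos (l * (π / k)) = -1) : IsMode k l := by
  obtain ⟨n, hn⟩ := cos_eq_neg_one_iff.1 h
  have hk' : (k : ℝ) ≠ 0 := by positivity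
  have h1 : (l : ℝ) = k * (2 * n + 1) := by
    field_simp at hn
    have := pi_pos.ne'
    linarith
  have h2 : (l : ℤ) = k * (2 * n + 1) := by exact_mod_cast h1
  have hn0 : 0 ≤ n := by
    by_contra hneg
    have : (k : ℤ) * (2 * n + 1) < 0 := mul_neg_of_pos_of_neg (by exact_mod_cast hk) (by omega)
    omega
  lift n to ℕ using hn0
  exact ⟨n, by exact_mod_cast h2⟩

theorem cos_of_isMode {k l : ℕ} (hk : 0 < k) (h : IsMode k l) :
    cos (l * (π / k)) = -1 ∧ sin (l * (π / k)) = 0 := by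
  obtain ⟨j, rfl⟩ := h
  have hk' : (k : ℝ) ≠ 0 := by positivity
  have e : ((k * (2 * j + 1) : ℕ) : ℝ) * (π / k) = π + j * (2 * π) := by
    push_cast
    field_simp
    ring
  rw [e]
  exact ⟨by rw [cos_add_nat_mul_two_pi, cos_pi], by rw [sin_add_nat_mul_two_pi, sin_pi]⟩

theorem sinMode_rotPlane (l : ℕ) (φ : ℝ) {x : Plane} (hx : x ≠ 0) :
    sinMode l (rotPlane φ x) = sinMode l x * cos (l * φ) + cosMode l x * sin (l * φ) := by
  obtain ⟨θ, h⟩ := exists_polarPt x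
  have hr : 0 < ‖x‖ := norm_pos_iff.2 hx
  rw [h, rotPlane_polarPt, sinMode_polarPt hr, sinMode_polarPt hr, cosMode_polarPt hr, mul_add,
    sin_add]

theorem sinMode_conjPlane (l : ℕ) {x : Plane} (hx : x ≠ 0) :
    sinMode l (conjPlane x) = -sinMode l x := by
  obtain ⟨θ, h⟩ := exists_polarPt x
  have hr : 0 < ‖x‖ := norm_pos_iff.2 hx
  rw [h, conjPlane_polarPt, sinMode_polarPt hr, sinMode_polarPt hr, mul_neg, sin_neg]

theorem cosMode_conjPlane (l : ℕ) {x : Plane} (hx : x ≠ 0) :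
    cosMode l (conjPlane x) = cosMode l x := by
  obtain ⟨θ, h⟩ := exists_polarPt x
  have hr : 0 < ‖x‖ := norm_pos_iff.2 hx
  rw [h, conjPlane_polarPt, cosMode_polarPt hr, cosMode_polarPt hr, mul_neg, cos_neg]

/-- Continuous functions with compact support in `(R, ∞)`. -/
def RadialTest (R : ℝ) (e : ℝ → ℝ) : Prop :=
  Continuous e ∧ ∃ a b, R < a ∧ ∀ r ∉ Icc a b, e r = 0

theorem RadialTest.zero (R : ℝ) : RadialTest R 0 :=
  ⟨continuous_zero, R + 1, 0, by linarith, fun _ _ => rfl⟩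

theorem continuous_radial_mul {R : ℝ} {e : ℝ → ℝ} (he : RadialTest R e)
    {f : Plane → ℝ} (hf : ContinuousOn f (exteriorDomain R)) :
    Continuous fun x : Plane => e ‖x‖ * f x := by
  obtain ⟨ce, a, b, hRa, hs⟩ := he
  rw [continuous_iff_continuousAt]
  intro x
  by_cases hx : R < ‖x‖
  · exact (ce.comp continuous_norm).continuousAt.mul
      (hf.continuousAt ((isOpen_exteriorDomain R).mem_nhds hx))
  · have hlt : ‖x‖ < a := by linarith [not_lt.1 hx]
    have : (fun x : Plane => e ‖x‖ * f x) =ᶠ[𝓝 x] fun _ => 0 := by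
      filter_upwards [(isOpen_lt continuous_norm continuous_const).mem_nhds hlt] with y hy
      rw [hs _ fun h => absurd h.1 (not_le.2 hy), zero_mul]
    exact continuousAt_const.congr this.symm

theorem hasCompactSupport_radial_mul {R : ℝ} {e : ℝ → ℝ} (he : RadialTest R e)
    (f : Plane → ℝ) : HasCompactSupport fun x : Plane => e ‖x‖ * f x := by
  obtain ⟨ce, a, b, hRa, hs⟩ := he
  refine HasCompactSupport.intro (isCompact_closedBall (0 : Plane) b) fun x hx => ?_
  have : b < ‖x‖ := by simpa using hx
  rw [hs _ fun h => absurd h.2 (not_le.2 this), zero_mul]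

theorem memLp_radial_mul {R : ℝ} {e : ℝ → ℝ} (he : RadialTest R e)
    {f : Plane → ℝ} (hf : ContinuousOn f (exteriorDomain R)) (μ : Measure Plane)
    [IsFiniteMeasureOnCompacts μ] : MemLp (fun x : Plane => e ‖x‖ * f x) 2 μ :=
  memLp_of_hasCompactSupport (continuous_radial_mul he hf) (hasCompactSupport_radial_mul he f) μ

theorem memLp_sinSum {R : ℝ} (hR : 0 ≤ R) {A : ℕ → ℝ → ℝ} (hA : ∀ l, RadialTest R (A l)) (N : ℕ)
    (μ : Measure Plane) [IsFiniteMeasureOnCompacts μ] : MemLp (sinSum A N) 2 μ :=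
  memLp_finsetSum _ fun l _ => memLp_radial_mul (hA l) (continuousOn_sinMode hR l) μ

theorem memLp_cosSum {R : ℝ} (hR : 0 ≤ R) {A : ℕ → ℝ → ℝ} (hA : ∀ l, RadialTest R (A l)) (N : ℕ)
    (μ : Measure Plane) [IsFiniteMeasureOnCompacts μ] : MemLp (cosSum A N) 2 μ :=
  memLp_finsetSum _ fun l _ => memLp_radial_mul (hA l) (continuousOn_cosMode hR l) μ

section

variable {k : ℕ} {R : ℝ} {w : Plane → ℝ}

/-- The reflection preserves measure, the function is odd under it and the cosine mode is even. -/
theorem integral_mul_cosMode_eq_zero (hR : 0 ≤ R)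
    (hc : ∀ᵐ x ∂(volume.restrict (exteriorDomain R)), w (conjPlane x) = -w x)
    (A : ℝ → ℝ) (l : ℕ) :
    ∫ x in exteriorDomain R, w x * (A ‖x‖ * cosMode l x) = 0 := by
  have h := setIntegral_comp_isometry conjIso R fun x => w x * (A ‖x‖ * cosMode l x)
  have e : ∫ x in exteriorDomain R, w (conjIso x) * (A ‖conjIso x‖ * cosMode l (conjIso x)) =
      ∫ x in exteriorDomain R, -(w x * (A ‖x‖ * cosMode l x)) := by
    refine integral_congr_ae ?_
    filter_upwards [hc, ae_restrict_mem (measurableSet_exteriorDomain R)] with x hx hxΩ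
    rw [LinearIsometryEquiv.norm_map]
    change w (conjPlane x) * (_ * cosMode l (conjPlane x)) = _
    rw [hx, cosMode_conjPlane l (ne_zero_of_mem_exteriorDomain hR hxΩ)]
    ring
  rw [e, integral_neg] at h
  linarith

/-- Rotating by `-π/k` gives `I = -cos (lπ/k) I + sin (lπ/k) J` for the sine integral `I` and the
cosine integral `J`. Since `J = 0`, the product `(1 + cos (lπ/k)) I` vanishes, and its first factor
is zero only for odd multiples of `k`. -/
theorem integral_mul_sinMode_eq_zero (hR : 0 ≤ R) (hk : 0 < k)
    (hw : MemLp w 2 (volume.restrict (exteriorDomain R)))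
    (hr : ∀ᵐ x ∂(volume.restrict (exteriorDomain R)), w (rotPlane (-(π / k)) x) = -w x)
    (hc : ∀ᵐ x ∂(volume.restrict (exteriorDomain R)), w (conjPlane x) = -w x)
    {A : ℝ → ℝ} (hA : RadialTest R A) {l : ℕ} (hl : ¬IsMode k l) :
    ∫ x in exteriorDomain R, w x * (A ‖x‖ * sinMode l x) = 0 := by
  have h := setIntegral_comp_isometry (rotIso (-(π / k))) R fun x => w x * (A ‖x‖ * sinMode l x)
  have i1 : IntegrableOn (fun x => w x * (A ‖x‖ * sinMode l x)) (exteriorDomain R) :=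
    hw.integrable_mul (memLp_radial_mul hA (continuousOn_sinMode hR l) _)
  have i2 : IntegrableOn (fun x => w x * (A ‖x‖ * cosMode l x)) (exteriorDomain R) :=
    hw.integrable_mul (memLp_radial_mul hA (continuousOn_cosMode hR l) _)
  have e : ∫ x in exteriorDomain R, w (rotIso (-(π / k)) x) *
        (A ‖rotIso (-(π / k)) x‖ * sinMode l (rotIso (-(π / k)) x)) =
      ∫ x in exteriorDomain R, (-cos (l * (π / k)) * (w x * (A ‖x‖ * sinMode l x)) +
        sin (l * (π / k)) * (w x * (A ‖x‖ * cosMode l x))) := by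
    refine integral_congr_ae ?_
    filter_upwards [hr, ae_restrict_mem (measurableSet_exteriorDomain R)] with x hx hxΩ
    rw [LinearIsometryEquiv.norm_map]
    change w (rotPlane _ x) * (_ * sinMode l (rotPlane _ x)) = _
    rw [hx, sinMode_rotPlane l _ (ne_zero_of_mem_exteriorDomain hR hxΩ), mul_neg, cos_neg, sin_neg]
    ring
  rw [e, integral_add (i1.const_mul _) (i2.const_mul _), integral_const_mul, integral_const_mul,
    integral_mul_cosMode_eq_zero hR hc A l] at h
  have h2 : (1 + cos (l * (π / k))) *
      ∫ x in exteriorDomain R, w x * (A ‖x‖ * sinMode l x) = 0 := by linarith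
  rcases mul_eq_zero.1 h2 with h3 | h3
  · exact absurd (isMode_of_cos_eq hk (by linarith)) hl
  · exact h3

theorem integral_mul_sinSum_add_cosSum_eq_zero (hR : 0 ≤ R) (hk : 0 < k)
    (hw : MemLp w 2 (volume.restrict (exteriorDomain R)))
    (hr : ∀ᵐ x ∂(volume.restrict (exteriorDomain R)), w (rotPlane (-(π / k)) x) = -w x)
    (hc : ∀ᵐ x ∂(volume.restrict (exteriorDomain R)), w (conjPlane x) = -w x)
    {A B : ℕ → ℝ → ℝ} (hA : ∀ l, RadialTest R (A l)) (hB : ∀ l, RadialTest R (B l))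
    (hA0 : ∀ l, IsMode k l → A l = 0) (N : ℕ) :
    ∫ x in exteriorDomain R, w x * (sinSum A N x + cosSum B N x) = 0 := by
  have i1 : ∀ l, IntegrableOn (fun x => w x * (A l ‖x‖ * sinMode l x)) (exteriorDomain R) :=
    fun l => hw.integrable_mul (memLp_radial_mul (hA l) (continuousOn_sinMode hR l) _)
  have i2 : ∀ l, IntegrableOn (fun x => w x * (B l ‖x‖ * cosMode l x)) (exteriorDomain R) :=
    fun l => hw.integrable_mul (memLp_radial_mul (hB l) (continuousOn_cosMode hR l) _)
  simp only [sinSum, cosSum, mul_add, Finset.mul_sum]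
  rw [integral_add (integrable_finsetSum _ fun l _ => i1 l)
    (integrable_finsetSum _ fun l _ => i2 l), integral_finsetSum _ fun l _ => i1 l,
    integral_finsetSum _ fun l _ => i2 l, Finset.sum_eq_zero, Finset.sum_eq_zero, add_zero]
  · exact fun l _ => integral_mul_cosMode_eq_zero hR hc _ l
  · intro l _
    by_cases hl : IsMode k l
    · simp [hA0 l hl]
    · exact integral_mul_sinMode_eq_zero hR hk hw hr hc (hA l) hl

end

theorem sinSum_rotPlane {k : ℕ} (hk : 0 < k) {e : ℕ → ℝ → ℝ} (he : ∀ l, ¬IsMode k l → e l = 0)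
    (N : ℕ) {x : Plane} (hx : x ≠ 0) :
    sinSum e N (rotPlane (-(π / k)) x) = -sinSum e N x := by
  simp only [sinSum, norm_rotPlane, ← Finset.sum_neg_distrib]
  refine Finset.sum_congr rfl fun l _ => ?_
  by_cases hl : IsMode k l
  · obtain ⟨h1, h2⟩ := cos_of_isMode hk hl
    rw [sinMode_rotPlane l _ hx, mul_neg, cos_neg, sin_neg, h1, h2]
    ring
  · simp [he l hl]

theorem sinSum_conjPlane (e : ℕ → ℝ → ℝ) (N : ℕ) {x : Plane} (hx : x ≠ 0) :
    sinSum e N (conjPlane x) = -sinSum e N x := by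
  simp only [sinSum, norm_conjPlane, ← Finset.sum_neg_distrib, sinMode_conjPlane _ hx, mul_neg]

/-- Pythagoras: `‖p - q‖² = ‖p‖² + ‖q‖²` for orthogonal `p` and `q`. -/
theorem eLpNorm_le_of_integral_mul_eq_zero {α : Type*} [MeasurableSpace α] {μ : Measure α}
    {p q : α → ℝ} (hp : MemLp p 2 μ) (hq : MemLp q 2 μ) (h : ∫ x, p x * q x ∂μ = 0) :
    eLpNorm p 2 μ ≤ eLpNorm (p - q) 2 μ := by
  have hpq := hp.sub hq
  rw [← ENNReal.pow_le_pow_left_iff two_ne_zero, sq_eLpNorm_two, sq_eLpNorm_two,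
    ← ofReal_integral_eq_lintegral_ofReal hp.integrable_sq (Eventually.of_forall fun x => sq_nonneg _),
    ← ofReal_integral_eq_lintegral_ofReal hpq.integrable_sq
      (Eventually.of_forall fun x => sq_nonneg _)]
  refine ENNReal.ofReal_le_ofReal ?_
  have e : ∫ x, (p - q) x ^ 2 ∂μ = ∫ x, (p x ^ 2 + q x ^ 2 + (-2) * (p x * q x)) ∂μ := by
    congr 1
    funext x
    simp only [Pi.sub_apply]
    ring
  have hpqi : Integrable (fun x => p x * q x) μ := hp.integrable_mul hq
  have hsum : Integrable (fun x => p x ^ 2 + q x ^ 2) μ := hp.integrable_sq.add hq.integrable_sq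
  rw [e, integral_add hsum (hpqi.const_mul _),
    integral_add hp.integrable_sq hq.integrable_sq, integral_const_mul, h]
  have : 0 ≤ ∫ x, q x ^ 2 ∂μ := integral_nonneg fun x => sq_nonneg _
  linarith

/-! ### Angular averages -/

/-- The total mass of the kernel `(1 + cos φ)ⁿ`. -/
def kernelMass (n : ℕ) : ℝ := ∫ φ in Icc (-π) π, (1 + cos φ) ^ n

/-- The average of `f` over rotations against the normalized kernel `(1 + cos φ)ⁿ`. -/
def angAvg (n : ℕ) (f : Plane → ℝ) (x : Plane) : ℝ :=
  (kernelMass n)⁻¹ * ∫ φ in Icc (-π) π, (1 + cos φ) ^ n * f (rotPlane φ x)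

theorem one_add_cos_nonneg (φ : ℝ) : 0 ≤ 1 + cos φ := by linarith [neg_one_le_cos φ]

theorem kernelMass_pos (n : ℕ) : 0 < kernelMass n := by
  have hc : Continuous fun φ : ℝ => (1 + cos φ) ^ n := by fun_prop
  rw [kernelMass, integral_Icc_eq_integral_Ioc,
    ← intervalIntegral.integral_of_le (by linarith [pi_pos])]
  refine intervalIntegral.integral_pos (by linarith [pi_pos]) hc.continuousOn
    (fun φ _ => pow_nonneg (one_add_cos_nonneg φ) n) ⟨0, ⟨by linarith [pi_pos], pi_pos.le⟩, ?_⟩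
  rw [cos_zero]
  positivity

/-- The span of the functions `cos (lφ)` is stable under multiplication by `1 + cos φ`, by the
product formula. Consequently averaging against this kernel produces finitely many angular modes. -/
theorem exists_pow_one_add_cos (n : ℕ) :
    ∃ (N : ℕ) (a : ℕ → ℝ), ∀ φ, (1 + cos φ) ^ n = ∑ l ∈ Finset.range N, a l * cos (l * φ) := by
  let v : ℕ → ℝ → ℝ := fun l φ => cos (l * φ)
  have hmul : ∀ f ∈ Submodule.span ℝ (Set.range v),
      (fun φ => (1 + cos φ) * f φ) ∈ Submodule.span ℝ (Set.range v) := by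
    intro f hf
    induction hf using Submodule.span_induction with
    | mem f hf =>
      obtain ⟨l, rfl⟩ := hf
      rcases l with _ | l
      · have : (fun φ => (1 + cos φ) * v 0 φ) = v 0 + v 1 := by
          funext φ
          simp [v]
        rw [this]
        exact add_mem (Submodule.subset_span ⟨_, rfl⟩) (Submodule.subset_span ⟨_, rfl⟩)
      · have : (fun φ => (1 + cos φ) * v (l + 1) φ) =
            v (l + 1) + (1 / 2 : ℝ) • (v (l + 2) + v l) := by
          funext φ
          have e1 : ((l + 2 : ℕ) : ℝ) * φ = ((l + 1 : ℕ) : ℝ) * φ + φ := by push_cast; ring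
          have e2 : (l : ℝ) * φ = ((l + 1 : ℕ) : ℝ) * φ - φ := by push_cast; ring
          simp only [v, Pi.add_apply, Pi.smul_apply, smul_eq_mul]
          rw [e1, e2, cos_add, cos_sub]
          ring
        rw [this]
        exact add_mem (Submodule.subset_span ⟨_, rfl⟩) (Submodule.smul_mem _ _
          (add_mem (Submodule.subset_span ⟨_, rfl⟩) (Submodule.subset_span ⟨_, rfl⟩)))
    | zero =>
      simp only [Pi.zero_apply, mul_zero]
      exact Submodule.zero_mem _
    | add f g _ _ hf hg =>
      have := add_mem hf hg
      convert this using 1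
      funext φ
      simp [mul_add]
    | smul c f _ hf =>
      have := Submodule.smul_mem _ c hf
      convert this using 1
      funext φ
      simp only [Pi.smul_apply, smul_eq_mul]
      ring
  have hmem : (fun φ : ℝ => (1 + cos φ) ^ n) ∈ Submodule.span ℝ (Set.range v) := by
    induction n with
    | zero =>
      have : (fun φ : ℝ => (1 + cos φ) ^ 0) = v 0 := by
        funext φ
        simp [v]
      rw [this]
      exact Submodule.subset_span ⟨_, rfl⟩
    | succ n ih =>
      have := hmul _ ih
      simpa only [pow_succ'] using this
  obtain ⟨c, hc⟩ := Finsupp.mem_span_range_iff_exists_finsupp.1 hmem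
  refine ⟨c.support.sup id + 1, c, fun φ => ?_⟩
  have h1 := congrFun hc φ
  rw [Finsupp.sum_of_support_subset c (s := Finset.range (c.support.sup id + 1))] at h1
  · rw [← h1]
    simp [v]
  · intro l hl
    rw [Finset.mem_range]
    exact Nat.lt_succ_of_le (Finset.le_sup (f := id) hl)
  · simp

section

variable {f : Plane → ℝ}

theorem continuous_rotPlane_angle (x : Plane) : Continuous fun φ => rotPlane φ x := by
  unfold rotPlane
  refine (PiLp.continuous_toLp 2 _).comp (continuous_pi fun i => ?_)
  fin_cases i <;> simp <;> fun_prop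

theorem continuous_rotPlane_prod : Continuous fun p : Plane × ℝ => rotPlane p.2 p.1 := by
  unfold rotPlane
  refine (PiLp.continuous_toLp 2 _).comp (continuous_pi fun i => ?_)
  fin_cases i <;> simp <;> fun_prop

/-- The kernel has its unique maximum on `[-π, π]` at `0`, so its normalized powers concentrate
there. -/
theorem tendsto_angAvg (hf : Continuous f) (x : Plane) :
    Tendsto (fun n => angAvg n f x) atTop (𝓝 (f x)) := by
  have hpi := pi_pos
  have h := tendsto_setIntegral_pow_smul_of_unique_maximum_of_isCompact_of_continuousOn
    (μ := volume) (s := Icc (-π) π) (x₀ := (0 : ℝ)) isCompact_Icc (c := fun φ => 1 + cos φ)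
    (g := fun φ => f (rotPlane φ x)) (by fun_prop) ?_ (fun φ _ => one_add_cos_nonneg φ)
    (by simp) ?_ (hf.comp (continuous_rotPlane_angle x)).continuousOn
  · simpa only [rotPlane_zero, smul_eq_mul, angAvg, kernelMass] using h
  · intro φ hφ h0
    have : cos φ ≠ 1 := by
      intro h1
      rw [cos_eq_one_iff_of_lt_of_lt (by linarith [hφ.1]) (by linarith [hφ.2])] at h1
      exact h0 h1
    rw [cos_zero]
    linarith [lt_of_le_of_ne (cos_le_one φ) this]
  · rw [interior_Icc, closure_Ioo (by linarith)]
    exact ⟨by linarith, hpi.le⟩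

/-- The kernel is non-negative with total mass one, so a bound on a circle is kept with the same
constant. Partial Fourier sums do not have this property, and the pointwise estimate of solutions
depends on it. -/
theorem abs_angAvg_le {M : ℝ} {x : Plane} (h : ∀ y, ‖y‖ = ‖x‖ → |f y| ≤ M)
    (n : ℕ) : |angAvg n f x| ≤ M := by
  have hm := kernelMass_pos n
  have hcf : Continuous fun φ : ℝ => (1 + cos φ) ^ n * M := by fun_prop
  have h1 : ‖∫ φ in Icc (-π) π, (1 + cos φ) ^ n * f (rotPlane φ x)‖ ≤
      ∫ φ in Icc (-π) π, (1 + cos φ) ^ n * M := by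
    refine norm_integral_le_of_norm_le (hcf.continuousOn.integrableOn_compact isCompact_Icc)
      (Eventually.of_forall fun φ => ?_)
    rw [norm_mul, norm_pow, Real.norm_of_nonneg (one_add_cos_nonneg φ)]
    exact mul_le_mul_of_nonneg_left (h _ (norm_rotPlane φ x)) (pow_nonneg (one_add_cos_nonneg φ) n)
  rw [integral_mul_const] at h1
  rw [angAvg, abs_mul, abs_of_pos (inv_pos.2 hm)]
  calc _ ≤ (kernelMass n)⁻¹ * (kernelMass n * M) := by gcongr; exact h1
    _ = M := by field_simp

theorem continuous_angAvg (hf : Continuous f) (n : ℕ) : Continuous (angAvg n f) := by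
  refine continuous_const.mul ?_
  have := continuous_parametric_integral_of_continuous (μ := volume) (s := Icc (-π) π)
    (f := fun (x : Plane) φ => (1 + cos φ) ^ n * f (rotPlane φ x)) ?_ isCompact_Icc
  · exact this
  · have := hf.comp continuous_rotPlane_prod
    exact (by fun_prop : Continuous fun p : Plane × ℝ => (1 + cos p.2) ^ n).mul this

theorem angAvg_rotPlane {ψ : ℝ} {R : ℝ} (h : ∀ x, R < ‖x‖ → f (rotPlane ψ x) = -f x) (n : ℕ)
    {x : Plane} (hx : R < ‖x‖) : angAvg n f (rotPlane ψ x) = -angAvg n f x := by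
  rw [angAvg, angAvg, ← mul_neg, ← integral_neg]
  congr 2
  funext φ
  rw [rotPlane_rotPlane, add_comm φ, ← rotPlane_rotPlane, h _ (by rwa [norm_rotPlane]), mul_neg]

theorem rotPlane_conjPlane (φ : ℝ) (x : Plane) :
    rotPlane φ (conjPlane x) = conjPlane (rotPlane (-φ) x) := by
  ext i
  fin_cases i <;> simp [rotPlane, conjPlane] <;> ring

theorem angAvg_conjPlane {R : ℝ} (h : ∀ x, R < ‖x‖ → f (conjPlane x) = -f x) (n : ℕ)
    {x : Plane} (hx : R < ‖x‖) : angAvg n f (conjPlane x) = -angAvg n f x := by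
  rw [angAvg, angAvg, ← mul_neg, ← integral_neg]
  congr 1
  rw [integral_Icc_eq_integral_Ioc, integral_Icc_eq_integral_Ioc,
    ← intervalIntegral.integral_of_le (by linarith [pi_pos]),
    ← intervalIntegral.integral_of_le (by linarith [pi_pos])]
  have := intervalIntegral.integral_comp_neg (a := -π) (b := π)
    (f := fun φ => -((1 + cos φ) ^ n * f (rotPlane φ x)))
  rw [neg_neg] at this
  rw [← this]
  refine intervalIntegral.integral_congr fun φ _ => ?_
  rw [rotPlane_conjPlane, h _ (by rwa [norm_rotPlane]), cos_neg, mul_neg]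

/-- Shift the variable of integration, which is allowed by periodicity, and use the addition theorem
for the cosine. -/
theorem integral_cos_mul_rotPlane (hf : Continuous f) (l : ℕ) (r θ : ℝ) :
    ∫ φ in Icc (-π) π, cos (l * φ) * f (rotPlane φ (polarPt r θ)) =
      (∫ ψ in -π..π, sin (l * ψ) * f (polarPt r ψ)) * sin (l * θ) +
        (∫ ψ in -π..π, cos (l * ψ) * f (polarPt r ψ)) * cos (l * θ) := by
  have hpp : Continuous fun ψ => polarPt r ψ := by
    have := continuous_polarPt
    exact this.comp (by fun_prop : Continuous fun ψ : ℝ => ((r, ψ) : ℝ × ℝ))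
  have hfp := hf.comp hpp
  rw [integral_Icc_eq_integral_Ioc, ← intervalIntegral.integral_of_le (by linarith [pi_pos])]
  let g : ℝ → ℝ := fun ψ => cos (l * (ψ - θ)) * f (polarPt r ψ)
  have e1 : ∫ φ in -π..π, cos (l * φ) * f (rotPlane φ (polarPt r θ)) =
      ∫ φ in -π..π, g (φ + θ) := by
    refine intervalIntegral.integral_congr fun φ _ => ?_
    simp only [g, rotPlane_polarPt, add_comm φ θ]
    rw [add_sub_cancel_left]
  have hper : Function.Periodic g (2 * π) := by
    intro ψ
    have h1 : polarPt r (ψ + 2 * π) = polarPt r ψ := by simp [polarPt]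
    have h2 : (l : ℝ) * (ψ + 2 * π - θ) = l * (ψ - θ) + l * (2 * π) := by ring
    simp only [g, h1, h2, cos_add_nat_mul_two_pi]
  rw [e1, intervalIntegral.integral_comp_add_right]
  have e2 := hper.intervalIntegral_add_eq (-π + θ) (-π)
  rw [show -π + θ + 2 * π = π + θ by ring, show -π + 2 * π = π by ring] at e2
  rw [e2, ← intervalIntegral.integral_mul_const, ← intervalIntegral.integral_mul_const,
    ← intervalIntegral.integral_add]
  · refine intervalIntegral.integral_congr fun ψ _ => ?_
    simp only [g, mul_sub, cos_sub]
    ring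
  · exact Continuous.intervalIntegrable
      ((Continuous.mul (by fun_prop) hfp).mul continuous_const) _ _
  · exact Continuous.intervalIntegrable
      ((Continuous.mul (by fun_prop) hfp).mul continuous_const) _ _

/-- The truncation `max r 0` gives a continuous function on the whole line with support in `[a, b]`:
for `r ≤ 0` the function is evaluated at the origin, where it vanishes because `a > 0`. -/
theorem radialTest_angular_integral {R a b : ℝ} (hR : 0 ≤ R) (ha : R < a) (hf : Continuous f)
    (hs : ∀ x, ‖x‖ ∉ Icc a b → f x = 0) {p : ℝ → ℝ} (hp : Continuous p) (c : ℝ) :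
    RadialTest R fun r => c * ∫ ψ in -π..π, p ψ * f (polarPt (max r 0) ψ) := by
  refine ⟨continuous_const.mul ?_, a, b, ha, fun r hr => ?_⟩
  · refine intervalIntegral.continuous_parametric_intervalIntegral_of_continuous' ?_ _ _
    have h1 : Continuous fun q : ℝ × ℝ => polarPt (max q.1 0) q.2 :=
      continuous_polarPt.comp (by fun_prop : Continuous fun q : ℝ × ℝ => (max q.1 0, q.2))
    exact (hp.comp continuous_snd).mul (hf.comp h1)
  · have : ∀ ψ, f (polarPt (max r 0) ψ) = 0 := fun ψ => hs _ fun h => by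
      rw [norm_polarPt (le_max_right _ _)] at h
      rcases le_total r 0 with h0 | h0
      · rw [max_eq_right h0] at h
        linarith [h.1]
      · rw [max_eq_left h0] at h
        exact hr h
    simp [this]

theorem exists_angAvg_eq {R a b : ℝ} (hR : 0 ≤ R) (ha : R < a) (hf : Continuous f)
    (hs : ∀ x, ‖x‖ ∉ Icc a b → f x = 0) (n : ℕ) :
    ∃ (N : ℕ) (A B : ℕ → ℝ → ℝ), (∀ l, RadialTest R (A l)) ∧ (∀ l, RadialTest R (B l)) ∧
      ∀ x ∈ exteriorDomain R, angAvg n f x = sinSum A N x + cosSum B N x := by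
  obtain ⟨N, c, hc⟩ := exists_pow_one_add_cos n
  refine ⟨N, fun l r => ((kernelMass n)⁻¹ * c l) *
      ∫ ψ in -π..π, sin (l * ψ) * f (polarPt (max r 0) ψ), fun l r => ((kernelMass n)⁻¹ * c l) *
      ∫ ψ in -π..π, cos (l * ψ) * f (polarPt (max r 0) ψ),
    fun l => radialTest_angular_integral hR ha hf hs (by fun_prop) _,
    fun l => radialTest_angular_integral hR ha hf hs (by fun_prop) _, fun x hx => ?_⟩
  obtain ⟨θ, hθ⟩ := exists_polarPt x
  have hr : 0 < ‖x‖ := lt_of_le_of_lt hR hx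
  set r := ‖x‖ with hrdef
  rw [hθ, sinSum_polarPt _ _ hr, cosSum_polarPt _ _ hr, ← Finset.sum_add_distrib, angAvg]
  have e : ∫ φ in Icc (-π) π, (1 + cos φ) ^ n * f (rotPlane φ (polarPt r θ)) =
      ∑ l ∈ Finset.range N, c l * ∫ φ in Icc (-π) π, cos (l * φ) * f (rotPlane φ (polarPt r θ)) := by
    simp only [hc, Finset.sum_mul, ← integral_const_mul]
    rw [integral_finsetSum]
    · simp only [mul_assoc]
    · intro l _
      have : Continuous fun φ => c l * cos (l * φ) * f (rotPlane φ (polarPt r θ)) :=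
        Continuous.mul (by fun_prop) (hf.comp (continuous_rotPlane_angle _))
      exact this.continuousOn.integrableOn_compact isCompact_Icc
  rw [e, Finset.mul_sum]
  refine Finset.sum_congr rfl fun l _ => ?_
  rw [integral_cos_mul_rotPlane hf, max_eq_left hr.le]
  ring

theorem tendsto_eLpNorm_of_dominated {α : Type*} [MeasurableSpace α] {μ : Measure α}
    {F : ℕ → α → ℝ} {f b : α → ℝ} (hF : ∀ n, AEStronglyMeasurable (F n) μ)
    (hf : AEStronglyMeasurable f μ) (hb : MemLp b 2 μ) (hle : ∀ n, ∀ᵐ x ∂μ, |F n x - f x| ≤ b x)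
    (hlim : ∀ᵐ x ∂μ, Tendsto (fun n => F n x) atTop (𝓝 (f x))) :
    Tendsto (fun n => eLpNorm (F n - f) 2 μ) atTop (𝓝 0) := by
  have h : Tendsto (fun n => ∫⁻ x, ENNReal.ofReal ((F n - f) x ^ 2) ∂μ) atTop
      (𝓝 (∫⁻ _, 0 ∂μ)) := by
    refine tendsto_lintegral_of_dominated_convergence' (fun x => ENNReal.ofReal (b x ^ 2))
      (fun n => (((hF n).sub hf).aemeasurable.pow_const 2).ennreal_ofReal) (fun n => ?_) ?_ ?_
    · filter_upwards [hle n] with x hx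
      refine ENNReal.ofReal_le_ofReal ?_
      rw [← sq_abs]
      exact pow_le_pow_left₀ (abs_nonneg _) hx 2
    · rw [← sq_eLpNorm_two]
      exact ENNReal.pow_ne_top hb.2.ne
    · filter_upwards [hlim] with x hx
      have h1 : Tendsto (fun n => (F n - f) x ^ 2) atTop (𝓝 0) := by
        have := (hx.sub_const (f x)).pow 2
        simpa using this
      simpa using ENNReal.tendsto_ofReal h1
  simp only [← sq_eLpNorm_two, lintegral_zero] at h
  have h2 := (ENNReal.continuous_rpow_const (y := 1 / 2)).tendsto 0 |>.comp h
  have h3 : (fun t : ℝ≥0∞ => t ^ (1 / 2 : ℝ)) ∘ (fun n => eLpNorm (F n - f) 2 μ ^ 2) =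
      fun n => eLpNorm (F n - f) 2 μ := by
    funext n
    simp only [Function.comp]
    rw [← ENNReal.rpow_natCast, ← ENNReal.rpow_mul]
    norm_num
  rw [h3] at h2
  simpa using h2

theorem tendsto_eLpNorm_angAvg {a b : ℝ} (hf : Continuous f)
    (hs : ∀ x, ‖x‖ ∉ Icc a b → f x = 0) (μ : Measure Plane) [IsFiniteMeasureOnCompacts μ] :
    Tendsto (fun n => eLpNorm (angAvg n f - f) 2 μ) atTop (𝓝 0) := by
  have hc : HasCompactSupport f := by
    refine HasCompactSupport.intro (isCompact_closedBall (0 : Plane) b) fun x hx => ?_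
    have : b < ‖x‖ := by simpa using hx
    exact hs _ fun h => absurd h.2 (not_le.2 this)
  obtain ⟨M, hM⟩ := hf.bounded_above_of_compact_support hc
  refine tendsto_eLpNorm_of_dominated (b := (Metric.closedBall 0 b).indicator fun _ => M + M)
    (fun n => (continuous_angAvg hf n).aestronglyMeasurable) hf.aestronglyMeasurable
    (memLp_indicator_const 2 Metric.isClosed_closedBall.measurableSet _
      (Or.inr (isCompact_closedBall _ _).measure_lt_top.ne)) (fun n => Eventually.of_forall fun x => ?_)
    (Eventually.of_forall fun x => tendsto_angAvg hf x)
  by_cases hx : x ∈ Metric.closedBall (0 : Plane) b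
  · rw [indicator_of_mem hx]
    exact (abs_sub _ _).trans (add_le_add (abs_angAvg_le (fun y _ => hM y) n) (hM x))
  · rw [indicator_of_notMem hx]
    have hxb : b < ‖x‖ := by simpa using hx
    have h0 : ∀ y : Plane, ‖y‖ = ‖x‖ → f y = 0 := fun y hy => hs _ fun h => by
      rw [hy] at h
      linarith [h.2]
    have h1 := abs_angAvg_le (f := f) (M := 0) (x := x) (fun y hy => by rw [h0 y hy, abs_zero]) n
    rw [h0 x rfl, sub_zero]
    exact h1

end

/-! ### Approximation by finite sums of modes -/

/-- A cutoff function with compact support in `(R, ∞)`. -/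
def radialCutoff (R : ℝ) (n : ℕ) (r : ℝ) : ℝ :=
  smoothTransition (((n : ℝ) + 1) * (r - R) - 1) * smoothTransition ((n : ℝ) + 2 - r)

theorem contDiff_radialCutoff (R : ℝ) (n : ℕ) : ContDiff ℝ ∞ (radialCutoff R n) :=
  ((Real.smoothTransition.contDiff (n := ⊤)).comp (by fun_prop)).mul
    ((Real.smoothTransition.contDiff (n := ⊤)).comp (by fun_prop))

theorem radialCutoff_nonneg (R : ℝ) (n : ℕ) (r : ℝ) : 0 ≤ radialCutoff R n r :=
  mul_nonneg (smoothTransition.nonneg _) (smoothTransition.nonneg _)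

theorem radialCutoff_le_one (R : ℝ) (n : ℕ) (r : ℝ) : radialCutoff R n r ≤ 1 :=
  mul_le_one₀ (smoothTransition.le_one _) (smoothTransition.nonneg _) (smoothTransition.le_one _)

theorem radialCutoff_eq_zero (R : ℝ) (n : ℕ) {r : ℝ}
    (h : r ∉ Icc (R + 1 / ((n : ℝ) + 1)) ((n : ℝ) + 2)) : radialCutoff R n r = 0 := by
  have hn : (0 : ℝ) < (n : ℝ) + 1 := by positivity
  rw [mem_Icc, not_and_or, not_le, not_le] at h
  rcases h with h | h
  · have h1 : (r - R) < 1 / ((n : ℝ) + 1) := by linarith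
    rw [lt_div_iff₀ hn] at h1
    rw [radialCutoff, smoothTransition.zero_of_nonpos (by linarith), zero_mul]
  · rw [radialCutoff, smoothTransition.zero_of_nonpos (x := (n : ℝ) + 2 - r) (by linarith), mul_zero]

theorem radialTest_radialCutoff (R : ℝ) (n : ℕ) : RadialTest R (radialCutoff R n) :=
  ⟨(contDiff_radialCutoff R n).continuous, _, _,
    by have : (0 : ℝ) < 1 / ((n : ℝ) + 1) := by positivity
       linarith, fun _ h => radialCutoff_eq_zero R n h⟩

theorem radialCutoff_eq_one {R : ℝ} {n : ℕ} {r : ℝ} (h1 : 2 ≤ ((n : ℝ) + 1) * (r - R))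
    (h2 : r ≤ n + 1) : radialCutoff R n r = 1 := by
  rw [radialCutoff, smoothTransition.one_of_one_le (by linarith),
    smoothTransition.one_of_one_le (by linarith), one_mul]

theorem eventually_radialCutoff_conditions {R r : ℝ} (h : R < r) :
    ∀ᶠ n : ℕ in atTop, 2 < ((n : ℝ) + 1) * (r - R) ∧ r < n + 1 := by
  have t1 : Tendsto (fun n : ℕ => (n : ℝ) + 1) atTop atTop :=
    tendsto_atTop_add_const_right _ _ tendsto_natCast_atTop_atTop
  exact ((t1.atTop_mul_const (sub_pos.2 h)).eventually_gt_atTop 2).and (t1.eventually_gt_atTop r)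

theorem tendsto_radialCutoff {R r : ℝ} (h : R < r) :
    Tendsto (fun n => radialCutoff R n r) atTop (𝓝 1) := by
  refine tendsto_const_nhds.congr' ?_
  filter_upwards [eventually_radialCutoff_conditions h] with n hn
  exact (radialCutoff_eq_one hn.1.le hn.2.le).symm

theorem tendsto_eLpNorm_radialCutoff_mul {R : ℝ} {f : Plane → ℝ}
    (hf : MemLp f 2 (volume.restrict (exteriorDomain R))) :
    Tendsto (fun n => eLpNorm ((fun x => radialCutoff R n ‖x‖ * f x) - f) 2
      (volume.restrict (exteriorDomain R))) atTop (𝓝 0) := by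
  refine tendsto_eLpNorm_of_dominated (b := fun x => |f x|) (fun n => ?_) hf.1 hf.norm
    (fun n => Eventually.of_forall fun x => ?_) ?_
  · exact (((contDiff_radialCutoff R n).continuous.comp continuous_norm).aestronglyMeasurable).mul
      hf.1
  · have h0 := radialCutoff_nonneg R n ‖x‖
    have h1 := radialCutoff_le_one R n ‖x‖
    have e : radialCutoff R n ‖x‖ * f x - f x = (radialCutoff R n ‖x‖ - 1) * f x := by ring
    rw [e, abs_mul]
    exact mul_le_of_le_one_left (abs_nonneg _) (by rw [abs_le]; constructor <;> linarith)
  · filter_upwards [ae_restrict_mem (measurableSet_exteriorDomain R)] with x hx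
    simpa using (tendsto_radialCutoff hx).mul_const (f x)

section

variable {k : ℕ} {R : ℝ} {w : Plane → ℝ}

theorem ae_eq_on_exteriorDomain {f g : Plane → ℝ} (hf : ContinuousOn f (exteriorDomain R))
    (hg : ContinuousOn g (exteriorDomain R))
    (h : f =ᵐ[volume.restrict (exteriorDomain R)] g) : EqOn f g (exteriorDomain R) :=
  Measure.eqOn_open_of_ae_eq h (isOpen_exteriorDomain R) hf hg

theorem memLp_of_continuous_of_annulus {f : Plane → ℝ} {a b : ℝ} (hf : Continuous f)
    (hs : ∀ x, ‖x‖ ∉ Icc a b → f x = 0) (μ : Measure Plane) [IsFiniteMeasureOnCompacts μ] :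
    MemLp f 2 μ := by
  refine memLp_of_hasCompactSupport hf ?_ μ
  refine HasCompactSupport.intro (isCompact_closedBall (0 : Plane) b) fun x hx => ?_
  have : b < ‖x‖ := by simpa using hx
  exact hs _ fun h => absurd h.2 (not_le.2 this)

/-- The sum `sinSum e N` is the projection of the average onto the admissible modes. What is
discarded is orthogonal to every equivariant function, so the projection does not move away from any
equivariant `w`, even if `f` itself has no symmetry. -/
theorem exists_modes_near_angAvg (hR : 0 ≤ R) (hk : 0 < k) {f : Plane → ℝ} {a b : ℝ} (ha : R < a)
    (hf : Continuous f) (hs : ∀ x, ‖x‖ ∉ Icc a b → f x = 0) (n : ℕ) :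
    ∃ (N : ℕ) (e : ℕ → ℝ → ℝ), (∀ l, RadialTest R (e l)) ∧
      (∀ l, (l < N ∧ IsMode k l) ∨ e l = 0) ∧
      (∀ w : Plane → ℝ, MemLp w 2 (volume.restrict (exteriorDomain R)) →
        (∀ᵐ x ∂(volume.restrict (exteriorDomain R)), w (rotPlane (-(π / k)) x) = -w x) →
        (∀ᵐ x ∂(volume.restrict (exteriorDomain R)), w (conjPlane x) = -w x) →
        eLpNorm (w - sinSum e N) 2 (volume.restrict (exteriorDomain R)) ≤
          eLpNorm (w - angAvg n f) 2 (volume.restrict (exteriorDomain R))) ∧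
      ((∀ x, R < ‖x‖ → f (rotPlane (-(π / k)) x) = -f x) →
        (∀ x, R < ‖x‖ → f (conjPlane x) = -f x) →
        ∀ x, R < ‖x‖ → sinSum e N x = angAvg n f x) := by
  obtain ⟨N, A, B, hA, hB, hAB⟩ := exists_angAvg_eq hR ha hf hs n
  classical
  let e : ℕ → ℝ → ℝ := fun l => if l < N ∧ IsMode k l then A l else 0
  let A' : ℕ → ℝ → ℝ := fun l => A l - e l
  have he : ∀ l, RadialTest R (e l) := fun l => by
    by_cases h : l < N ∧ IsMode k l
    · simpa only [e, if_pos h] using hA l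
    · simpa only [e, if_neg h] using RadialTest.zero R
  have he0 : ∀ l, (l < N ∧ IsMode k l) ∨ e l = 0 := fun l => by
    by_cases h : l < N ∧ IsMode k l
    · exact Or.inl h
    · right
      simp only [e, if_neg h]
  have hem : ∀ l, ¬IsMode k l → e l = 0 := fun l h => by
    rcases he0 l with h1 | h1
    · exact absurd h1.2 h
    · exact h1
  -- The inadmissible sine modes; with the cosine modes they make up the discarded part of the
  -- average.
  let A'' : ℕ → ℝ → ℝ := fun l => if IsMode k l then 0 else A l
  have hA'' : ∀ l, RadialTest R (A'' l) := fun l => by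
    by_cases h : IsMode k l
    · simpa only [A'', if_pos h] using RadialTest.zero R
    · simpa only [A'', if_neg h] using hA l
  have hsplit : ∀ x, sinSum A N x = sinSum e N x + sinSum A'' N x := fun x => by
    simp only [sinSum, ← Finset.sum_add_distrib]
    refine Finset.sum_congr rfl fun l hl => ?_
    have hl := Finset.mem_range.1 hl
    by_cases h : IsMode k l
    · simp [e, A'', hl, h]
    · simp [e, A'', h]
  have hq : ∀ x ∈ exteriorDomain R, angAvg n f x - sinSum e N x =
      sinSum A'' N x + cosSum B N x := fun x hx => by
    rw [hAB x hx, hsplit]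
    ring
  have hmem : MemLp (sinSum e N) 2 (volume.restrict (exteriorDomain R)) := memLp_sinSum hR he N _
  have hmq : MemLp (fun x => sinSum A'' N x + cosSum B N x) 2
      (volume.restrict (exteriorDomain R)) := (memLp_sinSum hR hA'' N _).add (memLp_cosSum hR hB N _)
  have hmav : MemLp (angAvg n f) 2 (volume.restrict (exteriorDomain R)) := by
    refine (memLp_congr_ae ?_).1 (hmem.add hmq)
    filter_upwards [ae_restrict_mem (measurableSet_exteriorDomain R)] with x hx
    simp only [Pi.add_apply]
    rw [← hq x hx]
    ring
  have hsr : ∀ x ∈ exteriorDomain R, sinSum e N (rotPlane (-(π / k)) x) = -sinSum e N x :=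
    fun x hx => sinSum_rotPlane hk hem N (ne_zero_of_mem_exteriorDomain hR hx)
  have hsc : ∀ x ∈ exteriorDomain R, sinSum e N (conjPlane x) = -sinSum e N x :=
    fun x hx => sinSum_conjPlane e N (ne_zero_of_mem_exteriorDomain hR hx)
  have key : ∀ w : Plane → ℝ, MemLp w 2 (volume.restrict (exteriorDomain R)) →
        (∀ᵐ x ∂(volume.restrict (exteriorDomain R)), w (rotPlane (-(π / k)) x) = -w x) →
        (∀ᵐ x ∂(volume.restrict (exteriorDomain R)), w (conjPlane x) = -w x) →
        eLpNorm (w - sinSum e N) 2 (volume.restrict (exteriorDomain R)) ≤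
          eLpNorm (w - angAvg n f) 2 (volume.restrict (exteriorDomain R)) := by
    intro w hw hr hc
    have h0 := integral_mul_sinSum_add_cosSum_eq_zero (w := w - sinSum e N) (A := A'') hR hk
      (hw.sub hmem) ?_ ?_ hA'' hB (fun l hl => by simp [A'', hl]) N
    · refine (eLpNorm_le_of_integral_mul_eq_zero (hw.sub hmem) hmq h0).trans_eq ?_
      refine eLpNorm_congr_ae ?_
      filter_upwards [ae_restrict_mem (measurableSet_exteriorDomain R)] with x hx
      simp only [Pi.sub_apply]
      rw [← hq x hx]
      ring
    · filter_upwards [hr, ae_restrict_mem (measurableSet_exteriorDomain R)] with x h1 hx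
      simp only [Pi.sub_apply]
      rw [h1, hsr x hx]
      ring
    · filter_upwards [hc, ae_restrict_mem (measurableSet_exteriorDomain R)] with x h1 hx
      simp only [Pi.sub_apply]
      rw [h1, hsc x hx]
      ring
  refine ⟨N, e, he, he0, key, fun hfr hfc => ?_⟩
  -- When `f` is equivariant so is its average, and it may serve as `w`. The right-hand side is then
  -- zero, so nothing was discarded and the pointwise bounds of the average carry over to the finite
  -- sum.
  have h1 := key (angAvg n f) hmav
    (by filter_upwards [ae_restrict_mem (measurableSet_exteriorDomain R)] with x hx
        exact angAvg_rotPlane hfr n hx)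
    (by filter_upwards [ae_restrict_mem (measurableSet_exteriorDomain R)] with x hx
        exact angAvg_conjPlane hfc n hx)
  rw [sub_self, eLpNorm_zero, nonpos_iff_eq_zero,
    eLpNorm_eq_zero_iff (hmav.sub hmem).1 two_ne_zero] at h1
  have h2 : sinSum e N =ᵐ[volume.restrict (exteriorDomain R)] angAvg n f := by
    filter_upwards [h1] with x hx
    simp only [Pi.sub_apply, Pi.zero_apply] at hx
    linarith
  exact fun x hx => ae_eq_on_exteriorDomain
    (continuousOn_sinSum hR (fun l => (he l).1.continuousOn) N)
    (continuous_angAvg hf n).continuousOn h2 hx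

/-- Three approximations, each costing `ε/3`: by a continuous function, by a radial cutoff of it,
and by an angular average. The projection onto admissible modes costs nothing. -/
theorem exists_modes_near (hR : 0 ≤ R) (hk : 0 < k)
    (hw : MemLp w 2 (volume.restrict (exteriorDomain R)))
    (hr : ∀ᵐ x ∂(volume.restrict (exteriorDomain R)), w (rotPlane (-(π / k)) x) = -w x)
    (hc : ∀ᵐ x ∂(volume.restrict (exteriorDomain R)), w (conjPlane x) = -w x)
    {ε : ℝ≥0∞} (hε : ε ≠ 0) :
    ∃ (N : ℕ) (e : ℕ → ℝ → ℝ), (∀ l, RadialTest R (e l)) ∧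
      (∀ l, (l < N ∧ IsMode k l) ∨ e l = 0) ∧
      eLpNorm (sinSum e N - w) 2 (volume.restrict (exteriorDomain R)) ≤ ε ∧
      (ContinuousOn w (exteriorDomain R) → ∀ b : ℝ → ℝ,
        (∀ x ∈ exteriorDomain R, |w x| ≤ b ‖x‖) →
        ∀ x ∈ exteriorDomain R, |sinSum e N x| ≤ b ‖x‖) := by
  have step : ∀ g : Plane → ℝ, ContinuousOn g (exteriorDomain R) →
      MemLp g 2 (volume.restrict (exteriorDomain R)) →
      eLpNorm (w - g) 2 (volume.restrict (exteriorDomain R)) ≤ ε / 3 →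
      ∃ (N : ℕ) (e : ℕ → ℝ → ℝ), (∀ l, RadialTest R (e l)) ∧
      (∀ l, (l < N ∧ IsMode k l) ∨ e l = 0) ∧
      eLpNorm (sinSum e N - w) 2 (volume.restrict (exteriorDomain R)) ≤ ε ∧
      ((∀ x, R < ‖x‖ → g (rotPlane (-(π / k)) x) = -g x) →
        (∀ x, R < ‖x‖ → g (conjPlane x) = -g x) → ∀ b : ℝ → ℝ,
        (∀ x ∈ exteriorDomain R, |g x| ≤ b ‖x‖) →
        ∀ x ∈ exteriorDomain R, |sinSum e N x| ≤ b ‖x‖) := by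
    intro g cg hg hwg
    have hε3 : 0 < ε / 3 := ENNReal.div_pos hε (by norm_num)
    obtain ⟨m, hm⟩ := ((ENNReal.tendsto_nhds_zero.1 (tendsto_eLpNorm_radialCutoff_mul hg)
      (ε / 3) hε3)).exists
    set f : Plane → ℝ := fun x => radialCutoff R m ‖x‖ * g x with hfdef
    have cf : Continuous f := continuous_radial_mul (radialTest_radialCutoff R m) cg
    have hs : ∀ x, ‖x‖ ∉ Icc (R + 1 / ((m : ℝ) + 1)) ((m : ℝ) + 2) → f x = 0 := fun x hx => by
      rw [hfdef]
      simp only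
      rw [radialCutoff_eq_zero R m hx, zero_mul]
    have hmf := memLp_of_continuous_of_annulus cf hs (volume.restrict (exteriorDomain R))
    obtain ⟨n, hn⟩ := ((ENNReal.tendsto_nhds_zero.1 (tendsto_eLpNorm_angAvg cf hs
      (volume.restrict (exteriorDomain R))) (ε / 3) hε3)).exists
    have ha : R < R + 1 / ((m : ℝ) + 1) := by
      have : (0 : ℝ) < 1 / ((m : ℝ) + 1) := by positivity
      linarith
    obtain ⟨N, e, he, he0, h1, h2⟩ := exists_modes_near_angAvg hR hk ha cf hs n
    refine ⟨N, e, he, he0, ?_, fun gr gc b hb x hx => ?_⟩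
    · rw [eLpNorm_sub_comm]
      refine (h1 w hw hr hc).trans ?_
      have e1 : w - angAvg n f = (w - g) + ((g - f) + (f - angAvg n f)) := by abel
      have m1 : AEStronglyMeasurable (angAvg n f) (volume.restrict (exteriorDomain R)) :=
        (continuous_angAvg cf n).aestronglyMeasurable
      rw [e1]
      calc _ ≤ eLpNorm (w - g) 2 (volume.restrict (exteriorDomain R)) +
            (eLpNorm (g - f) 2 (volume.restrict (exteriorDomain R)) +
              eLpNorm (f - angAvg n f) 2 (volume.restrict (exteriorDomain R))) := by
            refine (eLpNorm_add_le (hw.1.sub hg.1) ((hg.1.sub hmf.1).add (hmf.1.sub m1))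
              (by norm_num)).trans ?_
            gcongr
            exact eLpNorm_add_le (hg.1.sub hmf.1) (hmf.1.sub m1) (by norm_num)
        _ ≤ ε / 3 + (ε / 3 + ε / 3) := by
            gcongr
            · rw [eLpNorm_sub_comm]
              exact hm
            · rw [eLpNorm_sub_comm]
              exact hn
        _ = ε := by rw [← add_assoc, ENNReal.add_thirds]
    · rw [h2 (fun y hy => ?_) (fun y hy => ?_) x hx]
      · refine abs_angAvg_le (fun y hy => ?_) n
        have hy' : y ∈ exteriorDomain R := by
          change R < ‖y‖
          rwa [hy]
        rw [← hy, hfdef, abs_mul, abs_of_nonneg (radialCutoff_nonneg _ _ _)]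
        exact (mul_le_of_le_one_left (abs_nonneg _) (radialCutoff_le_one _ _ _)).trans (hb y hy')
      · simp only [hfdef, norm_rotPlane, gr y hy, mul_neg]
      · simp only [hfdef, norm_conjPlane, gc y hy, mul_neg]
  -- A continuous `w` is its own approximation, so symmetry and pointwise bounds are retained.
  -- Otherwise an arbitrary compactly supported continuous approximation suffices, and it need not
  -- be equivariant.
  by_cases cw : ContinuousOn w (exteriorDomain R)
  · obtain ⟨N, e, he, he0, h1, h2⟩ := step w cw hw (by simp)
    refine ⟨N, e, he, he0, h1, fun _ => h2 ?_ ?_⟩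
    · refine ae_eq_on_exteriorDomain (cw.comp (continuous_rotPlane _).continuousOn fun x hx => ?_)
        cw.neg hr
      simpa [exteriorDomain, norm_rotPlane] using hx
    · refine ae_eq_on_exteriorDomain (cw.comp continuous_conjPlane.continuousOn fun x hx => ?_)
        cw.neg hc
      simpa [exteriorDomain, norm_conjPlane] using hx
  · obtain ⟨g, -, hg1, hg2, hg3⟩ := hw.exists_hasCompactSupport_eLpNorm_sub_le (by norm_num)
      (ENNReal.div_pos hε (by norm_num : (3 : ℝ≥0∞) ≠ ⊤)).ne'
    obtain ⟨N, e, he, he0, h1, -⟩ := step g hg2.continuousOn hg3 hg1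
    exact ⟨N, e, he, he0, h1, fun h => absurd h cw⟩

theorem exists_modes_tendsto (hR : 0 ≤ R) (hk : 0 < k)
    (hw : MemLp w 2 (volume.restrict (exteriorDomain R)))
    (hr : ∀ᵐ x ∂(volume.restrict (exteriorDomain R)), w (rotPlane (-(π / k)) x) = -w x)
    (hc : ∀ᵐ x ∂(volume.restrict (exteriorDomain R)), w (conjPlane x) = -w x) :
    ∃ (N : ℕ → ℕ) (e : ℕ → ℕ → ℝ → ℝ), (∀ n l, RadialTest R (e n l)) ∧
      (∀ n l, (l < N n ∧ IsMode k l) ∨ e n l = 0) ∧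
      Tendsto (fun n => eLpNorm (sinSum (e n) (N n) - w) 2 (volume.restrict (exteriorDomain R)))
        atTop (𝓝 0) ∧
      (ContinuousOn w (exteriorDomain R) → ∀ b : ℝ → ℝ,
        (∀ x ∈ exteriorDomain R, |w x| ≤ b ‖x‖) →
        ∀ n, ∀ x ∈ exteriorDomain R, |sinSum (e n) (N n) x| ≤ b ‖x‖) := by
  choose N e h1 h2 h3 h4 using fun n : ℕ => exists_modes_near hR hk hw hr hc
    (ε := ((n : ℝ≥0∞) + 1)⁻¹) (by simp)
  refine ⟨N, e, h1, h2, ?_, fun cw b hb n => h4 n cw b hb⟩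
  refine tendsto_of_tendsto_of_tendsto_of_le_of_le tendsto_const_nhds ?_ (fun _ => zero_le) h3
  have := ENNReal.tendsto_inv_nat_nhds_zero.comp (tendsto_add_atTop_nat 1)
  simpa [Function.comp_def] using this

/-- The function is orthogonal to its own approximations, so its norm is at most its distance from
them, which tends to zero. -/
theorem ae_eq_zero_of_forall_integral_mode (hR : 0 ≤ R) (hk : 0 < k)
    (hw : MemLp w 2 (volume.restrict (exteriorDomain R)))
    (hr : ∀ᵐ x ∂(volume.restrict (exteriorDomain R)), w (rotPlane (-(π / k)) x) = -w x)
    (hc : ∀ᵐ x ∂(volume.restrict (exteriorDomain R)), w (conjPlane x) = -w x)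
    (h : ∀ l, IsMode k l → ∀ e, RadialTest R e →
      ∫ x in exteriorDomain R, w x * (e ‖x‖ * sinMode l x) = 0) :
    w =ᵐ[volume.restrict (exteriorDomain R)] 0 := by
  obtain ⟨N, e, he, he0, ht, -⟩ := exists_modes_tendsto hR hk hw hr hc
  have hle : ∀ n, eLpNorm w 2 (volume.restrict (exteriorDomain R)) ≤
      eLpNorm (sinSum (e n) (N n) - w) 2 (volume.restrict (exteriorDomain R)) := fun n => by
    rw [eLpNorm_sub_comm]
    refine eLpNorm_le_of_integral_mul_eq_zero hw (memLp_sinSum hR (he n) _ _) ?_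
    simp only [sinSum, Finset.mul_sum]
    rw [integral_finsetSum]
    · refine Finset.sum_eq_zero fun l _ => ?_
      rcases he0 n l with hl | hl
      · exact h l hl.2 _ (he n l)
      · simp [hl]
    · exact fun l _ => hw.integrable_mul
        (memLp_radial_mul (he n l) (continuousOn_sinMode hR l) _)
  have h0 : eLpNorm w 2 (volume.restrict (exteriorDomain R)) = 0 :=
    le_antisymm (ge_of_tendsto' ht hle) zero_le
  exact (eLpNorm_eq_zero_iff hw.1 two_ne_zero).1 h0

end

/-! ### The maximum principle in a sector -/

/-- A positive second derivative would make the point a local minimum too. The function would then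
be locally constant, with vanishing second derivative. -/
theorem second_deriv_nonpos_of_isLocalMax {f f' : ℝ → ℝ} {f'' a : ℝ}
    (hf : ∀ᶠ x in 𝓝 a, HasDerivAt f (f' x) x) (hf' : HasDerivAt f' f'' a)
    (h : IsLocalMax f a) : f'' ≤ 0 := by
  by_contra hpos
  have hd : deriv f =ᶠ[𝓝 a] f' := hf.mono fun x hx => hx.deriv
  have hdd : deriv (deriv f) a = f'' := by rw [hd.deriv_eq, hf'.deriv]
  have hmin := isLocalMin_of_deriv_deriv_pos (by rw [hdd]; exact not_le.1 hpos)
    h.deriv_eq_zero hf.self_of_nhds.continuousAt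
  have hconst : f =ᶠ[𝓝 a] fun _ => f a := by
    filter_upwards [h, hmin] with x h1 h2 using le_antisymm h1 h2
  have h0 : deriv f =ᶠ[𝓝 a] fun _ => 0 := by
    filter_upwards [hconst.eventuallyEq_nhds] with x hx
    rw [hx.deriv_eq, deriv_const]
  rw [h0.deriv_eq, deriv_const] at hdd
  exact hpos hdd.symm.le

/-- The barrier function for the equation in the sector. -/
def barrier (A ε r θ : ℝ) : ℝ :=
  A * (r * exp (-(r ^ 2 / 8))) * (2 * cos (θ - π / 6) - 1) + ε * r ^ 2 * cos (2 * (θ - π / 6))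

/-- In a sector of opening at most `π/3` the angle to the ray `θ = π/6` is at most `π/6`, where the
cosine is at least `√3/2`. This is what makes the barrier positive, and it is where `k ≥ 3` is
needed in the comparison. -/
theorem half_le_two_cos {θ : ℝ} (h0 : 0 ≤ θ) (h1 : θ ≤ π / 3) :
    1 / 2 ≤ 2 * cos (θ - π / 6) - 1 ∧ 1 / 2 ≤ cos (2 * (θ - π / 6)) := by
  have hpi := pi_pos
  have h3 : √3 / 2 ≤ cos (θ - π / 6) := by
    rw [← cos_pi_div_six, ← cos_abs (θ - π / 6)]
    refine cos_le_cos_of_nonneg_of_le_pi (abs_nonneg _) (by linarith) ?_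
    rw [abs_le]
    constructor <;> linarith
  have h4 : 1.5 ≤ √3 := by
    rw [show (1.5 : ℝ) = √(1.5 ^ 2) by rw [sqrt_sq (by norm_num)]]
    exact sqrt_le_sqrt (by norm_num)
  refine ⟨by linarith, ?_⟩
  rw [cos_two_mul]
  have : √3 * √3 = 3 := mul_self_sqrt (by norm_num)
  have h5 : 3 / 4 ≤ cos (θ - π / 6) ^ 2 := by nlinarith [sqrt_nonneg 3]
  linarith

section

variable {A ε r θ : ℝ}

theorem barrier_ge (hA : 0 ≤ A) (hε : 0 ≤ ε) (hr : 0 ≤ r) (h0 : 0 ≤ θ) (h1 : θ ≤ π / 3) :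
    A * (r * exp (-(r ^ 2 / 8))) / 2 + ε * r ^ 2 / 2 ≤ barrier A ε r θ := by
  obtain ⟨h2, h3⟩ := half_le_two_cos h0 h1
  have e1 : 0 ≤ A * (r * exp (-(r ^ 2 / 8))) := by positivity
  have e2 : 0 ≤ ε * r ^ 2 := by positivity
  rw [barrier]
  nlinarith

theorem hasDerivAt_barrier_radial (A ε r θ : ℝ) :
    HasDerivAt (fun r => barrier A ε r θ)
      (A * ((1 - r ^ 2 / 4) * exp (-(r ^ 2 / 8))) * (2 * cos (θ - π / 6) - 1) +
        ε * (2 * r) * cos (2 * (θ - π / 6))) r := by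
  have h1 := (hasDerivAt_id r).mul (hasDerivAt_exp_neg_sq r)
  have h2 := ((h1.const_mul A).mul_const (2 * cos (θ - π / 6) - 1)).add
    (((hasDerivAt_pow 2 r).const_mul ε).mul_const (cos (2 * (θ - π / 6))))
  refine h2.congr_deriv ?_
  simp only [id]
  push_cast
  ring

theorem hasDerivAt_barrier_radial₂ (A ε r θ : ℝ) :
    HasDerivAt (fun r => A * ((1 - r ^ 2 / 4) * exp (-(r ^ 2 / 8))) * (2 * cos (θ - π / 6) - 1) +
        ε * (2 * r) * cos (2 * (θ - π / 6)))
      (A * ((-(3 * r / 4) + r ^ 3 / 16) * exp (-(r ^ 2 / 8))) * (2 * cos (θ - π / 6) - 1) +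
        ε * 2 * cos (2 * (θ - π / 6))) r := by
  have h1 := (((hasDerivAt_pow 2 r).div_const 4).const_sub 1).mul (hasDerivAt_exp_neg_sq r)
  have h2 := ((h1.const_mul A).mul_const (2 * cos (θ - π / 6) - 1)).add
    ((((hasDerivAt_id r).const_mul 2).const_mul ε).mul_const (cos (2 * (θ - π / 6))))
  refine h2.congr_deriv ?_
  push_cast
  ring

theorem hasDerivAt_barrier_angular (A ε r θ : ℝ) :
    HasDerivAt (fun θ => barrier A ε r θ)
      (A * (r * exp (-(r ^ 2 / 8))) * (-2 * sin (θ - π / 6)) -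
        ε * r ^ 2 * (2 * sin (2 * (θ - π / 6)))) θ := by
  have h0 : HasDerivAt (fun θ : ℝ => θ - π / 6) 1 θ := (hasDerivAt_id θ).sub_const _
  have h1 := ((h0.cos.const_mul 2).sub_const 1).const_mul (A * (r * exp (-(r ^ 2 / 8))))
  have h2 := (h0.const_mul 2).cos.const_mul (ε * r ^ 2)
  refine (h1.add h2).congr_deriv ?_
  ring

theorem hasDerivAt_barrier_angular₂ (A ε r θ : ℝ) :
    HasDerivAt (fun θ => A * (r * exp (-(r ^ 2 / 8))) * (-2 * sin (θ - π / 6)) -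
        ε * r ^ 2 * (2 * sin (2 * (θ - π / 6))))
      (A * (r * exp (-(r ^ 2 / 8))) * (-2 * cos (θ - π / 6)) -
        ε * r ^ 2 * (4 * cos (2 * (θ - π / 6)))) θ := by
  have h0 : HasDerivAt (fun θ : ℝ => θ - π / 6) 1 θ := (hasDerivAt_id θ).sub_const _
  have h1 := (h0.sin.const_mul (-2)).const_mul (A * (r * exp (-(r ^ 2 / 8))))
  have h2 := ((h0.const_mul 2).sin.const_mul 2).const_mul (ε * r ^ 2)
  refine (h1.sub h2).congr_deriv ?_
  ring

/-- For `r ≤ 4` one has `r³ ≤ 64` and `e^{-r²/8} ≥ e^{-2}`. The range `r ≤ 4` is the one in which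
the zero-order coefficient `1 - r²/16` is non-negative. -/
theorem cube_mul_exp_le {r : ℝ} (hr : 0 < r) (h4 : r ≤ 4) :
    r ^ 2 ≤ 64 * exp 2 * (exp (-(r ^ 2 / 8)) / r) := by
  have h1 : exp (-2) ≤ exp (-(r ^ 2 / 8)) := exp_le_exp.2 (by nlinarith)
  have h2 : exp 2 * exp (-2) = 1 := by rw [← exp_add]; simp
  have h3 : r ^ 3 ≤ 64 := by
    calc r ^ 3 ≤ 4 ^ 3 := pow_le_pow_left₀ hr.le h4 3
      _ = 64 := by norm_num
  have h5 : 1 ≤ exp 2 * exp (-(r ^ 2 / 8)) := by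
    rw [← h2]
    exact mul_le_mul_of_nonneg_left h1 (exp_pos _).le
  rw [← mul_div_assoc, le_div_iff₀ hr]
  nlinarith

/-- The barrier is a strict supersolution. -/
theorem barrier_operator_lt {M : ℝ} (hA : A = M + ε * (64 * exp 2)) (hε : 0 < ε) (hr : 0 < r) (h0 : 0 ≤ θ)
    (h1 : θ ≤ π / 3) :
    (A * ((-(3 * r / 4) + r ^ 3 / 16) * exp (-(r ^ 2 / 8))) * (2 * cos (θ - π / 6) - 1) +
        ε * 2 * cos (2 * (θ - π / 6))) +
      (A * ((1 - r ^ 2 / 4) * exp (-(r ^ 2 / 8))) * (2 * cos (θ - π / 6) - 1) +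
        ε * (2 * r) * cos (2 * (θ - π / 6))) / r +
      (A * (r * exp (-(r ^ 2 / 8))) * (-2 * cos (θ - π / 6)) -
        ε * r ^ 2 * (4 * cos (2 * (θ - π / 6)))) / r ^ 2 +
      (1 - r ^ 2 / 16) * barrier A ε r θ < -(M * (exp (-(r ^ 2 / 8)) / r)) := by
  obtain ⟨-, h3⟩ := half_le_two_cos h0 h1
  have hc1 := cos_le_one (2 * (θ - π / 6))
  -- Undoing the Gaussian conjugation, the main term is `A r (2 cos (θ - π/6) - 1)`. `L_P`
  -- annihilates linear functions and sends `r` to `1/r`, so the result is exactly `-A/r`. The `ε`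
  -- term is `r² cos 2(θ - π/6)`, which is harmonic, and only the zero-order part acts on it.
  have e : (A * ((-(3 * r / 4) + r ^ 3 / 16) * exp (-(r ^ 2 / 8))) * (2 * cos (θ - π / 6) - 1) +
        ε * 2 * cos (2 * (θ - π / 6))) +
      (A * ((1 - r ^ 2 / 4) * exp (-(r ^ 2 / 8))) * (2 * cos (θ - π / 6) - 1) +
        ε * (2 * r) * cos (2 * (θ - π / 6))) / r +
      (A * (r * exp (-(r ^ 2 / 8))) * (-2 * cos (θ - π / 6)) -
        ε * r ^ 2 * (4 * cos (2 * (θ - π / 6)))) / r ^ 2 +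
      (1 - r ^ 2 / 16) * barrier A ε r θ =
      -(A * (exp (-(r ^ 2 / 8)) / r)) +
        ε * ((1 - r ^ 2 / 16) * r ^ 2 * cos (2 * (θ - π / 6))) := by
    rw [barrier]
    field_simp
    ring
  have key : (1 - r ^ 2 / 16) * r ^ 2 * cos (2 * (θ - π / 6)) <
      64 * exp 2 * (exp (-(r ^ 2 / 8)) / r) := by
    have hr2 : 0 < r ^ 2 := by positivity
    -- For `r ≥ 4` the perturbation has a favourable sign; for `r ≤ 4` it is absorbed by the surplus
    -- `64 e² ε` built into `A`.
    rcases le_total r 4 with h4 | h4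
    · have h5 : 0 ≤ 1 - r ^ 2 / 16 := by nlinarith
      calc (1 - r ^ 2 / 16) * r ^ 2 * cos (2 * (θ - π / 6)) ≤ (1 - r ^ 2 / 16) * r ^ 2 * 1 := by
            gcongr
        _ < r ^ 2 := by nlinarith
        _ ≤ _ := cube_mul_exp_le hr h4
    · have h5 : 1 - r ^ 2 / 16 ≤ 0 := by nlinarith
      have h6 : (1 - r ^ 2 / 16) * r ^ 2 * cos (2 * (θ - π / 6)) ≤ 0 :=
        mul_nonpos_of_nonpos_of_nonneg (mul_nonpos_of_nonpos_of_nonneg h5 hr2.le) (by linarith)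
      have h7 : 0 < 64 * exp 2 * (exp (-(r ^ 2 / 8)) / r) := by positivity
      linarith
  rw [e, hA]
  have := mul_lt_mul_of_pos_left key hε
  linarith

end

/-! ### Comparison of finite sums of modes with the barrier -/

section

variable {k : ℕ} {R : ℝ} {N : ℕ} {e V V₁ V₂ : ℕ → ℝ → ℝ}

theorem hasDerivAt_sin_sum (c : ℕ → ℝ) (N : ℕ) (θ : ℝ) :
    HasDerivAt (fun θ => ∑ l ∈ Finset.range N, c l * sin (l * θ))
      (∑ l ∈ Finset.range N, c l * (l * cos (l * θ))) θ := by
  refine HasDerivAt.fun_sum fun l _ => ?_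
  have h0 : HasDerivAt (fun θ : ℝ => (l : ℝ) * θ) l θ := by
    simpa using (hasDerivAt_id θ).const_mul (l : ℝ)
  exact (h0.sin.const_mul (c l)).congr_deriv (by ring)

theorem hasDerivAt_cos_sum (c : ℕ → ℝ) (N : ℕ) (θ : ℝ) :
    HasDerivAt (fun θ => ∑ l ∈ Finset.range N, c l * (l * cos (l * θ)))
      (-∑ l ∈ Finset.range N, (l : ℝ) ^ 2 * c l * sin (l * θ)) θ := by
  rw [← Finset.sum_neg_distrib]
  refine HasDerivAt.fun_sum fun l _ => ?_
  have h0 : HasDerivAt (fun θ : ℝ => (l : ℝ) * θ) l θ := by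
    simpa using (hasDerivAt_id θ).const_mul (l : ℝ)
  exact ((h0.cos.const_mul (l : ℝ)).const_mul (c l)).congr_deriv (by ring)

theorem hasDerivAt_radial_sum {B B' : ℕ → ℝ → ℝ} {r : ℝ}
    (h : ∀ l, HasDerivAt (B l) (B' l r) r) (N : ℕ) (θ : ℝ) :
    HasDerivAt (fun r => ∑ l ∈ Finset.range N, B l r * sin (l * θ))
      (∑ l ∈ Finset.range N, B' l r * sin (l * θ)) r :=
  HasDerivAt.fun_sum fun l _ => (h l).mul_const _

theorem FiniteSol.sum_ode (h : FiniteSol k R N e V V₁ V₂) {r : ℝ} (hr : R < r) (θ : ℝ) :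
    ∑ l ∈ Finset.range N, V₂ l r * sin (l * θ) + (∑ l ∈ Finset.range N, V₁ l r * sin (l * θ)) / r -
      (∑ l ∈ Finset.range N, (l : ℝ) ^ 2 * V l r * sin (l * θ)) / r ^ 2 +
      (1 - r ^ 2 / 16) * ∑ l ∈ Finset.range N, V l r * sin (l * θ) =
      ∑ l ∈ Finset.range N, e l r * sin (l * θ) := by
  simp only [Finset.sum_div, Finset.mul_sum, ← Finset.sum_add_distrib, ← Finset.sum_sub_distrib]
  refine Finset.sum_congr rfl fun l _ => ?_
  have := (h.mode l).ode r hr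
  rw [radialPot] at this
  linear_combination sin (l * θ) * this

/-- No positive interior maximum of the quotient by the barrier exceeds one. -/
theorem FiniteSol.le_barrier (hk : 3 ≤ k) (hR : 0 ≤ R) (h : FiniteSol k R N e V V₁ V₂) {M ε : ℝ}
    (hM : 0 ≤ M) (hε : 0 < ε)
    (hF : ∀ r, R < r → ∀ θ, |∑ l ∈ Finset.range N, e l r * sin (l * θ)| ≤
      M * (exp (-(r ^ 2 / 8)) / r)) {r θ : ℝ} (hr : R < r) (h0 : 0 ≤ θ) (h1 : θ ≤ π / k) :
    ∑ l ∈ Finset.range N, V l r * sin (l * θ) ≤ barrier (M + ε * (64 * exp 2)) ε r θ := by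
  set A := M + ε * (64 * exp 2) with hA
  have hApos : 0 < A := by positivity
  have hk3 : (3 : ℝ) ≤ k := by exact_mod_cast hk
  have hk0 : (0 : ℝ) < k := by linarith
  have hpk : π / k ≤ π / 3 := div_le_div_of_nonneg_left pi_pos.le (by norm_num) hk3
  set w : ℝ → ℝ → ℝ := fun r θ => ∑ l ∈ Finset.range N, V l r * sin (l * θ) with hw
  set S : ℝ → ℝ := fun r => ∑ l ∈ Finset.range N, |V l r| with hS
  have hwS : ∀ r θ, w r θ ≤ S r := fun r θ => Finset.sum_le_sum fun l _ =>
    (le_abs_self _).trans (by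
      rw [abs_mul]
      exact mul_le_of_le_one_right (abs_nonneg _) (abs_sin_le_one _))
  have bpos : ∀ r θ, R < r → 0 ≤ θ → θ ≤ π / k → 0 < barrier A ε r θ := by
    intro r θ hr h0 h1
    have hr0 : 0 < r := lt_of_le_of_lt hR hr
    exact lt_of_lt_of_le (by positivity) (barrier_ge hApos.le hε.le hr0.le h0 (h1.trans hpk))
  by_contra hcon
  have hcon : barrier A ε r θ < w r θ := not_le.1 hcon
  -- Near `R` the solution is `o(s)`, while the barrier is at least a positive constant times `s`.
  -- Dividing by `s` treats `R = 0` and `R > 0` together.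
  have near : ∀ᶠ s in 𝓝[>] R, ∀ θ, 0 ≤ θ → θ ≤ π / k → w s θ < barrier A ε s θ := by
    have hlim : Tendsto (fun s => ∑ l ∈ Finset.range N, |V l s / s|) (𝓝[>] R) (𝓝 0) := by
      have := tendsto_finsetSum (Finset.range N) fun l _ => ((h.mode l).lim).abs
      simpa using this
    set c : ℝ := A * exp (-((R + 1) ^ 2 / 8)) / 2 with hc
    have hcpos : 0 < c := by positivity
    filter_upwards [hlim.eventually_lt_const hcpos, self_mem_nhdsWithin,
      Ioo_mem_nhdsGT (show R < R + 1 by linarith)] with s hs hsR hs1 θ h0 h1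
    have hs0 : 0 < s := lt_of_le_of_lt hR hsR
    have e1 : S s = s * ∑ l ∈ Finset.range N, |V l s / s| := by
      rw [hS, Finset.mul_sum]
      refine Finset.sum_congr rfl fun l _ => ?_
      rw [abs_div, abs_of_pos hs0]
      field_simp
    have e2 : exp (-((R + 1) ^ 2 / 8)) ≤ exp (-(s ^ 2 / 8)) := by
      refine exp_le_exp.2 ?_
      have := hs1.2
      nlinarith
    have e3 : c * s ≤ A * (s * exp (-(s ^ 2 / 8))) / 2 := by
      rw [hc]
      have : A * s * exp (-((R + 1) ^ 2 / 8)) ≤ A * s * exp (-(s ^ 2 / 8)) := by gcongr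
      linarith
    have e4 : 0 ≤ ε * s ^ 2 / 2 := by positivity
    calc w s θ ≤ S s := hwS s θ
      _ < c * s := by rw [e1, mul_comm]; gcongr
      _ ≤ A * (s * exp (-(s ^ 2 / 8))) / 2 + ε * s ^ 2 / 2 := by linarith
      _ ≤ _ := barrier_ge hApos.le hε.le hs0.le h0 (h1.trans hpk)
  -- At infinity only the `ε` term helps: it keeps the barrier above `ε/2` for `s ≥ 1`, whereas the
  -- solution tends to zero.
  have far : ∀ᶠ s in atTop, ∀ θ, 0 ≤ θ → θ ≤ π / k → w s θ < barrier A ε s θ := by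
    have hlim : Tendsto (fun s => ∑ l ∈ Finset.range N, |s ^ 2 * V l s|) atTop (𝓝 0) := by
      have := tendsto_finsetSum (Finset.range N) fun l _ => ((h.mode l).lim_top).abs
      simpa using this
    filter_upwards [hlim.eventually_lt_const (half_pos hε), eventually_ge_atTop (1 : ℝ)]
      with s hs hs1 θ h0 h1
    have e1 : S s ≤ ∑ l ∈ Finset.range N, |s ^ 2 * V l s| := by
      refine Finset.sum_le_sum fun l _ => ?_
      rw [abs_mul, abs_of_nonneg (sq_nonneg s)]
      exact le_mul_of_one_le_left (abs_nonneg _) (by nlinarith)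
    have hs0 : 0 < s := by linarith
    have e2 : ε / 2 ≤ ε * s ^ 2 / 2 := by
      have : 1 ≤ s ^ 2 := by nlinarith
      nlinarith
    have e3 : 0 ≤ A * (s * exp (-(s ^ 2 / 8))) / 2 := by positivity
    calc w s θ ≤ S s := hwS s θ
      _ < ε / 2 := lt_of_le_of_lt e1 hs
      _ ≤ A * (s * exp (-(s ^ 2 / 8))) / 2 + ε * s ^ 2 / 2 := by linarith
      _ ≤ _ := barrier_ge hApos.le hε.le hs0.le h0 (h1.trans hpk)
  obtain ⟨a, ha1, haR, har⟩ : ∃ a, (∀ θ, 0 ≤ θ → θ ≤ π / k → w a θ < barrier A ε a θ) ∧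
      R < a ∧ a < r := (near.and (Ioo_mem_nhdsGT hr)).exists
  obtain ⟨b, hb1, hbr⟩ : ∃ b, (∀ θ, 0 ≤ θ → θ ≤ π / k → w b θ < barrier A ε b θ) ∧ r < b :=
    (far.and (eventually_gt_atTop r)).exists
  have hcomp : IsCompact (Icc a b ×ˢ Icc 0 (π / k)) := isCompact_Icc.prod isCompact_Icc
  have hbc : Continuous fun p : ℝ × ℝ => barrier A ε p.1 p.2 := by unfold barrier; fun_prop
  have hwc : ContinuousOn (fun p : ℝ × ℝ => w p.1 p.2) (Icc a b ×ˢ Icc 0 (π / k)) := by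
    refine continuousOn_finsetSum _ fun l _ => ContinuousOn.mul ?_ (by fun_prop)
    refine ((h.mode l).continuousOn).comp continuousOn_fst fun p hp => ?_
    exact lt_of_lt_of_le haR hp.1.1
  -- The quotient is maximized, not the difference, because `1 - r²/16` is positive for `r < 4` and
  -- the maximum principle does not apply directly. If `c` is the maximal quotient, then `w - c ·
  -- barrier` vanishes at the maximum point and the zero-order terms cancel.
  obtain ⟨p, hp, hmax⟩ := hcomp.exists_isMaxOn (f := fun p : ℝ × ℝ => w p.1 p.2 / barrier A ε p.1 p.2)
    ⟨(r, θ), ⟨har.le, hbr.le⟩, h0, h1⟩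
    (hwc.div hbc.continuousOn fun p hp =>
      (bpos p.1 p.2 (lt_of_lt_of_le haR hp.1.1) hp.2.1 hp.2.2).ne')
  obtain ⟨s, t⟩ := p
  obtain ⟨⟨hs1, hs2⟩, ht1, ht2⟩ := hp
  simp only at hs1 hs2 ht1 ht2
  have hsR : R < s := lt_of_lt_of_le haR hs1
  have hs0 : 0 < s := lt_of_le_of_lt hR hsR
  have hbp := bpos s t hsR ht1 ht2
  set c := w s t / barrier A ε s t with hc
  have hcw : w s t = c * barrier A ε s t := by rw [hc]; field_simp
  have hc1 : 1 < c := by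
    have h2 := hmax (show (r, θ) ∈ Icc a b ×ˢ Icc 0 (π / k) from ⟨⟨har.le, hbr.le⟩, h0, h1⟩)
    have h3 : 1 < w r θ / barrier A ε r θ := (one_lt_div (bpos r θ hr h0 h1)).2 hcon
    exact lt_of_lt_of_le h3 h2
  have hle : ∀ s' t', s' ∈ Icc a b → t' ∈ Icc 0 (π / k) → w s' t' - c * barrier A ε s' t' ≤ 0 := by
    intro s' t' hs' ht'
    have h2 : w s' t' / barrier A ε s' t' ≤ c :=
      hmax (show (s', t') ∈ Icc a b ×ˢ Icc 0 (π / k) from ⟨hs', ht'⟩)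
    rw [div_le_iff₀ (bpos s' t' (lt_of_lt_of_le haR hs'.1) ht'.1 ht'.2)] at h2
    linarith
  have hwb : barrier A ε s t < w s t := by
    rw [hcw]
    nlinarith
  have hsa : a < s := lt_of_le_of_ne hs1 fun hh => by
    have := ha1 t ht1 ht2
    rw [hh] at this
    linarith
  have hsb : s < b := lt_of_le_of_ne hs2 fun hh => by
    have := hb1 t ht1 ht2
    rw [← hh] at this
    linarith
  have ht0 : 0 < t := lt_of_le_of_ne ht1 fun hh => by
    have : w s t = 0 := by simp [hw, ← hh]
    linarith
  -- On the far side of the sector each admissible mode vanishes, since `lπ/k` is a multiple of `π`.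
  have htk : t < π / k := lt_of_le_of_ne ht2 fun hh => by
    have : w s t = 0 := Finset.sum_eq_zero fun l _ => by
      rcases h.zero l with ⟨-, hl⟩ | hl
      · rw [hh, (cos_of_isMode (by omega) hl).2, mul_zero]
      · simp [hl.2.1]
    linarith
  have hmr : IsLocalMax (fun s => w s t - c * barrier A ε s t) s := by
    filter_upwards [Ioo_mem_nhds hsa hsb] with s' hs'
    simp only [hcw, sub_self]
    exact hle s' t ⟨hs'.1.le, hs'.2.le⟩ ⟨ht1, ht2⟩
  have hmt : IsLocalMax (fun t => w s t - c * barrier A ε s t) t := by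
    filter_upwards [Ioo_mem_nhds ht0 htk] with t' ht'
    simp only [hcw, sub_self]
    exact hle s t' ⟨hs1, hs2⟩ ⟨ht'.1.le, ht'.2.le⟩
  have dr : ∀ s', R < s' → HasDerivAt (fun s => w s t - c * barrier A ε s t) _ s' := fun s' hs' =>
    (hasDerivAt_radial_sum (fun l => (h.mode l).deriv s' hs') N t).sub
      ((hasDerivAt_barrier_radial A ε s' t).const_mul c)
  have drr := (hasDerivAt_radial_sum (fun l => (h.mode l).deriv₁ s hsR) N t).sub
      ((hasDerivAt_barrier_radial₂ A ε s t).const_mul c)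
  have q1 := hmr.hasDerivAt_eq_zero (dr s hsR)
  have q2 := second_deriv_nonpos_of_isLocalMax
    (by filter_upwards [lt_mem_nhds hsR] with s' hs' using dr s' hs') drr hmr
  have q3 := second_deriv_nonpos_of_isLocalMax (Eventually.of_forall fun t' =>
    (hasDerivAt_sin_sum (fun l => V l s) N t').sub
      ((hasDerivAt_barrier_angular A ε s t').const_mul c))
    ((hasDerivAt_cos_sum (fun l => V l s) N t).sub
      ((hasDerivAt_barrier_angular₂ A ε s t).const_mul c)) hmt
  have q4 := h.sum_ode hsR t
  have q5 := barrier_operator_lt hA hε hs0 ht1 (ht2.trans hpk)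
  have q6 := hF s hsR t
  have q7 : (∑ l ∈ Finset.range N, V l s * sin (l * t)) = c * barrier A ε s t := hcw
  have q8 : 0 ≤ M * (exp (-(s ^ 2 / 8)) / s) := by positivity
  have q9 := (_root_.abs_le.1 q6).1
  set Br := (A * ((1 - s ^ 2 / 4) * exp (-(s ^ 2 / 8))) * (2 * cos (t - π / 6) - 1) +
        ε * (2 * s) * cos (2 * (t - π / 6)))
  set Brr := (A * ((-(3 * s / 4) + s ^ 3 / 16) * exp (-(s ^ 2 / 8))) * (2 * cos (t - π / 6) - 1) +
        ε * 2 * cos (2 * (t - π / 6)))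
  set Btt := (A * (s * exp (-(s ^ 2 / 8))) * (-2 * cos (t - π / 6)) -
        ε * s ^ 2 * (4 * cos (2 * (t - π / 6))))
  set W₁ := ∑ l ∈ Finset.range N, V₁ l s * sin (l * t)
  set W₂ := ∑ l ∈ Finset.range N, V₂ l s * sin (l * t)
  set Wt := ∑ l ∈ Finset.range N, (l : ℝ) ^ 2 * V l s * sin (l * t)
  rw [q7] at q4
  have q10 : W₁ / s = c * (Br / s) := by
    rw [sub_eq_zero.1 q1]
    ring
  have q11 : -(Wt / s ^ 2) ≤ c * (Btt / s ^ 2) := by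
    have : (-Wt - c * Btt) / s ^ 2 ≤ 0 := div_nonpos_of_nonpos_of_nonneg q3 (sq_nonneg s)
    have e : (-Wt - c * Btt) / s ^ 2 = -(Wt / s ^ 2) - c * (Btt / s ^ 2) := by ring
    linarith
  -- The operator applied to `w` is at most `c` times its value on the barrier, hence below `-c M
  -- e^{-s²/8}/s`. As `c > 1`, this contradicts the assumed bound on the right-hand side.
  have q12 := mul_lt_mul_of_pos_left q5 (by linarith : 0 < c)
  have q13 := le_mul_of_one_le_left q8 hc1.le
  linarith

theorem FiniteSol.neg (h : FiniteSol k R N e V V₁ V₂) : FiniteSol k R N (-e) (-V) (-V₁) (-V₂) where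
  mode l := by simpa using (ModeSol.zero R l).sub (h.mode l)
  zero l := by simpa using h.zero l

/-- Let `ε → 0` in the barrier bound and use `2 cos (θ - π/6) - 1 ≤ 1`; no constant is lost. -/
theorem FiniteSol.sum_le (hk : 3 ≤ k) (hR : 0 ≤ R) (h : FiniteSol k R N e V V₁ V₂) {M : ℝ}
    (hM : 0 ≤ M)
    (hF : ∀ r, R < r → ∀ θ, |∑ l ∈ Finset.range N, e l r * sin (l * θ)| ≤
      M * (exp (-(r ^ 2 / 8)) / r)) {r θ : ℝ} (hr : R < r) (h0 : 0 ≤ θ) (h1 : θ ≤ π / k) :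
    ∑ l ∈ Finset.range N, V l r * sin (l * θ) ≤ M * (r * exp (-(r ^ 2 / 8))) := by
  have hr0 : 0 < r := lt_of_le_of_lt hR hr
  have hlim : Tendsto (fun ε => barrier (M + ε * (64 * exp 2)) ε r θ) (𝓝[>] 0)
      (𝓝 (barrier (M + 0 * (64 * exp 2)) 0 r θ)) := by
    have : Continuous fun ε => barrier (M + ε * (64 * exp 2)) ε r θ := by unfold barrier; fun_prop
    exact (this.tendsto 0).mono_left nhdsWithin_le_nhds
  have := ge_of_tendsto hlim (by
    filter_upwards [self_mem_nhdsWithin] with ε hε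
    exact h.le_barrier hk hR hM hε hF hr h0 h1)
  refine this.trans ?_
  rw [barrier]
  have h2 : 2 * cos (θ - π / 6) - 1 ≤ 1 := by linarith [cos_le_one (θ - π / 6)]
  have h3 : 0 ≤ M * (r * exp (-(r ^ 2 / 8))) := by positivity
  nlinarith

/-- Changing the sign of the data gives the lower bound in the sector. Since admissible modes change
sign under rotation by `π/k`, the absolute value has period `π/k` and one sector suffices. -/
theorem FiniteSol.abs_sum_le (hk : 3 ≤ k) (hR : 0 ≤ R) (h : FiniteSol k R N e V V₁ V₂) {M : ℝ}
    (hM : 0 ≤ M)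
    (hF : ∀ r, R < r → ∀ θ, |∑ l ∈ Finset.range N, e l r * sin (l * θ)| ≤
      M * (exp (-(r ^ 2 / 8)) / r)) {r : ℝ} (hr : R < r) (θ : ℝ) :
    |∑ l ∈ Finset.range N, V l r * sin (l * θ)| ≤ M * (r * exp (-(r ^ 2 / 8))) := by
  have hk0 : (0 : ℝ) < k := by
    have : (3 : ℝ) ≤ k := by exact_mod_cast hk
    linarith
  have sector : ∀ t, 0 ≤ t → t ≤ π / k →
      |∑ l ∈ Finset.range N, V l r * sin (l * t)| ≤ M * (r * exp (-(r ^ 2 / 8))) := by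
    intro t h0 h1
    have a1 := h.sum_le hk hR hM hF hr h0 h1
    have a2 := h.neg.sum_le hk hR hM (fun r hr θ => by simpa using hF r hr θ) hr h0 h1
    simp only [Pi.neg_apply, neg_mul, Finset.sum_neg_distrib] at a2
    exact _root_.abs_le.2 ⟨by linarith, a1⟩
  have hper : Function.Periodic (fun t => |∑ l ∈ Finset.range N, V l r * sin (l * t)|) (π / k) := by
    intro t
    have : ∑ l ∈ Finset.range N, V l r * sin (l * (t + π / k)) =
        -∑ l ∈ Finset.range N, V l r * sin (l * t) := by
      rw [← Finset.sum_neg_distrib]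
      refine Finset.sum_congr rfl fun l _ => ?_
      rcases h.zero l with ⟨-, hl⟩ | hl
      · obtain ⟨h1, h2⟩ := cos_of_isMode (by omega : 0 < k) hl
        rw [mul_add, sin_add, h1, h2]
        ring
      · simp [hl.2.1]
    simp only
    rw [this, abs_neg]
  obtain ⟨t, ht, hθ⟩ := hper.exists_mem_Ico₀ (by positivity) θ
  exact hθ.trans_le (sector t ht.1 ht.2.le)

theorem FiniteSol.abs_sinSum_le (hk : 3 ≤ k) (hR : 0 ≤ R) (h : FiniteSol k R N e V V₁ V₂) {M : ℝ}
    (hM : 0 ≤ M)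
    (hF : ∀ x ∈ exteriorDomain R, |sinSum e N x| ≤ M * (exp (-(‖x‖ ^ 2 / 8)) / ‖x‖))
    {x : Plane} (hx : x ∈ exteriorDomain R) :
    |sinSum V N x| ≤ M * (‖x‖ * exp (-(‖x‖ ^ 2 / 8))) := by
  obtain ⟨θ, hθ⟩ := exists_polarPt x
  have hr : R < ‖x‖ := hx
  rw [hθ, sinSum_polarPt _ _ (lt_of_le_of_lt hR hr), ← hθ]
  refine h.abs_sum_le hk hR hM (fun r hr θ => ?_) hr θ
  have hr0 : 0 < r := lt_of_le_of_lt hR hr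
  have := hF (polarPt r θ) (by
    change R < ‖_‖
    rwa [norm_polarPt hr0.le])
  rwa [sinSum_polarPt _ _ hr0, norm_polarPt hr0.le] at this

end

/-! ### Existence of solutions -/

section

variable {k : ℕ} {R : ℝ} {N N' : ℕ} {e V V₁ V₂ e' V' V₁' V₂' : ℕ → ℝ → ℝ}

theorem exists_finiteSol (hk : 3 ≤ k) (hR : 0 ≤ R) (he : ∀ l, RadialTest R (e l))
    (he0 : ∀ l, (l < N ∧ IsMode k l) ∨ e l = 0) :
    ∃ V V₁ V₂ : ℕ → ℝ → ℝ, FiniteSol k R N e V V₁ V₂ := by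
  have : ∀ l, ∃ V V₁ V₂ : ℝ → ℝ, ModeSol R l (e l) V V₁ V₂ ∧
      ((l < N ∧ IsMode k l) ∨ (e l = 0 ∧ V = 0 ∧ V₁ = 0 ∧ V₂ = 0)) := by
    intro l
    rcases he0 l with hl | hl
    · have h3 : 3 ≤ l := by
        obtain ⟨-, j, rfl⟩ := hl
        exact hk.trans (Nat.le_mul_of_pos_right k (by omega))
      obtain ⟨V, V₁, V₂, h⟩ := exists_modeSol hR h3 (he l).1 (he l).2
      exact ⟨V, V₁, V₂, h, Or.inl hl⟩
    · exact ⟨0, 0, 0, hl ▸ ModeSol.zero R l, Or.inr ⟨hl, rfl, rfl, rfl⟩⟩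
  choose V V₁ V₂ h1 h2 using this
  exact ⟨V, V₁, V₂, h1, h2⟩

/-- Solutions with different numbers of modes have to be subtracted; both are first viewed as sums
with a common number of terms. -/
theorem FiniteSol.pad (h : FiniteSol k R N e V V₁ V₂) (hN : N ≤ N') :
    FiniteSol k R N' e V V₁ V₂ where
  mode := h.mode
  zero l := (h.zero l).imp_left fun hl => ⟨hl.1.trans_le hN, hl.2⟩

theorem FiniteSol.sub (h : FiniteSol k R N e V V₁ V₂) (h' : FiniteSol k R N e' V' V₁' V₂') :
    FiniteSol k R N (e - e') (V - V') (V₁ - V₁') (V₂ - V₂') where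
  mode l := (h.mode l).sub (h'.mode l)
  zero l := by
    rcases h.zero l with hl | hl
    · exact Or.inl hl
    · rcases h'.zero l with hl' | hl'
      · exact Or.inl hl'
      · right
        simp [hl, hl']

theorem sinSum_pad {B : ℕ → ℝ → ℝ} (hN : N ≤ N') (hB : ∀ l, N ≤ l → B l = 0) :
    sinSum B N' = sinSum B N := by
  funext x
  refine (Finset.sum_subset (Finset.range_mono hN) fun l _ hl => ?_).symm
  rw [hB l (by simpa using hl), Pi.zero_apply, zero_mul]

theorem cosSum_pad {B : ℕ → ℝ → ℝ} (hN : N ≤ N') (hB : ∀ l, N ≤ l → B l = 0) :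
    cosSum B N' = cosSum B N := by
  funext x
  refine (Finset.sum_subset (Finset.range_mono hN) fun l _ hl => ?_).symm
  rw [hB l (by simpa using hl), Pi.zero_apply, zero_mul]

theorem FiniteSol.zero_of_le (h : FiniteSol k R N e V V₁ V₂) {l : ℕ} (hl : N ≤ l) :
    e l = 0 ∧ V l = 0 ∧ V₁ l = 0 ∧ V₂ l = 0 :=
  (h.zero l).resolve_left fun hh => absurd hh.1 (not_lt.2 hl)

theorem FiniteSol.sinSumGrad_pad (h : FiniteSol k R N e V V₁ V₂) (hN : N ≤ N') (j : Fin 2) :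
    sinSumGrad V V₁ N' j = sinSumGrad V V₁ N j := by
  funext x
  rw [sinSumGrad, sinSumGrad, sinSum_pad hN, cosSum_pad hN]
  all_goals
    intro l hl
    funext r
    simp [h.zero_of_le hl]

theorem FiniteSol.sinSumHess_pad (h : FiniteSol k R N e V V₁ V₂) (hN : N ≤ N') (i j : Fin 2) :
    sinSumHess V V₁ V₂ N' i j = sinSumHess V V₁ V₂ N i j := by
  funext x
  unfold sinSumHess
  congr 1
  · congr 1
    · congr 1
      · congr 1
        · congr 2
          · rw [sinSum_pad hN]
            intro l hl
            funext r
            simp [h.zero_of_le hl]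
          · rw [sinSum_pad hN]
            intro l hl
            funext r
            simp [h.zero_of_le hl]
        · rw [cosSum_pad hN]
          intro l hl
          funext r
          simp [h.zero_of_le hl]
      · rw [cosSum_pad hN]
        intro l hl
        funext r
        simp [h.zero_of_le hl]
    · rw [cosSum_pad hN]
      intro l hl
      funext r
      simp [h.zero_of_le hl]
  · rw [sinSum_pad hN]
    intro l hl
    funext r
    simp [h.zero_of_le hl]

theorem sinSum_sub (A B : ℕ → ℝ → ℝ) (N : ℕ) : sinSum (A - B) N = sinSum A N - sinSum B N := by
  funext x
  simp only [sinSum, Pi.sub_apply, ← Finset.sum_sub_distrib, sub_mul]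

theorem sinSumGrad_sub (V V₁ V' V₁' : ℕ → ℝ → ℝ) (N : ℕ) (j : Fin 2) :
    sinSumGrad (V - V') (V₁ - V₁') N j = sinSumGrad V V₁ N j - sinSumGrad V' V₁' N j := by
  funext x
  simp only [sinSumGrad, sinSum, cosSum, Pi.sub_apply, Finset.mul_sum, ← Finset.sum_sub_distrib,
    ← Finset.sum_add_distrib]
  refine Finset.sum_congr rfl fun l _ => ?_
  ring

theorem sinSumHess_sub (V V₁ V₂ V' V₁' V₂' : ℕ → ℝ → ℝ) (N : ℕ) (i j : Fin 2) :
    sinSumHess (V - V') (V₁ - V₁') (V₂ - V₂') N i j =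
      sinSumHess V V₁ V₂ N i j - sinSumHess V' V₁' V₂' N i j := by
  funext x
  simp only [sinSumHess, sinSum, cosSum, Pi.sub_apply, Finset.mul_sum, ← Finset.sum_sub_distrib,
    ← Finset.sum_add_distrib]
  refine Finset.sum_congr rfl fun l _ => ?_
  ring

theorem FiniteSol.continuousOn_sinSum (hR : 0 ≤ R) (h : FiniteSol k R N e V V₁ V₂) :
    ContinuousOn (sinSum V N) (exteriorDomain R) :=
  SelfShrinker.continuousOn_sinSum hR (fun l => (h.mode l).continuousOn) N

theorem FiniteSol.continuousOn_grad (hR : 0 ≤ R) (h : FiniteSol k R N e V V₁ V₂) (j : Fin 2) :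
    ContinuousOn (sinSumGrad V V₁ N j) (exteriorDomain R) := by
  refine ((continuous_coord j).continuousOn.mul (SelfShrinker.continuousOn_sinSum hR (fun l => ?_) N)).add
    ((continuous_tang j).continuousOn.mul (continuousOn_cosSum hR (fun l => ?_) N))
  · simpa using continuousOn_div_pow hR (h.mode l).continuousOn₁ 1
  · exact continuousOn_div_pow hR (continuousOn_const.mul (h.mode l).continuousOn) 2

theorem FiniteSol.continuousOn_hess (hR : 0 ≤ R) (h : FiniteSol k R N e V V₁ V₂) (i j : Fin 2) :
    ContinuousOn (sinSumHess V V₁ V₂ N i j) (exteriorDomain R) := by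
  have c0 := fun l => (h.mode l).continuousOn
  have c1 := fun l => (h.mode l).continuousOn₁
  have c2 := fun l => (h.mode l).continuousOn₂ hR
  have d1 : ∀ l, ContinuousOn (fun r => V₁ l r / r) (Ioi R) := fun l => by
    simpa using continuousOn_div_pow hR (c1 l) 1
  have d0 : ∀ l : ℕ, ContinuousOn (fun r => l * V l r / r ^ 2) (Ioi R) := fun l =>
    continuousOn_div_pow hR (continuousOn_const.mul (c0 l)) 2
  have d2 : ∀ l : ℕ, ContinuousOn (fun r => 2 * V l r / r ^ 2) (Ioi R) := fun l =>
    continuousOn_div_pow hR (continuousOn_const.mul (c0 l)) 2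
  have ci := (continuous_coord i).continuousOn (s := exteriorDomain R)
  have cj := (continuous_coord j).continuousOn (s := exteriorDomain R)
  have ti := (continuous_tang i).continuousOn (s := exteriorDomain R)
  have tj := (continuous_tang j).continuousOn (s := exteriorDomain R)
  refine (((((continuousOn_const.mul (SelfShrinker.continuousOn_sinSum hR d1 N)).add
    ((ci.mul cj).mul (SelfShrinker.continuousOn_sinSum hR (fun l =>
      continuousOn_div_pow hR ((c2 l).sub (d1 l)) 2) N))).add
    ((ci.mul tj).mul (continuousOn_cosSum hR (fun l =>
      continuousOn_div_pow hR (continuousOn_const.mul (d1 l)) 2) N))).add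
    (continuousOn_const.mul (continuousOn_cosSum hR d0 N))).add
    ((ti.mul cj).mul (continuousOn_cosSum hR (fun l =>
      continuousOn_div_pow hR (continuousOn_const.mul ((d1 l).sub (d2 l))) 2) N))).sub
    ((ti.mul tj).mul (SelfShrinker.continuousOn_sinSum hR (fun l =>
      continuousOn_div_pow hR (continuousOn_const.mul (d0 l)) 2) N))

theorem FiniteSol.memLp (hk : 3 ≤ k) (hR : 0 ≤ R) (h : FiniteSol k R N e V V₁ V₂) :
    MemLp (sinSum V N) 2 (volume.restrict (exteriorDomain R)) :=
  ⟨(h.continuousOn_sinSum hR).aestronglyMeasurable (measurableSet_exteriorDomain R),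
    (h.eLpNorm_le hk hR).trans_lt (ENNReal.mul_lt_top (by norm_num) (h.eLpNorm_rhs_lt_top hk hR))⟩

theorem FiniteSol.memLp_grad (hk : 3 ≤ k) (hR : 0 ≤ R) (h : FiniteSol k R N e V V₁ V₂)
    (j : Fin 2) : MemLp (sinSumGrad V V₁ N j) 2 (volume.restrict (exteriorDomain R)) :=
  ⟨(h.continuousOn_grad hR j).aestronglyMeasurable (measurableSet_exteriorDomain R),
    (h.eLpNorm_grad_le hk hR j).trans_lt
      (ENNReal.mul_lt_top (by norm_num) (h.eLpNorm_rhs_lt_top hk hR))⟩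

theorem FiniteSol.memLp_hess (hk : 3 ≤ k) (hR : 0 ≤ R) (h : FiniteSol k R N e V V₁ V₂)
    (i j : Fin 2) : MemLp (sinSumHess V V₁ V₂ N i j) 2 (volume.restrict (exteriorDomain R)) :=
  ⟨(h.continuousOn_hess hR i j).aestronglyMeasurable (measurableSet_exteriorDomain R),
    (h.eLpNorm_hess_le hk hR i j).trans_lt
      (ENNReal.mul_lt_top (by norm_num) (h.eLpNorm_rhs_lt_top hk hR))⟩

theorem FiniteSol.isWeakPartial (hR : 0 ≤ R) (h : FiniteSol k R N e V V₁ V₂) (j : Fin 2) :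
    IsWeakPartial (exteriorDomain R) j (sinSum V N) (sinSumGrad V V₁ N j) :=
  isWeakPartial_of_hasLineDerivAt (measurableSet_exteriorDomain R) (h.continuousOn_sinSum hR)
    (h.continuousOn_grad hR j) fun x hx =>
      hasLineDerivAt_sinSum (ne_zero_of_mem_exteriorDomain hR hx)
        (fun l => (h.mode l).deriv ‖x‖ hx) j

theorem FiniteSol.isWeakPartial_grad (hR : 0 ≤ R) (h : FiniteSol k R N e V V₁ V₂) (i j : Fin 2) :
    IsWeakPartial (exteriorDomain R) j (sinSumGrad V V₁ N i) (sinSumHess V V₁ V₂ N i j) :=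
  isWeakPartial_of_hasLineDerivAt (measurableSet_exteriorDomain R) (h.continuousOn_grad hR i)
    (h.continuousOn_hess hR i j) fun x hx =>
      hasLineDerivAt_sinSumGrad (ne_zero_of_mem_exteriorDomain hR hx)
        (fun l => (h.mode l).deriv ‖x‖ hx) (fun l => (h.mode l).deriv₁ ‖x‖ hx) i j

theorem FiniteSol.equation (hR : 0 ≤ R) (h : FiniteSol k R N e V V₁ V₂) {x : Plane}
    (hx : x ∈ exteriorDomain R) :
    ∑ i, sinSumHess V V₁ V₂ N i i x = (‖x‖ ^ 2 / 16 - 1) * sinSum V N x + sinSum e N x := by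
  rw [sinSumHess_trace _ _ _ _ (ne_zero_of_mem_exteriorDomain hR hx)]
  simp only [sinSum, Finset.mul_sum, ← Finset.sum_add_distrib]
  refine Finset.sum_congr rfl fun l _ => ?_
  have := (h.mode l).ode ‖x‖ hx
  rw [radialPot] at this
  linear_combination sinMode l x * this

/-- The radial factors tend to zero at `R`, so the extension by zero is continuous. For `R = 0` this
includes the origin, where the angular factors have no limit but stay bounded. -/
theorem FiniteSol.continuous_indicator (hR : 0 ≤ R) (h : FiniteSol k R N e V V₁ V₂) :
    Continuous ((exteriorDomain R).indicator (sinSum V N)) := by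
  rw [continuous_iff_continuousAt]
  intro x
  by_cases hx : x ∈ exteriorDomain R
  · have hn := (isOpen_exteriorDomain R).mem_nhds hx
    refine ((h.continuousOn_sinSum hR).continuousAt hn).congr ?_
    filter_upwards [hn] with y hy
    rw [indicator_of_mem hy]
  · have hxR : ‖x‖ ≤ R := not_lt.1 hx
    rw [ContinuousAt, indicator_of_notMem hx]
    have h1 : ∀ l, Tendsto (fun y : Plane => (Ioi R).indicator (fun r => |V l r|) ‖y‖) (𝓝 x)
        (𝓝 0) := by
      intro l
      have h2 : Tendsto (fun r => (Ioi R).indicator (fun r => |V l r|) r) (𝓝 ‖x‖) (𝓝 0) := by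
        rcases hxR.lt_or_eq with hlt | heq
        · refine tendsto_const_nhds.congr' ?_
          filter_upwards [gt_mem_nhds hlt] with r hr
          rw [indicator_of_notMem (by simpa using (le_of_lt hr))]
        · rw [heq, Metric.tendsto_nhds]
          intro ε hε
          have h3 := (Metric.tendsto_nhds.1 ((h.mode l).tendsto_zero hR) ε hε)
          rw [eventually_nhdsWithin_iff] at h3
          filter_upwards [h3] with r hr
          by_cases hrR : r ∈ Ioi R
          · rw [indicator_of_mem hrR]
            simpa using hr hrR
          · rw [indicator_of_notMem hrR]
            simpa using hε
      exact h2.comp continuous_norm.continuousAt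
    have h2 := tendsto_finsetSum (Finset.range N) fun l _ => h1 l
    rw [Finset.sum_const_zero] at h2
    refine squeeze_zero_norm (fun y => ?_) h2
    by_cases hy : y ∈ exteriorDomain R
    · rw [indicator_of_mem hy, sinSum]
      refine (norm_sum_le _ _).trans (Finset.sum_le_sum fun l _ => ?_)
      rw [indicator_of_mem (show ‖y‖ ∈ Ioi R from hy), norm_mul]
      exact mul_le_of_le_one_right (abs_nonneg _)
        (abs_sinMode_le l (ne_zero_of_mem_exteriorDomain hR hy))
    · rw [indicator_of_notMem hy, norm_zero]
      exact Finset.sum_nonneg fun l _ => indicator_nonneg (fun _ _ => abs_nonneg _) _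

end

/-! ### Limits in `L²` and solutions for general right-hand sides -/

theorem exists_tendsto_eLpNorm {α : Type*} [MeasurableSpace α] {μ : Measure α}
    {f F : ℕ → α → ℝ} {F₀ : α → ℝ} {C : ℝ≥0∞} (hC : C ≠ ⊤) (hf : ∀ n, MemLp (f n) 2 μ)
    (hF : ∀ n, MemLp (F n) 2 μ) (hF₀ : MemLp F₀ 2 μ)
    (hle : ∀ n m, eLpNorm (f n - f m) 2 μ ≤ C * eLpNorm (F n - F m) 2 μ)
    (hlim : Tendsto (fun n => eLpNorm (F n - F₀) 2 μ) atTop (𝓝 0)) :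
    ∃ f₀, MemLp f₀ 2 μ ∧ Tendsto (fun n => eLpNorm (f n - f₀) 2 μ) atTop (𝓝 0) := by
  have h2 : (1 : ℝ≥0∞) ≤ 2 := by norm_num
  have : Fact ((1 : ℝ≥0∞) ≤ 2) := ⟨h2⟩
  -- The linear a priori bound makes the solutions Cauchy because the data converge.
  have hcau : CauchySeq fun n => (hf n).toLp (f n) := by
    rw [EMetric.cauchySeq_iff]
    intro ε hε
    have hε2 : (0 : ℝ≥0∞) < ε / 2 := ENNReal.half_pos hε.ne'
    have hlim' : Tendsto (fun n => C * eLpNorm (F n - F₀) 2 μ) atTop (𝓝 0) := by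
      simpa using ENNReal.Tendsto.const_mul hlim (Or.inr hC)
    obtain ⟨n₀, hn₀⟩ := eventually_atTop.1 (hlim'.eventually_lt_const hε2)
    refine ⟨n₀, fun n hn m hm => ?_⟩
    rw [Lp.edist_toLp_toLp]
    calc _ ≤ C * eLpNorm (F n - F m) 2 μ := hle n m
      _ ≤ C * (eLpNorm (F n - F₀) 2 μ + eLpNorm (F m - F₀) 2 μ) := by
          gcongr
          have e : F n - F m = (F n - F₀) - (F m - F₀) := by abel
          rw [e]
          exact eLpNorm_sub_le ((hF n).sub hF₀).1 ((hF m).sub hF₀).1 h2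
      _ = C * eLpNorm (F n - F₀) 2 μ + C * eLpNorm (F m - F₀) 2 μ := mul_add _ _ _
      _ < ε / 2 + ε / 2 := ENNReal.add_lt_add (hn₀ n hn) (hn₀ m hm)
      _ = ε := ENNReal.add_halves ε
  obtain ⟨f₀, hf₀⟩ := cauchySeq_tendsto_of_complete hcau
  refine ⟨f₀, Lp.memLp f₀, ?_⟩
  have h := tendsto_iff_edist_tendsto_0.1 hf₀
  refine h.congr fun n => ?_
  rw [Lp.edist_def]
  refine eLpNorm_congr_ae ?_
  filter_upwards [(hf n).coeFn_toLp] with x hx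
  simp [hx]

theorem ae_eq_of_tendsto {α : Type*} [MeasurableSpace α] {μ : Measure α}
    {f : ℕ → α → ℝ} {f₀ g : α → ℝ} (hf : ∀ n, MemLp (f n) 2 μ) (hf₀ : MemLp f₀ 2 μ)
    (hlim : Tendsto (fun n => eLpNorm (f n - f₀) 2 μ) atTop (𝓝 0))
    (hg : ∀ᵐ x ∂μ, Tendsto (fun n => f n x) atTop (𝓝 (g x))) : f₀ =ᵐ[μ] g := by
  obtain ⟨ns, hns, h⟩ := (tendstoInMeasure_of_tendsto_eLpNorm two_ne_zero (fun n => (hf n).1) hf₀.1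
    hlim).exists_seq_tendsto_ae
  filter_upwards [h, hg] with x h1 h2
  exact tendsto_nhds_unique h1 (h2.comp hns.tendsto_atTop)

/-- A solution of `Δ v - |x|² v / 16 + v = F` in `H²` of an exterior domain which vanishes on
the complement of the domain. -/
structure PlaneSol (R : ℝ) (F v : Plane → ℝ) (g : Fin 2 → Plane → ℝ)
    (h : Fin 2 → Fin 2 → Plane → ℝ) : Prop where
  cont : Continuous v
  zero : ∀ x, ‖x‖ ≤ R → v x = 0
  memLp : MemLp v 2 (volume.restrict (exteriorDomain R))
  memLp_grad : ∀ i, MemLp (g i) 2 (volume.restrict (exteriorDomain R))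
  memLp_hess : ∀ i j, MemLp (h i j) 2 (volume.restrict (exteriorDomain R))
  grad : ∀ i, IsWeakPartial (exteriorDomain R) i v (g i)
  hess : ∀ i j, IsWeakPartial (exteriorDomain R) j (g i) (h i j)
  equation : ∀ᵐ x ∂(volume.restrict (exteriorDomain R)),
    ∑ i, h i i x = (‖x‖ ^ 2 / 16 - 1) * v x + F x

/-- Approximate `F` by finite sums of admissible modes and solve for each. By linearity the uniform
bounds apply to differences of these solutions, so they and their derivatives converge in `L²`, and
by `FiniteSol.abs_le` they converge locally uniformly. The limit is therefore continuous and zero on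
the closed ball. The barrier bound is inherited because the approximations satisfy the same
pointwise bound as `F`. -/
theorem exists_planeSol {k : ℕ} (hk : 3 ≤ k) {R : ℝ} (hR : 0 ≤ R) {F : Plane → ℝ}
    (hF : MemLp F 2 (volume.restrict (exteriorDomain R)))
    (hr : ∀ᵐ x ∂(volume.restrict (exteriorDomain R)), F (rotPlane (-(π / k)) x) = -F x)
    (hc : ∀ᵐ x ∂(volume.restrict (exteriorDomain R)), F (conjPlane x) = -F x) :
    ∃ v g h, PlaneSol R F v g h ∧ (∀ x, R < ‖x‖ → v (rotPlane (-(π / k)) x) = -v x) ∧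
      (∀ x, R < ‖x‖ → v (conjPlane x) = -v x) ∧
      (ContinuousOn F (exteriorDomain R) → ∀ M, 0 ≤ M →
        (∀ x ∈ exteriorDomain R, |F x| ≤ M * (exp (-(‖x‖ ^ 2 / 8)) / ‖x‖)) →
        ∀ x ∈ exteriorDomain R, |v x| ≤ M * (‖x‖ * exp (-(‖x‖ ^ 2 / 8)))) := by
  set μ := (volume : Measure Plane).restrict (exteriorDomain R) with hμ
  obtain ⟨N, e, he, he0, hlim, hb⟩ := exists_modes_tendsto hR (by omega : 0 < k) hF hr hc
  choose V V₁ V₂ hS using fun n => exists_finiteSol hk hR (he n) (he0 n)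
  have hF' : ∀ n, MemLp (sinSum (e n) (N n)) 2 μ := fun n => memLp_sinSum hR (he n) _ _
  have hdiff : ∀ n m, FiniteSol k R (max (N n) (N m)) (e n - e m) (V n - V m) (V₁ n - V₁ m)
      (V₂ n - V₂ m) := fun n m =>
    ((hS n).pad (le_max_left _ _)).sub ((hS m).pad (le_max_right _ _))
  have pe : ∀ n m, sinSum (e n - e m) (max (N n) (N m)) = sinSum (e n) (N n) - sinSum (e m) (N m) :=
    fun n m => by
      rw [sinSum_sub, sinSum_pad (le_max_left _ _) fun l hl => ((hS n).zero_of_le hl).1,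
        sinSum_pad (le_max_right _ _) fun l hl => ((hS m).zero_of_le hl).1]
  have pV : ∀ n m, sinSum (V n - V m) (max (N n) (N m)) = sinSum (V n) (N n) - sinSum (V m) (N m) :=
    fun n m => by
      rw [sinSum_sub, sinSum_pad (le_max_left _ _) fun l hl => ((hS n).zero_of_le hl).2.1,
        sinSum_pad (le_max_right _ _) fun l hl => ((hS m).zero_of_le hl).2.1]
  obtain ⟨v₀, hv₀, lv₀⟩ := exists_tendsto_eLpNorm (C := 18) (by norm_num)
    (fun n => (hS n).memLp hk hR) hF' hF (fun n m => by
      rw [← pe, ← pV]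
      exact (hdiff n m).eLpNorm_le hk hR) hlim
  have hgrad : ∀ i, ∃ g₀, MemLp g₀ 2 μ ∧
      Tendsto (fun n => eLpNorm (sinSumGrad (V n) (V₁ n) (N n) i - g₀) 2 μ) atTop (𝓝 0) :=
    fun i => exists_tendsto_eLpNorm (C := 36) (by norm_num)
      (fun n => (hS n).memLp_grad hk hR i) hF' hF (fun n m => by
        rw [← pe, ← (hS n).sinSumGrad_pad (le_max_left (N n) (N m)),
          ← (hS m).sinSumGrad_pad (le_max_right (N n) (N m)), ← sinSumGrad_sub]
        exact (hdiff n m).eLpNorm_grad_le hk hR i) hlim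
  have hhess : ∀ i j, ∃ h₀, MemLp h₀ 2 μ ∧
      Tendsto (fun n => eLpNorm (sinSumHess (V n) (V₁ n) (V₂ n) (N n) i j - h₀) 2 μ)
        atTop (𝓝 0) :=
    fun i j => exists_tendsto_eLpNorm (C := 108) (by norm_num)
      (fun n => (hS n).memLp_hess hk hR i j) hF' hF (fun n m => by
        rw [← pe, ← (hS n).sinSumHess_pad (le_max_left (N n) (N m)),
          ← (hS m).sinSumHess_pad (le_max_right (N n) (N m)), ← sinSumHess_sub]
        exact (hdiff n m).eLpNorm_hess_le hk hR i j) hlim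
  choose g hg lg using hgrad
  choose h hh lh using hhess
  set δ : ℕ → ℝ := fun n => (eLpNorm (sinSum (e n) (N n) - F) 2 μ).toReal with hδ
  have hδ0 : Tendsto δ atTop (𝓝 0) := by
    have := (ENNReal.tendsto_toReal ENNReal.zero_ne_top).comp hlim
    rwa [ENNReal.toReal_zero] at this
  have hfin : ∀ n, eLpNorm (sinSum (e n) (N n) - F) 2 μ ≠ ⊤ := fun n => ((hF' n).sub hF).2.ne
  have hpt : ∀ n m, ∀ x ∈ exteriorDomain R,
      |sinSum (V n) (N n) x - sinSum (V m) (N m) x| ≤ 9 * ‖x‖ * (δ n + δ m) := by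
    intro n m x hx
    have h1 := (hdiff n m).abs_le hk hR hx
    rw [pe, pV, Pi.sub_apply] at h1
    refine h1.trans (mul_le_mul_of_nonneg_left ?_ (by positivity))
    rw [hδ, ← ENNReal.toReal_add (hfin n) (hfin m)]
    refine ENNReal.toReal_mono (ENNReal.add_ne_top.2 ⟨hfin n, hfin m⟩) ?_
    have e1 : sinSum (e n) (N n) - sinSum (e m) (N m) =
        (sinSum (e n) (N n) - F) - (sinSum (e m) (N m) - F) := by abel
    rw [e1]
    exact eLpNorm_sub_le ((hF' n).sub hF).1 ((hF' m).sub hF).1 (by norm_num)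
  have hexl : ∀ x, ∃ y, (R < ‖x‖ → Tendsto (fun n => sinSum (V n) (N n) x) atTop (𝓝 y)) ∧
      (‖x‖ ≤ R → y = 0) := by
    intro x
    rcases lt_or_ge R ‖x‖ with hx | hx
    · have hcau : CauchySeq fun n => sinSum (V n) (N n) x := by
        rw [Metric.cauchySeq_iff]
        intro ε hε
        have h1 : Tendsto (fun n => 9 * ‖x‖ * δ n) atTop (𝓝 0) := by
          simpa using hδ0.const_mul (9 * ‖x‖)
        obtain ⟨n₀, hn₀⟩ := eventually_atTop.1 (h1.eventually_lt_const (half_pos hε))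
        refine ⟨n₀, fun n hn m hm => ?_⟩
        rw [Real.dist_eq]
        have := hpt n m x hx
        have := hn₀ n hn
        have := hn₀ m hm
        linarith
      obtain ⟨y, hy⟩ := cauchySeq_tendsto_of_complete hcau
      exact ⟨y, fun _ => hy, fun h => absurd hx (not_lt.2 h)⟩
    · exact ⟨0, fun h => absurd h (not_lt.2 hx), fun _ => rfl⟩
  choose v hv hvz using hexl
  have hunif : ∀ n, ∀ x ∈ exteriorDomain R, |sinSum (V n) (N n) x - v x| ≤ 9 * ‖x‖ * δ n := by
    intro n x hx
    have h1 := ((tendsto_const_nhds (x := sinSum (V n) (N n) x)).sub (hv x hx)).abs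
    have h2 : Tendsto (fun m => 9 * ‖x‖ * (δ n + δ m)) atTop (𝓝 (9 * ‖x‖ * (δ n + 0))) :=
      (hδ0.const_add _).const_mul _
    rw [add_zero] at h2
    exact le_of_tendsto_of_tendsto' h1 h2 fun m => hpt n m x hx
  have hcont : Continuous v := by
    have hloc : TendstoLocallyUniformly
        (fun n => (exteriorDomain R).indicator (sinSum (V n) (N n))) v atTop := by
      rw [Metric.tendstoLocallyUniformly_iff]
      intro ε hε x
      refine ⟨Metric.ball x 1, Metric.ball_mem_nhds x one_pos, ?_⟩
      have h1 : Tendsto (fun n => 9 * (‖x‖ + 1) * δ n) atTop (𝓝 0) := by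
        simpa using hδ0.const_mul (9 * (‖x‖ + 1))
      filter_upwards [h1.eventually_lt_const hε] with n hn y hy
      rw [dist_comm, Real.dist_eq]
      by_cases hyΩ : y ∈ exteriorDomain R
      · rw [indicator_of_mem hyΩ]
        refine (hunif n y hyΩ).trans_lt (lt_of_le_of_lt ?_ hn)
        have h2 : ‖y‖ ≤ ‖x‖ + 1 := by
          have : ‖y‖ ≤ ‖x‖ + ‖y - x‖ := by
            calc ‖y‖ = ‖x + (y - x)‖ := by congr 1; abel
              _ ≤ _ := norm_add_le _ _
          have h3 : ‖y - x‖ < 1 := by simpa [dist_eq_norm] using hy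
          linarith
        have h3 : 0 ≤ δ n := ENNReal.toReal_nonneg
        gcongr
      · rw [indicator_of_notMem hyΩ, hvz y (not_lt.1 hyΩ), sub_zero, abs_zero]
        exact hε
    exact hloc.continuous (Frequently.of_forall fun n => (hS n).continuous_indicator hR)
  have hae : v₀ =ᵐ[μ] v := ae_eq_of_tendsto (fun n => (hS n).memLp hk hR) hv₀ lv₀
    ((ae_restrict_mem (measurableSet_exteriorDomain R)).mono fun x hx => hv x hx)
  have hvm : MemLp v 2 μ := (memLp_congr_ae hae).1 hv₀
  have lv : Tendsto (fun n => eLpNorm (sinSum (V n) (N n) - v) 2 μ) atTop (𝓝 0) := by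
    refine lv₀.congr fun n => eLpNorm_congr_ae ?_
    filter_upwards [hae] with x hx
    simp [hx]
  refine ⟨v, g, h, ⟨hcont, fun x => hvz x, hvm, hg, hh, fun i => ?_, fun i j => ?_, ?_⟩,
    fun x hx => ?_, fun x hx => ?_, fun cF M hM hbF x hx => ?_⟩
  · exact IsWeakPartial.of_tendsto (fun n => (hS n).isWeakPartial hR i)
      (fun n => (hS n).memLp hk hR) (fun n => (hS n).memLp_grad hk hR i) hvm (hg i) lv (lg i)
  · exact IsWeakPartial.of_tendsto (fun n => (hS n).isWeakPartial_grad hR i j)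
      (fun n => (hS n).memLp_grad hk hR i) (fun n => (hS n).memLp_hess hk hR i j) (hg i) (hh i j)
      (lg i) (lh i j)
  · have hm : ∀ n, MemLp (sinSumHess (V n) (V₁ n) (V₂ n) (N n) 0 0 +
        sinSumHess (V n) (V₁ n) (V₂ n) (N n) 1 1 - sinSum (e n) (N n)) 2 μ := fun n =>
      (((hS n).memLp_hess hk hR 0 0).add ((hS n).memLp_hess hk hR 1 1)).sub (hF' n)
    have hm₀ : MemLp (h 0 0 + h 1 1 - F) 2 μ := ((hh 0 0).add (hh 1 1)).sub hF
    -- The combination `h 0 0 + h 1 1 - F` is an `L²` limit of functions whose pointwise limit is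
    -- `(|x|²/16 - 1) v`. Comparing the two limits avoids having to control `|x|² v` in `L²`.
    have hsum := ae_eq_of_tendsto (g := fun x => (‖x‖ ^ 2 / 16 - 1) * v x) hm hm₀ ?_ ?_
    · filter_upwards [hsum] with x hx
      simp only [Pi.sub_apply, Pi.add_apply] at hx
      rw [Fin.sum_univ_two]
      linarith
    · have h0 := ((lh 0 0).add (lh 1 1)).add hlim
      simp only [add_zero] at h0
      refine tendsto_of_tendsto_of_tendsto_of_le_of_le tendsto_const_nhds h0
        (fun _ => zero_le) fun n => ?_
      have e1 : (sinSumHess (V n) (V₁ n) (V₂ n) (N n) 0 0 +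
          sinSumHess (V n) (V₁ n) (V₂ n) (N n) 1 1 - sinSum (e n) (N n)) - (h 0 0 + h 1 1 - F) =
          ((sinSumHess (V n) (V₁ n) (V₂ n) (N n) 0 0 - h 0 0) +
          (sinSumHess (V n) (V₁ n) (V₂ n) (N n) 1 1 - h 1 1)) - (sinSum (e n) (N n) - F) := by
        abel
      rw [e1]
      have m0 := (((hS n).memLp_hess hk hR 0 0).sub (hh 0 0)).1
      have m1 := (((hS n).memLp_hess hk hR 1 1).sub (hh 1 1)).1
      refine (eLpNorm_sub_le (m0.add m1) ((hF' n).sub hF).1 (by norm_num)).trans ?_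
      gcongr
      exact eLpNorm_add_le m0 m1 (by norm_num)
    · filter_upwards [ae_restrict_mem (measurableSet_exteriorDomain R)] with x hx
      refine ((hv x hx).const_mul (‖x‖ ^ 2 / 16 - 1)).congr fun n => ?_
      have := (hS n).equation hR hx
      rw [Fin.sum_univ_two] at this
      simp only [Pi.sub_apply, Pi.add_apply]
      linarith
  · have hx' : R < ‖rotPlane (-(π / k)) x‖ := by rwa [norm_rotPlane]
    refine tendsto_nhds_unique (hv _ hx') (((hv x hx).neg).congr fun n => ?_)
    refine (sinSum_rotPlane (by omega : 0 < k) (fun l hl => ?_) (N n)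
      (ne_zero_of_mem_exteriorDomain hR hx)).symm
    rcases (hS n).zero l with h1 | h1
    · exact absurd h1.2 hl
    · exact h1.2.1
  · have hx' : R < ‖conjPlane x‖ := by rwa [norm_conjPlane]
    exact tendsto_nhds_unique (hv _ hx') (((hv x hx).neg).congr fun n =>
      (sinSum_conjPlane (V n) (N n) (ne_zero_of_mem_exteriorDomain hR hx)).symm)
  · exact le_of_tendsto' (hv x hx).abs fun n => (hS n).abs_sinSum_le hk hR hM
      (hb cF (fun r => M * (exp (-(r ^ 2 / 8)) / r)) hbF n) hx

/-! ### Conjugation by Gaussian weights -/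

/-- The Gaussian weight `exp (c |x|²)`. -/
def gaussWeight (c : ℝ) (x : Plane) : ℝ := exp (c * ‖x‖ ^ 2)

theorem contDiff_gaussWeight (c : ℝ) : ContDiff ℝ ∞ (gaussWeight c) :=
  (contDiff_const.mul (contDiff_norm_sq ℝ)).exp

theorem partialDeriv_gaussWeight (c : ℝ) (i : Fin 2) (x : Plane) :
    partialDeriv i (gaussWeight c) x = gaussWeight c x * (2 * c * x i) := by
  have h1 : HasFDerivAt (fun y : Plane => exp (c * ‖y‖ ^ 2)) _ x :=
    ((hasStrictFDerivAt_norm_sq x).hasFDerivAt.const_mul c).exp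
  rw [partialDeriv]
  change fderiv ℝ (fun y : Plane => exp (c * ‖y‖ ^ 2)) x _ = _
  rw [h1.fderiv]
  simp [EuclideanSpace.inner_single_right, gaussWeight]
  ring

theorem partialDeriv_coord (i : Fin 2) (x : Plane) :
    partialDeriv i (fun y => y i) x = 1 := by
  have h : HasFDerivAt (fun y : Plane => y i) (EuclideanSpace.proj (𝕜 := ℝ) i) x :=
    (EuclideanSpace.proj (𝕜 := ℝ) i).hasFDerivAt
  rw [partialDeriv, h.fderiv]
  simp

theorem partialDeriv_const_mul {φ : Plane → ℝ} (hφ : ContDiff ℝ ∞ φ) (c : ℝ) (i : Fin 2)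
    (x : Plane) : partialDeriv i (fun y => c * φ y) x = c * partialDeriv i φ x := by
  rw [partialDeriv, fderiv_const_mul ((hφ.differentiable (by simp)) x)]
  simp [partialDeriv]

theorem partialDeriv_partialDeriv_gaussWeight (c : ℝ) (i : Fin 2) (x : Plane) :
    partialDeriv i (partialDeriv i (gaussWeight c)) x =
      gaussWeight c x * (2 * c + 4 * c ^ 2 * x i ^ 2) := by
  have e : partialDeriv i (gaussWeight c) = fun x => gaussWeight c x * (2 * c * x i) :=
    funext fun y => partialDeriv_gaussWeight c i y
  have hco : ContDiff ℝ ∞ fun y : Plane => y i := (EuclideanSpace.proj (𝕜 := ℝ) i).contDiff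
  rw [e, partialDeriv_mul (contDiff_gaussWeight c) (contDiff_const.mul hco),
    partialDeriv_const_mul hco, partialDeriv_coord, partialDeriv_gaussWeight]
  ring

section

variable {Ω : Set Plane}

theorem isWeakPartial_gaussWeight_mul (hΩ : IsOpen Ω) {i : Fin 2} {u g : Plane → ℝ}
    (h1 : IsWeakPartial Ω i u g) (c : ℝ) :
    IsWeakPartial Ω i (fun x => gaussWeight c x * u x)
      (fun x => gaussWeight c x * (g x + 2 * c * x i * u x)) := by
  have := h1.mul_smooth hΩ (contDiff_gaussWeight c)
  convert this using 2 with x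
  rw [partialDeriv_gaussWeight]
  ring

theorem isWeakPartial_gaussWeight_mul₂ (hΩ : IsOpen Ω) {i : Fin 2} {u g h : Plane → ℝ}
    (h1 : IsWeakPartial Ω i u g) (h2 : IsWeakPartial Ω i g h) (c : ℝ) :
    IsWeakPartial Ω i (fun x => gaussWeight c x * (g x + 2 * c * x i * u x))
      (fun x => gaussWeight c x *
        (h x + 4 * c * x i * g x + (2 * c + 4 * c ^ 2 * x i ^ 2) * u x)) := by
  have d1 := h2.mul_smooth hΩ (contDiff_gaussWeight c)
  have d2 := h1.mul_smooth hΩ (contDiff_partialDeriv (contDiff_gaussWeight c) i)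
  convert d1.add d2 using 2 with x x
  · rw [partialDeriv_gaussWeight]
    ring
  · rw [partialDeriv_partialDeriv_gaussWeight, partialDeriv_gaussWeight]
    ring

/-- `v` is a weak solution of `Δ v - |x|² v / 16 + v = F`. -/
def OscEq (Ω : Set Plane) (v F : Plane → ℝ) : Prop :=
  ∃ g h : Fin 2 → Plane → ℝ,
    (∀ i, IsWeakPartial Ω i v (g i)) ∧ (∀ i, IsWeakPartial Ω i (g i) (h i)) ∧
      ∀ᵐ x ∂(volume.restrict Ω), ∑ i, h i x = (‖x‖ ^ 2 / 16 - 1) * v x + F x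

/-- For the weight `e^{|x|²/8}` the cross term `2∇(|x|²/8) · ∇v = x · ∇v / 2` cancels the drift, and
the zero-order terms add up to `1 - |x|²/16`. -/
theorem OscEq.lpEq (hΩ : IsOpen Ω) {v E : Plane → ℝ}
    (h : OscEq Ω v fun x => exp (-(‖x‖ ^ 2 / 8)) * E x) :
    LPEq Ω (fun x => exp (‖x‖ ^ 2 / 8) * v x) E := by
  obtain ⟨g, h, h1, h2, h3⟩ := h
  have ew : (fun x => exp (‖x‖ ^ 2 / 8) * v x) = fun x => gaussWeight (1 / 8) x * v x := by
    funext x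
    rw [gaussWeight]
    congr 2
    ring
  rw [ew]
  refine ⟨_, _, fun i => isWeakPartial_gaussWeight_mul hΩ (h1 i) (1 / 8),
    fun i => isWeakPartial_gaussWeight_mul₂ hΩ (h1 i) (h2 i) (1 / 8), ?_⟩
  filter_upwards [h3] with x hx
  have hn := norm_sq_plane x
  have hG : gaussWeight (1 / 8) x * exp (-(‖x‖ ^ 2 / 8)) = 1 := by
    rw [gaussWeight, ← exp_add]
    simp only [exp_eq_one_iff]
    ring
  rw [Fin.sum_univ_two] at hx ⊢
  rw [Fin.sum_univ_two]
  rw [hn] at hx hG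
  linear_combination gaussWeight (1 / 8) x * hx + E x * hG

theorem LPEq.oscEq (hΩ : IsOpen Ω) {u E : Plane → ℝ} (h : LPEq Ω u E) :
    OscEq Ω (fun x => exp (-(‖x‖ ^ 2 / 8)) * u x) fun x => exp (-(‖x‖ ^ 2 / 8)) * E x := by
  obtain ⟨g, h, h1, h2, h3⟩ := h
  have ew : ∀ x : Plane, exp (-(‖x‖ ^ 2 / 8)) = gaussWeight (-(1 / 8)) x := by
    intro x
    rw [gaussWeight]
    congr 1
    ring
  simp only [ew]
  refine ⟨_, _, fun i => isWeakPartial_gaussWeight_mul hΩ (h1 i) (-(1 / 8)),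
    fun i => isWeakPartial_gaussWeight_mul₂ hΩ (h1 i) (h2 i) (-(1 / 8)), ?_⟩
  filter_upwards [h3] with x hx
  have hn := norm_sq_plane x
  rw [Fin.sum_univ_two, Fin.sum_univ_two] at hx
  rw [Fin.sum_univ_two, hn]
  linear_combination gaussWeight (-(1 / 8)) x * hx

theorem OscEq.sub {v v' F F' : Plane → ℝ} (h : OscEq Ω v F) (h' : OscEq Ω v' F') :
    OscEq Ω (fun x => v x - v' x) fun x => F x - F' x := by
  obtain ⟨g, h, h1, h2, h3⟩ := h
  obtain ⟨g', h', h1', h2', h3'⟩ := h'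
  refine ⟨_, _, fun i => (h1 i).sub (h1' i), fun i => (h2 i).sub (h2' i), ?_⟩
  filter_upwards [h3, h3'] with x hx hx'
  rw [Finset.sum_sub_distrib, hx, hx']
  ring

theorem PlaneSol.oscEq {R : ℝ} {F v : Plane → ℝ} {g : Fin 2 → Plane → ℝ}
    {h : Fin 2 → Fin 2 → Plane → ℝ} (hs : PlaneSol R F v g h) : OscEq (exteriorDomain R) v F :=
  ⟨g, fun i => h i i, hs.grad, fun i => hs.hess i i, hs.equation⟩

/-- The distributional form of the homogeneous equation. -/
theorem OscEq.integral_eq_zero {z : Plane → ℝ} (h : OscEq Ω z fun _ => 0)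
    {φ : Plane → ℝ} (hφ : ContDiff ℝ ∞ φ) (hc : HasCompactSupport φ) (hs : tsupport φ ⊆ Ω) :
    ∫ x in Ω, z x * ((∑ i, partialDeriv i (partialDeriv i φ) x) -
      (‖x‖ ^ 2 / 16 - 1) * φ x) = 0 := by
  obtain ⟨g, h, h1, h2, h3⟩ := h
  have hsd : ∀ i, tsupport (partialDeriv i φ) ⊆ Ω := fun i =>
    (tsupport_partialDeriv_subset φ i).trans hs
  have key : ∀ i, ∫ x in Ω, z x * partialDeriv i (partialDeriv i φ) x = ∫ x in Ω, h i x * φ x := by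
    intro i
    rw [(h1 i).2.2 _ (contDiff_partialDeriv hφ i) (hasCompactSupport_partialDeriv hc i) (hsd i),
      (h2 i).2.2 φ hφ hc hs, neg_neg]
  have i1 : ∀ i, IntegrableOn (fun x => z x * partialDeriv i (partialDeriv i φ) x) Ω := fun i =>
    (integrable_mul_of_tsupport_subset (h1 i).1
      (continuous_partialDeriv (contDiff_partialDeriv hφ i) i)
      (hasCompactSupport_partialDeriv (hasCompactSupport_partialDeriv hc i) i)
      ((tsupport_partialDeriv_subset _ i).trans (hsd i))).integrableOn
  have i2 : ∀ i, IntegrableOn (fun x => h i x * φ x) Ω := fun i =>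
    (integrable_mul_of_tsupport_subset (h2 i).2.1 hφ.continuous hc hs).integrableOn
  have i3 : IntegrableOn (fun x => z x * ((‖x‖ ^ 2 / 16 - 1) * φ x)) Ω :=
    (integrable_mul_of_tsupport_subset (h1 0).1
      ((by fun_prop : Continuous fun x : Plane => ‖x‖ ^ 2 / 16 - 1).mul hφ.continuous)
      hc.mul_left (tsupport_mul_subset_right.trans hs)).integrableOn
  have i4 : IntegrableOn (fun x => z x * partialDeriv 0 (partialDeriv 0 φ) x +
      z x * partialDeriv 1 (partialDeriv 1 φ) x) Ω := (i1 0).add (i1 1)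
  simp only [Fin.sum_univ_two, mul_sub, mul_add]
  rw [integral_sub i4 i3, integral_add (i1 0) (i1 1), key, key,
    ← integral_add (i2 0) (i2 1), sub_eq_zero]
  refine integral_congr_ae ?_
  filter_upwards [h3] with x hx
  rw [Fin.sum_univ_two, add_zero] at hx
  linear_combination φ x * hx

end

/-! ### Derivatives of the radial cutoff functions -/

/-- The first derivative of `radialCutoff`. -/
def radialCutoff₁ (R : ℝ) (n : ℕ) (r : ℝ) : ℝ :=
  ((n : ℝ) + 1) * deriv smoothTransition (((n : ℝ) + 1) * (r - R) - 1) *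
      smoothTransition ((n : ℝ) + 2 - r) -
    smoothTransition (((n : ℝ) + 1) * (r - R) - 1) * deriv smoothTransition ((n : ℝ) + 2 - r)

/-- The second derivative of `radialCutoff`. -/
def radialCutoff₂ (R : ℝ) (n : ℕ) (r : ℝ) : ℝ :=
  ((n : ℝ) + 1) ^ 2 * deriv (deriv smoothTransition) (((n : ℝ) + 1) * (r - R) - 1) *
      smoothTransition ((n : ℝ) + 2 - r) -
    2 * ((n : ℝ) + 1) * deriv smoothTransition (((n : ℝ) + 1) * (r - R) - 1) *
      deriv smoothTransition ((n : ℝ) + 2 - r) +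
    smoothTransition (((n : ℝ) + 1) * (r - R) - 1) *
      deriv (deriv smoothTransition) ((n : ℝ) + 2 - r)

section

variable (R : ℝ) (n : ℕ)

theorem hasDerivAt_inner_arg (r : ℝ) :
    HasDerivAt (fun r : ℝ => ((n : ℝ) + 1) * (r - R) - 1) ((n : ℝ) + 1) r := by
  simpa using (((hasDerivAt_id r).sub_const R).const_mul ((n : ℝ) + 1)).sub_const 1

theorem hasDerivAt_outer_arg (r : ℝ) :
    HasDerivAt (fun r : ℝ => (n : ℝ) + 2 - r) (-1) r := by
  simpa using (hasDerivAt_id r).const_sub ((n : ℝ) + 2)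

theorem hasDerivAt_radialCutoff (r : ℝ) :
    HasDerivAt (radialCutoff R n) (radialCutoff₁ R n r) r := by
  have h1 := (hasDerivAt_smoothTransition _).comp r (hasDerivAt_inner_arg R n r)
  have h2 := (hasDerivAt_smoothTransition _).comp r (hasDerivAt_outer_arg n r)
  refine (h1.mul h2).congr_deriv ?_
  simp only [radialCutoff₁, Function.comp]
  ring

theorem hasDerivAt_radialCutoff₁ (r : ℝ) :
    HasDerivAt (radialCutoff₁ R n) (radialCutoff₂ R n r) r := by
  have h1 := (hasDerivAt_smoothTransition _).comp r (hasDerivAt_inner_arg R n r)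
  have h2 := (hasDerivAt_smoothTransition _).comp r (hasDerivAt_outer_arg n r)
  have h3 := (hasDerivAt_deriv_smoothTransition _).comp r (hasDerivAt_inner_arg R n r)
  have h4 := (hasDerivAt_deriv_smoothTransition _).comp r (hasDerivAt_outer_arg n r)
  refine (((h3.const_mul ((n : ℝ) + 1)).mul h2).sub (h1.mul h4)).congr_deriv ?_
  simp only [radialCutoff₂, Function.comp]
  ring

theorem continuous_radialCutoff₁ : Continuous (radialCutoff₁ R n) :=
  continuous_iff_continuousAt.2 fun r => (hasDerivAt_radialCutoff₁ R n r).continuousAt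

theorem continuous_radialCutoff₂ : Continuous (radialCutoff₂ R n) := by
  have c0 := (Real.smoothTransition.contDiff (n := 1)).continuous
  have c1 := contDiff_deriv_smoothTransition.continuous
  have c2 := continuous_deriv_deriv_smoothTransition
  have d1 : Continuous fun r : ℝ => ((n : ℝ) + 1) * (r - R) - 1 := by fun_prop
  have d2 : Continuous fun r : ℝ => (n : ℝ) + 2 - r := by fun_prop
  exact ((((continuous_const.mul (c2.comp d1)).mul (c0.comp d2)).sub
    ((continuous_const.mul (c1.comp d1)).mul (c1.comp d2))).add ((c0.comp d1).mul (c2.comp d2)))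

variable {R n}

/-- The cutoff has two transition zones, `1 ≤ (n + 1)(r - R) ≤ 2` and `n + 1 ≤ r ≤ n + 2`. Left of
`n + 1` only the inner one is active, with derivatives growing like powers of `n + 1`. The next
lemma isolates the outer zone, where the derivatives stay bounded. -/
theorem radialCutoff₁_of_lt {r : ℝ} (h : r < n + 1) :
    radialCutoff₁ R n r = ((n : ℝ) + 1) * deriv smoothTransition (((n : ℝ) + 1) * (r - R) - 1) ∧
    radialCutoff₂ R n r =
      ((n : ℝ) + 1) ^ 2 * deriv (deriv smoothTransition) (((n : ℝ) + 1) * (r - R) - 1) := by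
  have h1 : (n : ℝ) + 2 - r ∉ Icc (0 : ℝ) 1 := fun hh => by linarith [hh.2]
  obtain ⟨h2, h3⟩ := deriv_smoothTransition_eq_zero h1
  have h4 := smoothTransition.one_of_one_le (x := (n : ℝ) + 2 - r) (by linarith)
  rw [radialCutoff₁, radialCutoff₂, h2, h3, h4]
  constructor <;> ring

theorem radialCutoff₁_of_gt {r : ℝ} (h : 2 < ((n : ℝ) + 1) * (r - R)) :
    radialCutoff₁ R n r = -deriv smoothTransition ((n : ℝ) + 2 - r) ∧
    radialCutoff₂ R n r = deriv (deriv smoothTransition) ((n : ℝ) + 2 - r) := by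
  have h1 : ((n : ℝ) + 1) * (r - R) - 1 ∉ Icc (0 : ℝ) 1 := fun hh => by linarith [hh.2]
  obtain ⟨h2, h3⟩ := deriv_smoothTransition_eq_zero h1
  have h4 := smoothTransition.one_of_one_le (x := ((n : ℝ) + 1) * (r - R) - 1) (by linarith)
  rw [radialCutoff₁, radialCutoff₂, h2, h3, h4]
  constructor <;> ring

theorem radialCutoff₁_eq_zero {r : ℝ} (h1 : 2 < ((n : ℝ) + 1) * (r - R)) (h2 : r < n + 1) :
    radialCutoff₁ R n r = 0 ∧ radialCutoff₂ R n r = 0 := by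
  have h3 : ((n : ℝ) + 1) * (r - R) - 1 ∉ Icc (0 : ℝ) 1 := fun hh => by linarith [hh.2]
  obtain ⟨h4, h5⟩ := deriv_smoothTransition_eq_zero h3
  obtain ⟨h6, h7⟩ := radialCutoff₁_of_lt (R := R) h2
  rw [h6, h7, h4, h5]
  simp

theorem radialCutoff₁_eq_zero_of_notMem {r : ℝ}
    (h : r ∉ Icc (R + 1 / ((n : ℝ) + 1)) ((n : ℝ) + 2)) :
    radialCutoff₁ R n r = 0 ∧ radialCutoff₂ R n r = 0 := by
  have hz : radialCutoff R n =ᶠ[𝓝 r] fun _ => 0 := by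
    filter_upwards [isClosed_Icc.isOpen_compl.mem_nhds h] with s hs
    exact radialCutoff_eq_zero R n hs
  have h1 : radialCutoff₁ R n =ᶠ[𝓝 r] fun _ => 0 := by
    have h2 := hz.deriv
    have h3 : deriv (radialCutoff R n) = radialCutoff₁ R n :=
      funext fun s => (hasDerivAt_radialCutoff R n s).deriv
    rw [h3] at h2
    simpa using h2
  refine ⟨h1.self_of_nhds, ?_⟩
  have := h1.deriv_eq
  rwa [(hasDerivAt_radialCutoff₁ R n r).deriv, deriv_const] at this

end

/-! ### Smooth test functions with one angular mode -/

theorem contDiffAt_sinMode (l : ℕ) {x : Plane} (hx : x ≠ 0) : ContDiffAt ℝ ∞ (sinMode l) x := by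
  have e : sinMode l = fun y => (‖y‖⁻¹) ^ l * ((toComplex y) ^ l).im := by
    funext y
    rw [sinMode, angMode, div_pow, ← Complex.ofReal_pow, Complex.div_ofReal_im, inv_pow,
      div_eq_inv_mul]
  have hco : ∀ i, ContDiff ℝ ∞ fun y : Plane => (y i : ℂ) := fun i =>
    Complex.ofRealCLM.contDiff.comp (EuclideanSpace.proj (𝕜 := ℝ) i).contDiff
  have ht : toComplex = fun y : Plane => (y 0 : ℂ) + y 1 * Complex.I := by
    funext y
    apply Complex.ext <;> simp [toComplex]
  have hc : ContDiff ℝ ∞ fun y : Plane => ((toComplex y) ^ l).im := by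
    rw [ht]
    exact Complex.imCLM.contDiff.comp (((hco 0).add ((hco 1).mul contDiff_const)).pow l)
  rw [e]
  exact (((contDiffAt_norm ℝ hx).inv (norm_ne_zero_iff.2 hx)).pow l).mul hc.contDiffAt

theorem contDiff_radial_mul_sinMode {R : ℝ} (hR : 0 ≤ R) {A : ℝ → ℝ} {a b : ℝ} (ha : R < a)
    (hA : ContDiffOn ℝ ∞ A (Ioi R)) (hs : ∀ r ∉ Icc a b, A r = 0) (m : ℕ) :
    ContDiff ℝ ∞ fun x : Plane => A ‖x‖ * sinMode m x := by
  rw [contDiff_iff_contDiffAt]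
  intro x
  by_cases hx : R < ‖x‖
  · have hx0 : x ≠ 0 := ne_zero_of_mem_exteriorDomain hR hx
    exact ((hA.contDiffAt (Ioi_mem_nhds hx)).comp x (contDiffAt_norm ℝ hx0)).mul
      (contDiffAt_sinMode m hx0)
  · have hlt : ‖x‖ < a := by linarith [not_lt.1 hx]
    have : (fun x : Plane => A ‖x‖ * sinMode m x) =ᶠ[𝓝 x] fun _ => 0 := by
      filter_upwards [(isOpen_lt continuous_norm continuous_const).mem_nhds hlt] with y hy
      rw [hs _ fun h => absurd h.1 (not_le.2 hy), zero_mul]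
    exact contDiffAt_const.congr_of_eventuallyEq this

theorem sinSum_single (A : ℝ → ℝ) (m : ℕ) :
    sinSum (fun l => if l = m then A else 0) (m + 1) = fun x => A ‖x‖ * sinMode m x := by
  funext x
  rw [sinSum, Finset.sum_eq_single m]
  · simp
  · intro l _ hl
    simp [hl]
  · simp

theorem laplacian_radial_mul_sinMode {R : ℝ} (hR : 0 ≤ R) {A A₁ A₂ : ℝ → ℝ} (m : ℕ)
    (hφ : ContDiff ℝ ∞ fun x : Plane => A ‖x‖ * sinMode m x)
    (h1 : ∀ r, R < r → HasDerivAt A (A₁ r) r) (h2 : ∀ r, R < r → HasDerivAt A₁ (A₂ r) r)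
    {x : Plane} (hx : x ∈ exteriorDomain R) :
    ∑ i, partialDeriv i (partialDeriv i fun x : Plane => A ‖x‖ * sinMode m x) x =
      (A₂ ‖x‖ + A₁ ‖x‖ / ‖x‖ - (m : ℝ) ^ 2 / ‖x‖ ^ 2 * A ‖x‖) * sinMode m x := by
  set B : ℕ → ℝ → ℝ := fun l => if l = m then A else 0 with hB
  set B₁ : ℕ → ℝ → ℝ := fun l => if l = m then A₁ else 0 with hB₁
  set B₂ : ℕ → ℝ → ℝ := fun l => if l = m then A₂ else 0 with hB₂
  have d1 : ∀ y ∈ exteriorDomain R, ∀ l, HasDerivAt (B l) (B₁ l ‖y‖) ‖y‖ := fun y hy l => by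
    by_cases hl : l = m
    · simpa [hB, hB₁, hl] using h1 ‖y‖ hy
    · simp [hB, hB₁, hl]
  have d2 : ∀ y ∈ exteriorDomain R, ∀ l, HasDerivAt (B₁ l) (B₂ l ‖y‖) ‖y‖ := fun y hy l => by
    by_cases hl : l = m
    · simpa [hB₂, hB₁, hl] using h2 ‖y‖ hy
    · simp [hB₂, hB₁, hl]
  rw [← sinSum_single] at hφ ⊢
  have e1 : ∀ i, ∀ y ∈ exteriorDomain R,
      partialDeriv i (sinSum B (m + 1)) y = sinSumGrad B B₁ (m + 1) i y := fun i y hy =>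
    (hasLineDerivAt_of_contDiff hφ i y).unique
      (hasLineDerivAt_sinSum (ne_zero_of_mem_exteriorDomain hR hy) (d1 y hy) i)
  have e2 : ∀ i, partialDeriv i (partialDeriv i (sinSum B (m + 1))) x =
      sinSumHess B B₁ B₂ (m + 1) i i x := fun i => by
    have h3 := hasLineDerivAt_sinSumGrad (N := m + 1) (ne_zero_of_mem_exteriorDomain hR hx)
      (d1 x hx) (d2 x hx) i i
    refine (hasLineDerivAt_of_contDiff (contDiff_partialDeriv hφ i) i x).unique
      (h3.congr_of_eventuallyEq ?_)
    filter_upwards [(isOpen_exteriorDomain R).mem_nhds hx] with y hy using e1 i y hy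
  change ∑ i, partialDeriv i (partialDeriv i (sinSum B (m + 1))) x = _
  simp only [e2]
  rw [sinSumHess_trace _ _ _ _ (ne_zero_of_mem_exteriorDomain hR hx), sinSum,
    Finset.sum_eq_single m]
  · simp [hB, hB₁, hB₂]
  · intro l _ hl
    simp [hB, hB₁, hB₂, hl]
  · simp

/-! ### Uniqueness by duality -/

section

variable {R : ℝ} {m : ℕ} {e V V₁ V₂ : ℝ → ℝ} {z : Plane → ℝ}

theorem radialTest_of_continuousOn {A : ℝ → ℝ} {a b : ℝ} (ha : R < a)
    (hA : ContinuousOn A (Ioi R)) (hs : ∀ r ∉ Icc a b, A r = 0) : RadialTest R A := by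
  refine ⟨continuous_iff_continuousAt.2 fun r => ?_, a, b, ha, hs⟩
  by_cases hr : R < r
  · exact hA.continuousAt (Ioi_mem_nhds hr)
  · have : A =ᶠ[𝓝 r] fun _ => 0 := by
      filter_upwards [Iio_mem_nhds (lt_of_le_of_lt (not_lt.1 hr) ha)] with s hs'
      exact hs s fun h => absurd h.1 (not_le.2 hs')
    exact continuousAt_const.congr this.symm

/-- The error made by cutting off a solution of the radial equation. -/
def cutoffErr (R : ℝ) (n : ℕ) (V V₁ : ℝ → ℝ) (r : ℝ) : ℝ :=
  2 * radialCutoff₁ R n r * V₁ r + (radialCutoff₂ R n r + radialCutoff₁ R n r / r) * V r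

theorem lt_add_one_div (R : ℝ) (n : ℕ) : R < R + 1 / ((n : ℝ) + 1) := by
  have : (0 : ℝ) < 1 / ((n : ℝ) + 1) := by positivity
  linarith

theorem radialTest_cutoffErr (hR : 0 ≤ R) (h : ModeSol R m e V V₁ V₂) (n : ℕ) :
    RadialTest R (cutoffErr R n V V₁) := by
  refine radialTest_of_continuousOn (lt_add_one_div R n) ?_ (b := (n : ℝ) + 2) fun r hr => ?_
  · have c1 := (continuous_radialCutoff₁ R n).continuousOn (s := Ioi R)
    have c2 := (continuous_radialCutoff₂ R n).continuousOn (s := Ioi R)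
    have c3 : ContinuousOn (fun r => radialCutoff₁ R n r / r) (Ioi R) := by
      simpa using continuousOn_div_pow hR c1 1
    exact ((continuousOn_const.mul c1).mul h.continuousOn₁).add ((c2.add c3).mul h.continuousOn)
  · obtain ⟨h1, h2⟩ := radialCutoff₁_eq_zero_of_notMem hr
    simp [cutoffErr, h1, h2]

theorem radialTest_radialCutoff_mul (h : ContinuousOn V (Ioi R)) (n : ℕ) :
    RadialTest R fun r => radialCutoff R n r * V r :=
  radialTest_of_continuousOn (lt_add_one_div R n)
    ((contDiff_radialCutoff R n).continuous.continuousOn.mul h) (b := (n : ℝ) + 2) fun r hr => by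
      rw [radialCutoff_eq_zero R n hr, zero_mul]

/-- Test the homogeneous equation with `χ V sin (mθ)`, `χ = radialCutoff R n`. The radial equation
turns the main part into `χ e`, and `cutoffErr` is the commutator of the operator with `χ`. -/
theorem integral_cutoff_mode_eq_zero (hR : 0 ≤ R) (h : ModeSol R m e V V₁ V₂)
    (he : ContDiff ℝ ∞ e) (hosc : OscEq (exteriorDomain R) z fun _ => 0) (n : ℕ) :
    ∫ x in exteriorDomain R, z x *
      ((radialCutoff R n ‖x‖ * e ‖x‖ + cutoffErr R n V V₁ ‖x‖) * sinMode m x) = 0 := by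
  set A : ℝ → ℝ := fun r => radialCutoff R n r * V r with hA
  have hsupp : ∀ r ∉ Icc (R + 1 / ((n : ℝ) + 1)) ((n : ℝ) + 2), A r = 0 := fun r hr => by
    simp only [hA]
    rw [radialCutoff_eq_zero R n hr, zero_mul]
  have hφ : ContDiff ℝ ∞ fun x : Plane => A ‖x‖ * sinMode m x :=
    contDiff_radial_mul_sinMode hR (lt_add_one_div R n)
      ((contDiff_radialCutoff R n).contDiffOn.mul (h.contDiffOn hR he)) hsupp m
  have hc := hasCompactSupport_radial_mul (radialTest_radialCutoff_mul h.continuousOn n) (sinMode m)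
  have hts : (tsupport fun x : Plane => A ‖x‖ * sinMode m x) ⊆ exteriorDomain R := by
    have hcl : IsClosed {x : Plane | R + 1 / ((n : ℝ) + 1) ≤ ‖x‖} :=
      isClosed_le continuous_const continuous_norm
    refine (closure_minimal (fun x hx => ?_) hcl).trans fun x hx =>
      lt_of_lt_of_le (lt_add_one_div R n) hx
    by_contra hlt
    refine hx ?_
    simp only
    rw [hsupp _ fun hh => hlt hh.1, zero_mul]
  have key := hosc.integral_eq_zero hφ hc hts
  rw [← key]
  refine setIntegral_congr_fun (measurableSet_exteriorDomain R) fun x hx => ?_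
  rw [laplacian_radial_mul_sinMode hR (A := A)
    (A₁ := fun r => radialCutoff₁ R n r * V r + radialCutoff R n r * V₁ r)
    (A₂ := fun r => (radialCutoff₂ R n r * V r + radialCutoff₁ R n r * V₁ r) +
      (radialCutoff₁ R n r * V₁ r + radialCutoff R n r * V₂ r)) m hφ
    (fun r hr => (hasDerivAt_radialCutoff R n r).mul (h.deriv r hr))
    (fun r hr => ((hasDerivAt_radialCutoff₁ R n r).mul (h.deriv r hr)).add
      ((hasDerivAt_radialCutoff R n r).mul (h.deriv₁ r hr))) hx]
  have hode := h.ode ‖x‖ hx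
  rw [radialPot] at hode
  simp only [hA, cutoffErr]
  linear_combination -(z x * radialCutoff R n ‖x‖ * sinMode m x) * hode

theorem memLp_mode (hR : 0 ≤ R) (hm : 3 ≤ m) (h : ModeSol R m e V V₁ V₂) {A : ℝ → ℝ}
    (hA : ContinuousOn A (Ioi R)) (hb : ∀ r, R < r → A r ^ 2 ≤
      60 * (radialPot m r * V₁ r ^ 2 + radialPot m r ^ 2 * V r ^ 2 / 18) + 3 * e r ^ 2) :
    MemLp (fun x => A ‖x‖ * sinMode m x) 2 (volume.restrict (exteriorDomain R)) := by
  have hc : ∀ l, ContinuousOn ((fun l => if l = m then A else 0 : ℕ → ℝ → ℝ) l) (Ioi R) := by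
    intro l
    by_cases hl : l = m
    · simpa only [if_pos hl] using hA
    · simp only [if_neg hl]
      exact continuousOn_const
  rw [← sinSum_single]
  refine ⟨(continuousOn_sinSum hR hc _).aestronglyMeasurable (measurableSet_exteriorDomain R), ?_⟩
  have h1 := sq_eLpNorm_sinSum hR hc (if_neg (by omega)) (m + 1)
  have h2 : eLpNorm (sinSum (fun l => if l = m then A else 0) (m + 1)) 2
      (volume.restrict (exteriorDomain R)) ^ 2 < ⊤ := by
    rw [h1]
    refine ENNReal.mul_lt_top ENNReal.ofReal_lt_top (ENNReal.sum_lt_top.2 fun l _ => ?_)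
    by_cases hl : l = m
    · rw [if_pos hl]
      refine (h.radialNorm_le hR hm hb).trans_lt (ENNReal.mul_lt_top (by norm_num) ?_)
      rw [h.radialNorm_rhs hR]
      exact ENNReal.ofReal_lt_top
    · rw [if_neg hl]
      simp [radialNorm]
  by_contra hcon
  rw [not_lt, top_le_iff] at hcon
  rw [hcon] at h2
  simp at h2

theorem tendsto_integral_of_memLp_bound {S : Set Plane} (hS : MeasurableSet S)
    (hz : MemLp z 2 (volume.restrict S)) {D : ℕ → Plane → ℝ} {B : Plane → ℝ}
    (hD : ∀ n, AEStronglyMeasurable (D n) (volume.restrict S))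
    (hB : MemLp B 2 (volume.restrict S)) (hle : ∀ᶠ n in atTop, ∀ x ∈ S, |D n x| ≤ B x)
    (h0 : ∀ x ∈ S, ∀ᶠ n in atTop, D n x = 0) :
    Tendsto (fun n => ∫ x in S, z x * D n x) atTop (𝓝 0) := by
  have := tendsto_integral_filter_of_dominated_convergence (μ := volume.restrict S)
    (F := fun n x => z x * D n x) (f := fun _ => 0) (l := atTop) (fun x => ‖z x * B x‖)
    (Eventually.of_forall fun n => hz.1.mul (hD n)) ?_ (hz.integrable_mul hB).norm ?_
  · simpa using this
  · filter_upwards [hle] with n hn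
    filter_upwards [ae_restrict_mem hS] with x hx
    rw [norm_mul, norm_mul]
    exact mul_le_mul_of_nonneg_left ((hn x hx).trans (le_abs_self _)) (norm_nonneg _)
  · filter_upwards [ae_restrict_mem hS] with x hx
    refine tendsto_const_nhds.congr' ?_
    filter_upwards [h0 x hx] with n hn
    rw [hn, mul_zero]

theorem cutoffErr_eventually_zero {r : ℝ} (hr : R < r) :
    ∀ᶠ n : ℕ in atTop, cutoffErr R n V V₁ r = 0 := by
  filter_upwards [eventually_radialCutoff_conditions hr] with n hn
  obtain ⟨h1, h2⟩ := radialCutoff₁_eq_zero hn.1 hn.2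
  simp [cutoffErr, h1, h2]

theorem abs_cutoffErr_outer_le {K : ℝ} (hK : ∀ t, |deriv smoothTransition t| ≤ K ∧
    |deriv (deriv smoothTransition) t| ≤ K) (hR : 0 ≤ R) {n : ℕ} (hn : 1 < n) {r : ℝ}
    (hr : R + 1 < r) : |cutoffErr R n V V₁ r| ≤ 2 * K * |V₁ r| + 2 * K * |V r| := by
  have hn' : (1 : ℝ) < n := by exact_mod_cast hn
  -- For `n > 1` the inner transition is already complete at distance `1` from `R`.
  have h2 : 2 < ((n : ℝ) + 1) * (r - R) := by nlinarith
  obtain ⟨e1, e2⟩ := radialCutoff₁_of_gt h2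
  obtain ⟨k1, k2⟩ := hK ((n : ℝ) + 2 - r)
  have hr1 : 1 < r := by linarith
  have hK0 : 0 ≤ K := (abs_nonneg _).trans k1
  rw [cutoffErr, e1, e2]
  set s := deriv smoothTransition ((n : ℝ) + 2 - r)
  set s' := deriv (deriv smoothTransition) ((n : ℝ) + 2 - r)
  have k3 : |-s / r| ≤ K := by
    rw [abs_div, abs_neg, abs_of_pos (by linarith : 0 < r), div_le_iff₀ (by linarith)]
    nlinarith
  calc |2 * -s * V₁ r + (s' + -s / r) * V r| ≤ |2 * -s * V₁ r| + |(s' + -s / r) * V r| :=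
        abs_add_le _ _
    _ = 2 * |s| * |V₁ r| + |s' + -s / r| * |V r| := by
        rw [abs_mul, abs_mul, abs_mul, abs_neg, abs_two]
    _ ≤ 2 * K * |V₁ r| + (K + K) * |V r| := by
        gcongr
        exact (abs_add_le _ _).trans (add_le_add k2 k3)
    _ = _ := by ring

/-- In the inner region the cutoff error lives where `1 ≤ (n + 1) (r - R) ≤ 2`. -/
theorem cutoffErr_inner {K : ℝ} (hK : ∀ t, |deriv smoothTransition t| ≤ K ∧
    |deriv (deriv smoothTransition) t| ≤ K) (hR : 0 ≤ R) {n : ℕ} {r : ℝ} (hr : R < r)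
    (hrn : r < n + 1) :
    (((n : ℝ) + 1) * (r - R) ∉ Icc (1 : ℝ) 2 → cutoffErr R n V V₁ r = 0) ∧
    |cutoffErr R n V V₁ r| ≤ 2 * (((n : ℝ) + 1) * K) * |V₁ r| +
      (((n : ℝ) + 1) ^ 2 * K + ((n : ℝ) + 1) * K / r) * |V r| := by
  obtain ⟨e1, e2⟩ := radialCutoff₁_of_lt (R := R) hrn
  have hr0 : 0 < r := hR.trans_lt hr
  have hn : (0 : ℝ) < (n : ℝ) + 1 := by positivity
  constructor
  · intro h
    have : ((n : ℝ) + 1) * (r - R) - 1 ∉ Icc (0 : ℝ) 1 := fun hh =>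
      h ⟨by linarith [hh.1], by linarith [hh.2]⟩
    obtain ⟨d1, d2⟩ := deriv_smoothTransition_eq_zero this
    rw [cutoffErr, e1, e2, d1, d2]
    simp
  · obtain ⟨k1, k2⟩ := hK (((n : ℝ) + 1) * (r - R) - 1)
    rw [cutoffErr, e1, e2]
    set s := deriv smoothTransition (((n : ℝ) + 1) * (r - R) - 1)
    set s' := deriv (deriv smoothTransition) (((n : ℝ) + 1) * (r - R) - 1)
    have k3 : |((n : ℝ) + 1) * s| ≤ ((n : ℝ) + 1) * K := by
      rw [abs_mul, abs_of_pos hn]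
      gcongr
    have k4 : |((n : ℝ) + 1) ^ 2 * s'| ≤ ((n : ℝ) + 1) ^ 2 * K := by
      rw [abs_mul, abs_of_pos (by positivity : (0 : ℝ) < ((n : ℝ) + 1) ^ 2)]
      gcongr
    have k5 : |((n : ℝ) + 1) * s / r| ≤ ((n : ℝ) + 1) * K / r := by
      rw [abs_div, abs_of_pos hr0]
      gcongr
    refine (abs_add_le _ _).trans (add_le_add ?_ ?_)
    · rw [abs_mul, abs_mul, abs_two]
      exact mul_le_mul_of_nonneg_right (mul_le_mul_of_nonneg_left k3 (by norm_num)) (abs_nonneg _)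
    · rw [abs_mul]
      exact mul_le_mul_of_nonneg_right ((abs_add_le _ _).trans (add_le_add k4 k5)) (abs_nonneg _)

/-- The derivatives of the outer cutoff are bounded uniformly in `n`, and `V` and `V'` give `L²`
functions by the energy estimate. As the error vanishes eventually at each point, dominated
convergence applies. -/
theorem tendsto_outer_integral (hR : 0 ≤ R) (hm : 3 ≤ m) (h : ModeSol R m e V V₁ V₂)
    (hz : MemLp z 2 (volume.restrict (exteriorDomain R))) :
    Tendsto (fun n => ∫ x in exteriorDomain (R + 1), z x * (cutoffErr R n V V₁ ‖x‖ * sinMode m x))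
      atTop (𝓝 0) := by
  obtain ⟨K, hK0, hK⟩ := exists_smoothTransition_bound
  have hsub : exteriorDomain (R + 1) ⊆ exteriorDomain R := fun x hx => by
    have : R + 1 < ‖x‖ := hx
    change R < ‖x‖
    linarith
  have hmono : (volume : Measure Plane).restrict (exteriorDomain (R + 1)) ≤
      volume.restrict (exteriorDomain R) := Measure.restrict_mono_set _ hsub
  have m0 := memLp_mode hR hm h h.continuousOn fun r hr =>
    mode_sq_le (V := fun _ => V) (e := fun _ => e) (V₁ := fun _ => V₁) hm (hR.trans_lt hr)
  have m1 := memLp_mode hR hm h h.continuousOn₁ fun r hr =>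
    mode_deriv_sq_le (V := fun _ => V) (e := fun _ => e) (V₁ := fun _ => V₁) hm (hR.trans_lt hr)
  refine tendsto_integral_of_memLp_bound (measurableSet_exteriorDomain _) (hz.mono_measure hmono)
    (B := fun x => 2 * K * ‖V₁ ‖x‖ * sinMode m x‖ + 2 * K * ‖V ‖x‖ * sinMode m x‖)
    (fun n => ?_) ?_ ?_ fun x hx => ?_
  · exact (memLp_radial_mul (radialTest_cutoffErr hR h n) (continuousOn_sinMode hR m) _).1
  · exact ((m1.norm.const_mul _).add (m0.norm.const_mul _)).mono_measure hmono
  · filter_upwards [eventually_gt_atTop 1] with n hn x hx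
    rw [abs_mul, Real.norm_eq_abs, Real.norm_eq_abs, abs_mul, abs_mul]
    have := abs_cutoffErr_outer_le (V := V) (V₁ := V₁) hK hR hn hx
    nlinarith [abs_nonneg (sinMode m x)]
  · filter_upwards [cutoffErr_eventually_zero (V := V) (V₁ := V₁) (hsub hx)] with n hn
    rw [hn, zero_mul]

/-- In the inner zone `n + 1 ≤ 2/r`, so the cutoff derivatives cost `1/r` and `1/r²`. The energy
estimate puts `V'/r` and `V/r²` in `L²`, so square integrability of `z` suffices and no condition at
the origin is needed. -/
theorem tendsto_inner_integral_zero (hm : 3 ≤ m) (h : ModeSol 0 m e V V₁ V₂)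
    (hz : MemLp z 2 (volume.restrict (exteriorDomain 0))) :
    Tendsto (fun n => ∫ x in exteriorDomain 0 \ exteriorDomain (0 + 1),
      z x * (cutoffErr 0 n V V₁ ‖x‖ * sinMode m x)) atTop (𝓝 0) := by
  obtain ⟨K, hK0, hK⟩ := exists_smoothTransition_bound
  have hmono : (volume : Measure Plane).restrict (exteriorDomain 0 \ exteriorDomain (0 + 1)) ≤
      volume.restrict (exteriorDomain 0) := Measure.restrict_mono_set _ sdiff_subset
  have m0 := memLp_mode le_rfl hm h (A := fun r => V r / r ^ 2)
    (continuousOn_div_pow le_rfl h.continuousOn 2) fun r hr => by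
      have h1 := mode_mul_div_sq_sq_le (V := fun _ => V) (e := fun _ => e) (V₁ := fun _ => V₁) hm hr
      refine le_trans ?_ h1
      have h2 := nine_le_sq hm
      have e1 : ((m : ℝ) * V r / r ^ 2) ^ 2 = (m : ℝ) ^ 2 * (V r / r ^ 2) ^ 2 := by ring
      rw [e1]
      nlinarith [sq_nonneg (V r / r ^ 2)]
  have m1 := memLp_mode le_rfl hm h (A := fun r => V₁ r / r)
    (by simpa using continuousOn_div_pow le_rfl h.continuousOn₁ 1) fun r hr => by
      have h1 := mode_deriv_div_sq_le (V := fun _ => V) (e := fun _ => e) (V₁ := fun _ => V₁) hm hr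
      refine le_trans ?_ h1
      nlinarith [sq_nonneg (V₁ r / r)]
  refine tendsto_integral_of_memLp_bound
    ((measurableSet_exteriorDomain _).diff (measurableSet_exteriorDomain _)) (hz.mono_measure hmono)
    -- Inserting `n + 1 ≤ 2/r` into `cutoffErr_inner` gives `2 · 2 = 4` and `2² + 2 = 6`.
    (B := fun x => 4 * K * ‖V₁ ‖x‖ / ‖x‖ * sinMode m x‖ + 6 * K * ‖V ‖x‖ / ‖x‖ ^ 2 * sinMode m x‖)
    (fun n => ?_) ?_ ?_ fun x hx => ?_
  · exact (memLp_radial_mul (radialTest_cutoffErr le_rfl h n) (continuousOn_sinMode le_rfl m) _).1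
  · exact ((m1.norm.const_mul _).add (m0.norm.const_mul _)).mono_measure hmono
  · filter_upwards [eventually_gt_atTop 0] with n hn x hx
    have hn' : (0 : ℝ) < n := by exact_mod_cast hn
    have hr : 0 < ‖x‖ := hx.1
    have hr1 : ‖x‖ ≤ 0 + 1 := not_lt.1 hx.2
    obtain ⟨h1, h2⟩ := cutoffErr_inner (V := V) (V₁ := V₁) hK le_rfl hr
      (by linarith : ‖x‖ < n + 1)
    rw [abs_mul, norm_mul, norm_mul, Real.norm_eq_abs, Real.norm_eq_abs, Real.norm_eq_abs,
      ← mul_assoc, ← mul_assoc, ← add_mul]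
    refine mul_le_mul_of_nonneg_right ?_ (abs_nonneg _)
    rw [sub_zero] at h1
    by_cases hin : ((n : ℝ) + 1) * ‖x‖ ∈ Icc (1 : ℝ) 2
    · refine h2.trans ?_
      have hle : (n : ℝ) + 1 ≤ 2 / ‖x‖ := by
        rw [le_div_iff₀ hr]
        exact hin.2
      rw [abs_div, abs_div, abs_of_pos hr, abs_of_pos (by positivity : 0 < ‖x‖ ^ 2)]
      calc 2 * (((n : ℝ) + 1) * K) * |V₁ ‖x‖| +
            (((n : ℝ) + 1) ^ 2 * K + ((n : ℝ) + 1) * K / ‖x‖) * |V ‖x‖|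
          ≤ 2 * (2 / ‖x‖ * K) * |V₁ ‖x‖| + ((2 / ‖x‖) ^ 2 * K + 2 / ‖x‖ * K / ‖x‖) * |V ‖x‖| := by
            gcongr
        _ = _ := by
            field_simp
            ring
    · rw [h1 hin, abs_zero]
      positivity
  · filter_upwards [cutoffErr_eventually_zero (V := V) (V₁ := V₁) hx.1] with n hn
    rw [hn, zero_mul]

theorem volume_annulus (hR : 0 ≤ R) (n : ℕ) :
    (volume (Metric.closedBall (0 : Plane) (R + 2 / ((n : ℝ) + 1)) \
      Metric.closedBall (0 : Plane) R)).toReal * ((n : ℝ) + 1) ≤ π * (4 * R + 4) := by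
  have hn : (0 : ℝ) < (n : ℝ) + 1 := by positivity
  have hp : (0 : ℝ) < 2 / ((n : ℝ) + 1) := by positivity
  have hv : ∀ r : ℝ, 0 ≤ r → volume (Metric.closedBall (0 : Plane) r) =
      ENNReal.ofReal (r ^ 2 * π) := fun r hr => by
    rw [EuclideanSpace.volume_closedBall_fin_two, ← ENNReal.ofReal_pow hr,
      ← ENNReal.ofReal_mul (by positivity)]
  rw [measure_sdiff (Metric.closedBall_subset_closedBall (by linarith))
    Metric.isClosed_closedBall.measurableSet.nullMeasurableSet
    (isCompact_closedBall _ _).measure_lt_top.ne, hv _ (by linarith), hv _ hR,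
    ← ENNReal.ofReal_sub _ (by positivity), ENNReal.toReal_ofReal (by
      rw [← sub_mul]
      exact mul_nonneg (by nlinarith) pi_pos.le)]
  have e1 : ((R + 2 / ((n : ℝ) + 1)) ^ 2 * π - R ^ 2 * π) * ((n : ℝ) + 1) =
      π * (4 * R + 4 / ((n : ℝ) + 1)) := by
    field_simp
    ring
  rw [e1]
  have h4 : 4 / ((n : ℝ) + 1) ≤ 4 := by
    rw [div_le_iff₀ hn]
    have : (0 : ℝ) ≤ n := Nat.cast_nonneg n
    linarith
  gcongr

/-- The mean value inequality on `(s, r)` with `s → R`, where `V` tends to zero. -/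
theorem ModeSol.exists_linear_bound (hR : 0 ≤ R) (h : ModeSol R m e V V₁ V₂) :
    ∃ C ρ, 0 ≤ C ∧ R < ρ ∧ ∀ r, R < r → r < ρ → |V₁ r| ≤ C ∧ |V r| ≤ C * (r - R) := by
  obtain ⟨C, hC⟩ := h.bdd₁
  obtain ⟨ρ, hρ, hb⟩ := mem_nhdsGT_iff_exists_Ioo_subset.1 hC
  have hρ : R < ρ := hρ
  have hb' : ∀ r, R < r → r < ρ → |V₁ r| ≤ C := fun r h1 h2 => hb ⟨h1, h2⟩
  have hC0 : 0 ≤ C := by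
    obtain ⟨r, h1, h2⟩ := exists_between hρ
    exact (abs_nonneg _).trans (hb' r h1 h2)
  refine ⟨C, ρ, hC0, hρ, fun r h1 h2 => ⟨hb' r h1 h2, ?_⟩⟩
  have hlip : ∀ᶠ s in 𝓝[>] R, |V r - V s| ≤ C * (r - R) := by
    filter_upwards [Ioo_mem_nhdsGT h1] with s hs
    have := (convex_Ioo R ρ).norm_image_sub_le_of_norm_hasDerivWithin_le (f := V) (f' := V₁)
      (C := C) (fun t ht => (h.deriv t ht.1).hasDerivWithinAt) (fun t ht => hb' t ht.1 ht.2)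
      ⟨hs.1, hs.2.trans h2⟩ ⟨h1, h2⟩
    refine this.trans ?_
    rw [Real.norm_of_nonneg (by linarith [hs.2])]
    have := hs.1
    gcongr
  have ht := ((tendsto_const_nhds (x := V r)).sub (h.tendsto_zero hR)).abs
  rw [sub_zero] at ht
  exact le_of_tendsto ht hlip

/-- Since `V = O(r - R)` and `V'` is bounded, the error is `O(n)` on an annulus of area `O(1/n)`.
The integral is thus bounded by a constant times the supremum of `|z|` on that annulus, which the
Dirichlet condition makes small. -/
theorem tendsto_inner_integral_pos (hR : 0 < R) (h : ModeSol R m e V V₁ V₂)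
    (hbd : ∀ ε, 0 < ε → ∃ ρ, R < ρ ∧
      ∀ᵐ x ∂(volume.restrict (exteriorDomain R)), ‖x‖ < ρ → |z x| ≤ ε) :
    Tendsto (fun n => ∫ x in exteriorDomain R \ exteriorDomain (R + 1),
      z x * (cutoffErr R n V V₁ ‖x‖ * sinMode m x)) atTop (𝓝 0) := by
  obtain ⟨K, hK0, hK⟩ := exists_smoothTransition_bound
  obtain ⟨C, ρ₀, hC, hρ₀, hV⟩ := h.exists_linear_bound hR.le
  set C₂ : ℝ := 4 * K * C + 2 * K * C / R with hC₂
  have hC₂0 : 0 ≤ C₂ := by positivity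
  rw [Metric.tendsto_nhds]
  intro ε hε
  set Q : ℝ := C₂ * (π * (4 * R + 4)) with hQ
  have hQ0 : 0 ≤ Q := by positivity
  obtain ⟨ρ, hρ, hzρ⟩ := hbd (ε / (Q + 1)) (by positivity)
  have hlim : Tendsto (fun n : ℕ => R + 2 / ((n : ℝ) + 1)) atTop (𝓝 R) := by
    have := (tendsto_one_div_add_atTop_nhds_zero_nat (𝕜 := ℝ)).const_mul 2
    have := this.const_add R
    simpa [div_eq_mul_inv] using this
  filter_upwards [hlim.eventually_lt_const hρ, hlim.eventually_lt_const hρ₀,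
    tendsto_natCast_atTop_atTop.eventually_gt_atTop R] with n hn1 hn2 hnR
  have hn : (0 : ℝ) < (n : ℝ) + 1 := by positivity
  rw [dist_zero_right]
  set T := Metric.closedBall (0 : Plane) (R + 2 / ((n : ℝ) + 1)) \ Metric.closedBall (0 : Plane) R
    with hT
  have hTm : MeasurableSet T :=
    Metric.isClosed_closedBall.measurableSet.diff Metric.isClosed_closedBall.measurableSet
  have hTfin : volume T ≠ ⊤ :=
    (lt_of_le_of_lt (measure_mono sdiff_subset) (isCompact_closedBall _ _).measure_lt_top).ne
  set S := exteriorDomain R \ exteriorDomain (R + 1) with hSdef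
  have hS : MeasurableSet S :=
    (measurableSet_exteriorDomain _).diff (measurableSet_exteriorDomain _)
  set c : ℝ := ε / (Q + 1) * (((n : ℝ) + 1) * C₂) with hc
  have hc0 : 0 ≤ c := by positivity
  have hbound : ∀ᵐ x ∂(volume.restrict S), ‖z x * (cutoffErr R n V V₁ ‖x‖ * sinMode m x)‖ ≤
      T.indicator (fun _ => c) x := by
    filter_upwards [ae_restrict_of_ae_restrict_of_subset sdiff_subset hzρ, ae_restrict_mem hS]
      with x hx hxS
    have hr : R < ‖x‖ := hxS.1
    have hr1 : ‖x‖ ≤ R + 1 := not_lt.1 hxS.2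
    have hr0 : 0 < ‖x‖ := hR.trans hr
    obtain ⟨h1, h2⟩ := cutoffErr_inner (V := V) (V₁ := V₁) hK hR.le hr
      (by linarith : ‖x‖ < n + 1)
    by_cases hin : ((n : ℝ) + 1) * (‖x‖ - R) ∈ Icc (1 : ℝ) 2
    · have hle : ‖x‖ - R ≤ 2 / ((n : ℝ) + 1) := by
        rw [le_div_iff₀ hn, mul_comm]
        exact hin.2
      have hxT : x ∈ T := by
        refine ⟨?_, ?_⟩
        · rw [mem_closedBall_zero_iff]
          linarith
        · rw [mem_closedBall_zero_iff]
          linarith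
      rw [indicator_of_mem hxT, norm_mul, norm_mul, Real.norm_eq_abs, Real.norm_eq_abs,
        Real.norm_eq_abs, hc]
      obtain ⟨v1, v2⟩ := hV ‖x‖ hr (by linarith)
      have hs1 := abs_sinMode_le m (ne_zero_of_mem_exteriorDomain hR.le hxS.1)
      have herr : |cutoffErr R n V V₁ ‖x‖| ≤ ((n : ℝ) + 1) * C₂ := by
        refine h2.trans ?_
        calc 2 * (((n : ℝ) + 1) * K) * |V₁ ‖x‖| +
              (((n : ℝ) + 1) ^ 2 * K + ((n : ℝ) + 1) * K / ‖x‖) * |V ‖x‖|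
            ≤ 2 * (((n : ℝ) + 1) * K) * C +
              (((n : ℝ) + 1) ^ 2 * K + ((n : ℝ) + 1) * K / R) * (C * (2 / ((n : ℝ) + 1))) := by
              gcongr
              exact v2.trans (by gcongr)
          _ = ((n : ℝ) + 1) * (4 * K * C) + 2 * K * C / R := by
              field_simp
              ring
          _ ≤ _ := by
              rw [hC₂, mul_add]
              have : 0 ≤ 2 * K * C / R := by positivity
              have hn1 : (0 : ℝ) ≤ n := Nat.cast_nonneg n
              nlinarith
      refine mul_le_mul (hx (by linarith)) ?_ (by positivity) (by positivity)
      calc |cutoffErr R n V V₁ ‖x‖| * |sinMode m x| ≤ ((n : ℝ) + 1) * C₂ * 1 := by gcongr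
        _ = _ := mul_one _
    · rw [h1 hin, zero_mul, mul_zero, norm_zero]
      exact indicator_nonneg (fun _ _ => hc0) _
  have hTS : volume.real (T ∩ S) ≤ (volume T).toReal :=
    ENNReal.toReal_mono hTfin (measure_mono inter_subset_left)
  have hint : IntegrableOn (T.indicator fun _ => c) S volume := by
    refine (integrable_indicator_iff hTm).2 ?_ |>.integrableOn
    exact integrableOn_const hTfin
  calc ‖∫ x in S, z x * (cutoffErr R n V V₁ ‖x‖ * sinMode m x)‖
      ≤ ∫ x in S, T.indicator (fun _ => c) x := norm_integral_le_of_norm_le hint hbound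
    _ = volume.real (T ∩ S) * c := by
        rw [integral_indicator hTm, Measure.restrict_restrict hTm, setIntegral_const, smul_eq_mul]
    _ ≤ (volume T).toReal * c := by gcongr
    _ = ε / (Q + 1) * (C₂ * ((volume T).toReal * ((n : ℝ) + 1))) := by rw [hc]; ring
    _ ≤ ε / (Q + 1) * (C₂ * (π * (4 * R + 4))) := by
        exact mul_le_mul_of_nonneg_left (mul_le_mul_of_nonneg_left (volume_annulus hR.le n) hC₂0)
          (by positivity)
    _ < ε := by
        rw [← hQ, div_mul_eq_mul_div, div_lt_iff₀ (by positivity)]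
        nlinarith

/-- Duality: solve the radial problem with right-hand side `e` and test the equation of `z` with the
cut-off solution. Once the cutoff equals one on the support of `e`, only the commutator is left, and
it vanishes in the limit on both sides of `|x| = R + 1`. -/
theorem integral_smooth_mode_eq_zero (hR : 0 ≤ R) (hm : 3 ≤ m)
    (hz : MemLp z 2 (volume.restrict (exteriorDomain R)))
    (hosc : OscEq (exteriorDomain R) z fun _ => 0)
    (hbd : 0 < R → ∀ ε, 0 < ε → ∃ ρ, R < ρ ∧
      ∀ᵐ x ∂(volume.restrict (exteriorDomain R)), ‖x‖ < ρ → |z x| ≤ ε)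
    (he : RadialTest R e) (hes : ContDiff ℝ ∞ e) :
    ∫ x in exteriorDomain R, z x * (e ‖x‖ * sinMode m x) = 0 := by
  obtain ⟨V, V₁, V₂, h⟩ := exists_modeSol hR hm he.1 he.2
  have hsub : exteriorDomain (R + 1) ⊆ exteriorDomain R := fun x hx => by
    have : R + 1 < ‖x‖ := hx
    change R < ‖x‖
    linarith
  have hinner : Tendsto (fun n => ∫ x in exteriorDomain R \ exteriorDomain (R + 1),
      z x * (cutoffErr R n V V₁ ‖x‖ * sinMode m x)) atTop (𝓝 0) := by
    rcases hR.eq_or_lt with rfl | hpos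
    · exact tendsto_inner_integral_zero hm h hz
    · exact tendsto_inner_integral_pos hpos h (hbd hpos)
  have hsum := hinner.add (tendsto_outer_integral hR hm h hz)
  rw [add_zero] at hsum
  have ierr : ∀ n, IntegrableOn (fun x => z x * (cutoffErr R n V V₁ ‖x‖ * sinMode m x))
      (exteriorDomain R) := fun n =>
    hz.integrable_mul (memLp_radial_mul (radialTest_cutoffErr hR h n) (continuousOn_sinMode hR m) _)
  have ie : IntegrableOn (fun x => z x * (e ‖x‖ * sinMode m x)) (exteriorDomain R) :=
    hz.integrable_mul (memLp_radial_mul he (continuousOn_sinMode hR m) _)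
  obtain ⟨-, a, b, ha, hs⟩ := he
  have hev : ∀ᶠ n : ℕ in atTop, ∀ r, radialCutoff R n r * e r = e r := by
    filter_upwards [eventually_radialCutoff_conditions ha,
      tendsto_natCast_atTop_atTop.eventually_gt_atTop b] with n hn hnb r
    by_cases hr : r ∈ Icc a b
    · have hn0 : (0 : ℝ) < (n : ℝ) + 1 := by positivity
      have h1 : 2 ≤ ((n : ℝ) + 1) * (r - R) := by
        have := mul_le_mul_of_nonneg_left (sub_le_sub_right hr.1 R) hn0.le
        linarith [hn.1]
      rw [radialCutoff_eq_one h1 (by linarith [hr.2]), one_mul]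
    · rw [hs r hr, mul_zero]
  have hlim : Tendsto (fun _ : ℕ => -∫ x in exteriorDomain R, z x * (e ‖x‖ * sinMode m x))
      atTop (𝓝 0) := by
    refine hsum.congr' ?_
    filter_upwards [hev] with n hn
    have h0 := integral_cutoff_mode_eq_zero hR h hes hosc n
    simp only [hn, add_mul, mul_add] at h0
    rw [integral_add ie (ierr n)] at h0
    have h1 := integral_inter_add_sdiff (measurableSet_exteriorDomain (R + 1)) (ierr n)
    rw [inter_eq_self_of_subset_right hsub] at h1
    linarith
  have := tendsto_nhds_unique tendsto_const_nhds hlim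
  linarith

/-- Smoothness of `e` was needed only for the test function to be smooth. A continuous `e` is a
uniform limit of smooth functions whose supports lie in the same interval. -/
theorem integral_mode_eq_zero (hR : 0 ≤ R) (hm : 3 ≤ m)
    (hz : MemLp z 2 (volume.restrict (exteriorDomain R)))
    (hosc : OscEq (exteriorDomain R) z fun _ => 0)
    (hbd : 0 < R → ∀ ε, 0 < ε → ∃ ρ, R < ρ ∧
      ∀ᵐ x ∂(volume.restrict (exteriorDomain R)), ‖x‖ < ρ → |z x| ≤ ε)
    (he : RadialTest R e) :
    ∫ x in exteriorDomain R, z x * (e ‖x‖ * sinMode m x) = 0 := by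
  obtain ⟨ce, a, b, ha, hs⟩ := he
  choose f hf1 hf2 hf3 using fun n : ℕ => ce.exists_contDiff_approx ⊤
    (ε := fun _ => 1 / ((n : ℝ) + 1)) continuous_const fun _ => by positivity
  have hf0 : ∀ n, ∀ r ∉ Icc a b, f n r = 0 := fun n r hr => by
    by_contra hne
    exact hf3 n hne (hs r hr)
  have hft : ∀ n, RadialTest R (f n) := fun n => ⟨(hf1 n).continuous, a, b, ha, hf0 n⟩
  have hzero : ∀ n, ∫ x in exteriorDomain R, z x * (f n ‖x‖ * sinMode m x) = 0 := fun n =>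
    integral_smooth_mode_eq_zero hR hm hz hosc hbd (hft n) (hf1 n)
  have hB : MemLp ((Metric.closedBall (0 : Plane) b).indicator fun _ => (1 : ℝ)) 2
      (volume.restrict (exteriorDomain R)) :=
    memLp_indicator_const 2 Metric.isClosed_closedBall.measurableSet _
      (Or.inr (isCompact_closedBall _ _).measure_lt_top.ne)
  have hconv : Tendsto (fun n => ∫ x in exteriorDomain R, z x * (f n ‖x‖ * sinMode m x)) atTop
      (𝓝 (∫ x in exteriorDomain R, z x * (e ‖x‖ * sinMode m x))) := by
    have hmode := fun (g : ℝ → ℝ) (hg : RadialTest R g) =>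
      memLp_radial_mul hg (continuousOn_sinMode hR m) (volume.restrict (exteriorDomain R))
    have het : RadialTest R e := ⟨ce, a, b, ha, hs⟩
    have h1 := tendsto_integral_mul_of_eLpNorm (fun n => hmode _ (hft n)) (hmode e het) hz
      (tendsto_eLpNorm_of_dominated (fun n => (hmode _ (hft n)).1) (hmode e het).1 hB
        (fun n => ?_) ?_)
    · simpa only [mul_comm (z _)] using h1
    · filter_upwards [ae_restrict_mem (measurableSet_exteriorDomain R)] with x hx
      have hs1 := abs_sinMode_le m (ne_zero_of_mem_exteriorDomain hR hx)
      rw [← sub_mul, abs_mul]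
      by_cases hxb : x ∈ Metric.closedBall (0 : Plane) b
      · rw [indicator_of_mem hxb]
        have h2 := (hf2 n ‖x‖).le
        rw [Real.dist_eq] at h2
        have h3 : 1 / ((n : ℝ) + 1) ≤ 1 := by
          rw [div_le_one (by positivity)]
          have : (0 : ℝ) ≤ n := Nat.cast_nonneg n
          linarith
        exact mul_le_one₀ (h2.trans h3) (abs_nonneg _) hs1
      · have hxb' : b < ‖x‖ := by simpa using hxb
        have hni : ‖x‖ ∉ Icc a b := fun hh => absurd hh.2 (not_le.2 hxb')
        rw [indicator_of_notMem hxb, hf0 n _ hni, hs _ hni]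
        simp
    · refine Eventually.of_forall fun x => ?_
      have h2 : Tendsto (fun n => f n ‖x‖) atTop (𝓝 (e ‖x‖)) := by
        rw [tendsto_iff_dist_tendsto_zero]
        exact squeeze_zero (fun _ => dist_nonneg) (fun n => (hf2 n ‖x‖).le)
          tendsto_one_div_add_atTop_nhds_zero_nat
      exact h2.mul_const _
  simp only [hzero] at hconv
  exact (tendsto_nhds_unique tendsto_const_nhds hconv).symm

theorem ae_eq_zero_of_oscEq {k : ℕ} (hk : 3 ≤ k) (hR : 0 ≤ R)
    (hz : MemLp z 2 (volume.restrict (exteriorDomain R)))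
    (hr : ∀ᵐ x ∂(volume.restrict (exteriorDomain R)), z (rotPlane (-(π / k)) x) = -z x)
    (hc : ∀ᵐ x ∂(volume.restrict (exteriorDomain R)), z (conjPlane x) = -z x)
    (hosc : OscEq (exteriorDomain R) z fun _ => 0)
    (hbd : 0 < R → ∀ ε, 0 < ε → ∃ ρ, R < ρ ∧
      ∀ᵐ x ∂(volume.restrict (exteriorDomain R)), ‖x‖ < ρ → |z x| ≤ ε) :
    z =ᵐ[volume.restrict (exteriorDomain R)] 0 := by
  refine ae_eq_zero_of_forall_integral_mode hR (by omega : 0 < k) hz hr hc fun l hl e he => ?_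
  have h3 : 3 ≤ l := by
    obtain ⟨j, rfl⟩ := hl
    exact hk.trans (Nat.le_mul_of_pos_right k (by omega))
  exact integral_mode_eq_zero hR h3 hz hosc hbd he

end

/-! ### The weighted problem -/

theorem memLp_exp_neg_norm_sq (μ : Measure Plane) (hμ : μ ≤ volume) :
    MemLp (fun x : Plane => exp (-(‖x‖ ^ 2 / 8))) 2 μ := by
  refine MemLp.mono_measure hμ ((memLp_two_iff_integrable_sq ?_).2 ?_)
  · exact (by fun_prop : Continuous fun x : Plane => exp (-(‖x‖ ^ 2 / 8))).aestronglyMeasurable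
  · have h : Integrable fun x : Plane => exp (-(1 / 4 : ℝ) * ‖x‖ ^ 2) := by
      refine Integrable.of_integral_ne_zero ?_
      rw [GaussianFourier.integral_rexp_neg_mul_sq_norm (by norm_num)]
      positivity
    refine h.congr (Eventually.of_forall fun x => ?_)
    change exp (-(1 / 4 : ℝ) * ‖x‖ ^ 2) = exp (-(‖x‖ ^ 2 / 8)) ^ 2
    rw [← exp_nat_mul]
    congr 1
    push_cast
    ring

theorem mul_le_weightedSup {Ω : Set Plane} {E : Plane → ℝ} (hE : DecayingContinuous Ω E)
    {x : Plane} (hx : x ∈ Ω) : (1 + ‖x‖) * |E x| ≤ weightedSup Ω E :=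
  le_csSup hE.2 (mem_image_of_mem _ hx)

theorem weightedSup_nonneg (Ω : Set Plane) (E : Plane → ℝ) : 0 ≤ weightedSup Ω E := by
  refine Real.sSup_nonneg ?_
  rintro _ ⟨x, -, rfl⟩
  positivity

theorem DecayingContinuous.memWeightedL2 {Ω : Set Plane} (hΩ : MeasurableSet Ω) {E : Plane → ℝ}
    (hE : DecayingContinuous Ω E) : MemWeightedL2 Ω E := by
  have hc : ContinuousOn (fun x => exp (-(‖x‖ ^ 2 / 8)) * E x) Ω :=
    (by fun_prop : Continuous fun x : Plane => exp (-(‖x‖ ^ 2 / 8))).continuousOn.mul hE.1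
  refine ((memLp_exp_neg_norm_sq _ Measure.restrict_le_self).const_mul
    (weightedSup Ω E)).mono (hc.aestronglyMeasurable hΩ) ?_
  filter_upwards [ae_restrict_mem hΩ] with x hx
  have h1 : |E x| ≤ weightedSup Ω E :=
    (le_mul_of_one_le_left (abs_nonneg _) (by linarith [norm_nonneg x])).trans
      (mul_le_weightedSup hE hx)
  rw [norm_mul, norm_mul, mul_comm, Real.norm_eq_abs (E x), Real.norm_eq_abs (weightedSup Ω E),
    abs_of_nonneg (weightedSup_nonneg Ω E)]
  gcongr

theorem exteriorDomain_eq_compl (R : ℝ) : exteriorDomain R = (Metric.closedBall 0 R)ᶜ := by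
  ext x
  simp [exteriorDomain]

theorem frontier_exteriorDomain {R : ℝ} (hR : R ≠ 0) :
    frontier (exteriorDomain R) = Metric.sphere 0 R := by
  rw [exteriorDomain_eq_compl, frontier_compl, frontier_closedBall _ hR]

/-- A continuous function on the closed exterior domain that vanishes on the boundary is small
near the boundary. -/
theorem exists_abs_le_near_frontier {R : ℝ} (hR : 0 < R) {q : Plane → ℝ}
    (hq : ContinuousOn q (closure (exteriorDomain R)))
    (h0 : ∀ x ∈ frontier (exteriorDomain R), q x = 0) {ε : ℝ} (hε : 0 < ε) :
    ∃ ρ, R < ρ ∧ ∀ x ∈ exteriorDomain R, ‖x‖ < ρ → |q x| ≤ ε := by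
  have hK : IsCompact (closure (exteriorDomain R) ∩ Metric.closedBall (0 : Plane) (R + 1)) :=
    (isCompact_closedBall _ _).inter_left isClosed_closure
  have hu := hK.uniformContinuousOn_of_continuous (hq.mono inter_subset_left)
  obtain ⟨δ, hδ, h⟩ := Metric.uniformContinuousOn_iff.1 hu ε hε
  refine ⟨R + min δ 1, lt_add_of_pos_right _ (lt_min hδ one_pos), fun x hx hxρ => ?_⟩
  have hxR : R < ‖x‖ := hx
  have hx0 : 0 < ‖x‖ := hR.trans hxR
  have hyn : ‖(R / ‖x‖) • x‖ = R := by
    rw [norm_smul, Real.norm_of_nonneg (by positivity), div_mul_cancel₀ _ hx0.ne']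
  have hyf : (R / ‖x‖) • x ∈ frontier (exteriorDomain R) := by
    rw [frontier_exteriorDomain hR.ne', mem_sphere_zero_iff_norm, hyn]
  have hd : dist x ((R / ‖x‖) • x) = ‖x‖ - R := by
    have e : x - (R / ‖x‖) • x = (1 - R / ‖x‖) • x := by rw [sub_smul, one_smul]
    have h1 : 0 ≤ 1 - R / ‖x‖ := by
      rw [sub_nonneg, div_le_one hx0]
      exact hxR.le
    rw [dist_eq_norm, e, norm_smul, Real.norm_of_nonneg h1]
    field_simp
  have := h x ⟨subset_closure hx, ?_⟩ _ ⟨frontier_subset_closure hyf, ?_⟩ ?_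
  -- The comparison point is the radial projection of `x` onto the boundary circle, where `q`
  -- vanishes.
  · rw [h0 _ hyf, Real.dist_eq, sub_zero] at this
    exact this.le
  · rw [mem_closedBall_zero_iff]
    linarith [min_le_right δ 1]
  · rw [mem_closedBall_zero_iff, hyn]
    linarith
  · rw [hd]
    linarith [min_le_left δ 1]

theorem exp_mul_exp_neg_mul (x : Plane) (a : ℝ) :
    exp (‖x‖ ^ 2 / 8) * (exp (-(‖x‖ ^ 2 / 8)) * a) = a := by
  rw [← mul_assoc, ← exp_add, add_neg_cancel, exp_zero, one_mul]

theorem exp_neg_mul_exp_mul (x : Plane) (a : ℝ) :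
    exp (-(‖x‖ ^ 2 / 8)) * (exp (‖x‖ ^ 2 / 8) * a) = a := by
  rw [← mul_assoc, ← exp_add, neg_add_cancel, exp_zero, one_mul]

section

variable {k : ℕ} {τ R : ℝ} {E : Plane → ℝ}

/-- Translation of `exists_planeSol` and of the duality argument through the Gaussian weight, for `R
= 0` and `R > 0` at once. The boundary condition is demanded of competitors only when `R > 0`. In
the last part `(1 + |x|)|E| ≤ M` is used in the weaker form `|E| ≤ M/|x|`, and the result is the
stronger `|u| ≤ M|x|`. -/
theorem exists_weightedSol (hk : 3 ≤ k) (hτ : π * τ = π / k) (hR : 0 ≤ R)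
    (hE : Equivariant τ (exteriorDomain R) E) (hL : MemWeightedL2 (exteriorDomain R) E) :
    ∃ v g h, PlaneSol R (fun x => exp (-(‖x‖ ^ 2 / 8)) * E x) v g h ∧
      Equivariant τ (exteriorDomain R) (fun x => exp (‖x‖ ^ 2 / 8) * v x) ∧
      (∀ w, Equivariant τ (exteriorDomain R) w → MemWeightedL2 (exteriorDomain R) w →
        LPEq (exteriorDomain R) w E → (0 < R → VanishesOnBoundary (exteriorDomain R) w) →
        w =ᵐ[volume.restrict (exteriorDomain R)] fun x => exp (‖x‖ ^ 2 / 8) * v x) ∧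
      ∀ M, 0 ≤ M → ContinuousOn E (exteriorDomain R) →
        (∀ x ∈ exteriorDomain R, (1 + ‖x‖) * |E x| ≤ M) →
        ∀ x, |exp (‖x‖ ^ 2 / 8) * v x| ≤ M * (1 + ‖x‖) := by
  obtain ⟨v, g, h, hs, vr, vc, vb⟩ := exists_planeSol hk hR hL
    (by
      filter_upwards [hE.rot] with x hx
      rw [← hτ, norm_rotPlane, hx, mul_neg])
    (by
      filter_upwards [hE.conj] with x hx
      rw [norm_conjPlane, hx, mul_neg])
  refine ⟨v, g, h, hs, equivariant_of_forall (fun x hx => ?_) (fun x hx => ?_), ?_, ?_⟩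
  · rw [norm_rotPlane, hτ, vr x hx, mul_neg]
  · rw [norm_conjPlane, vc x hx, mul_neg]
  · intro w we wL weq wb
    have hz : MemLp (fun x => exp (-(‖x‖ ^ 2 / 8)) * w x - v x) 2
        (volume.restrict (exteriorDomain R)) := MemLp.sub wL hs.memLp
    have hosc : OscEq (exteriorDomain R) (fun x => exp (-(‖x‖ ^ 2 / 8)) * w x - v x)
        fun _ => 0 := by
      simpa using (weq.oscEq (isOpen_exteriorDomain R)).sub hs.oscEq
    have h0 := ae_eq_zero_of_oscEq hk hR hz
      (by
        filter_upwards [we.rot, ae_restrict_mem (measurableSet_exteriorDomain R)] with x hx hxΩ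
        rw [← hτ, norm_rotPlane, hx, hτ, vr x hxΩ]
        ring)
      (by
        filter_upwards [we.conj, ae_restrict_mem (measurableSet_exteriorDomain R)] with x hx hxΩ
        rw [norm_conjPlane, hx, vc x hxΩ]
        ring) hosc
      (fun hR0 ε hε => by
        obtain ⟨W, Wc, Ww, W0⟩ := wb hR0
        have hq : ContinuousOn (fun x => exp (-(‖x‖ ^ 2 / 8)) * W x - v x)
            (closure (exteriorDomain R)) :=
          ((by fun_prop : Continuous fun x : Plane => exp (-(‖x‖ ^ 2 / 8))).continuousOn.mul
            Wc).sub hs.cont.continuousOn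
        obtain ⟨ρ, hρ, hb⟩ := exists_abs_le_near_frontier hR0 hq (fun x hx => by
          rw [W0 x hx]
          rw [frontier_exteriorDomain hR0.ne', mem_sphere_zero_iff_norm] at hx
          rw [hs.zero x hx.le, mul_zero, sub_zero]) hε
        refine ⟨ρ, hρ, ?_⟩
        filter_upwards [Ww, ae_restrict_mem (measurableSet_exteriorDomain R)] with x hx hxΩ hxρ
        rw [← hx]
        exact hb x hxΩ hxρ)
    filter_upwards [h0] with x hx
    rw [← sub_eq_zero.1 hx, exp_mul_exp_neg_mul]
  · intro M hM hc hb x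
    by_cases hx : x ∈ exteriorDomain R
    · have hF : ContinuousOn (fun x => exp (-(‖x‖ ^ 2 / 8)) * E x) (exteriorDomain R) :=
        (by fun_prop : Continuous fun x : Plane => exp (-(‖x‖ ^ 2 / 8))).continuousOn.mul hc
      have h1 := vb hF M hM (fun y hy => by
        have hy0 : 0 < ‖y‖ := hR.trans_lt hy
        rw [abs_mul, abs_exp, mul_div_assoc', le_div_iff₀ hy0]
        have : ‖y‖ * |E y| ≤ M :=
          (mul_le_mul_of_nonneg_right (by linarith) (abs_nonneg _)).trans (hb y hy)
        calc exp (-(‖y‖ ^ 2 / 8)) * |E y| * ‖y‖ = exp (-(‖y‖ ^ 2 / 8)) * (‖y‖ * |E y|) := by ring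
          _ ≤ exp (-(‖y‖ ^ 2 / 8)) * M := by gcongr
          _ = _ := mul_comm _ _) x hx
      rw [abs_mul, abs_exp]
      calc exp (‖x‖ ^ 2 / 8) * |v x|
          ≤ exp (‖x‖ ^ 2 / 8) * (exp (-(‖x‖ ^ 2 / 8)) * (M * ‖x‖)) := by
            gcongr
            linarith
        _ = M * ‖x‖ := exp_mul_exp_neg_mul _ _
        _ ≤ M * (1 + ‖x‖) := by gcongr; linarith
    · rw [hs.zero x (not_lt.1 hx), mul_zero, abs_zero]
      positivity

theorem PlaneSol.memWeightedH2 {F v : Plane → ℝ} {g : Fin 2 → Plane → ℝ}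
    {h : Fin 2 → Fin 2 → Plane → ℝ} (hs : PlaneSol R F v g h) :
    MemWeightedH2 (exteriorDomain R) (fun x => exp (‖x‖ ^ 2 / 8) * v x) := by
  rw [MemWeightedH2]
  simp only [exp_neg_mul_exp_mul]
  exact ⟨hs.memLp, g, h, fun i => ⟨hs.grad i, hs.memLp_grad i⟩,
    fun i j => ⟨hs.hess i j, hs.memLp_hess i j⟩⟩

theorem continuous_exp_mul {v : Plane → ℝ} (hv : Continuous v) :
    Continuous fun x => exp (‖x‖ ^ 2 / 8) * v x := by
  fun_prop

theorem exteriorProblem (hk : 3 ≤ k) (hτ : π * τ = π / k) (hR : 0 < R)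
    (hE : Equivariant τ (exteriorDomain R) E) (hL : MemWeightedL2 (exteriorDomain R) E) :
    ∃ u : Plane → ℝ, ContinuousOn u (closure (exteriorDomain R)) ∧
      (∀ x ∈ frontier (exteriorDomain R), u x = 0) ∧ IsSolution τ (exteriorDomain R) E u ∧
      (∀ w : Plane → ℝ, IsSolution τ (exteriorDomain R) E w →
        VanishesOnBoundary (exteriorDomain R) w →
        w =ᵐ[volume.restrict (exteriorDomain R)] u) ∧
      (DecayingContinuous (exteriorDomain R) E → ∀ x ∈ exteriorDomain R,
        |u x| ≤ 1 * weightedSup (exteriorDomain R) E * (1 + ‖x‖)) := by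
  obtain ⟨v, g, h, hs, he, hu, hb⟩ := exists_weightedSol hk hτ hR.le hE hL
  refine ⟨_, (continuous_exp_mul hs.cont).continuousOn, fun x hx => ?_,
    ⟨he, hs.memWeightedH2, hs.oscEq.lpEq (isOpen_exteriorDomain R)⟩,
    fun w hw hw0 => hu w hw.1 hw.2.1.1 hw.2.2 fun _ => hw0, fun hd x _ => ?_⟩
  · rw [frontier_exteriorDomain hR.ne', mem_sphere_zero_iff_norm] at hx
    rw [hs.zero x hx.le, mul_zero]
  · rw [one_mul]
    exact hb _ (weightedSup_nonneg _ _) hd.1 (fun y hy => mul_le_weightedSup hd hy) x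

theorem LPEq.mono {Ω Ω' : Set Plane} (hsub : Ω' ⊆ Ω) {u : Plane → ℝ} (h : LPEq Ω u E) :
    LPEq Ω' u E := by
  obtain ⟨g, h, h1, h2, h3⟩ := h
  exact ⟨g, h, fun i => (h1 i).mono hsub, fun i => (h2 i).mono hsub,
    ae_restrict_of_ae_restrict_of_subset hsub h3⟩

theorem equivariant_exteriorDomain_zero_iff {f : Plane → ℝ} :
    Equivariant τ (exteriorDomain 0) f ↔ Equivariant τ univ f := by
  rw [Equivariant, Equivariant, restrict_exteriorDomain_zero, Measure.restrict_univ]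

theorem memWeightedL2_exteriorDomain_zero_iff {f : Plane → ℝ} :
    MemWeightedL2 (exteriorDomain 0) f ↔ MemWeightedL2 univ f := by
  rw [MemWeightedL2, MemWeightedL2, restrict_exteriorDomain_zero, Measure.restrict_univ]

/-- The plane differs from the exterior domain with `R = 0` by one null point. The weak derivatives
extend across it by `IsWeakPartial.of_punctured`, and uniqueness already holds on the punctured
plane. -/
theorem planeProblem (hk : 3 ≤ k) (hτ : π * τ = π / k)
    (hE : Equivariant τ univ E) (hL : MemWeightedL2 univ E) :
    ∃ u : Plane → ℝ, Continuous u ∧ IsSolution τ univ E u ∧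
      (∀ w : Plane → ℝ, IsSolution τ univ E w → w =ᵐ[volume] u) ∧
      (DecayingContinuous univ E → ∀ x, |u x| ≤ 1 * weightedSup univ E * (1 + ‖x‖)) := by
  obtain ⟨v, g, h, hs, he, hu, hb⟩ := exists_weightedSol hk hτ le_rfl
    (equivariant_exteriorDomain_zero_iff.2 hE) (memWeightedL2_exteriorDomain_zero_iff.2 hL)
  have m0 := hs.memLp
  have m1 := hs.memLp_grad
  have m2 := hs.memLp_hess
  have eq := hs.equation
  rw [restrict_exteriorDomain_zero] at m0 eq
  simp only [restrict_exteriorDomain_zero] at m1 m2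
  have d1 : ∀ i, IsWeakPartial univ i v (g i) := fun i => (hs.grad i).of_punctured m0 (m1 i)
  have d2 : ∀ i j, IsWeakPartial univ j (g i) (h i j) := fun i j =>
    (hs.hess i j).of_punctured (m1 i) (m2 i j)
  refine ⟨_, continuous_exp_mul hs.cont,
    ⟨equivariant_exteriorDomain_zero_iff.1 he, ?_, OscEq.lpEq isOpen_univ
      ⟨g, fun i => h i i, d1, fun i => d2 i i, by simpa only [Measure.restrict_univ] using eq⟩⟩,
    fun w hw => ?_, fun hd x => ?_⟩
  · rw [MemWeightedH2]
    simp only [exp_neg_mul_exp_mul]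
    rw [MemH2, Measure.restrict_univ]
    exact ⟨m0, g, h, fun i => ⟨d1 i, m1 i⟩, fun i j => ⟨d2 i j, m2 i j⟩⟩
  · have := hu w (equivariant_exteriorDomain_zero_iff.2 hw.1)
      (memWeightedL2_exteriorDomain_zero_iff.2 hw.2.1.1) (hw.2.2.mono (subset_univ _))
      fun h0 => absurd h0 (lt_irrefl 0)
    rwa [restrict_exteriorDomain_zero] at this
  · rw [one_mul]
    exact hb _ (weightedSup_nonneg _ _) (hd.1.mono (subset_univ _))
      (fun y _ => mul_le_weightedSup hd (mem_univ y)) x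

end

end SelfShrinker

end

theorem mainTheorem10 :
    ∃ C : ℝ, 0 < C ∧ ∀ τ : ℝ, 0 < τ → τ ≤ 1 / 3 → (∃ k : ℕ, τ⁻¹ = k) →
      ((∀ E : SelfShrinker.Plane → ℝ,
          SelfShrinker.DecayingContinuous univ E → SelfShrinker.MemWeightedL2 univ E) ∧
        ∀ E : SelfShrinker.Plane → ℝ,
          SelfShrinker.Equivariant τ univ E → SelfShrinker.MemWeightedL2 univ E →
          ∃ u : SelfShrinker.Plane → ℝ,
            Continuous u ∧ SelfShrinker.IsSolution τ univ E u ∧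
            (∀ w : SelfShrinker.Plane → ℝ,
              SelfShrinker.IsSolution τ univ E w → w =ᵐ[volume] u) ∧
            (SelfShrinker.DecayingContinuous univ E →
              ∀ x, |u x| ≤ C * SelfShrinker.weightedSup univ E * (1 + ‖x‖))) ∧
      ∀ R : ℝ, 0 < R →
        (∀ E : SelfShrinker.Plane → ℝ,
          SelfShrinker.DecayingContinuous (SelfShrinker.exteriorDomain R) E →
          SelfShrinker.MemWeightedL2 (SelfShrinker.exteriorDomain R) E) ∧
        ∀ E : SelfShrinker.Plane → ℝ,
          SelfShrinker.Equivariant τ (SelfShrinker.exteriorDomain R) E →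
          SelfShrinker.MemWeightedL2 (SelfShrinker.exteriorDomain R) E →
          ∃ u : SelfShrinker.Plane → ℝ,
            ContinuousOn u (closure (SelfShrinker.exteriorDomain R)) ∧
            (∀ x ∈ frontier (SelfShrinker.exteriorDomain R), u x = 0) ∧
            SelfShrinker.IsSolution τ (SelfShrinker.exteriorDomain R) E u ∧
            (∀ w : SelfShrinker.Plane → ℝ,
              SelfShrinker.IsSolution τ (SelfShrinker.exteriorDomain R) E w →
              SelfShrinker.VanishesOnBoundary (SelfShrinker.exteriorDomain R) w →
              w =ᵐ[volume.restrict (SelfShrinker.exteriorDomain R)] u) ∧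
            (SelfShrinker.DecayingContinuous (SelfShrinker.exteriorDomain R) E →
              ∀ x ∈ SelfShrinker.exteriorDomain R,
                |u x| ≤ C * SelfShrinker.weightedSup (SelfShrinker.exteriorDomain R) E
                  * (1 + ‖x‖)) := by
  -- The comparison with the barrier loses nothing, so the constant `1` works for all `τ` and all
  -- `R`.
  refine ⟨1, one_pos, fun τ hτ0 hτ ⟨k, hk⟩ => ?_⟩
  have hk3 : 3 ≤ k := by
    have h : (3 : ℝ) ≤ τ⁻¹ := by
      rw [le_inv_comm₀ (by norm_num) hτ0]
      linarith
    rw [hk] at h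
    exact_mod_cast h
  have hτk : π * τ = π / k := by rw [← hk, div_inv_eq_mul]
  exact ⟨⟨fun E hE => hE.memWeightedL2 MeasurableSet.univ,
      fun E hE hL => SelfShrinker.planeProblem hk3 hτk hE hL⟩,
    fun R hR => ⟨fun E hE => hE.memWeightedL2 (SelfShrinker.measurableSet_exteriorDomain R),
      fun E hE hL => SelfShrinker.exteriorProblem hk3 hτk hR hE hL⟩⟩
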